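/- Let $k$ be a commutative ring, $C(k)$ the category of complexes of $k$-modules with the projective model structure (weak equivalences are quasi-isomorphisms, fibrations are degreewise surjections), and let $\mathcal O$ be a (small, symmetric) coloured operad in $C(k)$ with set of colours $[\mathcal O]$. Then the forgetful functor $\mathbb G:\mathtt{Alg}_{\mathcal O}(C(k))\to C(k)^{[\mathcal O]}$ has a left adjoint $\mathbb F_{\mathcal O}$ (the free algebra functor). Let $A$ be a cofibrant $\mathcal O$-algebra, i.e. one having the left lifting property with respect to all maps of $\mathcal O$-algebras that are componentwise surjective quasi-isomorphisms. Then $A$ has an enveloping operad $\mathcal O_A$: the operad with colours $[\mathcal O]$ governing $\mathcal O$-algebras $X$ endowed with a morphism of $\mathcal O$-algebras $A\to X$; it comes with a map of operads $\mathcal O\to\mathcal O_A$ and a morphism of $\mathcal O$-algebras $A\to\mathcal O_A(\emptyset,-)$. The following holds for it. Let $f:V\to W$ be a collection of cofibrations $f_c:V_c\to W_c$ of cofibrant complexes, $c\in[\mathcal O]$, and let $$\begin{array}{ccc}\mathbb F_{\mathcal O}(V)&\xrightarrow{\ \mathbb F_{\mathcal O}(f)\ }&\mathbb F_{\mathcal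 O}(W)\\ \downarrow&&\downarrow\\ A&\longrightarrow&B\end{array}$$ be a pushout square of $\mathcal O$-algebras. Let $\alpha:V\to\mathbb G(A)$ be the map adjoint to $\mathbb F_{\mathcal O}(V)\to A$. Then $\mathbb G(A)\to\mathbb G(B)$ is the map $B_0\to\operatorname{colim}_n B_n$ for a sequence $$\mathbb G(A)=B_0\to B_1\to B_2\to\cdots$$ in $C(k)^{[\mathcal O]}$ with colimit $\mathbb G(B)$, such that for every $n\ge 1$ and $d\in[\mathcal O]$ the $d$-component of $B_{n-1}\to B_n$ is the pushout of the map $$\bigoplus_{c}\ \mathcal O_A(c,d)\otimes_{\Sigma_c}\bigwedge_{i\in I}f_{c(i)}$$ along the attaching map described below. Here $c:I\to[\mathcal O]$ runs over representatives of the isomorphism classes of finite collections of colours with $|I|=n$, $\Sigma_c$ is the automorphism group of $c$, and $\bigwedge_{i\in I}f_{c(i)}:\operatorname{colim}_{S\subsetneq I}Z(S)\to Z(I)$ with $Z(S)=\bigotimes_{i\in S}W_{c(i)}\otimes\bigotimes_{i\notin S}V_{c(i)}$. The identification $\mathbb G(A)=\mathcal O_A(\emptyset,-)$ and the pushout squares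 give maps $\mathcal O_A(c,d)\otimes\bigotimes_{i\in I}W_{c(i)}\to (B_{|I|})_d$ for all $c$, compatible with isomorphisms of collections (for $|I|=0$ the map is the identification $\mathcal O_A(\emptyset,d)=A_d$). The attaching map is given on the summand $\mathcal O_A(c,d)\otimes Z(S)$, $S\subsetneq I$, by replacing the factors $V_{c(i)}$, $i\notin S$, by $A_{c(i)}=\mathcal O_A(\emptyset,c(i))$ via $\alpha$, composing in $\mathcal O_A$ to get $\mathcal O_A(c|_S,d)\otimes\bigotimes_{i\in S}W_{c(i)}$, and then mapping to $(B_{|S|})_d\to (B_{n-1})_d$. If moreover $\mathcal O$ is $\Sigma$-cofibrant (each $\mathcal O(c,d)$ is projectively cofibrant as a complex of $\Sigma_c$-modules), then all the maps $B_{n-1}\to B_n$ are cofibrations in $C(k)^{[\mathcal O]}$, i.e. componentwise cofibrations of complexes. -/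

import Mathlib

open CategoryTheory Limits

universe u

namespace DGOperad

noncomputable section

/-! ## Complexes, homogeneous elements, tensor products -/

/-- The category `C(k)` of complexes of `k`-modules. -/
abbrev Cx (k : Type u) [CommRing k] := CochainComplex (ModuleCat.{u} k) ℤ

/-- A homogeneous element of a complex, together with its degree. -/
@[ext] structure Homog {k : Type u} [CommRing k] (X : Cx k) : Type u where
  /-- The degree. -/
  deg : ℤ
  /-- The element itself. -/
  val : X.X deg

namespace Homog

variable {k : Type u} [CommRing k] {X Y Z : Cx k}

/-- The differential of a homogeneous element. -/
def diff (x : Homog X) : Homog X := ⟨x.deg + 1, X.d x.deg (x.deg + 1) x.val⟩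

/-- The image of a homogeneous element under a map of complexes. -/
def map (f : X ⟶ Y) (x : Homog X) : Homog Y := ⟨x.deg, f.f x.deg x.val⟩

/-- A sign times a homogeneous element. -/
def sgn (s : ℤˣ) (x : Homog X) : Homog X := ⟨x.deg, s • x.val⟩

@[simp] theorem deg_map (f : X ⟶ Y) (x : Homog X) : (map f x).deg = x.deg := rfl

@[simp] theorem deg_diff (x : Homog X) : x.diff.deg = x.deg + 1 := rfl

@[simp] theorem deg_sgn (s : ℤˣ) (x : Homog X) : (sgn s x).deg = x.deg := rfl

theorem map_mk (f : X ⟶ Y) (n : ℤ) (a : X.X n) : map f (mk n a) = mk n (f.f n a) := rfl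

@[simp] theorem map_id (x : Homog X) : map (𝟙 X) x = x := rfl

@[simp] theorem map_comp (f : X ⟶ Y) (g : Y ⟶ Z) (x : Homog X) :
    map (f ≫ g) x = map g (map f x) := rfl

theorem map_sgn (f : X ⟶ Y) (s : ℤˣ) (x : Homog X) : map f (sgn s x) = sgn s (map f x) := by
  refine Homog.ext rfl (heq_of_eq ?_)
  change (f.f x.deg) (s • x.val) = s • (f.f x.deg) x.val
  rcases Int.units_eq_one_or s with rfl | rfl <;> simp

theorem map_diff (f : X ⟶ Y) (x : Homog X) : map f x.diff = (map f x).diff := by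
  refine Homog.ext rfl (heq_of_eq ?_)
  change (f.f (x.deg + 1)) (X.d x.deg (x.deg + 1) x.val) = Y.d x.deg (x.deg + 1) (f.f x.deg x.val)
  rw [← ModuleCat.comp_apply, ← ModuleCat.comp_apply, f.comm]

end Homog

section Tensor

variable {k : Type u} [CommRing k] {n : ℕ}

/-- The total degree of a finite sequence of homogeneous elements. -/
def tdeg {X : Fin n → Cx k} (x : ∀ i, Homog (X i)) : ℤ := ∑ i, (x i).deg

theorem tdeg_update {X : Fin n → Cx k} (x : ∀ i, Homog (X i)) (i : Fin n) (y : Homog (X i)) :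
    tdeg (Function.update x i y) = tdeg x - (x i).deg + y.deg := by
  unfold tdeg
  have h : ∀ j, (Function.update x i y j).deg =
      Function.update (fun j => (x j).deg) i y.deg j := by
    intro j
    rcases eq_or_ne j i with rfl | hj
    · simp
    · simp [hj]
  simp_rw [h]
  rw [Finset.sum_update_of_mem (Finset.mem_univ i), ← Finset.erase_eq,
    ← Finset.sum_erase_add _ (fun j => (x j).deg) (Finset.mem_univ i)]
  ring

/-- The symbols `x₁ ⊗ ⋯ ⊗ xₙ` of total degree `m`. -/
abbrev TSymb (X : Fin n → Cx k) (m : ℤ) : Type u := {x : ∀ i, Homog (X i) // tdeg x = m}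

/-- The symbol `x₁ ⊗ ⋯ ⊗ xₙ` as a basis element of the free module on symbols. -/
def tsymb {X : Fin n → Cx k} {m : ℤ} (x : ∀ i, Homog (X i)) (h : tdeg x = m) :
    TSymb X m →₀ k := Finsupp.single ⟨x, h⟩ 1

/-- The relations expressing multilinearity of `x₁ ⊗ ⋯ ⊗ xₙ`. -/
def tRel (X : Fin n → Cx k) (m : ℤ) : Submodule k (TSymb X m →₀ k) :=
  Submodule.span k
    ({z | ∃ (x : ∀ i, Homog (X i)) (i : Fin n) (q : ℤ) (a b : (X i).X q)
        (h : tdeg (Function.update x i (Homog.mk q (a + b))) = m)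
        (h₁ : tdeg (Function.update x i (Homog.mk q a)) = m)
        (h₂ : tdeg (Function.update x i (Homog.mk q b)) = m),
        z = tsymb _ h - tsymb _ h₁ - tsymb _ h₂} ∪
     {z | ∃ (x : ∀ i, Homog (X i)) (i : Fin n) (q : ℤ) (r : k) (a : (X i).X q)
        (h : tdeg (Function.update x i (Homog.mk q (r • a))) = m)
        (h₁ : tdeg (Function.update x i (Homog.mk q a)) = m),
        z = tsymb _ h - r • tsymb _ h₁})

/-- The degree `m` part of `X₁ ⊗ ⋯ ⊗ Xₙ`. -/
abbrev TMod (X : Fin n → Cx k) (m : ℤ) : Type u := (TSymb X m →₀ k) ⧸ tRel X m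

/-- The pure tensor `x₁ ⊗ ⋯ ⊗ xₙ`. -/
def tmod {X : Fin n → Cx k} {m : ℤ} (x : ∀ i, Homog (X i)) (h : tdeg x = m) : TMod X m :=
  Submodule.Quotient.mk (tsymb x h)

theorem tmod_add {X : Fin n → Cx k} {m : ℤ} (x : ∀ i, Homog (X i)) (i : Fin n) (q : ℤ)
    (a b : (X i).X q) (h : tdeg (Function.update x i (Homog.mk q (a + b))) = m)
    (h₁ : tdeg (Function.update x i (Homog.mk q a)) = m)
    (h₂ : tdeg (Function.update x i (Homog.mk q b)) = m) :
    tmod _ h = tmod _ h₁ + tmod _ h₂ := by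
  unfold tmod
  rw [← Submodule.Quotient.mk_add, Submodule.Quotient.eq, ← sub_sub]
  exact Submodule.subset_span (Or.inl ⟨x, i, q, a, b, h, h₁, h₂, rfl⟩)

theorem tmod_smul {X : Fin n → Cx k} {m : ℤ} (x : ∀ i, Homog (X i)) (i : Fin n) (q : ℤ) (r : k)
    (a : (X i).X q) (h : tdeg (Function.update x i (Homog.mk q (r • a))) = m)
    (h₁ : tdeg (Function.update x i (Homog.mk q a)) = m) :
    tmod _ h = r • tmod _ h₁ := by
  unfold tmod
  rw [← Submodule.Quotient.mk_smul, Submodule.Quotient.eq]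
  exact Submodule.subset_span (Or.inr ⟨x, i, q, r, a, h, h₁, rfl⟩)

theorem tmod_congr {X : Fin n → Cx k} {m : ℤ} {x y : ∀ i, Homog (X i)} (e : x = y)
    (h : tdeg x = m) (h' : tdeg y = m) : tmod x h = tmod y h' := by
  subst e; rfl

/-- Linear maps out of `TMod X m` are given by multilinear functions of homogeneous elements. -/
def tlift {X : Fin n → Cx k} {m : ℤ} {M : Type u} [AddCommGroup M] [Module k M]
    (φ : ∀ x : (∀ i, Homog (X i)), tdeg x = m → M)
    (hadd : ∀ (x : ∀ i, Homog (X i)) (i : Fin n) (q : ℤ) (a b : (X i).X q)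
      (h : tdeg (Function.update x i (Homog.mk q (a + b))) = m)
      (h₁ : tdeg (Function.update x i (Homog.mk q a)) = m)
      (h₂ : tdeg (Function.update x i (Homog.mk q b)) = m), φ _ h = φ _ h₁ + φ _ h₂)
    (hsmul : ∀ (x : ∀ i, Homog (X i)) (i : Fin n) (q : ℤ) (r : k) (a : (X i).X q)
      (h : tdeg (Function.update x i (Homog.mk q (r • a))) = m)
      (h₁ : tdeg (Function.update x i (Homog.mk q a)) = m), φ _ h = r • φ _ h₁) :
    TMod X m →ₗ[k] M :=
  (tRel X m).liftQ (Finsupp.linearCombination k (fun s : TSymb X m => φ s.1 s.2)) (by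
    rw [tRel, Submodule.span_le]
    rintro z (⟨x, i, q, a, b, h, h₁, h₂, rfl⟩ | ⟨x, i, q, r, a, h, h₁, rfl⟩)
    · simp [tsymb, hadd x i q a b h h₁ h₂]
    · simp [tsymb, hsmul x i q r a h h₁])

theorem tlift_tmod {X : Fin n → Cx k} {m : ℤ} {M : Type u} [AddCommGroup M] [Module k M]
    (φ : ∀ x : (∀ i, Homog (X i)), tdeg x = m → M) (hadd hsmul)
    (x : ∀ i, Homog (X i)) (h : tdeg x = m) :
    tlift φ hadd hsmul (tmod x h) = φ x h := by
  unfold tlift tmod tsymb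
  simp

theorem tmod_hom_ext {X : Fin n → Cx k} {m : ℤ} {M : Type u} [AddCommGroup M] [Module k M]
    {f g : TMod X m →ₗ[k] M} (h : ∀ x hx, f (tmod x hx) = g (tmod x hx)) : f = g := by
  refine Submodule.linearMap_qext _ (Finsupp.lhom_ext' fun s => LinearMap.ext_ring ?_)
  exact h s.1 s.2

/-- The sign `(-1)^{|x₁| + ⋯ + |x_{i-1}|}`. -/
def preSign {X : Fin n → Cx k} (x : ∀ i, Homog (X i)) (i : Fin n) : ℤˣ :=
  (∑ j ∈ Finset.univ.filter (· < i), (x j).deg).negOnePow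

theorem preSign_congr {X Y : Fin n → Cx k} (x : ∀ i, Homog (X i)) (y : ∀ i, Homog (Y i))
    (i : Fin n) (h : ∀ j, j < i → (x j).deg = (y j).deg) : preSign x i = preSign y i := by
  unfold preSign
  congr 1
  exact Finset.sum_congr rfl fun j hj => h j (by simpa using hj)

theorem preSign_update_of_le {X : Fin n → Cx k} (x : ∀ i, Homog (X i)) (i j : Fin n)
    (y : Homog (X j)) (h : i ≤ j) : preSign (Function.update x j y) i = preSign x i := by
  refine preSign_congr _ _ _ fun l hl => ?_
  rw [Function.update_of_ne (lt_of_lt_of_le hl h).ne]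

theorem preSign_update_diff {X : Fin n → Cx k} (x : ∀ i, Homog (X i)) (i j : Fin n)
    (h : j < i) : preSign (Function.update x j (x j).diff) i = - preSign x i := by
  unfold preSign
  have hj : j ∈ Finset.univ.filter (· < i) := by simpa using h
  rw [← Finset.sum_erase_add _ _ hj, ← Finset.sum_erase_add _ (fun l => (x l).deg) hj,
    Finset.sum_congr rfl (g := fun l => (x l).deg)]
  · simp only [Function.update_self, Homog.deg_diff]
    rw [← add_assoc, Int.negOnePow_succ]
  · intro l hl
    rw [Function.update_of_ne (Finset.ne_of_mem_erase hl)]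

theorem tdeg_diff {X : Fin n → Cx k} (x : ∀ i, Homog (X i)) (i : Fin n) {m m' : ℤ}
    (h : tdeg x = m) (hm : m + 1 = m') : tdeg (Function.update x i (x i).diff) = m' := by
  rw [tdeg_update, Homog.deg_diff, h, ← hm]; ring

/-- The differential on symbols:
`d(x₁ ⊗ ⋯ ⊗ xₙ) = ∑ᵢ (-1)^{|x₁| + ⋯ + |x_{i-1}|} x₁ ⊗ ⋯ ⊗ d xᵢ ⊗ ⋯ ⊗ xₙ`. -/
def tdiffSymb {X : Fin n → Cx k} {m m' : ℤ} (hm : m + 1 = m') (x : ∀ i, Homog (X i))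
    (h : tdeg x = m) : TMod X m' :=
  ∑ i, preSign x i • tmod (Function.update x i (x i).diff) (tdeg_diff x i h hm)

end Tensor
section Tensor

variable {k : Type u} [CommRing k] {n : ℕ}

theorem Homog.diff_mk {X : Cx k} (q : ℤ) (a : X.X q) :
    (Homog.mk q a).diff = Homog.mk (q + 1) (X.d q (q + 1) a) := rfl

theorem preSign_update_mk {X : Fin n → Cx k} (x : ∀ i, Homog (X i)) (i j : Fin n) (q : ℤ)
    (a b : (X i).X q) : preSign (Function.update x i (Homog.mk q a)) j =
      preSign (Function.update x i (Homog.mk q b)) j := by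
  refine preSign_congr _ _ _ fun l _ => ?_
  rcases eq_or_ne l i with rfl | hl
  · simp
  · simp [hl]

theorem tdiffSymb_add {X : Fin n → Cx k} {m m' : ℤ} (hm : m + 1 = m') (x : ∀ i, Homog (X i))
    (i : Fin n) (q : ℤ) (a b : (X i).X q)
    (h : tdeg (Function.update x i (Homog.mk q (a + b))) = m)
    (h₁ : tdeg (Function.update x i (Homog.mk q a)) = m)
    (h₂ : tdeg (Function.update x i (Homog.mk q b)) = m) :
    tdiffSymb hm _ h = tdiffSymb hm _ h₁ + tdiffSymb hm _ h₂ := by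
  unfold tdiffSymb
  rw [← Finset.sum_add_distrib]
  refine Finset.sum_congr rfl fun j _ => ?_
  rw [preSign_update_mk x i j q a (a + b), preSign_update_mk x i j q b (a + b), ← smul_add]
  congr 1
  have key : ∀ c : (X i).X q, Function.update (Function.update x i (Homog.mk q c)) j
      (Function.update x i (Homog.mk q c) j).diff =
      if j = i then Function.update x i (Homog.mk (q + 1) ((X i).d q (q + 1) c)) else
        Function.update (Function.update x j (x j).diff) i (Homog.mk q c) := by
    intro c
    split_ifs with hj
    · subst hj
      simp [Homog.diff_mk]
    · rw [Function.update_of_ne hj, Function.update_comm hj]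
  have e := tdeg_diff _ j h hm
  have e₁ := tdeg_diff _ j h₁ hm
  have e₂ := tdeg_diff _ j h₂ hm
  rw [key] at e e₁ e₂
  rw [tmod_congr (key _) _ e, tmod_congr (key _) _ e₁, tmod_congr (key _) _ e₂]
  by_cases hj : j = i
  · simp only [hj, if_true, map_add] at e e₁ e₂ ⊢
    exact tmod_add x i (q + 1) _ _ e e₁ e₂
  · simp only [hj, if_false] at e e₁ e₂ ⊢
    exact tmod_add _ i q a b e e₁ e₂

theorem tdiffSymb_smul {X : Fin n → Cx k} {m m' : ℤ} (hm : m + 1 = m') (x : ∀ i, Homog (X i))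
    (i : Fin n) (q : ℤ) (r : k) (a : (X i).X q)
    (h : tdeg (Function.update x i (Homog.mk q (r • a))) = m)
    (h₁ : tdeg (Function.update x i (Homog.mk q a)) = m) :
    tdiffSymb hm _ h = r • tdiffSymb hm _ h₁ := by
  unfold tdiffSymb
  rw [Finset.smul_sum]
  refine Finset.sum_congr rfl fun j _ => ?_
  rw [preSign_update_mk x i j q a (r • a), smul_comm]
  congr 1
  have key : ∀ c : (X i).X q, Function.update (Function.update x i (Homog.mk q c)) j
      (Function.update x i (Homog.mk q c) j).diff =
      if j = i then Function.update x i (Homog.mk (q + 1) ((X i).d q (q + 1) c)) else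
        Function.update (Function.update x j (x j).diff) i (Homog.mk q c) := by
    intro c
    split_ifs with hj
    · subst hj
      simp [Homog.diff_mk]
    · rw [Function.update_of_ne hj, Function.update_comm hj]
  have e := tdeg_diff _ j h hm
  have e₁ := tdeg_diff _ j h₁ hm
  rw [key] at e e₁
  rw [tmod_congr (key _) _ e, tmod_congr (key _) _ e₁]
  by_cases hj : j = i
  · simp only [hj, if_true, map_smul] at e e₁ ⊢
    exact tmod_smul x i (q + 1) r _ e e₁
  · simp only [hj, if_false] at e e₁ ⊢
    exact tmod_smul _ i q r a e e₁

/-- The differential of `X₁ ⊗ ⋯ ⊗ Xₙ`. -/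
def tdiff (X : Fin n → Cx k) {m m' : ℤ} (hm : m + 1 = m') : TMod X m →ₗ[k] TMod X m' :=
  tlift (tdiffSymb hm) (tdiffSymb_add hm) (tdiffSymb_smul hm)

theorem tmod_eq_zero {X : Fin n → Cx k} {m : ℤ} (x : ∀ i, Homog (X i)) (h : tdeg x = m)
    (i : Fin n) (h0 : (x i).val = 0) : tmod x h = 0 := by
  have e : x = Function.update x i (Homog.mk (x i).deg ((0 : k) • (0 : (X i).X (x i).deg))) := by
    rw [eq_comm, Function.update_eq_self_iff, smul_zero, ← h0]
  have e' : x = Function.update x i (Homog.mk (x i).deg (0 : (X i).X (x i).deg)) := by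
    rw [eq_comm, Function.update_eq_self_iff, ← h0]
  rw [tmod_congr e h (by rw [← e, h]),
    tmod_smul x i (x i).deg 0 0 (by rw [← e, h]) (by rw [← e', h]), zero_smul]

theorem tdiff_tdiff (X : Fin n → Cx k) {m m' m'' : ℤ} (hm : m + 1 = m') (hm' : m' + 1 = m'') :
    tdiff X hm' ∘ₗ tdiff X hm = 0 := by
  refine tmod_hom_ext fun x hx => ?_
  let F : Fin n → Fin n → TMod X m'' := fun i j =>
    preSign x i • preSign (Function.update x i (x i).diff) j •
      tmod (Function.update (Function.update x i (x i).diff) j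
        (Function.update x i (x i).diff j).diff)
        (tdeg_diff _ j (tdeg_diff x i hx hm) hm')
  have hsum : (tdiff X hm' ∘ₗ tdiff X hm) (tmod x hx) = ∑ i, ∑ j, F i j := by
    rw [LinearMap.comp_apply]
    unfold tdiff
    rw [tlift_tmod]
    conv_lhs => rw [tdiffSymb]
    rw [map_sum]
    refine Finset.sum_congr rfl fun i _ => ?_
    rw [Units.smul_def, map_zsmul, tlift_tmod, tdiffSymb, Finset.smul_sum]
    rfl
  have hdiag : ∀ i, F i i = 0 := by
    intro i
    simp only [F]
    rw [tmod_eq_zero _ _ i, smul_zero, smul_zero]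
    rw [Function.update_self, Function.update_self]
    change (X i).d ((x i).deg + 1) ((x i).deg + 1 + 1) ((X i).d (x i).deg ((x i).deg + 1) (x i).val) = 0
    rw [← ModuleCat.comp_apply, HomologicalComplex.d_comp_d]
    rfl
  have hanti : ∀ i j, i < j → F i j = - F j i := by
    intro i j hij
    simp only [F]
    rw [preSign_update_diff x j i hij, preSign_update_of_le x i j _ hij.le, smul_smul, smul_smul,
      tmod_congr (y := Function.update (Function.update x j (x j).diff) i
        (Function.update x j (x j).diff i).diff) _ _ (tdeg_diff _ i (tdeg_diff x j hx hm) hm')]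
    · rw [mul_neg, mul_comm, Units.smul_def, Units.val_neg, neg_smul, ← Units.smul_def]
    · rw [Function.update_of_ne hij.ne', Function.update_of_ne hij.ne,
        Function.update_comm hij.ne]
  have hswap : ∀ i j, F i j = - F j i := by
    intro i j
    rcases lt_trichotomy i j with h | rfl | h
    · exact hanti i j h
    · rw [hdiag, neg_zero]
    · rw [hanti j i h, neg_neg]
  rw [hsum, LinearMap.zero_apply, ← Finset.sum_product']
  refine Finset.sum_involution (fun p _ => (p.2, p.1)) ?_ ?_ ?_ ?_
  · rintro ⟨i, j⟩ _
    simp only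
    rw [hswap i j, neg_add_cancel]
  · rintro ⟨i, j⟩ _ h e
    simp only [Prod.mk.injEq] at e
    exact h (by simpa [e.2] using hdiag i)
  · simp
  · simp

/-- The tensor product `X₁ ⊗ ⋯ ⊗ Xₙ` of complexes. -/
def tensor (X : Fin n → Cx k) : Cx k where
  X m := ModuleCat.of k (TMod X m)
  d m m' := if hm : m + 1 = m' then ModuleCat.ofHom (tdiff X hm) else 0
  shape m m' h := dif_neg h
  d_comp_d' m m' m'' h h' := by
    have h₁ : m + 1 = m' := h
    have h₂ : m' + 1 = m'' := h'
    rw [dif_pos h₁, dif_pos h₂, ← ModuleCat.ofHom_comp, tdiff_tdiff]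
    rfl

/-- The pure tensor `x₁ ⊗ ⋯ ⊗ xₙ` as an element of degree `m`. -/
def tmk {X : Fin n → Cx k} (x : ∀ i, Homog (X i)) (m : ℤ) (h : tdeg x = m) : (tensor X).X m :=
  tmod x h

/-- The pure tensor `x₁ ⊗ ⋯ ⊗ xₙ`. -/
def tpure {X : Fin n → Cx k} (x : ∀ i, Homog (X i)) : Homog (tensor X) :=
  Homog.mk (tdeg x) (tmk x _ rfl)

theorem mk_tmk {X : Fin n → Cx k} (x : ∀ i, Homog (X i)) (m : ℤ) (h : tdeg x = m) :
    Homog.mk m (tmk x m h) = tpure x := by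
  subst h; rfl

/-- A map out of a tensor product of complexes is determined by its values on pure tensors. -/
theorem tensor_hom_ext {X : Fin n → Cx k} {Y : Cx k} {f g : tensor X ⟶ Y}
    (h : ∀ x, Homog.map f (tpure x) = Homog.map g (tpure x)) : f = g := by
  ext m : 1
  refine ModuleCat.hom_ext (tmod_hom_ext fun x hx => ?_)
  subst hx
  exact eq_of_heq (Homog.mk.inj (h x)).2

/-- A map out of a tensor product of complexes, from a multilinear function of homogeneous
elements which satisfies the Leibniz rule. -/
def tensorDesc {X : Fin n → Cx k} {Y : Cx k}
    (φ : ∀ (m : ℤ) (x : ∀ i, Homog (X i)), tdeg x = m → Y.X m)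
    (hadd : ∀ (m : ℤ) (x : ∀ i, Homog (X i)) (i : Fin n) (q : ℤ) (a b : (X i).X q)
      (h : tdeg (Function.update x i (Homog.mk q (a + b))) = m)
      (h₁ : tdeg (Function.update x i (Homog.mk q a)) = m)
      (h₂ : tdeg (Function.update x i (Homog.mk q b)) = m), φ m _ h = φ m _ h₁ + φ m _ h₂)
    (hsmul : ∀ (m : ℤ) (x : ∀ i, Homog (X i)) (i : Fin n) (q : ℤ) (r : k) (a : (X i).X q)
      (h : tdeg (Function.update x i (Homog.mk q (r • a))) = m)
      (h₁ : tdeg (Function.update x i (Homog.mk q a)) = m), φ m _ h = r • φ m _ h₁)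
    (hd : ∀ (m m' : ℤ) (hm : m + 1 = m') (x : ∀ i, Homog (X i)) (h : tdeg x = m),
      Y.d m m' (φ m x h) =
        ∑ i, preSign x i • φ m' (Function.update x i (x i).diff) (tdeg_diff x i h hm)) :
    tensor X ⟶ Y where
  f m := ModuleCat.ofHom (tlift (φ m) (hadd m) (hsmul m))
  comm' m m' h := by
    have hm : m + 1 = m' := h
    refine ModuleCat.hom_ext (tmod_hom_ext fun x hx => ?_)
    change Y.d m m' (tlift (φ m) (hadd m) (hsmul m) (tmod x hx)) =
      tlift (φ m') (hadd m') (hsmul m') (((tensor X).d m m').hom (tmod x hx))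
    have e : ((tensor X).d m m').hom (tmod x hx) = tdiffSymb hm x hx := by
      simp only [tensor, dif_pos hm, ModuleCat.hom_ofHom, tdiff]
      exact tlift_tmod _ _ _ _ _
    rw [e, tlift_tmod, hd m m' hm, tdiffSymb, map_sum]
    refine Finset.sum_congr rfl fun i _ => ?_
    rw [Units.smul_def, Units.smul_def, map_zsmul, tlift_tmod]

theorem map_tensorDesc {X : Fin n → Cx k} {Y : Cx k}
    (φ : ∀ (m : ℤ) (x : ∀ i, Homog (X i)), tdeg x = m → Y.X m) (hadd hsmul hd)
    (x : ∀ i, Homog (X i)) :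
    Homog.map (tensorDesc φ hadd hsmul hd) (tpure x) = Homog.mk (tdeg x) (φ _ x rfl) :=
  Homog.ext rfl (heq_of_eq (tlift_tmod _ (hadd _) (hsmul _) x rfl))

theorem map_update {X Y : Fin n → Cx k} (f : ∀ i, X i ⟶ Y i) (x : ∀ i, Homog (X i)) (i : Fin n)
    (y : Homog (X i)) : (fun j => Homog.map (f j) (Function.update x i y j)) =
      Function.update (fun j => Homog.map (f j) (x j)) i (Homog.map (f i) y) := by
  funext j
  rcases eq_or_ne j i with rfl | hj
  · simp
  · simp [hj]

/-- The tensor product of maps of complexes. -/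
def tensorMap {X Y : Fin n → Cx k} (f : ∀ i, X i ⟶ Y i) : tensor X ⟶ tensor Y :=
  tensorDesc (fun m x h => tmk (fun i => Homog.map (f i) (x i)) m h)
    (fun m x i q a b h h₁ h₂ => by
      have e := map_update f x i
      refine (tmod_congr (e _) h (by rw [← e]; exact h)).trans ?_
      refine Eq.trans ?_ (congrArg₂ (· + ·)
        (tmod_congr (e _) h₁ (by rw [← e]; exact h₁)).symm
        (tmod_congr (e _) h₂ (by rw [← e]; exact h₂)).symm)
      simp only [Homog.map_mk, map_add]
      exact tmod_add _ i q _ _ _ _ _)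
    (fun m x i q r a h h₁ => by
      have e := map_update f x i
      refine (tmod_congr (e _) h (by rw [← e]; exact h)).trans ?_
      refine Eq.trans ?_ (congrArg (r • ·)
        (tmod_congr (e _) h₁ (by rw [← e]; exact h₁)).symm)
      simp only [Homog.map_mk, map_smul]
      exact tmod_smul _ i q r _ _ _)
    (fun m m' hm x h => by
      have hd : ((tensor Y).d m m').hom (tmod (fun i => Homog.map (f i) (x i)) h) =
          tdiffSymb hm (fun i => Homog.map (f i) (x i)) h := by
        simp only [tensor, dif_pos hm, ModuleCat.hom_ofHom, tdiff]
        exact tlift_tmod _ _ _ _ _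
      refine hd.trans (Finset.sum_congr rfl fun i _ => ?_)
      refine congrArg₂ (· • ·) (preSign_congr _ _ _ fun _ _ => rfl) (tmod_congr ?_ _ _)
      rw [map_update, Homog.map_diff])

@[simp] theorem map_tensorMap {X Y : Fin n → Cx k} (f : ∀ i, X i ⟶ Y i)
    (x : ∀ i, Homog (X i)) :
    Homog.map (tensorMap f) (tpure x) = tpure (fun i => Homog.map (f i) (x i)) :=
  map_tensorDesc _ _ _ _ _

end Tensor
section Quotient

variable {k : Type u} [CommRing k]

/-- The degree `n` part of the subcomplex generated by a set of homogeneous elements. -/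
def genSub (X : Cx k) (R : Set (Homog X)) (n : ℤ) : Submodule k (X.X n) :=
  Submodule.span k {z | Homog.mk n z ∈ R ∨ ∃ r ∈ R, Homog.mk n z = r.diff}

theorem genSub_d (X : Cx k) (R : Set (Homog X)) (m n : ℤ) :
    genSub X R m ≤ (genSub X R n).comap (X.d m n).hom := by
  by_cases hmn : m + 1 = n
  · subst hmn
    rw [genSub, Submodule.span_le]
    rintro z (hz | ⟨r, hr, hz⟩)
    · exact Submodule.subset_span (Or.inr ⟨_, hz, rfl⟩)
    · obtain ⟨p, a⟩ := r
      obtain rfl : m = p + 1 := congrArg Homog.deg hz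
      obtain rfl : z = X.d p (p + 1) a := eq_of_heq (Homog.mk.inj hz).2
      have h0 : X.d (p + 1) (p + 1 + 1) (X.d p (p + 1) a) = 0 := by
        rw [← ModuleCat.comp_apply, HomologicalComplex.d_comp_d]; rfl
      change X.d (p + 1) (p + 1 + 1) (X.d p (p + 1) a) ∈ genSub X R (p + 1 + 1)
      rw [h0]
      exact Submodule.zero_mem _
  · intro z _
    rw [Submodule.mem_comap, X.shape m n hmn]
    exact Submodule.zero_mem _

/-- The quotient of a complex by the subcomplex generated by a set of homogeneous elements. -/
def quot (X : Cx k) (R : Set (Homog X)) : Cx k where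
  X n := ModuleCat.of k (X.X n ⧸ genSub X R n)
  d m n := ModuleCat.ofHom ((genSub X R m).mapQ (genSub X R n) (X.d m n).hom (genSub_d X R m n))
  shape m n h := by
    refine ModuleCat.hom_ext (Submodule.linearMap_qext _ (LinearMap.ext fun z => ?_))
    change Submodule.Quotient.mk (X.d m n z) = 0
    rw [X.shape m n h]
    rfl
  d_comp_d' l m n _ _ := by
    refine ModuleCat.hom_ext (Submodule.linearMap_qext _ (LinearMap.ext fun z => ?_))
    change Submodule.Quotient.mk (X.d m n (X.d l m z)) = 0
    rw [← ModuleCat.comp_apply, HomologicalComplex.d_comp_d]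
    rfl

/-- The projection to the quotient complex. -/
def quotProj (X : Cx k) (R : Set (Homog X)) : X ⟶ quot X R where
  f n := ModuleCat.ofHom (genSub X R n).mkQ
  comm' _ _ _ := rfl

/-- The map out of a quotient complex induced by a map which kills the generators. -/
def quotDesc {X Y : Cx k} (R : Set (Homog X)) (f : X ⟶ Y)
    (hf : ∀ r ∈ R, (Homog.map f r).val = 0) : quot X R ⟶ Y where
  f n := ModuleCat.ofHom ((genSub X R n).liftQ (f.f n).hom (by
    rw [genSub, Submodule.span_le]
    rintro z (hz | ⟨⟨p, a⟩, hr, hz⟩)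
    · exact hf _ hz
    · obtain rfl : n = p + 1 := congrArg Homog.deg hz
      obtain rfl : z = X.d p (p + 1) a := eq_of_heq (Homog.mk.inj hz).2
      change (f.f (p + 1)) (X.d p (p + 1) a) = 0
      rw [← ModuleCat.comp_apply, ← f.comm, ModuleCat.comp_apply]
      have h0 : (f.f p) a = 0 := hf _ hr
      rw [h0, map_zero]))
  comm' m n _ := by
    refine ModuleCat.hom_ext (Submodule.linearMap_qext _ (LinearMap.ext fun z => ?_))
    change Y.d m n ((f.f m) z) = (f.f n) (X.d m n z)
    rw [← ModuleCat.comp_apply, ← ModuleCat.comp_apply, f.comm]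

@[simp] theorem quotProj_desc {X Y : Cx k} (R : Set (Homog X)) (f : X ⟶ Y)
    (hf : ∀ r ∈ R, (Homog.map f r).val = 0) : quotProj X R ≫ quotDesc R f hf = f := rfl

theorem quotProj_eq_zero {X : Cx k} {R : Set (Homog X)} {r : Homog X} (hr : r ∈ R) :
    (Homog.map (quotProj X R) r).val = 0 :=
  (Submodule.Quotient.mk_eq_zero _).2 (Submodule.subset_span (Or.inl hr))

end Quotient

/-! ## Coloured operads and their algebras -/

section Headed

variable {k : Type u} [CommRing k] {n : ℕ}

/-- The sequence of complexes `P, Y₁, …, Yₙ`. -/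
def hfam (P : Cx k) (Y : Fin n → Cx k) : Fin (n + 1) → Cx k :=
  Fin.cons (α := fun _ => Cx k) P Y

/-- The sequence of homogeneous elements `θ, y₁, …, yₙ`. -/
def hargs {P : Cx k} {Y : Fin n → Cx k} (θ : Homog P) (y : ∀ i, Homog (Y i)) :
    ∀ i, Homog (hfam P Y i) :=
  Fin.cons (α := fun i => Homog (hfam P Y i)) θ y

/-- The complex `P ⊗ Y₁ ⊗ ⋯ ⊗ Yₙ`. -/
def htensor (P : Cx k) (Y : Fin n → Cx k) : Cx k := tensor (hfam P Y)

/-- The pure tensor `θ ⊗ y₁ ⊗ ⋯ ⊗ yₙ`. -/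
def hpure {P : Cx k} {Y : Fin n → Cx k} (θ : Homog P) (y : ∀ i, Homog (Y i)) :
    Homog (htensor P Y) := tpure (hargs θ y)

/-- The value of a map `P ⊗ Y₁ ⊗ ⋯ ⊗ Yₙ ⟶ Z` on the pure tensor `θ ⊗ y₁ ⊗ ⋯ ⊗ yₙ`. -/
def ev {P Z : Cx k} {Y : Fin n → Cx k} (f : htensor P Y ⟶ Z) (θ : Homog P)
    (y : ∀ i, Homog (Y i)) : Homog Z := Homog.map f (hpure θ y)

theorem tdeg_hargs {P : Cx k} {Y : Fin n → Cx k} (θ : Homog P) (y : ∀ i, Homog (Y i)) :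
    tdeg (hargs θ y) = θ.deg + ∑ i, (y i).deg := by
  unfold tdeg
  rw [Fin.sum_univ_succ]
  rfl

theorem deg_ev {P Z : Cx k} {Y : Fin n → Cx k} (f : htensor P Y ⟶ Z) (θ : Homog P)
    (y : ∀ i, Homog (Y i)) : (ev f θ y).deg = θ.deg + ∑ i, (y i).deg := tdeg_hargs θ y

/-- The tensor product of the maps `f, g₁, …, gₙ`. -/
def hmap {P P' : Cx k} {Y Y' : Fin n → Cx k} (f : P ⟶ P') (g : ∀ i, Y i ⟶ Y' i) :
    htensor P Y ⟶ htensor P' Y' :=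
  tensorMap (X := hfam P Y) (Y := hfam P' Y')
    (fun i => Fin.cases (motive := fun i => hfam P Y i ⟶ hfam P' Y' i) f g i)

theorem map_hargs {P P' : Cx k} {Y Y' : Fin n → Cx k} (f : P ⟶ P') (g : ∀ i, Y i ⟶ Y' i)
    (θ : Homog P) (y : ∀ i, Homog (Y i)) :
    (fun i => Homog.map (Fin.cases (motive := fun i => hfam P Y i ⟶ hfam P' Y' i) f g i)
      (hargs θ y i)) = hargs (Homog.map f θ) (fun i => Homog.map (g i) (y i)) := by
  funext i
  refine Fin.cases ?_ (fun i => ?_) i <;> rfl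

@[simp] theorem map_hmap {P P' : Cx k} {Y Y' : Fin n → Cx k} (f : P ⟶ P')
    (g : ∀ i, Y i ⟶ Y' i) (θ : Homog P) (y : ∀ i, Homog (Y i)) :
    Homog.map (hmap f g) (hpure θ y) = hpure (Homog.map f θ) (fun i => Homog.map (g i) (y i)) := by
  unfold hmap hpure htensor
  rw [map_tensorMap, map_hargs]

theorem htensor_hom_ext {P Z : Cx k} {Y : Fin n → Cx k} {f g : htensor P Y ⟶ Z}
    (h : ∀ θ y, ev f θ y = ev g θ y) : f = g := by
  refine tensor_hom_ext fun x => ?_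
  have e : hargs (P := P) (Y := Y) (x 0) (fun i => x i.succ) = x := Fin.cons_self_tail x
  have := h (x 0) (fun i => x i.succ)
  unfold ev hpure at this
  rwa [e] at this

end Headed

/-- Given a bijection `π : ∐ⱼ Iⱼ ≃ I` of (totally ordered) finite sets, with `p j` the degree of an
element `φⱼ` and `r i` the degree of an element `xᵢ`, this is the Koszul sign of the rearrangement
of `(φⱼ)_{j ∈ J}, (xᵢ)_{i ∈ I}` into `(φⱼ, (x_{π(j,y)})_{y ∈ Iⱼ})_{j ∈ J}`:  the product of
`(-1)^{|a||b|}` over all pairs of elements `a`, `b` whose order is reversed. -/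
def shuffleSign {n : ℕ} {m : Fin n → ℕ} {l : ℕ} (π : (Σ j, Fin (m j)) ≃ Fin l)
    (p : Fin n → ℤ) (r : Fin l → ℤ) : ℤˣ :=
  ((∑ j, ∑ i, if (π.symm i).1 < j then p j * r i else 0) +
    ∑ i, ∑ i', if i < i' ∧ ((π.symm i').1 < (π.symm i).1 ∨
      ((π.symm i').1 = (π.symm i).1 ∧ ((π.symm i').2 : ℕ) < ((π.symm i).2 : ℕ)))
      then r i * r i' else 0).negOnePow

/-- A coloured operad in `C(k)` with set of colours `C`. A finite collection of colours
`c : I → C` is presented by a numbering of `I`, that is as a function `Fin n → C`; a map `f : I → J`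
of finite sets is presented by numberings of its fibres, that is by a bijection
`π : ∐ⱼ Iⱼ ≃ I`. -/
structure ColoredOperad (k : Type u) [CommRing k] (C : Type u) where
  /-- The complex of operations with inputs `c` and output `d`. -/
  obj : ∀ {n : ℕ} (_ : Fin n → C) (_ : C), Cx k
  /-- The unit operations, cycles of degree zero. -/
  one : ∀ a : C, (obj (fun _ : Fin 1 => a) a).X 0
  d_one : ∀ a : C, (obj (fun _ : Fin 1 => a) a).d 0 1 (one a) = 0
  /-- The composition `O(d,e) ⊗ ⨂ⱼ O(cⱼ,d(j)) ⟶ O(c,e)`, where `cⱼ` is the restriction of `c` to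
  the `j`-th fibre. -/
  comp : ∀ {n : ℕ} {m : Fin n → ℕ} {l : ℕ} (d : Fin n → C) (b : ∀ j, Fin (m j) → C)
    (c : Fin l → C) (e : C) (π : (Σ j, Fin (m j)) ≃ Fin l) (_ : ∀ j y, c (π ⟨j, y⟩) = b j y),
    htensor (obj d e) (fun j => obj (b j) (d j)) ⟶ obj c e
  assoc : ∀ {n : ℕ} {m : Fin n → ℕ} {l : ℕ} {r : Fin l → ℕ} {s : ℕ} {t : Fin n → ℕ}
    (d : Fin n → C) (c : Fin l → C) (a : ∀ x, Fin (r x) → C) (q : ∀ j, Fin (t j) → C)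
    (g : Fin s → C) (e : C)
    (π : (Σ j, Fin (m j)) ≃ Fin l) (ρ : (Σ x, Fin (r x)) ≃ Fin s)
    (σ : ∀ j, (Σ y : Fin (m j), Fin (r (π ⟨j, y⟩))) ≃ Fin (t j)) (τ : (Σ j, Fin (t j)) ≃ Fin s)
    (_ : ∀ j y z, τ ⟨j, σ j ⟨y, z⟩⟩ = ρ ⟨π ⟨j, y⟩, z⟩)
    (hρ : ∀ x z, g (ρ ⟨x, z⟩) = a x z)
    (hσ : ∀ j y z, q j (σ j ⟨y, z⟩) = a (π ⟨j, y⟩) z)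
    (hτ : ∀ j w, g (τ ⟨j, w⟩) = q j w)
    (θ : Homog (obj d e)) (φ : ∀ j, Homog (obj (fun y => c (π ⟨j, y⟩)) (d j)))
    (ψ : ∀ x, Homog (obj (a x) (c x))),
    ev (comp c a g e ρ hρ) (ev (comp d (fun j y => c (π ⟨j, y⟩)) c e π (fun _ _ => rfl)) θ φ) ψ =
      Homog.sgn (shuffleSign π (fun j => (φ j).deg) (fun x => (ψ x).deg))
        (ev (comp d q g e τ hτ) θ (fun j =>
          ev (comp (fun y => c (π ⟨j, y⟩)) (fun y => a (π ⟨j, y⟩)) (q j) (d j) (σ j)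
            (fun y z => hσ j y z)) (φ j) (fun y => ψ (π ⟨j, y⟩))))
  one_comp : ∀ {l : ℕ} (c : Fin l → C) (e : C) (π : (Σ _ : Fin 1, Fin l) ≃ Fin l)
    (hπ : ∀ j y, π ⟨j, y⟩ = y) (θ : Homog (obj c e)),
    ev (comp (fun _ : Fin 1 => e) (fun _ => c) c e π (fun j y => congrArg c (hπ j y)))
      (Homog.mk 0 (one e)) (fun _ => θ) = θ
  comp_one : ∀ {n : ℕ} (d : Fin n → C) (e : C) (π : (Σ _ : Fin n, Fin 1) ≃ Fin n)
    (hπ : ∀ j y, π ⟨j, y⟩ = j) (θ : Homog (obj d e)),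
    ev (comp d (fun j _ => d j) d e π (fun j y => congrArg d (hπ j y)))
      θ (fun j => Homog.mk 0 (one (d j))) = θ

section Operads

variable {k : Type u} [CommRing k] {C : Type u}

/-- The unit operation as a homogeneous element. -/
def ColoredOperad.unit (O : ColoredOperad k C) (a : C) : Homog (O.obj (fun _ : Fin 1 => a) a) :=
  Homog.mk 0 (O.one a)

/-- The bijection `∐ⱼ {∗} ≃ J ≃ I` given by a permutation. -/
def permSigma {n : ℕ} (σ : Equiv.Perm (Fin n)) : (Σ _ : Fin n, Fin 1) ≃ Fin n :=
  (Equiv.sigmaUnique (Fin n) (fun _ => Fin 1)).trans σ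

/-- The action of isomorphisms of collections of colours: a permutation `σ` with
`c' ∘ σ = c` carries `O(c,e)` to `O(c',e)`, by composition with units. -/
def ColoredOperad.relabel (O : ColoredOperad k C) {n : ℕ} {c c' : Fin n → C} (e : C)
    (σ : Equiv.Perm (Fin n)) (h : ∀ i, c' (σ i) = c i) (θ : Homog (O.obj c e)) :
    Homog (O.obj c' e) :=
  ev (O.comp c (fun j _ => c j) c' e (permSigma σ) (fun j _ => h j)) θ (fun j => O.unit (c j))

/-- A map of operads which is the identity on colours. -/
structure OperadHom (O P : ColoredOperad k C) where
  /-- The components of the map. -/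
  app : ∀ {n : ℕ} (c : Fin n → C) (d : C), O.obj c d ⟶ P.obj c d
  map_unit : ∀ a, Homog.map (app (fun _ : Fin 1 => a) a) (O.unit a) = P.unit a
  map_comp : ∀ {n : ℕ} {m : Fin n → ℕ} {l : ℕ} (d : Fin n → C) (b : ∀ j, Fin (m j) → C)
    (c : Fin l → C) (e : C) (π : (Σ j, Fin (m j)) ≃ Fin l) (h : ∀ j y, c (π ⟨j, y⟩) = b j y)
    (θ : Homog (O.obj d e)) (φ : ∀ j, Homog (O.obj (b j) (d j))),
    Homog.map (app c e) (ev (O.comp d b c e π h) θ φ) =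
      ev (P.comp d b c e π h) (Homog.map (app d e) θ) (fun j => Homog.map (app (b j) (d j)) (φ j))

variable (k C) in
/-- The category `C(k)^C` of collections of complexes numbered by the colours. -/
abbrev Coll := C → Cx k

/-- An `O`-algebra structure on a collection of complexes. -/
@[ext] structure AlgStr (O : ColoredOperad k C) (X : Coll k C) where
  /-- The action `O(c,d) ⊗ ⨂ᵢ X_{c(i)} ⟶ X_d`. -/
  act : ∀ {n : ℕ} (c : Fin n → C) (d : C), htensor (O.obj c d) (fun i => X (c i)) ⟶ X d
  act_unit : ∀ (a : C) (x : Homog (X a)),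
    ev (act (fun _ : Fin 1 => a) a) (O.unit a) (fun _ => x) = x
  act_comp : ∀ {n : ℕ} {m : Fin n → ℕ} {l : ℕ} (d : Fin n → C) (c : Fin l → C) (e : C)
    (π : (Σ j, Fin (m j)) ≃ Fin l) (θ : Homog (O.obj d e))
    (φ : ∀ j, Homog (O.obj (fun y => c (π ⟨j, y⟩)) (d j))) (x : ∀ i, Homog (X (c i))),
    ev (act c e) (ev (O.comp d (fun j y => c (π ⟨j, y⟩)) c e π (fun _ _ => rfl)) θ φ) x =
      Homog.sgn (shuffleSign π (fun j => (φ j).deg) (fun i => (x i).deg))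
        (ev (act d e) θ (fun j => ev (act (fun y => c (π ⟨j, y⟩)) (d j)) (φ j)
          (fun y => x (π ⟨j, y⟩))))

/-- A map of collections commutes with the actions of `O`. -/
def IsAlgHom {O : ColoredOperad k C} {X Y : Coll k C} (s : AlgStr O X) (t : AlgStr O Y)
    (f : ∀ d, X d ⟶ Y d) : Prop :=
  ∀ {n : ℕ} (c : Fin n → C) (d : C) (θ : Homog (O.obj c d)) (x : ∀ i, Homog (X (c i))),
    Homog.map (f d) (ev (s.act c d) θ x) =
      ev (t.act c d) θ (fun i => Homog.map (f (c i)) (x i))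

/-- An `O`-algebra in `C(k)`. -/
structure Alg (O : ColoredOperad k C) where
  /-- The underlying collection. -/
  X : Coll k C
  /-- The algebra structure. -/
  str : AlgStr O X

namespace Alg

variable {O : ColoredOperad k C}

/-- A morphism of `O`-algebras. -/
@[ext] structure Hom (A B : Alg O) where
  /-- The components of the morphism. -/
  f : ∀ d, A.X d ⟶ B.X d
  isAlgHom : IsAlgHom A.str B.str f

instance : Category (Alg O) where
  Hom A B := Hom A B
  id A := ⟨fun d => 𝟙 (A.X d), fun _ _ _ _ => rfl⟩
  comp F G := ⟨fun d => F.f d ≫ G.f d, fun c d θ x => by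
    simp only [Homog.map_comp]
    rw [F.isAlgHom, G.isAlgHom]⟩
  id_comp _ := by apply Hom.ext; funext d; exact Category.id_comp _
  comp_id _ := by apply Hom.ext; funext d; exact Category.comp_id _
  assoc _ _ _ := by apply Hom.ext; funext d; exact Category.assoc _ _ _

/-- The forgetful functor `𝔾` from `O`-algebras to collections. -/
def forget (O : ColoredOperad k C) : Alg O ⥤ Coll k C where
  obj A := A.X
  map F := F.f

end Alg

/-- The pullback of an algebra structure along a map of operads. -/
def AlgStr.restrict {O P : ColoredOperad k C} (φ : OperadHom O P) {X : Coll k C}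
    (s : AlgStr P X) : AlgStr O X where
  act c d := hmap (φ.app c d) (fun i => 𝟙 (X (c i))) ≫ s.act c d
  act_unit a x := by
    simp only [ev, Homog.map_comp, map_hmap, φ.map_unit, Homog.map_id]
    exact s.act_unit a x
  act_comp d c e π θ ψ x := by
    have h := φ.map_comp d (fun j y => c (π ⟨j, y⟩)) c e π (fun _ _ => rfl) θ ψ
    have h' := s.act_comp d c e π (Homog.map (φ.app d e) θ)
      (fun j => Homog.map (φ.app _ (d j)) (ψ j)) x
    simp only [ev, Homog.map_comp, map_hmap, Homog.map_id, Homog.deg_map] at h h' ⊢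
    rw [h, h']

/-- The bijection of empty sets. -/
def emptySigma {n : ℕ} : (Σ _ : Fin n, Fin 0) ≃ Fin 0 where
  toFun x := x.2
  invFun y := y.elim0
  left_inv x := x.2.elim0
  right_inv y := y.elim0

/-- The algebra of nullary operations `d ↦ O(∅,d)` over an operad `O`. -/
def nullary (O : ColoredOperad k C) : AlgStr O (fun d => O.obj (Fin.elim0 : Fin 0 → C) d) where
  act c d := O.comp c (fun _ => Fin.elim0) Fin.elim0 d emptySigma
    (fun _ y => y.elim0)
  act_unit a x := O.one_comp Fin.elim0 a _ (fun _ y => y.elim0) x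
  act_comp d c e π θ φ x :=
    O.assoc d c (fun _ => Fin.elim0) (fun _ => Fin.elim0) Fin.elim0 e π
      emptySigma (fun _ => emptySigma) emptySigma
      (fun _ _ z => z.elim0) (fun _ z => z.elim0) (fun _ _ z => z.elim0) (fun _ w => w.elim0)
      θ φ x

end Operads
/-! ## Cofibrations -/

section Cofibrations

variable {k : Type u} [CommRing k] {C : Type u}

variable (k) in
/-- The trivial fibrations of `C(k)`: degreewise surjective quasi-isomorphisms. -/
def trivFib : MorphismProperty (Cx k) := fun _ _ p =>
  QuasiIso p ∧ ∀ n, Function.Surjective (p.f n)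

variable (k) in
/-- The cofibrations of `C(k)`, for the projective model structure. -/
def cofib : MorphismProperty (Cx k) := (trivFib k).llp

/-- A cofibration of collections: a collection of cofibrations of complexes. -/
def IsCofibration {V W : Coll k C} (f : V ⟶ W) : Prop := ∀ c, cofib k (f c)

/-- A cofibrant collection: a collection of cofibrant complexes. -/
def IsCofibrant (V : Coll k C) : Prop := ∀ c, cofib k (initial.to (V c))

/-- A cofibrant `O`-algebra: it has the lifting property with respect to all maps of
`O`-algebras which are componentwise surjective quasi-isomorphisms. -/
def Alg.IsCofibrant {O : ColoredOperad k C} (A : Alg O) : Prop :=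
  ∀ ⦃X Y : Alg O⦄ (p : X ⟶ Y), (∀ d, trivFib k (((Alg.forget O).map p) d)) →
    ∀ g : A ⟶ Y, ∃ l : A ⟶ X, l ≫ p = g

/-- The group `Σ_c` of automorphisms of a finite collection of colours. -/
def autGroup {n : ℕ} (c : Fin n → C) : Subgroup (Equiv.Perm (Fin n)) where
  carrier := {σ | ∀ i, c (σ i) = c i}
  one_mem' _ := rfl
  mul_mem' {σ τ} hσ hτ i := (hσ (τ i)).trans (hτ i)
  inv_mem' {σ} hσ i := by simpa using (hσ (σ⁻¹ i)).symm

/-- A `Σ`-cofibrant operad: each `O(c,d)` is projectively cofibrant as a complex with an action of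
`Σ_c`, that is, has the lifting property with respect to equivariant surjective
quasi-isomorphisms. -/
def ColoredOperad.IsSigmaCofibrant (O : ColoredOperad k C) : Prop :=
  ∀ {n : ℕ} (c : Fin n → C) (d : C) ⦃P Q : Action (Cx k) (autGroup c)⦄ (p : P ⟶ Q),
    trivFib k p.hom → ∀ g : O.obj c d ⟶ Q.V,
    (∀ (σ : autGroup c) (θ : Homog (O.obj c d)),
      Homog.map g (O.relabel d σ.1 σ.2 θ) = Homog.map (Q.ρ σ) (Homog.map g θ)) →
    ∃ l : O.obj c d ⟶ P.V, l ≫ p.hom = g ∧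
      ∀ (σ : autGroup c) (θ : Homog (O.obj c d)),
        Homog.map l (O.relabel d σ.1 σ.2 θ) = Homog.map (P.ρ σ) (Homog.map l θ)

end Cofibrations

/-! ## The enveloping operad -/

section Enveloping

variable {k : Type u} [CommRing k] {C : Type u}

/-- The map `A ⟶ X` induced by the action on a `P`-algebra `X` of nullary operations
`η : A ⟶ P(∅,-)`, on homogeneous elements. -/
def evNullary {P : ColoredOperad k C} {A X : Coll k C}
    (η : ∀ d, A d ⟶ P.obj (Fin.elim0 : Fin 0 → C) d) (s : AlgStr P X) (d : C)
    (a : Homog (A d)) : Homog (X d) :=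
  ev (s.act (Fin.elim0 : Fin 0 → C) d) (Homog.map (η d) a) (fun i => i.elim0)

/-- An enveloping operad of an `O`-algebra `A`: an operad governing `O`-algebras `X` endowed with a
morphism of `O`-algebras `A ⟶ X`. It has the same colours as `O`, comes with a map
of operads `φ` from `O` and a morphism of `O`-algebras `η` from `A` to its nullary operations, and,
along `φ` and `η`, its algebras and their morphisms are the `O`-algebras under `A` and
their morphisms. -/
structure EnvelopingOperad (O : ColoredOperad k C) (A : Alg O) where
  /-- The operad `O_A`. -/
  operad : ColoredOperad k C
  /-- The map `O ⟶ O_A`. -/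
  φ : OperadHom O operad
  /-- The map `A ⟶ O_A(∅,-)`. -/
  η : ∀ d, A.X d ⟶ operad.obj (Fin.elim0 : Fin 0 → C) d
  isAlgHom_η : IsAlgHom A.str ((nullary operad).restrict φ) η
  existsUnique_algStr : ∀ (X : Coll k C) (s : AlgStr O X) (u : ∀ d, A.X d ⟶ X d),
    IsAlgHom A.str s u →
    ∃! t : AlgStr operad X, t.restrict φ = s ∧
      ∀ (d : C) (a : Homog (A.X d)), evNullary η t d a = Homog.map (u d) a
  isAlgHom : ∀ (X Y : Coll k C) (s : AlgStr operad X) (t : AlgStr operad Y)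
    (f : ∀ d, X d ⟶ Y d), IsAlgHom (s.restrict φ) (t.restrict φ) f →
    (∀ (d : C) (a : Homog (A.X d)),
      Homog.map (f d) (evNullary η s d a) = evNullary η t d a) →
    IsAlgHom s t f

end Enveloping

/-! ## The cellular filtration -/

section Cube

variable {k : Type u} [CommRing k] {C : Type u} {V W : Coll k C}

variable (V W) in
/-- The `i`-th factor at the vertex `S` of the cube: `W` if `i` belongs to `S`, and `V` if not. -/
def vert (a : C) : Bool → Cx k
  | false => V a
  | true => W a

/-- The map `f` or an identity, from the factor at a vertex to the factor `W`. -/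
def vertTop (f : V ⟶ W) (a : C) : ∀ b : Bool, vert V W a b ⟶ W a
  | false => f a
  | true => 𝟙 _

/-- The map between factors of comparable vertices. -/
def vertMap (f : V ⟶ W) (a : C) : ∀ b b' : Bool, b ≤ b' → (vert V W a b ⟶ vert V W a b')
  | false, false, _ => 𝟙 _
  | false, true, _ => f a
  | true, true, _ => 𝟙 _
  | true, false, h => absurd h (by decide)

theorem vertMap_top (f : V ⟶ W) (a : C) (b b' : Bool) (h : b ≤ b') :
    vertMap f a b b' h ≫ vertTop f a b' = vertTop f a b := by
  cases b <;> cases b' <;> first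
    | exact absurd h (by decide)
    | simp [vertMap, vertTop, vert]

theorem vertMap_id (f : V ⟶ W) (a : C) (b : Bool) (h : b ≤ b) :
    vertMap f a b b h = 𝟙 _ := by
  cases b <;> rfl

theorem vertMap_comp (f : V ⟶ W) (a : C) (b b' b'' : Bool) (h : b ≤ b') (h' : b' ≤ b'') :
    vertMap f a b b' h ≫ vertMap f a b' b'' h' = vertMap f a b b'' (h.trans h') := by
  cases b <;> cases b' <;> cases b'' <;> first
    | exact absurd h (by decide)
    | exact absurd h' (by decide)
    | simp [vertMap, vert]

variable {n : ℕ}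

variable (n) in
/-- The poset of proper subsets `S ≠ I` of `I = {1, …, n}`, encoded by their indicator functions. -/
abbrev Proper : Type := {S : Fin n → Bool // S ≠ fun _ => true}

/-- The punctured cubical diagram `S ↦ P ⊗ Z(S)`, for `S ≠ I`, where `Z(S) = ⨂ᵢ Zᵢ` with
`Zᵢ = W_{c(i)}` if `i ∈ S` and `Zᵢ = V_{c(i)}` if `i ∉ S`. -/
def cube (f : V ⟶ W) (P : Cx k) (c : Fin n → C) : Proper n ⥤ Cx k where
  obj S := htensor P (fun i => vert V W (c i) (S.1 i))
  map {S S'} h := hmap (𝟙 P) (fun i => vertMap f (c i) (S.1 i) (S'.1 i) (leOfHom h i))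
  map_id S := htensor_hom_ext fun θ y => by
    simp only [ev, map_hmap, vertMap_id, Homog.map_id]
  map_comp h h' := htensor_hom_ext fun θ y => by
    simp only [ev, map_hmap, Homog.map_comp, Homog.map_id]
    simp only [← Homog.map_comp, vertMap_comp]

/-- The complex `P ⊗ colim_{S ≠ I} Z(S) = colim_{S ≠ I} P ⊗ Z(S)`. -/
def cornerObj (f : V ⟶ W) (P : Cx k) (c : Fin n → C) : Cx k := colimit (cube f P c)

/-- The map `P ⊗ Z(S) ⟶ P ⊗ colim_{S ≠ I} Z(S)`. -/
def cornerIncl (f : V ⟶ W) (P : Cx k) (c : Fin n → C) (S : Proper n) :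
    htensor P (fun i => vert V W (c i) (S.1 i)) ⟶ cornerObj f P c :=
  colimit.ι (cube f P c) S

/-- The map `P ⊗ Z(S) ⟶ P ⊗ Z(I)`. -/
def cubeTop (f : V ⟶ W) (P : Cx k) (c : Fin n → C) (S : Fin n → Bool) :
    htensor P (fun i => vert V W (c i) (S i)) ⟶ htensor P (fun i => W (c i)) :=
  hmap (𝟙 P) (fun i => vertTop f (c i) (S i))

theorem cube_map_cubeTop (f : V ⟶ W) (P : Cx k) (c : Fin n → C) {S S' : Proper n} (h : S ⟶ S') :
    (cube f P c).map h ≫ cubeTop f P c S'.1 = cubeTop f P c S.1 := by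
  refine htensor_hom_ext fun θ y => ?_
  simp only [ev, cube, cubeTop, map_hmap, Homog.map_comp, Homog.map_id]
  simp only [← Homog.map_comp, vertMap_top]

/-- The map `P ⊗ ⋀ᵢ f_{c(i)} : P ⊗ colim_{S ≠ I} Z(S) ⟶ P ⊗ Z(I) = P ⊗ ⨂ᵢ W_{c(i)}`. -/
def cornerMap (f : V ⟶ W) (P : Cx k) (c : Fin n → C) :
    cornerObj f P c ⟶ htensor P (fun i => W (c i)) :=
  colimit.desc (cube f P c)
    { pt := htensor P (fun i => W (c i))
      ι :=
        { app := fun S => cubeTop f P c S.1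
          naturality := fun _ _ h =>
            (cube_map_cubeTop f P c h).trans (Category.comp_id _).symm } }

theorem cornerIncl_map (f : V ⟶ W) (P : Cx k) (c : Fin n → C) (S : Proper n) :
    cornerIncl f P c S ≫ cornerMap f P c = cubeTop f P c S.1 :=
  colimit.ι_desc _ _

theorem map_cubeTop (f : V ⟶ W) (P : Cx k) (c : Fin n → C) (S : Fin n → Bool) (θ : Homog P)
    (x : ∀ i, Homog (vert V W (c i) (S i))) :
    Homog.map (cubeTop f P c S) (hpure θ x) =
      hpure θ (fun i => Homog.map (vertTop f (c i) (S i)) (x i)) := by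
  rw [cubeTop, map_hmap, Homog.map_id]

/-- The Koszul sign of the rearrangement of `x₁ ⊗ ⋯ ⊗ xₙ` into `x_{σ(1)} ⊗ ⋯ ⊗ x_{σ(n)}`, where
`r i = |xᵢ|`. -/
def koszulSign (σ : Equiv.Perm (Fin n)) (r : Fin n → ℤ) : ℤˣ :=
  (∑ i, ∑ j, if i < j ∧ σ j < σ i then r (σ i) * r (σ j) else 0).negOnePow

/-- The identification of the components of a collection at equal colours. -/
def recolor (X : Coll k C) {a b : C} (h : a = b) (x : Homog (X a)) : Homog (X b) :=
  Homog.map (eqToHom (congrArg X h)) x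

variable (O : ColoredOperad k C)

/-- The relations defining the coinvariants `O(c,d) ⊗_{Σ_c} colim_{S ≠ I} Z(S)`: the tensors
`σθ ⊗ x₁ ⊗ ⋯ ⊗ xₙ` and `± θ ⊗ x_{σ(1)} ⊗ ⋯ ⊗ x_{σ(n)}` are identified for `σ ∈ Σ_c`. -/
def srcRel (f : V ⟶ W) (c : Fin n → C) (d : C) : Set (Homog (cornerObj f (O.obj c d) c)) :=
  {z | ∃ (σ : Equiv.Perm (Fin n)) (h : ∀ i, c (σ i) = c i) (S : Fin n → Bool)
    (hS : S ≠ fun _ => true) (hS' : (fun i => S (σ i)) ≠ fun _ => true)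
    (θ : Homog (O.obj c d)) (x : ∀ i, Homog (vert V W (c i) (S i))) (m : ℤ)
    (h₁ : tdeg (hargs (O.relabel d σ h θ) x) = m)
    (h₂ : tdeg (hargs θ (fun i => recolor (fun a => vert V W a (S (σ i))) (h i) (x (σ i)))) = m),
    z = Homog.mk m ((cornerIncl f (O.obj c d) c ⟨S, hS⟩).f m (tmk _ m h₁) -
      koszulSign σ (fun i => (x i).deg) •
        (cornerIncl f (O.obj c d) c ⟨fun i => S (σ i), hS'⟩).f m (tmk _ m h₂))}

/-- The relations defining the coinvariants `O(c,d) ⊗_{Σ_c} ⨂ᵢ W_{c(i)}`. -/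
def tgtRel (W : Coll k C) (c : Fin n → C) (d : C) :
    Set (Homog (htensor (O.obj c d) (fun i => W (c i)))) :=
  {z | ∃ (σ : Equiv.Perm (Fin n)) (h : ∀ i, c (σ i) = c i)
    (θ : Homog (O.obj c d)) (x : ∀ i, Homog (W (c i))) (m : ℤ)
    (h₁ : tdeg (hargs (O.relabel d σ h θ) x) = m)
    (h₂ : tdeg (hargs θ (fun i => recolor W (h i) (x (σ i)))) = m),
    z = Homog.mk m ((tmk _ m h₁ : (htensor (O.obj c d) (fun i => W (c i))).X m) -
      koszulSign σ (fun i => (x i).deg) •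
        (tmk _ m h₂ : (htensor (O.obj c d) (fun i => W (c i))).X m))}

/-- The complex `O(c,d) ⊗_{Σ_c} colim_{S ≠ I} Z(S)`. -/
def orbitSrc (f : V ⟶ W) (c : Fin n → C) (d : C) : Cx k := quot _ (srcRel O f c d)

/-- The complex `O(c,d) ⊗_{Σ_c} ⨂ᵢ W_{c(i)}`. -/
def orbitTgt (W : Coll k C) (c : Fin n → C) (d : C) : Cx k := quot _ (tgtRel O W c d)

theorem recolor_vertTop (f : V ⟶ W) {a a' : C} (h : a = a') (b : Bool)
    (x : Homog (vert V W a b)) :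
    Homog.map (vertTop f a' b) (recolor (fun a => vert V W a b) h x) =
      recolor W h (Homog.map (vertTop f a b) x) := by
  subst h
  simp [recolor]

/-- The map `O(c,d) ⊗_{Σ_c} ⋀ᵢ f_{c(i)}`. -/
def orbitMap (f : V ⟶ W) (c : Fin n → C) (d : C) : orbitSrc O f c d ⟶ orbitTgt O W c d :=
  quotDesc _ (cornerMap f (O.obj c d) c ≫ quotProj _ (tgtRel O W c d)) (by
    rintro z ⟨σ, h, S, hS, hS', θ, x, m, h₁, h₂, rfl⟩
    have e₁ : ∀ (S' : Proper n) (θ' : Homog (O.obj c d))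
        (x' : ∀ i, Homog (vert V W (c i) (S'.1 i))) (h' : tdeg (hargs θ' x') = m)
        (y : ∀ i, Homog (W (c i))) (hy : y = fun i => Homog.map (vertTop f (c i) (S'.1 i)) (x' i))
        (h'' : tdeg (hargs θ' y) = m),
        (cornerMap f (O.obj c d) c).f m ((cornerIncl f (O.obj c d) c S').f m (tmk _ m h')) =
          (tmk (hargs θ' y) m h'' : (htensor (O.obj c d) (fun i => W (c i))).X m) := by
      intro S' θ' x' h' y hy h''
      subst h' hy
      have := map_cubeTop f (O.obj c d) c S'.1 θ' x'
      rw [← cornerIncl_map] at this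
      exact eq_of_heq (Homog.mk.inj (this.trans (mk_tmk _ _ h'').symm)).2
    have hy : (fun i => recolor W (h i) (Homog.map (vertTop f (c (σ i)) (S (σ i))) (x (σ i)))) =
        fun i => Homog.map (vertTop f (c i) (S (σ i)))
          (recolor (fun a => vert V W a (S (σ i))) (h i) (x (σ i))) := by
      funext i
      exact (recolor_vertTop f (h i) (S (σ i)) (x (σ i))).symm
    have g₁ : tdeg (hargs (O.relabel d σ h θ)
        (fun i => Homog.map (vertTop f (c i) (S i)) (x i))) = m := by
      rw [← h₁, tdeg_hargs, tdeg_hargs]; rfl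
    have g₂ : tdeg (hargs θ (fun i =>
        recolor W (h i) (Homog.map (vertTop f (c (σ i)) (S (σ i))) (x (σ i))))) = m := by
      rw [← h₂, tdeg_hargs, tdeg_hargs]; rfl
    change (quotProj _ (tgtRel O W c d)).f m ((cornerMap f (O.obj c d) c).f m (_ - _)) = 0
    rw [map_sub, Units.smul_def, map_zsmul, ← Units.smul_def,
      e₁ ⟨S, hS⟩ _ x h₁ _ rfl g₁, e₁ ⟨fun i => S (σ i), hS'⟩ _ _ h₂ _ hy g₂]
    exact quotProj_eq_zero (R := tgtRel O W c d)
      ⟨σ, h, θ, fun i => Homog.map (vertTop f (c i) (S i)) (x i), m, g₁, g₂, rfl⟩)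

end Cube
section Subsets

variable {n : ℕ}

/-- The subset of `{1, …, n}` with a given indicator function. -/
def supp (S : Fin n → Bool) : Finset (Fin n) := Finset.univ.filter (fun i => S i = true)

/-- The number of elements of a subset. -/
def size (S : Fin n → Bool) : ℕ := (supp S).card

/-- The increasing enumeration of a subset. -/
def enum (S : Fin n → Bool) : Fin (size S) ↪o Fin n := (supp S).orderEmbOfFin rfl

theorem enum_mem (S : Fin n → Bool) (a : Fin (size S)) : S (enum S a) = true := by
  have h : enum S a ∈ supp S := (supp S).orderEmbOfFin_mem rfl a
  simpa [supp] using h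

theorem exists_enum (S : Fin n → Bool) (i : Fin n) (h : S i = true) : ∃ a, enum S a = i := by
  have : i ∈ Set.range ((supp S).orderEmbOfFin rfl) := by
    rw [Finset.range_orderEmbOfFin]
    simpa [supp] using h
  exact this

theorem size_lt (S : Proper n) : size S.1 < n := by
  have h : supp S.1 ≠ Finset.univ := fun h => S.2 (funext fun i => by
    have : i ∈ supp S.1 := h ▸ Finset.mem_univ i
    simpa [supp] using this)
  simpa [size] using Finset.card_lt_card (Finset.ssubset_univ_iff.2 h)

/-- The number of inputs of the operation to be inserted at a place which belongs (resp. does not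
belong) to a subset: one (resp. zero). -/
def slotArity : Bool → ℕ
  | false => 0
  | true => 1

theorem slotArity_pos {b : Bool} (y : Fin (slotArity b)) : b = true := by
  cases b
  · exact y.elim0
  · rfl

instance (b : Bool) : Subsingleton (Fin (slotArity b)) := by
  cases b
  · exact inferInstanceAs (Subsingleton (Fin 0))
  · exact inferInstanceAs (Subsingleton (Fin 1))

/-- The bijection from the set of inputs left, after places which do not belong to `S` have been
filled, to `{1, …, |S|}`. -/
def slotEquiv (S : Fin n → Bool) : (Σ j, Fin (slotArity (S j))) ≃ Fin (size S) :=
  (Equiv.ofBijective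
    (fun a : Fin (size S) => (⟨enum S a, 
      Fin.cast (congrArg slotArity (enum_mem S a)).symm (0 : Fin 1)⟩ :
      Σ j, Fin (slotArity (S j))))
    ⟨fun a b h => (enum S).injective (congrArg Sigma.fst h), fun p => by
      obtain ⟨a, ha⟩ := exists_enum S p.1 (slotArity_pos p.2)
      refine ⟨a, ?_⟩
      obtain ⟨j, y⟩ := p
      dsimp only at ha
      subst ha
      exact congrArg (Sigma.mk _) (Subsingleton.elim _ _)⟩).symm

theorem enum_slotEquiv (S : Fin n → Bool) (p : Σ j, Fin (slotArity (S j))) :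
    enum S (slotEquiv S p) = p.1 :=
  congrArg Sigma.fst ((slotEquiv S).symm_apply_apply p)

end Subsets

section Filtration

variable {k : Type u} [CommRing k] {C : Type u}

variable (C) in
/-- Isomorphism of collections of `n` colours. -/
def collSetoid (n : ℕ) : Setoid (Fin n → C) where
  r c c' := ∃ σ : Equiv.Perm (Fin n), ∀ i, c' (σ i) = c i
  iseqv :=
    { refl := fun _ => ⟨1, fun _ => rfl⟩
      symm := fun {c c'} ⟨σ, h⟩ => ⟨σ⁻¹, fun i => by simpa using (h (σ⁻¹ i)).symm⟩
      trans := fun {_ _ _} ⟨σ, h⟩ ⟨τ, h'⟩ => ⟨τ * σ, fun i => (h' (σ i)).trans (h i)⟩ }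

variable (C) in
/-- The set of isomorphism classes of collections of `n` colours. -/
abbrev CollClass (n : ℕ) : Type u := Quotient (collSetoid C n)

variable {V W : Coll k C}

/-- The complex `⊕_c O(c,d) ⊗_{Σ_c} colim_{S ≠ I} Z(S)`, the sum being over representatives of the
isomorphism classes of collections of `n` colours. -/
def stepSrc (O : ColoredOperad k C) (f : V ⟶ W) (n : ℕ) (d : C) : Cx k :=
  ∐ fun c : CollClass C n => orbitSrc O f c.out d

/-- The complex `⊕_c O(c,d) ⊗_{Σ_c} ⨂ᵢ W_{c(i)}`. -/
def stepTgt (O : ColoredOperad k C) (W : Coll k C) (n : ℕ) (d : C) : Cx k :=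
  ∐ fun c : CollClass C n => orbitTgt O W c.out d

/-- The map `⊕_c O(c,d) ⊗_{Σ_c} ⋀ᵢ f_{c(i)}`. -/
def stepMap (O : ColoredOperad k C) (f : V ⟶ W) (n : ℕ) (d : C) :
    stepSrc O f n d ⟶ stepTgt O W n d :=
  Limits.Sigma.map fun c : CollClass C n => orbitMap O f c.out d

/-- The map from the vertex `O(c,d) ⊗ Z(S)`, `S ≠ I`, to the source of `stepMap`. -/
def vertexIncl (O : ColoredOperad k C) (f : V ⟶ W) {n : ℕ} (d : C) (c : CollClass C n)
    (S : Proper n) :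
    htensor (O.obj c.out d) (fun i => vert V W (c.out i) (S.1 i)) ⟶ stepSrc O f n d :=
  cornerIncl f (O.obj c.out d) c.out S ≫ quotProj _ (srcRel O f c.out d) ≫
    Limits.Sigma.ι (fun c : CollClass C n => orbitSrc O f c.out d) c

/-- The map from `O(c,d) ⊗ ⨂ᵢ W_{c(i)}` to the target of `stepMap`. -/
def topIncl (O : ColoredOperad k C) (W : Coll k C) {n : ℕ} (d : C) (c : CollClass C n) :
    htensor (O.obj c.out d) (fun i => W (c.out i)) ⟶ stepTgt O W n d :=
  quotProj _ (tgtRel O W c.out d) ≫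
    Limits.Sigma.ι (fun c : CollClass C n => orbitTgt O W c.out d) c

/-- The colours of the inputs of the operation to be inserted at a place of colour `a`. -/
def slotColor (a : C) : ∀ b : Bool, Fin (slotArity b) → C
  | false => Fin.elim0
  | true => fun _ => a

theorem slotColor_eq (a : C) (b : Bool) (y : Fin (slotArity b)) : a = slotColor a b y := by
  cases b
  · exact y.elim0
  · rfl

/-- The operation to be inserted at a place of colour `a`: a unit if the factor there is `W`, and
the nullary operation given by the image of `v` in `A` if the factor there is `V`. -/
def slotOp {O : ColoredOperad k C} {A : Alg O} (E : EnvelopingOperad O A)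
    (α : V ⟶ A.X) (a : C) :
    ∀ b : Bool, Homog (vert V W a b) → Homog (E.operad.obj (slotColor a b) a)
  | false, v => Homog.map (E.η a) (Homog.map (α a) v)
  | true, _ => E.operad.unit a

/-- An element of a factor `W` of a vertex. -/
def slotElt {a : C} : ∀ b : Bool, b = true → Homog (vert V W a b) → Homog (W a)
  | true, _, x => x

/-- The Koszul sign of the rearrangement of `x₁ ⊗ ⋯ ⊗ xₙ` into `⨂_{i ∉ S} xᵢ ⊗ ⨂_{i ∈ S} xᵢ`, where
`r i = |xᵢ|`. -/
def splitSign {n : ℕ} (S : Fin n → Bool) (r : Fin n → ℤ) : ℤˣ :=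
  (∑ i, ∑ j, if i < j ∧ S i = true ∧ S j = false then r i * r j else 0).negOnePow

/-- Given `θ ∈ O_A(c,d)` and an element `(xᵢ)` of `Z(S)`, the operation in `O_A(c|_S,d)` obtained by
replacing the `xᵢ ∈ V_{c(i)}`, `i ∉ S`, by their images in `A_{c(i)} = O_A(∅,c(i))` and composing
them with `θ`. -/
def fillOp {O : ColoredOperad k C} {A : Alg O} (E : EnvelopingOperad O A) (α : V ⟶ A.X) {n : ℕ}
    (c : Fin n → C) (d : C) (S : Fin n → Bool) (θ : Homog (E.operad.obj c d))
    (x : ∀ i, Homog (vert V W (c i) (S i))) :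
    Homog (E.operad.obj (fun a => c (enum S a)) d) :=
  ev (E.operad.comp c (fun j => slotColor (c j) (S j)) (fun a => c (enum S a)) d (slotEquiv S)
    (fun j y => (congrArg c (enum_slotEquiv S ⟨j, y⟩)).trans (slotColor_eq (c j) (S j) y)))
    θ (fun j => slotOp E α (c j) (S j) (x j))

/-- A sequence `𝔾(A) = B₀ ⟶ B₁ ⟶ ⋯` of collections with colimit `𝔾(B)`, in which each
`B_{n} ⟶ B_{n+1}` is a pushout of `⊕_{|I| = n+1} O_A(c,d) ⊗_{Σ_c} ⋀ᵢ f_{c(i)}` along the map which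
is given, at the vertex `S` of the cube, by replacing the factors `V` by factors `A`
along `α : V ⟶ 𝔾(A)`, composing in `O_A`, and applying the map
`O_A(c|_S,d) ⊗ ⨂_{i ∈ S} W_{c(i)} ⟶ B_{|S|} ⟶ B_{n}`. -/
structure CellFiltration {O : ColoredOperad k C} {A B : Alg O} (E : EnvelopingOperad O A)
    (f : V ⟶ W) (α : V ⟶ A.X) (i : A ⟶ B) where
  /-- The sequence `B₀ ⟶ B₁ ⟶ ⋯`. -/
  seq : ℕ ⥤ Coll k C
  /-- The identification `𝔾(A) = B₀`. -/
  zeroIso : A.X ≅ seq.obj 0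
  /-- The maps `Bₙ ⟶ 𝔾(B)`. -/
  toB : seq ⟶ (Functor.const ℕ).obj B.X
  /-- `𝔾(B)` is the colimit of the sequence. -/
  isColimit : IsColimit (Cocone.mk B.X toB)
  /-- The map `𝔾(A) = B₀ ⟶ 𝔾(B)` is `𝔾(i)`. -/
  zeroIso_toB : zeroIso.hom ≫ toB.app 0 = (Alg.forget O).map i
  /-- The maps `O_A(c,d) ⊗ ⨂ᵢ W_{c(i)} ⟶ Bₙ`, for `c : I → C` with `|I| = n`. -/
  cell : ∀ {n : ℕ} (c : Fin n → C) (d : C),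
    htensor (E.operad.obj c d) (fun i => W (c i)) ⟶ seq.obj n d
  /-- The maps `cell` are compatible with isomorphisms of collections of colours. -/
  cell_relabel : ∀ {n : ℕ} (c c' : Fin n → C) (d : C) (σ : Equiv.Perm (Fin n))
    (h : ∀ i, c' (σ i) = c i) (θ : Homog (E.operad.obj c d)) (x : ∀ i, Homog (W (c' i))),
    ev (cell c' d) (E.operad.relabel d σ h θ) x =
      Homog.sgn (koszulSign σ (fun i => (x i).deg))
        (ev (cell c d) θ (fun i => recolor W (h i) (x (σ i))))
  /-- For `n = 0` the map `cell` is the identification of `O_A(∅,d)` with `A_d`. -/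
  cell_zero : ∀ (d : C) (a : Homog (A.X d)),
    ev (cell (Fin.elim0 : Fin 0 → C) d) (Homog.map (E.η d) a) (fun i => i.elim0) =
      Homog.map (zeroIso.hom d) a
  /-- The attaching maps. -/
  attach : ∀ (n : ℕ) (d : C), stepSrc E.operad f (n + 1) d ⟶ seq.obj n d
  /-- The formula for the attaching maps. -/
  attach_eq : ∀ (n : ℕ) (d : C) (c : CollClass C (n + 1)) (S : Proper (n + 1))
    (θ : Homog (E.operad.obj c.out d)) (x : ∀ i, Homog (vert V W (c.out i) (S.1 i))),
    ev (vertexIncl E.operad f d c S ≫ attach n d) θ x =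
      Homog.sgn (splitSign S.1 (fun i => (x i).deg))
        (Homog.map (seq.map (homOfLE (Nat.le_of_lt_succ (size_lt S))) d)
          (ev (cell (fun a => c.out (enum S.1 a)) d) (fillOp E α c.out d S.1 θ x)
            (fun a => slotElt (S.1 (enum S.1 a)) (enum_mem S.1 a) (x (enum S.1 a)))))
  /-- The maps to `Bₙ₊₁` from the target of the cell maps. -/
  step : ∀ (n : ℕ) (d : C), stepTgt E.operad W (n + 1) d ⟶ seq.obj (n + 1) d
  topIncl_step : ∀ (n : ℕ) (d : C) (c : CollClass C (n + 1)),
    topIncl E.operad W d c ≫ step n d = cell c.out d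
  /-- The pushout squares. -/
  isPushout : ∀ (n : ℕ) (d : C),
    IsPushout (stepMap E.operad f (n + 1) d) (attach n d) (step n d)
      (seq.map (homOfLE (Nat.le_succ n)) d)

end Filtration

end

end DGOperad

open DGOperad

namespace DGOperad

noncomputable section

open Homog

variable {k : Type u} [CommRing k] {C : Type u}

/-! ## Multilinear functions of homogeneous elements -/

theorem mk_single_eq {n : ℕ} {X : Fin n → Cx k} {m : ℤ} (s : TSymb X m) (r : k) :
    (Submodule.Quotient.mk (Finsupp.single s r) : TMod X m) = r • tmod s.1 s.2 := by
  unfold tmod tsymb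
  rw [← Submodule.Quotient.mk_smul, Finsupp.smul_single, smul_eq_mul, mul_one]

section Multilinear

variable {X Y Z : Cx k}

namespace Homog

/-- The component in degree `m` of a homogeneous element. -/
def vat (z : Homog X) (m : ℤ) : X.X m := if h : z.deg = m then h ▸ z.val else 0

@[simp] theorem vat_mk (m : ℤ) (a : X.X m) : (mk m a).vat m = a := dif_pos rfl

@[simp] theorem vat_deg (z : Homog X) : z.vat z.deg = z.val := dif_pos rfl

theorem vat_of_ne (z : Homog X) {m : ℤ} (h : z.deg ≠ m) : z.vat m = 0 := dif_neg h

theorem mk_vat (z : Homog X) {m : ℤ} (h : z.deg = m) : mk m (z.vat m) = z := by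
  subst h; simp

theorem ext_vat {z z' : Homog X} (h : z.deg = z'.deg) (h' : z.vat z.deg = z'.vat z.deg) :
    z = z' := by
  rw [← mk_vat z rfl, h', mk_vat z' h.symm]

theorem vat_map (f : X ⟶ Y) (z : Homog X) (m : ℤ) : (map f z).vat m = f.f m (z.vat m) := by
  obtain ⟨q, a⟩ := z
  by_cases h : q = m
  · subst h; simp [map_mk]
  · rw [vat_of_ne _ (by simpa using h), vat_of_ne _ (by simpa using h), map_zero]

theorem vat_sgn (s : ℤˣ) (z : Homog X) (m : ℤ) : (sgn s z).vat m = s • z.vat m := by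
  obtain ⟨q, a⟩ := z
  by_cases h : q = m
  · subst h; simp [sgn]
  · rw [vat_of_ne _ (by simpa using h), vat_of_ne _ (by simpa using h), smul_zero]

theorem vat_diff (z : Homog X) {m m' : ℤ} (h : m + 1 = m') :
    z.diff.vat m' = X.d m m' (z.vat m) := by
  obtain ⟨q, a⟩ := z
  subst h
  by_cases h : q = m
  · subst h; rw [diff_mk, vat_mk, vat_mk]
  · rw [vat_of_ne _ (by simpa [diff] using h), vat_of_ne _ (by simpa using h), map_zero]

/-- A scalar times a homogeneous element. -/
def hsmul (r : k) (z : Homog X) : Homog X := ⟨z.deg, r • z.val⟩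

@[simp] theorem deg_hsmul (r : k) (z : Homog X) : (hsmul r z).deg = z.deg := rfl

theorem vat_hsmul (r : k) (z : Homog X) (m : ℤ) : (hsmul r z).vat m = r • z.vat m := by
  obtain ⟨q, a⟩ := z
  by_cases h : q = m
  · subst h; simp [hsmul]
  · rw [vat_of_ne _ (by simpa using h), vat_of_ne _ (by simpa using h), smul_zero]

theorem sgn_sgn (s t : ℤˣ) (z : Homog X) : sgn s (sgn t z) = sgn (s * t) z := by
  unfold sgn; simp only [smul_smul]

@[simp] theorem sgn_one (z : Homog X) : sgn 1 z = z :=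
  Homog.ext rfl (heq_of_eq (one_smul _ _))

theorem sgn_diff (s : ℤˣ) (z : Homog X) : (sgn s z).diff = sgn s z.diff := by
  refine ext_vat rfl ?_
  change (sgn s z).diff.vat (z.deg + 1) = (sgn s z.diff).vat (z.deg + 1)
  rw [vat_diff _ rfl, vat_sgn, vat_sgn, vat_diff _ rfl, Units.smul_def,
    Units.smul_def, map_zsmul]

theorem sgn_hsmul (s : ℤˣ) (r : k) (z : Homog X) : sgn s (hsmul r z) = hsmul r (sgn s z) := by
  refine Homog.ext rfl (heq_of_eq ?_)
  exact smul_comm s r z.val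

theorem sgn_eq_hsmul (s : ℤˣ) (z : Homog X) : sgn s z = hsmul ((s : ℤ) : k) z := by
  unfold sgn hsmul
  congr 1
  rw [Units.smul_def, Int.cast_smul_eq_zsmul]

theorem map_hsmul (f : X ⟶ Y) (r : k) (z : Homog X) : map f (hsmul r z) = hsmul r (map f z) := by
  unfold map hsmul; simp

theorem diff_hsmul (r : k) (z : Homog X) : (hsmul r z).diff = hsmul r z.diff := by
  unfold diff hsmul; simp

end Homog

/-- The homogeneous element `z` is the sum of `z₁` and `z₂`. -/
structure HAdd3 (z z₁ z₂ : Homog X) : Prop where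
  deg₁ : z₁.deg = z.deg
  deg₂ : z₂.deg = z.deg
  vat : ∀ m, z.vat m = z₁.vat m + z₂.vat m

theorem hadd_mk (q : ℤ) (a b : X.X q) : HAdd3 (mk q (a + b)) (mk q a) (mk q b) where
  deg₁ := rfl
  deg₂ := rfl
  vat m := by
    by_cases h : q = m
    · subst h; simp
    · simp [vat_of_ne, h]

theorem HAdd3.exists_mk {z z₁ z₂ : Homog X} (h : HAdd3 z z₁ z₂) :
    ∃ (q : ℤ) (a b : X.X q), z = Homog.mk q (a + b) ∧ z₁ = Homog.mk q a ∧ z₂ = Homog.mk q b := by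
  refine ⟨z.deg, z₁.vat z.deg, z₂.vat z.deg, ?_, (mk_vat _ h.deg₁).symm, (mk_vat _ h.deg₂).symm⟩
  rw [← h.vat, mk_vat _ rfl]

theorem HAdd3.unique {z z' z₁ z₂ : Homog X} (h : HAdd3 z z₁ z₂) (h' : HAdd3 z' z₁ z₂) :
    z = z' :=
  ext_vat (h.deg₁.symm.trans h'.deg₁) (by rw [h.vat, h'.vat])

theorem HAdd3.map {z z₁ z₂ : Homog X} (h : HAdd3 z z₁ z₂) (f : X ⟶ Y) :
    HAdd3 (Homog.map f z) (Homog.map f z₁) (Homog.map f z₂) :=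
  ⟨h.deg₁, h.deg₂, fun m => by rw [vat_map, vat_map, vat_map, h.vat, map_add]⟩

theorem HAdd3.sgn {z z₁ z₂ : Homog X} (h : HAdd3 z z₁ z₂) (s : ℤˣ) :
    HAdd3 (Homog.sgn s z) (Homog.sgn s z₁) (Homog.sgn s z₂) :=
  ⟨h.deg₁, h.deg₂, fun m => by rw [vat_sgn, vat_sgn, vat_sgn, h.vat, smul_add]⟩

theorem HAdd3.diff {z z₁ z₂ : Homog X} (h : HAdd3 z z₁ z₂) :
    HAdd3 z.diff z₁.diff z₂.diff :=
  ⟨by simp [h.deg₁], by simp [h.deg₂], fun m => by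
    rw [vat_diff _ (sub_add_cancel m 1), vat_diff _ (sub_add_cancel m 1),
      vat_diff _ (sub_add_cancel m 1), h.vat, map_add]⟩

/-- A linear function of homogeneous elements. -/
structure IsLin (L : Homog X → Homog Y) : Prop where
  add : ∀ {z z₁ z₂}, HAdd3 z z₁ z₂ → HAdd3 (L z) (L z₁) (L z₂)
  smul : ∀ r z, L (hsmul r z) = hsmul r (L z)

theorem isLin_map (f : X ⟶ Y) : IsLin (map f) := ⟨fun h => h.map f, map_hsmul f⟩

theorem isLin_sgn (s : ℤˣ) : IsLin (sgn s : Homog X → Homog X) :=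
  ⟨fun h => h.sgn s, sgn_hsmul s⟩

theorem isLin_diff : IsLin (diff : Homog X → Homog X) := ⟨fun h => h.diff, diff_hsmul⟩

theorem isLin_id : IsLin (id : Homog X → Homog X) := ⟨fun h => h, fun _ _ => rfl⟩

theorem IsLin.comp {L : Homog Y → Homog Z} {L' : Homog X → Homog Y} (h : IsLin L)
    (h' : IsLin L') : IsLin (fun x => L (L' x)) :=
  ⟨fun a => h.add (h'.add a), fun r z => by rw [h'.smul, h.smul]⟩

variable {ι : Type*} [DecidableEq ι] {A : ι → Cx k}

/-- A multilinear function of homogeneous elements. -/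
structure IsML (F : (∀ i, Homog (A i)) → Homog Y) : Prop where
  add : ∀ x i {z z₁ z₂}, HAdd3 z z₁ z₂ → HAdd3 (F (Function.update x i z))
    (F (Function.update x i z₁)) (F (Function.update x i z₂))
  smul : ∀ x i r z, F (Function.update x i (hsmul r z)) = hsmul r (F (Function.update x i z))

theorem IsML.lin {F : (∀ i, Homog (A i)) → Homog Y} (h : IsML F) (x : ∀ i, Homog (A i)) (i : ι) :
    IsLin (fun z => F (Function.update x i z)) :=
  ⟨fun a => h.add x i a, h.smul x i⟩

theorem isML_of_lin {F : (∀ i, Homog (A i)) → Homog Y}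
    (h : ∀ x i, IsLin (fun z => F (Function.update x i z))) : IsML F :=
  ⟨fun x i _ _ _ a => (h x i).add a, fun x i => (h x i).smul⟩

theorem IsLin.comp_ml {L : Homog Y → Homog Z} (h : IsLin L) {F : (∀ i, Homog (A i)) → Homog Y}
    (h' : IsML F) : IsML (fun x => L (F x)) :=
  isML_of_lin fun x i => h.comp (h'.lin x i)

/-- A sign which depends only on the degrees. -/
theorem IsML.sgn {F : (∀ i, Homog (A i)) → Homog Y} (h : IsML F) (s : (ι → ℤ) → ℤˣ) :
    IsML (fun x => Homog.sgn (s fun i => (x i).deg) (F x)) := by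
  have key : ∀ (x : ∀ i, Homog (A i)) i (z z' : Homog (A i)), z.deg = z'.deg →
      (fun j => (Function.update x i z j).deg) = (fun j => (Function.update x i z' j).deg) := by
    intro x i z z' hz
    funext j
    rcases eq_or_ne j i with rfl | hj
    · simpa using hz
    · simp [hj]
  refine ⟨fun x i z z₁ z₂ a => ?_, fun x i r z => ?_⟩
  · rw [key x i z₁ z a.deg₁, key x i z₂ z a.deg₂]
    exact (h.add x i a).sgn _
  · rw [key x i (hsmul r z) z rfl, h.smul, sgn_hsmul]

/-- Substitution of multilinear functions into a multilinear function. -/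
theorem IsML.subst {κ : Type*} [DecidableEq κ] {B : κ → Cx k}
    {G : (∀ j, Homog (B j)) → Homog Y} (hG : IsML G) (p : ι → κ)
    (H : ∀ j, (∀ i, Homog (A i)) → Homog (B j))
    (hind : ∀ x i z j, j ≠ p i → H j (Function.update x i z) = H j x)
    (hlin : ∀ x i, IsLin (fun z => H (p i) (Function.update x i z))) :
    IsML (fun x => G fun j => H j x) := by
  have key : ∀ x i z, (fun j => H j (Function.update x i z)) =
      Function.update (fun j => H j x) (p i) (H (p i) (Function.update x i z)) := by
    intro x i z
    funext j
    rcases eq_or_ne j (p i) with rfl | hj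
    · simp
    · rw [Function.update_of_ne hj, hind x i z j hj]
  refine isML_of_lin fun x i => ?_
  simp_rw [key]
  exact (hG.lin _ _).comp (hlin x i)

theorem mk_zero_eq_hsmul (m : ℤ) : mk m (0 : X.X m) = hsmul (0 : k) (mk m (0 : X.X m)) := by
  unfold hsmul; simp

theorem hsmul_zero_eq (z : Homog X) : hsmul (0 : k) z = mk z.deg 0 := by
  unfold hsmul; simp

theorem IsLin.zero {L : Homog X → Homog Y} (h : IsLin L) (m : ℤ) :
    L (Homog.mk m 0) = Homog.mk (L (Homog.mk m 0)).deg 0 := by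
  conv_lhs => rw [mk_zero_eq_hsmul, h.smul, hsmul_zero_eq]

/-- A set of homogeneous elements generates a complex as a graded module. -/
def Spans (S : Set (Homog X)) : Prop :=
  ∀ Q : Homog X → Prop, (∀ z ∈ S, Q z) → (∀ m, Q (mk m 0)) →
    (∀ {z z₁ z₂}, HAdd3 z z₁ z₂ → Q z₁ → Q z₂ → Q z) → (∀ r z, Q z → Q (hsmul r z)) → ∀ z, Q z

theorem spans_univ : Spans (Set.univ : Set (Homog X)) := fun _ h _ _ _ z => h z trivial

theorem spans_of_span {S : Set (Homog X)}
    (h : ∀ m, Submodule.span k {a : X.X m | mk m a ∈ S} = ⊤) : Spans S := by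
  rintro Q h₁ h₂ h₃ h₄ ⟨m, a⟩
  have ha : a ∈ Submodule.span k {a : X.X m | mk m a ∈ S} := by rw [h]; trivial
  induction ha using Submodule.span_induction with
  | mem a ha => exact h₁ _ ha
  | zero => exact h₂ m
  | add a b _ _ ha hb => exact h₃ (hadd_mk m a b) ha hb
  | smul r a _ ha => exact h₄ r _ ha

theorem Spans.span_eq_top {S : Set (Homog X)} (h : Spans S) (m : ℤ) :
    Submodule.span k {a : X.X m | Homog.mk m a ∈ S} = ⊤ := by
  rw [eq_top_iff]
  intro a _
  have := h (fun z => ∀ m, z.vat m ∈ Submodule.span k {a : X.X m | Homog.mk m a ∈ S}) ?_ ?_ ?_ ?_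
    (Homog.mk m a) m
  · simpa using this
  · intro z hz m
    by_cases hm : z.deg = m
    · exact Submodule.subset_span (by rw [Set.mem_ofPred_eq, mk_vat z hm]; exact hz)
    · rw [vat_of_ne _ hm]; exact Submodule.zero_mem _
  · intro n m
    by_cases hm : n = m
    · subst hm; simp
    · rw [vat_of_ne _ hm]; exact Submodule.zero_mem _
  · intro z z₁ z₂ a h₁ h₂ m
    rw [a.vat]
    exact Submodule.add_mem _ (h₁ m) (h₂ m)
  · intro r z hz m
    rw [vat_hsmul]
    exact Submodule.smul_mem _ _ (hz m)

theorem spans_pure {n : ℕ} (X : Fin n → Cx k) : Spans (Set.range (tpure (X := X))) := by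
  refine spans_of_span fun m => ?_
  rw [eq_top_iff]
  rintro a -
  obtain ⟨a, rfl⟩ := Submodule.Quotient.mk_surjective _ a
  induction a using Finsupp.induction_linear with
  | zero => exact Submodule.zero_mem _
  | add a b ha hb => exact Submodule.add_mem _ ha hb
  | single s r =>
    change (Submodule.Quotient.mk (Finsupp.single s r) : TMod X m) ∈ _
    rw [mk_single_eq]
    exact (Submodule.span k {a : (tensor X).X m | mk m a ∈ Set.range (tpure (X := X))}).smul_mem
      r (Submodule.subset_span ⟨s.1, (mk_tmk _ _ s.2).symm⟩)

theorem IsML.eq_of_spans [Fintype ι] {F G : (∀ i, Homog (A i)) → Homog Y} (hF : IsML F)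
    (hG : IsML G) (hdeg : ∀ x, (F x).deg = (G x).deg) {S : ∀ i, Set (Homog (A i))}
    (hS : ∀ i, Spans (S i)) (h : ∀ x, (∀ i, x i ∈ S i) → F x = G x) (x : ∀ i, Homog (A i)) :
    F x = G x := by
  suffices H : ∀ s : Finset ι, ∀ x : ∀ i, Homog (A i), (∀ i ∉ s, x i ∈ S i) → F x = G x from
    H Finset.univ x (by simp)
  intro s
  induction s using Finset.induction_on with
  | empty => exact fun x hx => h x fun i => hx i (by simp)
  | insert i s his ih =>
    intro x hx
    have key : ∀ z, F (Function.update x i z) = G (Function.update x i z) := by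
      refine hS i _ ?_ ?_ ?_ ?_
      · intro z hz
        refine ih _ fun j hj => ?_
        rcases eq_or_ne j i with rfl | hji
        · simpa using hz
        · rw [Function.update_of_ne hji]
          exact hx j (by simp [hji, hj])
      · intro m
        rw [(hF.lin x i).zero, (hG.lin x i).zero, hdeg]
      · intro z z₁ z₂ a h₁ h₂
        have := hF.add x i a
        rw [h₁, h₂] at this
        exact this.unique (hG.add x i a)
      · intro r z hz
        rw [hF.smul, hG.smul, hz]
    simpa using key (x i)

theorem IsLin.eq_of_spans {L L' : Homog X → Homog Y} (h : IsLin L) (h' : IsLin L')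
    (hdeg : ∀ z, (L z).deg = (L' z).deg) {S : Set (Homog X)} (hS : Spans S)
    (he : ∀ z ∈ S, L z = L' z) (z : Homog X) : L z = L' z := by
  refine hS (fun z => L z = L' z) he (fun m => ?_) (fun {z z₁ z₂} a h₁ h₂ => ?_)
    (fun r z hz => ?_) z
  · change L (Homog.mk m 0) = L' (Homog.mk m 0)
    rw [h.zero, h'.zero, hdeg]
  · have := h.add a
    rw [h₁, h₂] at this
    exact this.unique (h'.add a)
  · rw [h.smul, h'.smul, hz]

/-- The map out of a tensor product defined by a multilinear function of homogeneous elements. -/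
def tdesc {n : ℕ} {X : Fin n → Cx k} (F : (∀ i, Homog (X i)) → Homog Y) (hF : IsML F)
    (_hdeg : ∀ x, (F x).deg = tdeg x)
    (hd : ∀ x m, (F x).diff.vat m =
      ∑ i, preSign x i • (F (Function.update x i (x i).diff)).vat m) : tensor X ⟶ Y :=
  tensorDesc (fun m x _ => (F x).vat m)
    (fun m x i q a b _ _ _ => (hF.add x i (hadd_mk q a b)).vat m)
    (fun m x i q r a _ _ => by
      have := hF.smul x i r (mk q a)
      change F (Function.update x i (mk q (r • a))) = _ at this
      rw [this, vat_hsmul])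
    (fun m m' hm x h => by rw [← vat_diff _ hm, hd])

@[simp] theorem map_tdesc {n : ℕ} {X : Fin n → Cx k} (F : (∀ i, Homog (X i)) → Homog Y)
    (hF : IsML F) (hdeg hd) (x : ∀ i, Homog (X i)) : map (tdesc F hF hdeg hd) (tpure x) =
      F x :=
  (map_tensorDesc _ _ _ _ _).trans (mk_vat _ (hdeg x))

theorem tpure_add {n : ℕ} {X : Fin n → Cx k} : IsML (tpure (X := X)) := by
  refine ⟨fun x i z z₁ z₂ a => ?_, fun x i r z => ?_⟩
  · obtain ⟨q, b, c, rfl, rfl, rfl⟩ := a.exists_mk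
    have h₁ : ∀ c, tdeg (Function.update x i (mk q c)) = tdeg x - (x i).deg + q := fun c => by
      rw [tdeg_update]
    rw [← mk_tmk _ _ (h₁ (b + c)), ← mk_tmk _ _ (h₁ b), ← mk_tmk _ _ (h₁ c)]
    unfold tmk
    rw [tmod_add x i q b c (h₁ _) (h₁ _) (h₁ _)]
    exact hadd_mk (X := tensor X) _ _ _
  · obtain ⟨q, a⟩ := z
    have h₁ : ∀ c, tdeg (Function.update x i (mk q c)) = tdeg x - (x i).deg + q := fun c => by
      rw [tdeg_update]
    change tpure (Function.update x i (mk q (r • a))) = _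
    rw [← mk_tmk _ _ (h₁ (r • a)), ← mk_tmk _ _ (h₁ a)]
    unfold tmk
    rw [tmod_smul x i q r a (h₁ _) (h₁ _)]
    rfl

theorem tpure_diff {n : ℕ} {X : Fin n → Cx k} (x : ∀ i, Homog (X i)) (m : ℤ) :
    (tpure x).diff.vat m = ∑ i, preSign x i • (tpure (Function.update x i (x i).diff)).vat m := by
  have hdeg : ∀ i, (tpure (Function.update x i (x i).diff)).deg = tdeg x + 1 := fun i =>
    tdeg_diff x i rfl rfl
  by_cases hm : tdeg x + 1 = m
  · rw [vat_diff _ hm]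
    have e : (tpure x).vat (tdeg x) = tmk x _ rfl := vat_mk _ _
    rw [e]
    have e' : ((tensor X).d (tdeg x) m).hom (tmod x rfl) = tdiffSymb hm x rfl := by
      simp only [tensor, dif_pos hm, ModuleCat.hom_ofHom, tdiff]
      exact tlift_tmod _ _ _ _ _
    refine e'.trans (Finset.sum_congr rfl fun i _ => ?_)
    congr 1
    rw [← mk_tmk _ _ (tdeg_diff x i rfl hm), vat_mk]
    rfl
  · rw [vat_of_ne _ hm]
    refine (Finset.sum_eq_zero fun i _ => ?_).symm
    rw [vat_of_ne _ (by rw [hdeg]; exact hm), smul_zero]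

end Multilinear

section Headed

variable {n : ℕ} {P Z : Cx k} {Y : Fin n → Cx k}

theorem hargs_update (θ : Homog P) (y : ∀ i, Homog (Y i)) (i : Fin n) (z : Homog (Y i)) :
    hargs θ (Function.update y i z) =
      Function.update (hargs θ y) i.succ (show Homog (hfam P Y i.succ) from z) :=
  Fin.cons_update (α := fun i => Homog (hfam P Y i)) θ y i z

theorem hargs_update_zero (θ θ' : Homog P) (y : ∀ i, Homog (Y i)) :
    hargs θ' y = Function.update (hargs θ y) 0 (show Homog (hfam P Y 0) from θ') :=
  (Fin.update_cons_zero (α := fun i => Homog (hfam P Y i)) θ y θ').symm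

theorem hpure_isML (θ : Homog P) : IsML (hpure (Y := Y) θ) := by
  refine isML_of_lin fun y i => ?_
  unfold hpure
  simp_rw [hargs_update]
  exact (tpure_add (X := hfam P Y)).lin (hargs θ y) i.succ

theorem hpure_isLin (y : ∀ i, Homog (Y i)) : IsLin (fun θ : Homog P => hpure θ y) := by
  have e : (fun θ : Homog P => hpure θ y) = fun θ => tpure (X := hfam P Y)
      (Function.update (hargs ⟨0, 0⟩ y) 0 θ) :=
    funext fun θ => congrArg tpure (hargs_update_zero _ _ _)
  rw [e]
  exact (tpure_add (X := hfam P Y)).lin _ _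

theorem ev_isML (f : htensor P Y ⟶ Z) (θ : Homog P) : IsML (ev f θ) :=
  (isLin_map f).comp_ml (hpure_isML θ)

theorem ev_isLin (f : htensor P Y ⟶ Z) (y : ∀ i, Homog (Y i)) :
    IsLin (fun θ => ev f θ y) :=
  (isLin_map f).comp (hpure_isLin y)

/-- The sign `(-1)^{p + r₁ + ⋯ + r_{i-1}}`. -/
def leftSign (p : ℤ) (r : Fin n → ℤ) (i : Fin n) : ℤˣ :=
  (p + ∑ j ∈ Finset.univ.filter (· < i), r j).negOnePow

theorem preSign_hargs_zero (θ : Homog P) (y : ∀ i, Homog (Y i)) : preSign (hargs θ y) 0 = 1 := by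
  unfold preSign
  rw [Finset.sum_filter, Finset.sum_eq_zero, Int.negOnePow_zero]
  exact fun i _ => if_neg (Fin.not_lt_zero i)

theorem preSign_hargs_succ (θ : Homog P) (y : ∀ i, Homog (Y i)) (i : Fin n) :
    preSign (hargs θ y) i.succ = leftSign θ.deg (fun i => (y i).deg) i := by
  unfold preSign leftSign
  congr 1
  rw [Finset.sum_filter, Fin.sum_univ_succ, Finset.sum_filter]
  simp only [Fin.succ_pos, if_true, Fin.succ_lt_succ_iff]
  rfl

theorem hpure_diff (θ : Homog P) (y : ∀ i, Homog (Y i)) (m : ℤ) :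
    (hpure θ y).diff.vat m = (hpure θ.diff y).vat m +
      ∑ i, leftSign θ.deg (fun i => (y i).deg) i •
        (hpure θ (Function.update y i (y i).diff)).vat m := by
  unfold hpure
  refine (tpure_diff _ _).trans ?_
  rw [Fin.sum_univ_succ, preSign_hargs_zero, one_smul]
  refine congrArg₂ (· + ·) ?_ (Finset.sum_congr rfl fun i _ => ?_)
  · rw [hargs_update_zero θ θ.diff]; rfl
  · rw [hargs_update, preSign_hargs_succ]; rfl

theorem ev_diff (f : htensor P Y ⟶ Z) (θ : Homog P) (y : ∀ i, Homog (Y i)) (m : ℤ) :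
    (ev f θ y).diff.vat m = (ev f θ.diff y).vat m +
      ∑ i, leftSign θ.deg (fun i => (y i).deg) i •
        (ev f θ (Function.update y i (y i).diff)).vat m := by
  unfold ev
  rw [← map_diff, vat_map, hpure_diff, map_add, map_sum, vat_map]
  simp_rw [vat_map, Units.smul_def, map_zsmul]

theorem exists_hargs (x : ∀ i, Homog (hfam P Y i)) :
    ∃ θ y, x = hargs (P := P) (Y := Y) θ y :=
  ⟨x 0, fun i => x i.succ, (Fin.cons_self_tail x).symm⟩

/-- The map out of `P ⊗ Y₁ ⊗ ⋯ ⊗ Yₙ` defined by a multilinear function of homogeneous elements. -/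
def hdesc (F : Homog P → (∀ i, Homog (Y i)) → Homog Z) (hlin : ∀ y, IsLin (fun θ => F θ y))
    (hml : ∀ θ, IsML (F θ)) (hdeg : ∀ θ y, (F θ y).deg = θ.deg + ∑ i, (y i).deg)
    (hd : ∀ θ y m, (F θ y).diff.vat m = (F θ.diff y).vat m +
      ∑ i, leftSign θ.deg (fun i => (y i).deg) i • (F θ (Function.update y i (y i).diff)).vat m) :
    htensor P Y ⟶ Z :=
  tdesc (X := hfam P Y) (fun x => F (x 0) (fun i => x i.succ))
    (by
      refine isML_of_lin fun x i => ?_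
      obtain ⟨θ, y, rfl⟩ := exists_hargs x
      refine Fin.cases ?_ (fun i => ?_) i
      · have : ∀ z : Homog P, Function.update (hargs θ y) 0 z = hargs z y := fun z =>
          (hargs_update_zero θ z y).symm
        exact (funext fun z => by rw [this z]; rfl :
          (fun z => F z y) = fun z : Homog (hfam P Y 0) =>
            F (Function.update (hargs θ y) 0 z 0) (fun i => Function.update (hargs θ y) 0 z i.succ))
          ▸ hlin y
      · have : ∀ z : Homog (Y i), Function.update (hargs θ y) i.succ z =
            hargs θ (Function.update y i z) := fun z => (hargs_update θ y i z).symm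
        exact (funext fun z => by rw [this z]; rfl :
          (fun z => F θ (Function.update y i z)) = fun z : Homog (hfam P Y i.succ) =>
            F (Function.update (hargs θ y) i.succ z 0)
              (fun j => Function.update (hargs θ y) i.succ z j.succ)) ▸ (hml θ).lin y i)
    (fun x => by
      obtain ⟨θ, y, rfl⟩ := exists_hargs x
      rw [tdeg_hargs]
      exact hdeg θ y)
    (fun x m => by
      obtain ⟨θ, y, rfl⟩ := exists_hargs x
      rw [Fin.sum_univ_succ, preSign_hargs_zero, one_smul]
      refine (hd θ y m).trans (congrArg₂ (· + ·) ?_ (Finset.sum_congr rfl fun i _ => ?_))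
      · rw [show Function.update (hargs θ y) 0 (hargs θ y 0).diff = hargs θ.diff y from
          (hargs_update_zero θ θ.diff y).symm]
        rfl
      · rw [show Function.update (hargs θ y) i.succ (hargs θ y i.succ).diff =
          hargs θ (Function.update y i (y i).diff) from (hargs_update θ y i _).symm,
          preSign_hargs_succ]
        rfl)

@[simp] theorem ev_hdesc (F : Homog P → (∀ i, Homog (Y i)) → Homog Z) (hlin hml hdeg hd)
    (θ : Homog P) (y : ∀ i, Homog (Y i)) : ev (hdesc F hlin hml hdeg hd) θ y = F θ y :=
  map_tdesc _ _ _ _ _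

theorem spans_hpure (P : Cx k) (Y : Fin n → Cx k) :
    Spans {z | ∃ (θ : Homog P) (y : ∀ i, Homog (Y i)), z = hpure θ y} := by
  refine fun Q h => spans_pure (hfam P Y) Q ?_
  rintro _ ⟨x, rfl⟩
  exact h _ ⟨x 0, fun i => x i.succ, congrArg tpure (Fin.cons_self_tail x).symm⟩

end Headed

/-! ## Multilinear extension -/

section ModuleExtension

variable {ι : Type} [Fintype ι] [DecidableEq ι]
  {M : ι → Type u} [∀ i, AddCommGroup (M i)] [∀ i, Module k (M i)]
  {N : Type u} [AddCommGroup N] [Module k N] {Γ : ι → Type u}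

/-- A function of tuples of generators extends to a multilinear map if it extends to a linear map
in each variable. -/
theorem exists_multilinear_extension (γ : ∀ i, Γ i → M i)
    (hγ : ∀ i, Submodule.span k (Set.range (γ i)) = ⊤) (Φ : (∀ i, Γ i) → N)
    (hΦ : ∀ (i : ι) (s : ∀ i, Γ i), ∃ l : M i →ₗ[k] N, ∀ t,
      l (γ i t) = Φ (Function.update s i t)) :
    ∃ L : MultilinearMap k M N, ∀ s, L (fun i => γ i (s i)) = Φ s := by
  classical
  let Ψ : ∀ p : ∀ i, Γ i, MultilinearMap k (fun i => (fun i (_ : Γ i) => k) i (p i)) N :=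
    fun p => MultilinearMap.mkPiRing k ι (Φ p)
  let L₀ : MultilinearMap k (fun i => Π₀ _ : Γ i, k) N :=
    MultilinearMap.fromDFinsuppEquiv (M := fun i (_ : Γ i) => k) (N := N) Γ k Ψ
  have hL₀ : ∀ s : ∀ i, Γ i, L₀ (fun i => DFinsupp.single (s i) 1) = Φ s := by
    intro s
    have := MultilinearMap.fromDFinsuppEquiv_single (κ := Γ) (R := k)
      (M := fun i (_ : Γ i) => k) Ψ s (fun _ => 1)
    refine this.trans ?_
    simp [Ψ]
  let π : ∀ i, (Π₀ _ : Γ i, k) →ₗ[k] M i := fun i =>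
    DFinsupp.lsum ℕ fun t => LinearMap.toSpanSingleton k (M i) (γ i t)
  have hπ : ∀ i t, π i (DFinsupp.single t 1) = γ i t := fun i t => by simp [π]
  have hsurj : ∀ i, Function.Surjective (π i) := by
    intro i
    rw [← LinearMap.range_eq_top, eq_top_iff, ← hγ, Submodule.span_le]
    rintro _ ⟨t, rfl⟩
    exact ⟨_, hπ i t⟩
  have hker : ∀ (i : ι) (c : Π₀ _ : Γ i, k), π i c = 0 →
      ∀ g, L₀ (Function.update g i c) = 0 := by
    intro i c hc
    suffices H : ∀ s : Finset ι, ∀ g : (∀ i, Π₀ _ : Γ i, k),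
        (∀ j ∉ s, ∃ t, g j = DFinsupp.single t 1) → L₀ (Function.update g i c) = 0 from
      fun g => H Finset.univ g (by simp)
    intro s
    induction s using Finset.induction_on with
    | empty =>
      intro g hg
      choose t ht using fun j => hg j (by simp)
      obtain ⟨l, hl⟩ := hΦ i t
      have : L₀.toLinearMap g i = l ∘ₗ π i := by
        refine DFinsupp.lhom_ext' fun t' => LinearMap.ext_ring ?_
        change L₀ (Function.update g i (DFinsupp.single t' 1)) = l (π i (DFinsupp.single t' 1))
        rw [hπ, hl, ← hL₀]
        congr 1
        funext j
        rcases eq_or_ne j i with rfl | hj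
        · simp
        · simp [hj, ht]
      change L₀.toLinearMap g i c = 0
      rw [this, LinearMap.comp_apply, hc, map_zero]
    | insert j s hjs ih =>
      intro g hg
      rcases eq_or_ne j i with rfl | hji
      · by_cases hne : Nonempty (Γ j)
        · obtain ⟨t⟩ := hne
          have := ih (Function.update g j (DFinsupp.single t 1)) (fun l hl => by
            rcases eq_or_ne l j with rfl | hlj
            · exact ⟨t, by simp⟩
            · rw [Function.update_of_ne hlj]
              exact hg l (by simp [hlj, hl]))
          simpa using this
        · have hc0 : c = 0 := by ext t; exact (hne ⟨t⟩).elim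
          subst hc0
          exact L₀.map_coord_zero j (by simp)
      · have key : ∀ b : Π₀ _ : Γ j, k,
            L₀ (Function.update (Function.update g i c) j b) = 0 := by
          intro b
          induction b using DFinsupp.induction with
          | h0 => exact L₀.map_coord_zero j (by simp)
          | ha t r b _ _ hb =>
            rw [L₀.map_update_add, hb, add_zero]
            have : DFinsupp.single t r = r • (DFinsupp.single t 1 : Π₀ _ : Γ j, k) := by
              rw [← DFinsupp.single_smul, smul_eq_mul, mul_one]
            rw [this, L₀.map_update_smul, Function.update_comm hji.symm, ih, smul_zero]
            intro l hl
            rcases eq_or_ne l j with rfl | hlj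
            · exact ⟨t, by simp⟩
            · rw [Function.update_of_ne hlj]
              exact hg l (by simp [hlj, hl])
        have := key (g j)
        rwa [Function.update_eq_self_iff.2] at this
        rw [Function.update_of_ne hji]
  have hupd : ∀ (i : ι) (a b : Π₀ _ : Γ i, k), π i a = π i b → ∀ g,
      L₀ (Function.update g i a) = L₀ (Function.update g i b) := by
    intro i a b hab g
    rw [← sub_eq_zero, ← L₀.map_update_sub]
    exact hker i _ (by rw [map_sub, hab, sub_self]) g
  have hcongr : ∀ g g' : (∀ i, Π₀ _ : Γ i, k), (∀ i, π i (g i) = π i (g' i)) → L₀ g = L₀ g' := by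
    intro g g' h
    suffices H : ∀ s : Finset ι, L₀ (s.piecewise g g') = L₀ g' by
      simpa using H Finset.univ
    intro s
    induction s using Finset.induction_on with
    | empty => simp
    | insert i s his ih =>
      rw [Finset.piecewise_insert, hupd i (g i) (g' i) (h i), ← ih]
      congr 1
      rw [Function.update_eq_self_iff, Finset.piecewise_eq_of_notMem _ _ _ his]
  choose σ hσ using hsurj
  refine ⟨⟨fun x => L₀ (fun i => σ i (x i)), ?_, ?_⟩, fun s => ?_⟩
  · intro _ x i a b
    have e : ∀ c h, π i h = c → L₀ (fun j => σ j (Function.update x i c j)) =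
        L₀ (Function.update (fun j => σ j (x j)) i h) := by
      intro c h hc
      refine hcongr _ _ fun j => ?_
      rcases eq_or_ne j i with rfl | hj
      · simp [hσ, hc]
      · simp [hj]
    have h₁ := e (a + b) (σ i a + σ i b) (by rw [map_add, hσ, hσ])
    have h₂ := e a (σ i a) (hσ _ _)
    have h₃ := e b (σ i b) (hσ _ _)
    rw [L₀.map_update_add, ← h₂, ← h₃] at h₁
    convert h₁
  · intro _ x i r a
    have e : ∀ c h, π i h = c → L₀ (fun j => σ j (Function.update x i c j)) =
        L₀ (Function.update (fun j => σ j (x j)) i h) := by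
      intro c h hc
      refine hcongr _ _ fun j => ?_
      rcases eq_or_ne j i with rfl | hj
      · simp [hσ, hc]
      · simp [hj]
    have h₁ := e (r • a) (r • σ i a) (by rw [map_smul, hσ])
    have h₂ := e a (σ i a) (hσ _ _)
    rw [L₀.map_update_smul, ← h₂] at h₁
    convert h₁
  · change L₀ (fun i => σ i (γ i (s i))) = Φ s
    rw [← hL₀]
    exact hcongr _ _ fun i => by rw [hσ, hπ]

end ModuleExtension

section HomogExtension

variable {ι : Type} [Fintype ι] [DecidableEq ι] {X : ι → Cx k}
  {Z : Cx k} {Γ : ι → Type u}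

theorem IsLin.exists_linear {X Z : Cx k} {L : Homog X → Homog Z} (hL : IsLin L) (p m : ℤ) :
    ∃ l : X.X p →ₗ[k] Z.X m, ∀ a, l a = (L (Homog.mk p a)).vat m :=
  ⟨{  toFun := fun a => (L (Homog.mk p a)).vat m
      map_add' := fun a b => (hL.add (hadd_mk p a b)).vat m
      map_smul' := fun r a => by
        have := hL.smul r (Homog.mk p a)
        rw [RingHom.id_apply, ← vat_hsmul, ← this]
        rfl }, fun _ => rfl⟩

/-- A function of tuples of homogeneous generators extends to a multilinear function of homogeneous
elements if it extends to a linear function in each variable. -/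
theorem exists_homog_extension (γ : ∀ i, Γ i → Homog (X i))
    (hγ : ∀ i, Spans (Set.range (γ i))) (D : ℤ) (Φ : (∀ i, Γ i) → Homog Z)
    (hdeg : ∀ s, (Φ s).deg = D + ∑ i, (γ i (s i)).deg)
    (hΦ : ∀ (i : ι) (s : ∀ i, Γ i), ∃ l : Homog (X i) → Homog Z, IsLin l ∧ ∀ t,
      l (γ i t) = Φ (Function.update s i t)) :
    ∃ L : (∀ i, Homog (X i)) → Homog Z, IsML L ∧ (∀ x, (L x).deg = D + ∑ i, (x i).deg) ∧
      ∀ s, L (fun i => γ i (s i)) = Φ s := by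
  have main : ∀ p : ι → ℤ, ∃ L : MultilinearMap k (fun i => (X i).X (p i)) (Z.X (D + ∑ i, p i)),
      ∀ s : (∀ i, {t : Γ i // (γ i t).deg = p i}),
        L (fun i => (γ i (s i).1).vat (p i)) = (Φ fun i => (s i).1).vat (D + ∑ i, p i) := by
    intro p
    refine exists_multilinear_extension (Γ := fun i => {t : Γ i // (γ i t).deg = p i})
      (fun i t => (γ i t.1).vat (p i)) (fun i => ?_)
      (fun s => (Φ fun i => (s i).1).vat (D + ∑ i, p i)) (fun i s => ?_)
    · rw [← (hγ i).span_eq_top (p i)]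
      congr 1
      ext a
      constructor
      · rintro ⟨t, rfl⟩
        exact ⟨t.1, (mk_vat _ t.2).symm⟩
      · rintro ⟨t, ht⟩
        have hd : (γ i t).deg = p i := by rw [ht]
        exact ⟨⟨t, hd⟩, by dsimp only; rw [ht, vat_mk]⟩
    · obtain ⟨l, hl, hl'⟩ := hΦ i fun j => (s j).1
      obtain ⟨l₁, hl₁⟩ := hl.exists_linear (p i) (D + ∑ i, p i)
      refine ⟨l₁, fun t => ?_⟩
      rw [hl₁, mk_vat _ t.2, hl']
      congr 2
      funext j
      rcases eq_or_ne j i with rfl | hj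
      · simp
      · simp [hj]
  choose L hL using main
  have hp : ∀ (x : ∀ i, Homog (X i)) (p : ι → ℤ), (∀ i, (x i).deg = p i) →
      (mk _ (L (fun i => (x i).deg) fun i => (x i).val) : Homog Z) =
        mk _ (L p fun i => (x i).vat (p i)) := by
    intro x p h
    obtain rfl : p = fun i => (x i).deg := funext fun i => (h i).symm
    simp only [vat_deg]
  have hupd : ∀ (x : ∀ i, Homog (X i)) (i : ι) (p : ι → ℤ) (z : Homog (X i)),
      (∀ j, (Function.update x i z j).deg = p j) →
      (mk _ (L (fun j => (Function.update x i z j).deg)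
        fun j => (Function.update x i z j).val) : Homog Z) =
      mk _ (L p (Function.update (fun j => (x j).vat (p j)) i (z.vat (p i)))) := by
    intro x i p z h
    rw [hp _ p h]
    congr 2
    funext j
    rcases eq_or_ne j i with rfl | hj
    · simp
    · simp [hj]
  have hdu : ∀ (x : ∀ i, Homog (X i)) (i : ι) (z z' : Homog (X i)), z'.deg = z.deg → ∀ j,
      (Function.update x i z' j).deg = (Function.update x i z j).deg := by
    intro x i z z' h j
    rcases eq_or_ne j i with rfl | hj
    · simpa using h
    · simp [hj]
  refine ⟨fun x => mk _ (L (fun i => (x i).deg) fun i => (x i).val), ⟨?_, ?_⟩,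
    fun _ => rfl, fun s => ?_⟩
  · intro x i z z₁ z₂ a
    rw [hupd x i _ z (hdu x i z z rfl), hupd x i _ z₁ (hdu x i z z₁ a.deg₁),
      hupd x i _ z₂ (hdu x i z z₂ a.deg₂), a.vat, (L _).map_update_add]
    exact hadd_mk _ _ _
  · intro x i r z
    rw [hupd x i _ z (hdu x i z z rfl), hupd x i _ (hsmul r z) (hdu x i z (hsmul r z) rfl),
      vat_hsmul, (L _).map_update_smul]
    rfl
  · have := hL (fun i => (γ i (s i)).deg) (fun i => ⟨s i, rfl⟩)
    dsimp only at this ⊢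
    simp only [vat_deg] at this
    rw [this, mk_vat _ (hdeg s)]

/-- A closure property of generated elements: a property of homogeneous elements of a tensor product
holds if it holds for the tensors of generators and is stable under linear combinations. -/
theorem spans_tpure_of_spans {n : ℕ} {X : Fin n → Cx k} {S : ∀ i, Set (Homog (X i))}
    (hS : ∀ i, Spans (S i)) : Spans {z | ∃ x, (∀ i, x i ∈ S i) ∧ z = tpure (X := X) x} := by
  intro Q h₁ h₂ h₃ h₄
  refine spans_pure X Q ?_ h₂ h₃ h₄
  rintro _ ⟨x, rfl⟩
  suffices H : ∀ s : Finset (Fin n), ∀ x : ∀ i, Homog (X i), (∀ i ∉ s, x i ∈ S i) →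
      Q (tpure x) from H Finset.univ x (by simp)
  intro s
  induction s using Finset.induction_on with
  | empty => exact fun x hx => h₁ _ ⟨x, fun i => hx i (by simp), rfl⟩
  | insert i s his ih =>
    intro x hx
    have key : ∀ z, Q (tpure (Function.update x i z)) := by
      refine hS i _ ?_ ?_ ?_ ?_
      · intro z hz
        refine ih _ fun j hj => ?_
        rcases eq_or_ne j i with rfl | hji
        · simpa using hz
        · rw [Function.update_of_ne hji]
          exact hx j (by simp [hji, hj])
      · intro m
        rw [((tpure_add (X := X)).lin x i).zero]
        exact h₂ _
      · exact fun a h h' => h₃ (tpure_add.add x i a) h h'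
      · intro r z hz
        rw [tpure_add.smul]
        exact h₄ r _ hz
    simpa using key (x i)

variable {Y : Cx k}

/-- The linear maps on the components of a tensor product given by a multilinear function. -/
def mlLift {n : ℕ} {X : Fin n → Cx k} {F : (∀ i, Homog (X i)) → Homog Y} (hF : IsML F)
    (m m' : ℤ) : (tensor X).X m →ₗ[k] Y.X m' :=
  tlift (fun x _ => (F x).vat m')
    (fun x i q a b _ _ _ => (hF.add x i (hadd_mk q a b)).vat m')
    (fun x i q r a _ _ => by
      have := hF.smul x i r (mk q a)
      change F (Function.update x i (mk q (r • a))) = _ at this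
      rw [this, vat_hsmul])

theorem mlLift_vat {n : ℕ} {X : Fin n → Cx k} {F : (∀ i, Homog (X i)) → Homog Y} (hF : IsML F)
    (m m' : ℤ) (x : ∀ i, Homog (X i)) (h : tdeg x = m) :
    mlLift hF m m' ((tpure x).vat m) = (F x).vat m' := by
  subst h
  have : (tpure x).vat (tdeg x) = tmk x _ rfl := vat_mk _ _
  rw [this]
  exact tlift_tmod _ _ _ _ _

/-- A family of linear maps of degree `D` as a linear function of homogeneous elements. -/
theorem isLin_of_linear {X Y : Cx k} (D : ℤ) (f : ∀ m, X.X m →ₗ[k] Y.X (D + m)) :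
    IsLin (fun z : Homog X => mk (D + z.deg) (f z.deg z.val)) := by
  refine ⟨fun {z z₁ z₂} a => ?_, fun r z => ?_⟩
  · obtain ⟨q, b, c, rfl, rfl, rfl⟩ := a.exists_mk
    dsimp only
    rw [map_add]
    exact hadd_mk _ _ _
  · unfold hsmul
    dsimp only
    rw [map_smul]

theorem IsML.exists_lin {n : ℕ} {X : Fin n → Cx k} {F : (∀ i, Homog (X i)) → Homog Y}
    (hF : IsML F) {D : ℤ} (hdeg : ∀ x, (F x).deg = D + tdeg x) :
    ∃ l : Homog (tensor X) → Homog Y, IsLin l ∧ (∀ z, (l z).deg = D + z.deg) ∧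
      ∀ x, l (tpure x) = F x := by
  refine ⟨_, isLin_of_linear D (fun m => mlLift hF m (D + m)), fun _ => rfl, fun x => ?_⟩
  have := mlLift_vat hF (tdeg x) (D + tdeg x) x rfl
  rw [← mk_vat (F x) (hdeg x), ← this]
  congr 2
  exact (vat_deg (tpure x)).symm

theorem IsLin.vat_sum {X Y : Cx k} {L : Homog X → Homog Y} (hL : IsLin L) (q m : ℤ) {ι : Type*}
    (s : Finset ι) (g : ι → X.X q) : (L (Homog.mk q (∑ i ∈ s, g i))).vat m =
      ∑ i ∈ s, (L (Homog.mk q (g i))).vat m := by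
  obtain ⟨l, hl⟩ := hL.exists_linear q m
  simp_rw [← hl]
  exact map_sum l g s

/-- The map of complexes given by a linear function of degree zero which commutes with the
differentials. -/
def homOfLin {X Y : Cx k} (L : Homog X → Homog Y) (hL : IsLin L)
    (hd : ∀ z, L z.diff = (L z).diff) : X ⟶ Y where
  f m := ModuleCat.ofHom
    { toFun := fun a => (L (mk m a)).vat m
      map_add' := fun a b => (hL.add (hadd_mk m a b)).vat m
      map_smul' := fun r a => by
        have := hL.smul r (mk m a)
        rw [RingHom.id_apply, ← vat_hsmul, ← this]
        rfl }
  comm' m m' h := by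
    obtain rfl : m + 1 = m' := h
    refine ModuleCat.hom_ext (LinearMap.ext fun a => ?_)
    change Y.d m (m + 1) ((L (mk m a)).vat m) =
      (L (mk (m + 1) (X.d m (m + 1) a))).vat (m + 1)
    rw [← vat_diff _ rfl, ← hd]
    rfl

theorem map_homOfLin {X Y : Cx k} (L : Homog X → Homog Y) (hL : IsLin L) (hd)
    (hdeg : ∀ z, (L z).deg = z.deg) (z : Homog X) : map (homOfLin L hL hd) z = L z :=
  mk_vat (L z) (hdeg z)

theorem hom_ext_spans {X Y : Cx k} {f g : X ⟶ Y} {S : Set (Homog X)} (hS : Spans S)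
    (h : ∀ z ∈ S, map f z = map g z) : f = g := by
  ext m a
  have := (isLin_map f).eq_of_spans (isLin_map g) (fun _ => rfl) hS h (mk m a)
  exact eq_of_heq (mk.inj this).2

theorem Homog.hom_ext {X Y : Cx k} {f g : X ⟶ Y} (h : ∀ z, Homog.map f z = Homog.map g z) :
    f = g := hom_ext_spans spans_univ fun z _ => h z

/-- A map out of a tensor product, defined on generators of the factors: it suffices that it
extends to a linear function in each variable, and that the Leibniz rule holds on generators. -/
theorem exists_tensor_hom {n : ℕ} {X : Fin n → Cx k} {Γ : Fin n → Type u}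
    (γ : ∀ i, Γ i → Homog (X i)) (hγ : ∀ i, Spans (Set.range (γ i))) (Φ : (∀ i, Γ i) → Homog Z)
    (hdeg : ∀ s, (Φ s).deg = tdeg fun i => γ i (s i))
    (hΦ : ∀ (i : Fin n) (s : ∀ i, Γ i), ∃ l : Homog (X i) → Homog Z, IsLin l ∧ ∀ t,
      l (γ i t) = Φ (Function.update s i t))
    (hd : ∀ (s : ∀ i, Γ i) (l : ∀ i, Homog (X i) → Homog Z), (∀ i, IsLin (l i)) →
      (∀ i t, l i (γ i t) = Φ (Function.update s i t)) → ∀ m, (Φ s).diff.vat m =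
        ∑ i, preSign (fun i => γ i (s i)) i • (l i (γ i (s i)).diff).vat m) :
    ∃ F : tensor X ⟶ Z, ∀ s, map F (tpure fun i => γ i (s i)) = Φ s := by
  obtain ⟨L, hL, hLdeg, hLs⟩ := exists_homog_extension γ hγ 0 Φ
    (fun s => by rw [hdeg, zero_add]; rfl) hΦ
  obtain ⟨l, hl, hldeg, hlp⟩ := hL.exists_lin (D := 0) hLdeg
  have hl0 : ∀ z, (l z).deg = z.deg := fun z => by rw [hldeg, zero_add]
  refine ⟨homOfLin l hl ?_, fun s => ?_⟩
  · refine (hl.comp isLin_diff).eq_of_spans (isLin_diff.comp hl) (fun z => ?_)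
      (spans_tpure_of_spans hγ) ?_
    · rw [hl0, deg_diff, deg_diff, hl0]
    · rintro _ ⟨x, hx, rfl⟩
      choose s hs using hx
      obtain rfl : x = fun i => γ i (s i) := funext fun i => (hs i).symm
      refine ext_vat (by rw [hl0, deg_diff, deg_diff, hl0]) ?_
      generalize (l (tpure fun i => γ i (s i)).diff).deg = m
      rw [hlp, hLs, hd s (fun i z => L (Function.update (fun i => γ i (s i)) i z))
        (fun i => hL.lin _ i) (fun i t => ?_) m]
      · by_cases hm : tdeg (fun i => γ i (s i)) + 1 = m
        · have e : (tpure fun i => γ i (s i)).diff =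
              mk m ((tpure fun i => γ i (s i)).diff.vat m) := (mk_vat _ hm).symm
          rw [e, tpure_diff, hl.vat_sum]
          refine Finset.sum_congr rfl fun i _ => ?_
          have e' : mk m (preSign (fun i => γ i (s i)) i •
              (tpure (Function.update (fun i => γ i (s i)) i (γ i (s i)).diff)).vat m) =
              sgn (preSign (fun i => γ i (s i)) i)
                (tpure (Function.update (fun i => γ i (s i)) i (γ i (s i)).diff)) := by
            rw [← vat_sgn, mk_vat]
            exact tdeg_diff _ i rfl hm
          rw [e', sgn_eq_hsmul, hl.smul, ← sgn_eq_hsmul, vat_sgn, hlp]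
        · rw [vat_of_ne _ (by rw [hl0]; exact hm)]
          refine (Finset.sum_eq_zero fun i _ => ?_).symm
          rw [vat_of_ne, smul_zero]
          rw [hLdeg, zero_add]
          refine fun h => hm ?_
          rw [← h]
          exact (tdeg_diff _ i rfl rfl).symm
      · rw [← hLs]
        congr 1
        funext j
        rcases eq_or_ne j i with rfl | hj
        · simp
        · simp [hj]
  · rw [map_homOfLin _ _ _ hl0, hlp, hLs]

theorem IsML.sgn_all {ι : Type*} [Fintype ι] [DecidableEq ι] {X : ι → Cx k}
    {F : (∀ i, Homog (X i)) → Homog Y} (hF : IsML F) (s : ι → ℤˣ) (x : ∀ i, Homog (X i)) :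
    F (fun i => Homog.sgn (s i) (x i)) = Homog.sgn (∏ i, s i) (F x) := by
  suffices H : ∀ t : Finset ι, F (fun i => if i ∈ t then Homog.sgn (s i) (x i) else x i) =
      Homog.sgn (∏ i ∈ t, s i) (F x) by simpa using H Finset.univ
  intro t
  induction t using Finset.induction_on with
  | empty => simp
  | insert i t hi ih =>
    have e : (fun j => if j ∈ insert i t then Homog.sgn (s j) (x j) else x j) =
        Function.update (fun j => if j ∈ t then Homog.sgn (s j) (x j) else x j) i
          (hsmul ((s i : ℤ) : k) (x i)) := by
      funext j
      rcases eq_or_ne j i with rfl | hj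
      · simp [sgn_eq_hsmul]
      · simp [hj]
    rw [e, hF.smul, ← sgn_eq_hsmul, Finset.prod_insert hi, ← sgn_sgn, ← ih]
    congr 2
    rw [Function.update_eq_self_iff, if_neg hi]

end HomogExtension

section HeadedExtension

variable {n : ℕ} {P Z : Cx k} {Y : Fin n → Cx k} {Γ : Fin n → Type u}

/-- A map out of `P ⊗ Y₁ ⊗ ⋯ ⊗ Yₙ`, defined on generators of the factors `Yᵢ`. -/
theorem exists_htensor_hom (γ : ∀ i, Γ i → Homog (Y i)) (hγ : ∀ i, Spans (Set.range (γ i)))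
    (Φ : Homog P → (∀ i, Γ i) → Homog Z)
    (hdeg : ∀ θ s, (Φ θ s).deg = θ.deg + ∑ i, (γ i (s i)).deg)
    (hlin : ∀ s, IsLin (fun θ => Φ θ s))
    (hΦ : ∀ θ (i : Fin n) (s : ∀ i, Γ i), ∃ l : Homog (Y i) → Homog Z, IsLin l ∧ ∀ t,
      l (γ i t) = Φ θ (Function.update s i t))
    (hd : ∀ θ (s : ∀ i, Γ i) (l : ∀ i, Homog (Y i) → Homog Z), (∀ i, IsLin (l i)) →
      (∀ i t, l i (γ i t) = Φ θ (Function.update s i t)) → ∀ m, (Φ θ s).diff.vat m =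
        (Φ θ.diff s).vat m + ∑ i, leftSign θ.deg (fun i => (γ i (s i)).deg) i •
          (l i (γ i (s i)).diff).vat m) :
    ∃ F : htensor P Y ⟶ Z, ∀ θ s, ev F θ (fun i => γ i (s i)) = Φ θ s := by
  let Γ' : Fin (n + 1) → Type u := Fin.cases (motive := fun _ => Type u) (Homog P) Γ
  let γ' : ∀ i, Γ' i → Homog (hfam P Y i) := fun i =>
    Fin.cases (motive := fun i => Γ' i → Homog (hfam P Y i)) (fun θ => θ) (fun i => γ i) i
  have hs0 : ∀ (s : ∀ i, Γ' i) (t : Γ' 0) (i : Fin n),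
      Function.update s 0 t i.succ = s i.succ := fun s t i =>
    Function.update_of_ne (Fin.succ_ne_zero i) _ _
  have hs1 : ∀ (s : ∀ i, Γ' i) (i : Fin n) (t : Γ' i.succ),
      (fun j : Fin n => (Function.update s i.succ t j.succ : Γ j)) =
        Function.update (fun j : Fin n => (s j.succ : Γ j)) i t := by
    intro s i t
    funext j
    rcases eq_or_ne j i with rfl | hj
    · simp
    · rw [Function.update_of_ne hj, Function.update_of_ne (by simpa using hj)]
  have hγ's : ∀ s : (∀ i, Γ' i), (fun i => γ' i (s i)) =
      hargs (P := P) (Y := Y) (s 0) (fun i => γ i (s i.succ)) := by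
    intro s
    funext i
    refine Fin.cases ?_ (fun i => ?_) i <;> rfl
  suffices H : ∃ F : tensor (hfam P Y) ⟶ Z, ∀ s : (∀ i, Γ' i),
      map F (tpure fun i => γ' i (s i)) = Φ (s 0) (fun j => s j.succ) by
    obtain ⟨F, hF⟩ := H
    refine ⟨F, fun θ s => ?_⟩
    have := hF (Fin.cases (motive := Γ') θ s)
    rw [hγ's] at this
    exact this
  refine exists_tensor_hom γ' (fun i => ?_) (fun s => Φ (s 0) (fun j => s j.succ)) (fun s => ?_)
    (fun i s => ?_) (fun s l hl hl' m => ?_)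
  · refine Fin.cases ?_ (fun i => ?_) i
    · intro Q h₁ _ _ _ z
      exact h₁ z ⟨z, rfl⟩
    · exact hγ i
  · refine (hdeg _ _).trans ?_
    rw [hγ's]
    exact (tdeg_hargs _ _).symm
  · revert i
    refine Fin.cases ?_ (fun i => ?_)
    · exact ⟨_, hlin fun j => s j.succ, fun t => by simp only [Function.update_self, hs0]; rfl⟩
    · obtain ⟨l, hl, hl'⟩ := hΦ (s 0) i (fun j => s j.succ)
      refine ⟨l, hl, fun t => ?_⟩
      rw [Function.update_of_ne (Fin.succ_ne_zero i).symm, hs1]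
      exact hl' t
  · refine (hd (s 0) (fun j => s j.succ) (fun i => l i.succ) (fun i => hl i.succ)
      (fun i t => ?_) m).trans ?_
    · exact (hl' i.succ t).trans (congrArg₂ Φ
        (Function.update_of_ne (Fin.succ_ne_zero i).symm _ _ : _ = s 0) (hs1 s i t))
    · rw [Fin.sum_univ_succ, hγ's]
      refine congrArg₂ (· + ·) ?_ (Finset.sum_congr rfl fun i _ => ?_)
      · have := (hl' 0 (show Γ' 0 from (show Homog P from s 0).diff)).trans (congrArg₂ Φ
          (Function.update_self _ _ _) (funext (hs0 s _)))
        refine Eq.trans ?_ (congrArg₂ (· • ·) (preSign_hargs_zero (P := P) (Y := Y) (s 0)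
          (fun i => γ i (s i.succ))) (rfl : _ = (l 0 (γ' 0 (s 0)).diff).vat m)).symm
        rw [one_smul]
        exact congrArg (fun z => z.vat m) this.symm
      · exact congrArg₂ (· • ·) (preSign_hargs_succ (P := P) (Y := Y) (s 0)
          (fun i => γ i (s i.succ)) i).symm rfl

end HeadedExtension

/-! ## Signs -/

section Signs

/-- The sign `(-1)^e`. -/
def sg (e : ZMod 2) : ℤˣ := if e = 0 then 1 else -1

theorem sg_add (a b : ZMod 2) : sg (a + b) = sg a * sg b := by
  unfold sg; revert a b; decide

theorem sg_zero : sg 0 = 1 := rfl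

theorem sg_sum {ι : Type*} (s : Finset ι) (f : ι → ZMod 2) :
    sg (∑ i ∈ s, f i) = ∏ i ∈ s, sg (f i) := by
  classical
  induction s using Finset.induction_on with
  | empty => simp [sg_zero]
  | insert i s hi ih => rw [Finset.sum_insert hi, Finset.prod_insert hi, sg_add, ih]

theorem negOnePow_eq_sg (n : ℤ) : n.negOnePow = sg (n : ZMod 2) := by
  unfold sg
  rcases Int.even_or_odd n with h | h
  · rw [Int.negOnePow_even n h, if_pos]
    exact (ZMod.intCast_zmod_eq_zero_iff_dvd n 2).2 (by exact_mod_cast h.two_dvd)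
  · rw [Int.negOnePow_odd n h, if_neg]
    rw [ZMod.intCast_zmod_eq_zero_iff_dvd]
    exact_mod_cast Int.two_dvd_ne_zero.2 (Int.odd_iff.1 h)

/-- The indicator of a proposition. -/
def ind (p : Prop) [Decidable p] : ZMod 2 := if p then 1 else 0

theorem ite_eq_ind (p : Prop) [Decidable p] (a : ZMod 2) :
    (if p then a else 0) = ind p * a := by
  unfold ind; split_ifs <;> simp

theorem ind_congr {p q : Prop} [Decidable p] [Decidable q] (h : p ↔ q) : ind p = ind q := by
  unfold ind; simp only [h]

variable {n : ℕ} {m : Fin n → ℕ} {l : ℕ}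

/-- The order of the indices after a rearrangement. -/
abbrev Before (π : (Σ j, Fin (m j)) ≃ Fin l) (i' i : Fin l) : Prop :=
  (π.symm i').1 < (π.symm i).1 ∨
    ((π.symm i').1 = (π.symm i).1 ∧ ((π.symm i').2 : ℕ) < ((π.symm i).2 : ℕ))

theorem sigma_val_ext {p q : Σ j, Fin (m j)} (h : p.1 = q.1) (h' : (p.2 : ℕ) = q.2) : p = q := by
  obtain ⟨j, y⟩ := p
  obtain ⟨j', y'⟩ := q
  dsimp only at h
  subst h
  exact congrArg _ (Fin.ext h')

theorem val_symm_apply {α : Type*} {m : α → ℕ} (π : (Σ j, Fin (m j)) ≃ Fin l) (q : Σ j, Fin (m j)) :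
    ((π.symm (π q)).2 : ℕ) = q.2 := by
  rw [Equiv.symm_apply_apply]

theorem before_asymm (π : (Σ j, Fin (m j)) ≃ Fin l) {i i' : Fin l} (h : Before π i i') :
    ¬ Before π i' i := by
  unfold Before at *
  omega

theorem before_total (π : (Σ j, Fin (m j)) ≃ Fin l) {i i' : Fin l} (h : i ≠ i') :
    Before π i i' ∨ Before π i' i := by
  have : ¬ ((π.symm i).1 = (π.symm i').1 ∧ ((π.symm i).2 : ℕ) = (π.symm i').2) :=
    fun e => h (π.symm.injective (sigma_val_ext e.1 e.2))
  unfold Before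
  omega

/-- The exponent of the sign of a rearrangement. -/
def shE (π : (Σ j, Fin (m j)) ≃ Fin l) (p : Fin n → ZMod 2) (r : Fin l → ZMod 2) : ZMod 2 :=
  (∑ j, ∑ i, ind ((π.symm i).1 < j) * (p j * r i)) +
    ∑ i, ∑ i', ind (i < i' ∧ Before π i' i) * (r i * r i')

theorem shuffleSign_eq (π : (Σ j, Fin (m j)) ≃ Fin l) (p : Fin n → ℤ) (r : Fin l → ℤ) :
    shuffleSign π p r = sg (shE π (fun j => (p j : ZMod 2)) (fun i => (r i : ZMod 2))) := by
  unfold shuffleSign shE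
  rw [negOnePow_eq_sg]
  congr 1
  simp only [← ite_eq_ind]
  push_cast
  rfl

theorem leftSign_eq (p : ℤ) (r : Fin n → ℤ) (i : Fin n) :
    leftSign p r i = sg (p + ∑ j, ind (j < i) * (r j : ZMod 2)) := by
  unfold leftSign
  rw [negOnePow_eq_sg, Finset.sum_filter]
  simp only [← ite_eq_ind]
  push_cast
  rfl

theorem sum_sigma_equiv {R : Type*} [AddCommMonoid R] (π : (Σ j, Fin (m j)) ≃ Fin l)
    (g : Fin n → Fin l → R) : ∑ j, ∑ y, g j (π ⟨j, y⟩) = ∑ i, g (π.symm i).1 i := by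
  rw [← π.sum_comp, Fintype.sum_sigma]
  simp

/-- A sum over unordered pairs does not depend on the chosen orientation of the pairs. -/
theorem sum_pairs {X : Type*} [Fintype X] [DecidableEq X] (f : X → X → ZMod 2)
    (hf : ∀ a b, f a b = f b a) (L L' : X → X → Prop) [DecidableRel L] [DecidableRel L']
    (h : ∀ a b, L a b → ¬ L b a) (ht : ∀ a b, a ≠ b → L a b ∨ L b a)
    (h' : ∀ a b, L' a b → ¬ L' b a) (ht' : ∀ a b, a ≠ b → L' a b ∨ L' b a) :
    ∑ a, ∑ b, ind (L a b) * f a b = ∑ a, ∑ b, ind (L' a b) * f a b := by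
  have e₁ : ∀ a b, ind (L a b) * f a b =
      ind (L a b ∧ L' a b) * f a b + ind (L a b ∧ L' b a) * f a b := by
    intro a b
    unfold ind
    by_cases hab : a = b
    · subst hab
      have h₁ : ¬ L a a := fun e => h _ _ e e
      have h₂ : ¬ L' a a := fun e => h' _ _ e e
      simp [h₁, h₂]
    · rcases ht a b hab with h₁ | h₁ <;> rcases ht' a b hab with h₂ | h₂ <;>
        simp [h₁, h₂, h _ _ h₁, h' _ _ h₂]
  have e₂ : ∀ a b, ind (L' a b) * f a b =
      ind (L a b ∧ L' a b) * f a b + ind (L b a ∧ L' a b) * f a b := by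
    intro a b
    unfold ind
    by_cases hab : a = b
    · subst hab
      have h₁ : ¬ L a a := fun e => h _ _ e e
      have h₂ : ¬ L' a a := fun e => h' _ _ e e
      simp [h₁, h₂]
    · rcases ht a b hab with h₁ | h₁ <;> rcases ht' a b hab with h₂ | h₂ <;>
        simp [h₁, h₂, h _ _ h₁, h' _ _ h₂]
  simp_rw [e₁, e₂, Finset.sum_add_distrib]
  congr 1
  rw [Finset.sum_comm]
  exact Finset.sum_congr rfl fun a _ => Finset.sum_congr rfl fun b _ => by rw [hf]

theorem two_mul_zmod (a : ZMod 2) : a + a = 0 := CharTwo.add_self_eq_zero a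

theorem shE_op (π : (Σ j, Fin (m j)) ≃ Fin l) (p e : Fin n → ZMod 2) (r : Fin l → ZMod 2) :
    shE π (fun j => p j + e j) r = shE π p r + ∑ j, ∑ i, ind ((π.symm i).1 < j) * (e j * r i) := by
  unfold shE
  simp only [add_mul, mul_add, Finset.sum_add_distrib]
  ring

theorem shE_word (π : (Σ j, Fin (m j)) ≃ Fin l) (p : Fin n → ZMod 2) (r e : Fin l → ZMod 2) :
    shE π p (fun i => r i + e i) = shE π p r + shE π p e +
      ∑ i, ∑ i', ind ((i < i' ∧ Before π i' i) ∨ (i' < i ∧ Before π i i')) * (e i * r i') := by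
  have key : ∑ i, ∑ i', ind ((i < i' ∧ Before π i' i) ∨ (i' < i ∧ Before π i i')) * (e i * r i') =
      ∑ i, ∑ i', ind (i < i' ∧ Before π i' i) * (e i * r i') +
        ∑ i, ∑ i', ind (i < i' ∧ Before π i' i) * (r i * e i') := by
    conv_rhs => rw [add_comm, Finset.sum_comm, add_comm]
    simp_rw [← Finset.sum_add_distrib]
    refine Finset.sum_congr rfl fun i _ => Finset.sum_congr rfl fun i' _ => ?_
    rw [mul_comm (r i') (e i), ← add_mul]
    congr 1
    unfold ind
    rcases lt_trichotomy i i' with h | h | h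
    · simp [h, h.not_gt]
    · simp [h]
    · simp [h, h.not_gt]
  rw [key]
  unfold shE
  simp only [add_mul, mul_add, Finset.sum_add_distrib]
  ring

theorem update_add_one {ι : Type*} [DecidableEq ι] (p : ι → ℤ) (j : ι) :
    (fun a => ((Function.update p j (p j + 1) a : ℤ) : ZMod 2)) =
      fun a => (p a : ZMod 2) + ind (a = j) := by
  funext a
  rcases eq_or_ne a j with rfl | h
  · simp [ind]
  · simp [ind, h]

theorem sum_ind_eq {ι : Type*} [Fintype ι] [DecidableEq ι] (j : ι) (f : ι → ZMod 2) :
    ∑ a, ind (a = j) * f a = f j := by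
  simp [ind]

theorem leibniz_op (π : (Σ j, Fin (m j)) ≃ Fin l) (t : ℤ) (p : Fin n → ℤ) (r : Fin l → ℤ)
    (j : Fin n) : shuffleSign π p r * leftSign t p j =
      shuffleSign π (Function.update p j (p j + 1)) r *
        leftSign t (fun j => p j + ∑ y, r (π ⟨j, y⟩)) j := by
  rw [shuffleSign_eq, shuffleSign_eq, leftSign_eq, leftSign_eq, ← sg_add, ← sg_add, update_add_one,
    shE_op]
  congr 1
  have e₁ : ∑ a, ∑ i, ind ((π.symm i).1 < a) * (ind (a = j) * (r i : ZMod 2)) =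
      ∑ i, ind ((π.symm i).1 < j) * (r i : ZMod 2) := by
    rw [← sum_ind_eq j (fun a => ∑ i, ind ((π.symm i).1 < a) * (r i : ZMod 2))]
    refine Finset.sum_congr rfl fun a _ => ?_
    rw [Finset.mul_sum]
    exact Finset.sum_congr rfl fun i _ => by ring
  have e₂ : ∑ a, ind (a < j) * (((p a + ∑ y, r (π ⟨a, y⟩) : ℤ)) : ZMod 2) =
      ∑ a, ind (a < j) * (p a : ZMod 2) + ∑ i, ind ((π.symm i).1 < j) * (r i : ZMod 2) := by
    rw [← sum_sigma_equiv π (fun a i => ind (a < j) * (r i : ZMod 2)), ← Finset.sum_add_distrib]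
    refine Finset.sum_congr rfl fun a _ => ?_
    push_cast
    rw [mul_add, Finset.mul_sum]
  rw [e₁, e₂]
  have := two_mul_zmod (∑ i, ind ((π.symm i).1 < j) * (r i : ZMod 2))
  linear_combination (-1 : ZMod 2) * this

theorem leibniz_word (π : (Σ j, Fin (m j)) ≃ Fin l) (t : ℤ) (p : Fin n → ℤ) (r : Fin l → ℤ)
    (j : Fin n) (y : Fin (m j)) : shuffleSign π p r * leftSign (t + ∑ j, p j) r (π ⟨j, y⟩) =
      shuffleSign π p (Function.update r (π ⟨j, y⟩) (r (π ⟨j, y⟩) + 1)) *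
        (leftSign t (fun j => p j + ∑ y, r (π ⟨j, y⟩)) j *
          leftSign (p j) (fun y => r (π ⟨j, y⟩)) y) := by
  rw [shuffleSign_eq, shuffleSign_eq, leftSign_eq, leftSign_eq, leftSign_eq, ← sg_add, ← sg_add,
    ← sg_add, update_add_one, shE_word]
  congr 1
  obtain ⟨i, hi⟩ : ∃ i, i = π ⟨j, y⟩ := ⟨_, rfl⟩
  have hπ : π.symm i = ⟨j, y⟩ := by rw [hi, Equiv.symm_apply_apply]
  rw [← hi]
  have e₀ : shE π (fun j => (p j : ZMod 2)) (fun a => ind (a = i)) =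
      ∑ a, ind (j < a) * (p a : ZMod 2) := by
    have h₁ : ∀ a, ∑ b, ind ((π.symm b).1 < a) * ((p a : ZMod 2) * ind (b = i)) =
        ind (j < a) * (p a : ZMod 2) := by
      intro a
      rw [← show ind ((π.symm i).1 < a) * (p a : ZMod 2) = ind (j < a) * (p a : ZMod 2) by rw [hπ],
        ← sum_ind_eq i (fun b => ind ((π.symm b).1 < a) * (p a : ZMod 2))]
      exact Finset.sum_congr rfl fun b _ => by ring
    unfold shE
    simp_rw [h₁]
    rw [add_eq_left]
    refine Finset.sum_eq_zero fun a _ => Finset.sum_eq_zero fun b _ => ?_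
    unfold ind
    split_ifs with h₁ h₂ h₃ <;> simp
    exact absurd h₁.1 (by rw [h₂, h₃]; exact lt_irrefl _)
  have e₁ : ∑ a, ∑ b, ind ((a < b ∧ Before π b a) ∨ (b < a ∧ Before π a b)) *
      (ind (a = i) * (r b : ZMod 2)) =
      ∑ b, ind ((i < b ∧ Before π b i) ∨ (b < i ∧ Before π i b)) * (r b : ZMod 2) := by
    rw [← sum_ind_eq i (fun a => ∑ b, ind ((a < b ∧ Before π b a) ∨
      (b < a ∧ Before π a b)) * (r b : ZMod 2))]
    refine Finset.sum_congr rfl fun a _ => ?_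
    rw [Finset.mul_sum]
    exact Finset.sum_congr rfl fun i _ => by ring
  have e₂ : ∑ a, ind (a < j) * (((p a + ∑ y, r (π ⟨a, y⟩) : ℤ)) : ZMod 2) =
      ∑ a, ind (a < j) * (p a : ZMod 2) + ∑ b, ind ((π.symm b).1 < j) * (r b : ZMod 2) := by
    rw [← sum_sigma_equiv π (fun a i => ind (a < j) * (r i : ZMod 2)), ← Finset.sum_add_distrib]
    refine Finset.sum_congr rfl fun a _ => ?_
    push_cast
    rw [mul_add, Finset.mul_sum]
  have e₃ : ∑ y', ind (y' < y) * (r (π ⟨j, y'⟩) : ZMod 2) =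
      ∑ b, ind ((π.symm b).1 = j ∧ ((π.symm b).2 : ℕ) < y) * (r b : ZMod 2) := by
    rw [← π.sum_comp, Fintype.sum_sigma, Finset.sum_eq_single j]
    · refine Finset.sum_congr rfl fun y' _ => ?_
      congr 1
      refine ind_congr ?_
      rw [val_symm_apply, Equiv.symm_apply_apply]
      simp
    · intro a _ ha
      refine Finset.sum_eq_zero fun y' _ => ?_
      simp [ind, ha]
    · simp
  have e₄ : (∑ a, p a : ZMod 2) = ∑ a, ind (j < a) * (p a : ZMod 2) +
      ∑ a, ind (a < j) * (p a : ZMod 2) + p j := by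
    rw [← sum_ind_eq j (fun a => (p a : ZMod 2)), ← Finset.sum_add_distrib,
      ← Finset.sum_add_distrib]
    refine Finset.sum_congr rfl fun a _ => ?_
    rw [← add_mul, ← add_mul]
    unfold ind
    rcases lt_trichotomy j a with h | h | h
    · simp [h, h.not_gt, h.ne']
    · simp [h]
    · simp [h, h.not_gt, h.ne]
  have e₅ : ∑ b, ind (b < i) * (r b : ZMod 2) +
      ∑ b, ind ((i < b ∧ Before π b i) ∨ (b < i ∧ Before π i b)) * (r b : ZMod 2) =
      ∑ b, ind ((π.symm b).1 < j) * (r b : ZMod 2) +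
        ∑ b, ind ((π.symm b).1 = j ∧ ((π.symm b).2 : ℕ) < y) * (r b : ZMod 2) := by
    rw [← Finset.sum_add_distrib, ← Finset.sum_add_distrib]
    refine Finset.sum_congr rfl fun b _ => ?_
    rw [← add_mul, ← add_mul]
    congr 1
    have hb : ind ((π.symm b).1 < j) + ind ((π.symm b).1 = j ∧ ((π.symm b).2 : ℕ) < y) =
        ind (Before π b i) := by
      unfold Before ind
      rw [hπ]
      rcases lt_trichotomy (π.symm b).1 j with h | h | h
      · simp [h, h.ne]
      · simp [h]
      · simp [h.not_gt, h.ne']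
    rw [hb]
    unfold ind
    rcases lt_trichotomy b i with h | h | h
    · rcases before_total π h.ne with h' | h'
      · simp [h, h', before_asymm π h', h.not_gt]
      · simp only [h, h.not_gt, h', before_asymm π h', if_true, if_false, and_true,
          and_false, false_or]
        decide
    · subst h
      have : ¬ Before π b b := fun h => before_asymm π h h
      simp [this]
    · simp [h, h.not_gt]
  rw [e₀, e₁, e₂, e₃]
  push_cast
  rw [e₄]
  have h₁ := two_mul_zmod (∑ b, ind ((i < b ∧ Before π b i) ∨ (b < i ∧ Before π i b)) * (r b : ZMod 2))
  linear_combination e₅ - h₁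

variable {r : Fin l → ℕ} {s : ℕ} {t : Fin n → ℕ}

/-- The compatibility of the signs of rearrangements with the composition of rearrangements. -/
theorem shE_comp (π : (Σ j, Fin (m j)) ≃ Fin l) (ρ : (Σ x, Fin (r x)) ≃ Fin s)
    (σ : ∀ j, (Σ y : Fin (m j), Fin (r (π ⟨j, y⟩))) ≃ Fin (t j)) (τ : (Σ j, Fin (t j)) ≃ Fin s)
    (hστ : ∀ j y z, τ ⟨j, σ j ⟨y, z⟩⟩ = ρ ⟨π ⟨j, y⟩, z⟩) (p : Fin n → ZMod 2) (q : Fin l → ZMod 2)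
    (w : Fin s → ZMod 2) :
    shE ρ q w + shE π p (fun x => q x + ∑ z, w (ρ ⟨x, z⟩)) =
      shE π p q + shE τ (fun j => p j + ∑ y, q (π ⟨j, y⟩)) w +
        ∑ j, shE (σ j) (fun y => q (π ⟨j, y⟩)) (fun v => w (τ ⟨j, v⟩)) := by
  have hx : ∀ a : Fin s, ∃ (j : Fin n) (y : Fin (m j)) (z : Fin (r (π ⟨j, y⟩))),
      ρ.symm a = ⟨π ⟨j, y⟩, z⟩ ∧ τ.symm a = ⟨j, σ j ⟨y, z⟩⟩ ∧ π.symm (ρ.symm a).1 = ⟨j, y⟩ := by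
    intro a
    obtain ⟨⟨x, z⟩, rfl⟩ := ρ.surjective a
    obtain ⟨⟨j, y⟩, rfl⟩ := π.surjective x
    exact ⟨j, y, z, by simp, by rw [← hστ, Equiv.symm_apply_apply], by simp⟩
  have hJ : ∀ a, (τ.symm a).1 = (π.symm (ρ.symm a).1).1 := by
    intro a
    obtain ⟨j, y, z, h₁, h₂, h₃⟩ := hx a
    rw [h₂, h₃]
  have hv₀ : ∀ j y z, τ.symm (ρ ⟨π ⟨j, y⟩, z⟩) = ⟨j, σ j ⟨y, z⟩⟩ := fun j y z => by
    rw [← hστ, Equiv.symm_apply_apply]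
  have hv : ∀ j y z, ((τ.symm (ρ ⟨π ⟨j, y⟩, z⟩)).2 : ℕ) = σ j ⟨y, z⟩ := fun j y z => by
    rw [hv₀]
  have hy : ∀ j y z, ((π.symm (ρ.symm (ρ ⟨π ⟨j, y⟩, z⟩)).1).2 : ℕ) = y := fun j y z => by
    rw [Equiv.symm_apply_apply, Equiv.symm_apply_apply]
  -- the terms in `p` and `w`
  have hpw : ∑ j, ∑ x, ind ((π.symm x).1 < j) * (p j * ∑ z, w (ρ ⟨x, z⟩)) =
      ∑ j, ∑ a, ind ((τ.symm a).1 < j) * (p j * w a) := by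
    refine Finset.sum_congr rfl fun j _ => ?_
    simp_rw [hJ]
    rw [← sum_sigma_equiv ρ (fun x a => ind ((π.symm x).1 < j) * (p j * w a))]
    simp_rw [Finset.mul_sum]
  -- the terms in `q` and `w`
  have hqw : ∑ x, ∑ a, ind ((ρ.symm a).1 < x) * (q x * w a) +
      ∑ x, ∑ x', ind ((x < x' ∧ Before π x' x) ∨ (x' < x ∧ Before π x x')) *
        (q x * ∑ z, w (ρ ⟨x', z⟩)) =
      ∑ j, ∑ a, ind ((τ.symm a).1 < j) * ((∑ y, q (π ⟨j, y⟩)) * w a) +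
        ∑ j, ∑ y, ∑ v, ind (((σ j).symm v).1 < y) * (q (π ⟨j, y⟩) * w (τ ⟨j, v⟩)) := by
    have h₁ : ∀ x, ∑ x', ind ((x < x' ∧ Before π x' x) ∨ (x' < x ∧ Before π x x')) *
        (q x * ∑ z, w (ρ ⟨x', z⟩)) = ∑ a, ind ((x < (ρ.symm a).1 ∧ Before π (ρ.symm a).1 x) ∨
          ((ρ.symm a).1 < x ∧ Before π x (ρ.symm a).1)) * (q x * w a) := by
      intro x
      rw [← sum_sigma_equiv ρ (fun x' a => ind ((x < x' ∧ Before π x' x) ∨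
        (x' < x ∧ Before π x x')) * (q x * w a))]
      simp_rw [Finset.mul_sum]
    have h₂ : ∑ j, ∑ a, ind ((τ.symm a).1 < j) * ((∑ y, q (π ⟨j, y⟩)) * w a) =
        ∑ x, ∑ a, ind ((τ.symm a).1 < (π.symm x).1) * (q x * w a) := by
      rw [← sum_sigma_equiv π (fun j x => ∑ a, ind ((τ.symm a).1 < j) * (q x * w a))]
      refine Finset.sum_congr rfl fun j _ => ?_
      rw [Finset.sum_comm]
      refine Finset.sum_congr rfl fun a _ => ?_
      rw [Finset.sum_mul, Finset.mul_sum]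
    have h₃ : ∑ j, ∑ y, ∑ v, ind (((σ j).symm v).1 < y) * (q (π ⟨j, y⟩) * w (τ ⟨j, v⟩)) =
        ∑ x, ∑ a, ind ((τ.symm a).1 = (π.symm x).1 ∧
          ((π.symm (ρ.symm a).1).2 : ℕ) < (π.symm x).2) * (q x * w a) := by
      rw [← π.sum_comp, Fintype.sum_sigma]
      refine Finset.sum_congr rfl fun j _ => Finset.sum_congr rfl fun y _ => ?_
      rw [← τ.sum_comp, Fintype.sum_sigma, Finset.sum_eq_single j]
      · refine Finset.sum_congr rfl fun v _ => ?_
        congr 1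
        refine ind_congr ?_
        obtain ⟨⟨y', z⟩, rfl⟩ := (σ j).surjective v
        rw [hστ, hv₀, hy, val_symm_apply, Equiv.symm_apply_apply]
        simp
      · intro a _ ha
        refine Finset.sum_eq_zero fun y' _ => ?_
        simp [ind, ha]
      · simp
    simp_rw [h₁]
    rw [h₂, h₃, ← Finset.sum_add_distrib, ← Finset.sum_add_distrib]
    refine Finset.sum_congr rfl fun x _ => ?_
    rw [← Finset.sum_add_distrib, ← Finset.sum_add_distrib]
    refine Finset.sum_congr rfl fun a _ => ?_
    rw [← add_mul, ← add_mul]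
    congr 1
    rw [hJ]
    generalize (ρ.symm a).1 = x'
    have hb : ind ((π.symm x').1 < (π.symm x).1) + ind ((π.symm x').1 = (π.symm x).1 ∧
        ((π.symm x').2 : ℕ) < (π.symm x).2) = ind (Before π x' x) := by
      unfold Before ind
      rcases lt_trichotomy (π.symm x').1 (π.symm x).1 with h | h | h
      · simp [h, h.ne]
      · simp [h]
      · simp [h.not_gt, h.ne']
    rw [hb]
    unfold ind
    rcases lt_trichotomy x' x with h | h | h
    · rcases before_total π h.ne with h' | h'
      · simp [h, h', before_asymm π h', h.not_gt]
      · simp only [h, h.not_gt, h', before_asymm π h', if_true, if_false, and_true,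
          and_false, false_or]
        decide
    · subst h
      have : ¬ Before π x' x' := fun h => before_asymm π h h
      simp [this]
    · simp [h, h.not_gt]
  -- the terms in `w` and `w`
  have hww : ∑ a, ∑ b, ind (a < b ∧ Before ρ b a) * (w a * w b) +
      ∑ x, ∑ x', ind (x < x' ∧ Before π x' x) *
        ((∑ z, w (ρ ⟨x, z⟩)) * ∑ z, w (ρ ⟨x', z⟩)) =
      ∑ a, ∑ b, ind (a < b ∧ Before τ b a) * (w a * w b) +
        ∑ j, ∑ v, ∑ v', ind (v < v' ∧ Before (σ j) v' v) * (w (τ ⟨j, v⟩) * w (τ ⟨j, v'⟩)) := by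
    let g : Fin s → Fin s → ZMod 2 := fun a b =>
      ind (((ρ.symm a).1 < (ρ.symm b).1 ∧ Before π (ρ.symm b).1 (ρ.symm a).1) ∨
        ((ρ.symm b).1 < (ρ.symm a).1 ∧ Before π (ρ.symm a).1 (ρ.symm b).1)) * (w a * w b)
    let B : Fin s → Fin s → Prop := fun a b =>
      ((π.symm (ρ.symm a).1).2 : ℕ) < (π.symm (ρ.symm b).1).2 ∨
        (((π.symm (ρ.symm a).1).2 : ℕ) = (π.symm (ρ.symm b).1).2 ∧
          ((ρ.symm a).2 : ℕ) < (ρ.symm b).2)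
    have : DecidableRel B := fun _ _ => inferInstanceAs (Decidable (_ ∨ _))
    let h : Fin s → Fin s → ZMod 2 := fun a b =>
      ind ((τ.symm a).1 = (τ.symm b).1 ∧ ((((τ.symm a).2 : ℕ) < (τ.symm b).2 ∧ B b a) ∨
        (((τ.symm b).2 : ℕ) < (τ.symm a).2 ∧ B a b))) * (w a * w b)
    have hg : ∑ x, ∑ x', ind (x < x' ∧ Before π x' x) *
        ((∑ z, w (ρ ⟨x, z⟩)) * ∑ z, w (ρ ⟨x', z⟩)) = ∑ a, ∑ b, ind (a < b) * g a b := by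
      rw [sum_pairs g (fun a b => by simp only [g]; rw [mul_comm (w a)]; congr 1; exact ind_congr or_comm)
        (· < ·) (fun a b => Before ρ a b) (fun _ _ => lt_asymm) (fun _ _ h => lt_or_gt_of_ne h)
        (fun _ _ => before_asymm ρ) (fun _ _ => before_total ρ)]
      have : ∀ a b, ind (Before ρ a b) * g a b = ind ((ρ.symm a).1 < (ρ.symm b).1 ∧
          Before π (ρ.symm b).1 (ρ.symm a).1) * (w a * w b) := by
        intro a b
        simp only [g]
        rw [← mul_assoc]
        congr 1
        unfold ind
        rcases lt_trichotomy (ρ.symm a).1 (ρ.symm b).1 with h | h | h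
        · have : Before ρ a b := Or.inl h
          simp [this, h, h.not_gt]
        · simp [h]
        · have : ¬ Before ρ a b := before_asymm ρ (Or.inl h)
          simp [this, h.not_gt]
      simp_rw [this]
      rw [← sum_sigma_equiv ρ (fun x a => ∑ b, ind (x < (ρ.symm b).1 ∧
          Before π (ρ.symm b).1 x) * (w a * w b))]
      refine Finset.sum_congr rfl fun x _ => ?_
      simp_rw [fun z => (sum_sigma_equiv ρ (fun x' b => ind (x < x' ∧
          Before π x' x) * (w (ρ ⟨x, z⟩) * w b))).symm]
      rw [Finset.sum_comm]
      refine Finset.sum_congr rfl fun x' _ => ?_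
      rw [Finset.sum_mul_sum]
      simp_rw [Finset.mul_sum]
    have hh : ∑ j, ∑ v, ∑ v', ind (v < v' ∧ Before (σ j) v' v) * (w (τ ⟨j, v⟩) * w (τ ⟨j, v'⟩)) =
        ∑ a, ∑ b, ind (a < b) * h a b := by
      rw [sum_pairs h (fun a b => by
          simp only [h]; rw [mul_comm (w a)]; congr 1
          exact ind_congr (and_congr eq_comm or_comm))
        (· < ·) (fun a b => Before τ a b) (fun _ _ => lt_asymm) (fun _ _ h => lt_or_gt_of_ne h)
        (fun _ _ => before_asymm τ) (fun _ _ => before_total τ)]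
      have : ∀ a b, ind (Before τ a b) * h a b = ind ((τ.symm a).1 = (τ.symm b).1 ∧
          ((τ.symm a).2 : ℕ) < (τ.symm b).2 ∧ B b a) * (w a * w b) := by
        intro a b
        simp only [h]
        rw [← mul_assoc]
        congr 1
        unfold ind
        rcases eq_or_ne (τ.symm a).1 (τ.symm b).1 with h | h
        · rcases lt_trichotomy ((τ.symm a).2 : ℕ) (τ.symm b).2 with h' | h' | h'
          · have : Before τ a b := Or.inr ⟨h, h'⟩
            simp [this, h, h', h'.not_gt]
          · simp [h']
          · have : ¬ Before τ a b := before_asymm τ (Or.inr ⟨h.symm, h'⟩)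
            simp [this, h'.not_gt]
        · simp [h]
      simp_rw [this]
      rw [← τ.sum_comp, Fintype.sum_sigma]
      refine Finset.sum_congr rfl fun j _ => Finset.sum_congr rfl fun v _ => ?_
      rw [← τ.sum_comp, Fintype.sum_sigma, Finset.sum_eq_single j]
      · refine Finset.sum_congr rfl fun v' _ => ?_
        congr 1
        refine ind_congr ?_
        simp only [B, Equiv.symm_apply_apply, true_and]
        obtain ⟨⟨y, z⟩, rfl⟩ := (σ j).surjective v
        obtain ⟨⟨y', z'⟩, rfl⟩ := (σ j).surjective v'
        unfold Before
        rw [hστ, hστ, hv, hv, hy, hy, val_symm_apply, val_symm_apply, val_symm_apply,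
          val_symm_apply, Equiv.symm_apply_apply, Equiv.symm_apply_apply]
        simp [Fin.ext_iff]
      · intro a _ ha
        refine Finset.sum_eq_zero fun y' _ => ?_
        simp [ind, ha.symm]
      · simp
    rw [hg, hh, ← Finset.sum_add_distrib, ← Finset.sum_add_distrib]
    refine Finset.sum_congr rfl fun a _ => ?_
    rw [← Finset.sum_add_distrib, ← Finset.sum_add_distrib]
    refine Finset.sum_congr rfl fun b _ => ?_
    by_cases hab : a < b
    · simp only [g, h, hab, true_and]
      have e : ind True = 1 := rfl
      rw [e, one_mul, one_mul, ← add_mul, ← add_mul]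
      congr 1
      have hne : a ≠ b := hab.ne
      have hJa := hJ a
      have hJb := hJ b
      have n₁ : ¬ ((ρ.symm a).1 = (ρ.symm b).1 ∧ ((ρ.symm a).2 : ℕ) = (ρ.symm b).2) :=
        fun e => hne (ρ.symm.injective (sigma_val_ext e.1 e.2))
      have n₂ : ¬ ((τ.symm a).1 = (τ.symm b).1 ∧ ((τ.symm a).2 : ℕ) = (τ.symm b).2) :=
        fun e => hne (τ.symm.injective (sigma_val_ext e.1 e.2))
      have n₃ : (π.symm (ρ.symm a).1).1 = (π.symm (ρ.symm b).1).1 →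
          ((π.symm (ρ.symm a).1).2 : ℕ) = (π.symm (ρ.symm b).1).2 → (ρ.symm a).1 = (ρ.symm b).1 :=
        fun e e' => π.symm.injective (sigma_val_ext e e')
      have n₄ : (ρ.symm a).1 = (ρ.symm b).1 →
          ((π.symm (ρ.symm a).1).2 : ℕ) = (π.symm (ρ.symm b).1).2 := fun e => by rw [e]
      have n₅ : (ρ.symm a).1 = (ρ.symm b).1 →
          (π.symm (ρ.symm a).1).1 = (π.symm (ρ.symm b).1).1 := fun e => by rw [e]
      unfold Before
      simp only [B]
      have hF : ∀ P₁ P₂ F : Prop, ∀ [Decidable P₁] [Decidable P₂] [Decidable F],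
          (F ↔ ((P₁ ∧ ¬ P₂) ∨ (¬ P₁ ∧ P₂))) → ind P₁ + ind P₂ = ind F := by
        intro P₁ P₂ F _ _ _ h
        unfold ind
        by_cases h₁ : P₁ <;> by_cases h₂ : P₂ <;> simp [h₁, h₂, h] <;> decide
      refine (hF _ _ ((π.symm (ρ.symm b).1).1 < (π.symm (ρ.symm a).1).1 ∨
        ((π.symm (ρ.symm b).1).1 = (π.symm (ρ.symm a).1).1 ∧
          (((π.symm (ρ.symm b).1).2 : ℕ) < (π.symm (ρ.symm a).1).2 ∨
            (((π.symm (ρ.symm b).1).2 : ℕ) = (π.symm (ρ.symm a).1).2 ∧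
              ((ρ.symm b).2 : ℕ) < (ρ.symm a).2)))) ?_).trans (hF _ _ _ ?_).symm
      · clear hJa hJb n₂
        omega
      · clear n₄ n₅
        omega
    · simp [hab, ind]
  have hsplit : ∀ Q : Fin l → ZMod 2, shE π p (fun x => q x + Q x) = shE π p q + shE π p Q +
      ∑ x, ∑ x', ind ((x < x' ∧ Before π x' x) ∨ (x' < x ∧ Before π x x')) * (q x * Q x') := by
    intro Q
    have := shE_word π p Q q
    simp only [add_comm (Q _)] at this
    rw [this]
    ring
  rw [hsplit, shE_op]
  unfold shE at *
  rw [Finset.sum_add_distrib]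
  linear_combination hpw + hqw + hww

theorem shuffleSign_comp (π : (Σ j, Fin (m j)) ≃ Fin l) (ρ : (Σ x, Fin (r x)) ≃ Fin s)
    (σ : ∀ j, (Σ y : Fin (m j), Fin (r (π ⟨j, y⟩))) ≃ Fin (t j)) (τ : (Σ j, Fin (t j)) ≃ Fin s)
    (hστ : ∀ j y z, τ ⟨j, σ j ⟨y, z⟩⟩ = ρ ⟨π ⟨j, y⟩, z⟩) (p : Fin n → ℤ) (q : Fin l → ℤ)
    (w : Fin s → ℤ) :
    shuffleSign ρ q w * shuffleSign π p (fun x => q x + ∑ z, w (ρ ⟨x, z⟩)) =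
      shuffleSign π p q * (shuffleSign τ (fun j => p j + ∑ y, q (π ⟨j, y⟩)) w *
        ∏ j, shuffleSign (σ j) (fun y => q (π ⟨j, y⟩)) (fun v => w (τ ⟨j, v⟩))) := by
  simp only [shuffleSign_eq]
  rw [← sg_sum, ← sg_add, ← sg_add, ← sg_add]
  congr 1
  push_cast
  rw [shE_comp π ρ σ τ hστ, add_assoc]

theorem shuffleSign_zero_left {m : Fin n → ℕ} (π : (Σ j, Fin (m j)) ≃ Fin l)
    (hπ : ∀ i i', i < i' → Before π i i') (r : Fin l → ℤ) : shuffleSign π (fun _ => 0) r = 1 := by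
  rw [shuffleSign_eq, ← sg_zero]
  congr 1
  unfold shE
  simp only [Int.cast_zero, zero_mul, mul_zero, Finset.sum_const_zero, zero_add]
  refine Finset.sum_eq_zero fun i _ => Finset.sum_eq_zero fun i' _ => ?_
  have : ¬ (i < i' ∧ Before π i' i) := fun h => before_asymm π (hπ _ _ h.1) h.2
  simp [ind, this]

end Signs

/-! ## The free algebra on a collection: tensors and the action -/

section Lin

variable {X Z P : Cx k} {n : ℕ} {Y : Fin n → Cx k}

theorem deg_hpure (θ : Homog P) (y : ∀ i, Homog (Y i)) :
    (hpure θ y).deg = θ.deg + ∑ i, (y i).deg := tdeg_hargs θ y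

theorem deg_update {ι : Type*} [DecidableEq ι] {A : ι → Cx k} (x : ∀ i, Homog (A i)) (i : ι)
    (z : Homog (A i)) : (fun j => (Function.update x i z j).deg) =
      Function.update (fun j => (x j).deg) i z.deg := by
  funext j
  rcases eq_or_ne j i with rfl | hj
  · simp
  · simp [hj]

theorem isML_hfam {F : Homog P → (∀ i, Homog (Y i)) → Homog Z}
    (hlin : ∀ y, IsLin (fun θ => F θ y)) (hml : ∀ θ, IsML (F θ)) :
    IsML (fun x : ∀ i, Homog (hfam P Y i) => F (x 0) (fun i => x i.succ)) := by
  refine isML_of_lin fun x i => ?_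
  obtain ⟨θ, y, rfl⟩ := exists_hargs x
  refine Fin.cases ?_ (fun i => ?_) i
  · have : ∀ z : Homog P, Function.update (hargs θ y) 0 z = hargs z y := fun z =>
      (hargs_update_zero θ z y).symm
    exact (funext fun z => by rw [this z]; rfl :
      (fun z => F z y) = fun z : Homog (hfam P Y 0) =>
        F (Function.update (hargs θ y) 0 z 0) (fun i => Function.update (hargs θ y) 0 z i.succ))
      ▸ hlin y
  · have : ∀ z : Homog (Y i), Function.update (hargs θ y) i.succ z =
        hargs θ (Function.update y i z) := fun z => (hargs_update θ y i z).symm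
    exact (funext fun z => by rw [this z]; rfl :
      (fun z => F θ (Function.update y i z)) = fun z : Homog (hfam P Y i.succ) =>
        F (Function.update (hargs θ y) i.succ z 0)
          (fun j => Function.update (hargs θ y) i.succ z j.succ)) ▸ (hml θ).lin y i

theorem exists_hlin {F : Homog P → (∀ i, Homog (Y i)) → Homog Z}
    (hlin : ∀ y, IsLin (fun θ => F θ y)) (hml : ∀ θ, IsML (F θ)) {D : ℤ}
    (hdeg : ∀ θ y, (F θ y).deg = D + (θ.deg + ∑ i, (y i).deg)) :
    ∃ l : Homog (htensor P Y) → Homog Z, IsLin l ∧ (∀ z, (l z).deg = D + z.deg) ∧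
      ∀ θ y, l (hpure θ y) = F θ y := by
  obtain ⟨l, hl, hd, hp⟩ := (isML_hfam hlin hml).exists_lin (D := D) (fun x => by
    obtain ⟨θ, y, rfl⟩ := exists_hargs x
    rw [tdeg_hargs]
    exact hdeg θ y)
  exact ⟨l, hl, hd, fun θ y => hp (hargs θ y)⟩

theorem IsLin.vat_hpure_diff {l : Homog (htensor P Y) → Homog Z} (hl : IsLin l) (θ : Homog P)
    (y : ∀ i, Homog (Y i)) (m : ℤ) : (l (hpure θ y).diff).vat m = (l (hpure θ.diff y)).vat m +
      ∑ i, leftSign θ.deg (fun i => (y i).deg) i •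
        (l (hpure θ (Function.update y i (y i).diff))).vat m := by
  obtain ⟨q, hq⟩ : ∃ q, q = (hpure θ y).deg + 1 := ⟨_, rfl⟩
  obtain ⟨f, hf⟩ := hl.exists_linear q m
  have key : ∀ z : Homog (htensor P Y), z.deg = q → (l z).vat m = f (z.vat q) := fun z hz => by
    rw [hf, mk_vat z hz]
  rw [key _ hq.symm, hpure_diff, map_add, map_sum, ← key]
  · congr 1
    refine Finset.sum_congr rfl fun i _ => ?_
    rw [Units.smul_def, map_zsmul, ← key, ← Units.smul_def]
    rw [hq, deg_hpure, deg_hpure]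
    have := tdeg_update y i (y i).diff
    unfold tdeg at this
    rw [this, Homog.deg_diff]
    ring
  · rw [hq, deg_hpure, deg_hpure, Homog.deg_diff]; ring

/-- A function on tuples indexed along a bijection. -/
def reindex {ι κ : Type*} (π : ι ≃ κ) {A : κ → Type*} (x : ∀ i, A (π i)) : ∀ j, A j :=
  Equiv.piCongrLeft A π x

@[simp] theorem reindex_apply {ι κ : Type*} (π : ι ≃ κ) {A : κ → Type*} (x : ∀ i, A (π i)) (i : ι) :
    reindex π x (π i) = x i := Equiv.piCongrLeft_apply_apply A π x i

theorem reindex_comp {ι κ : Type*} (π : ι ≃ κ) {A : κ → Type*} (x : ∀ j, A j) :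
    reindex π (fun i => x (π i)) = x := by
  funext j
  obtain ⟨i, rfl⟩ := π.surjective j
  simp

end Lin

section Act

variable (P : ColoredOperad k C) (W : Coll k C)

@[simp] theorem recolor_rfl {a : C} (x : Homog (W a)) : recolor W rfl x = x := rfl

@[simp] theorem deg_recolor {a b : C} (h : a = b) (x : Homog (W a)) : (recolor W h x).deg = x.deg :=
  rfl

theorem recolor_recolor {a b c : C} (h : a = b) (h' : b = c) (x : Homog (W a)) :
    recolor W h' (recolor W h x) = recolor W (h.trans h') x := by
  subst h h'; rfl

variable {n : ℕ} {m : Fin n → ℕ} {l : ℕ}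

section Special

variable (d : Fin n → C) (c : Fin l → C) (e : C) (π : (Σ j, Fin (m j)) ≃ Fin l)

/-- The value of the action on pure tensors. -/
def actVal (θ : Homog (P.obj d e)) (φ : ∀ j, Homog (P.obj (fun y => c (π ⟨j, y⟩)) (d j)))
    (x : ∀ i, Homog (W (c i))) : Homog (htensor (P.obj c e) (fun i => W (c i))) :=
  sgn (shuffleSign π (fun j => (φ j).deg) (fun i => (x i).deg))
    (hpure (ev (P.comp d (fun j y => c (π ⟨j, y⟩)) c e π (fun _ _ => rfl)) θ φ) x)

variable {d c e π} {P W}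

theorem actVal_isLin (φ : ∀ j, Homog (P.obj (fun y => c (π ⟨j, y⟩)) (d j)))
    (x : ∀ i, Homog (W (c i))) :
    IsLin (fun θ : Homog (P.obj d e) => actVal P W d c e π θ φ x) :=
  (isLin_sgn _).comp ((hpure_isLin x).comp (ev_isLin _ φ))

theorem actVal_isML_op (θ : Homog (P.obj d e)) (x : ∀ i, Homog (W (c i))) :
    IsML (fun φ => actVal P W d c e π θ φ x) :=
  ((hpure_isLin x).comp_ml (ev_isML _ θ)).sgn (fun p => shuffleSign π p (fun i => (x i).deg))

theorem actVal_isML_word (θ : Homog (P.obj d e))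
    (φ : ∀ j, Homog (P.obj (fun y => c (π ⟨j, y⟩)) (d j))) :
    IsML (fun x => actVal P W d c e π θ φ x) :=
  (hpure_isML _).sgn (fun r => shuffleSign π (fun j => (φ j).deg) r)

theorem deg_actVal (θ : Homog (P.obj d e)) (φ : ∀ j, Homog (P.obj (fun y => c (π ⟨j, y⟩)) (d j)))
    (x : ∀ i, Homog (W (c i))) : (actVal P W d c e π θ φ x).deg =
      θ.deg + ∑ j, ((φ j).deg + ∑ y, (x (π ⟨j, y⟩)).deg) := by
  unfold actVal
  rw [deg_sgn, deg_hpure, deg_ev, Finset.sum_add_distrib, sum_sigma_equiv π (fun _ i => (x i).deg),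
    add_assoc]

theorem actVal_diff (θ : Homog (P.obj d e))
    (φ : ∀ j, Homog (P.obj (fun y => c (π ⟨j, y⟩)) (d j))) (x : ∀ i, Homog (W (c i))) (q : ℤ) :
    (actVal P W d c e π θ φ x).diff.vat q = (actVal P W d c e π θ.diff φ x).vat q +
      ∑ j, leftSign θ.deg (fun j => (φ j).deg + ∑ y, (x (π ⟨j, y⟩)).deg) j •
        ((actVal P W d c e π θ (Function.update φ j (φ j).diff) x).vat q +
          ∑ y, leftSign (φ j).deg (fun y => (x (π ⟨j, y⟩)).deg) y •
            (actVal P W d c e π θ φ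
              (Function.update x (π ⟨j, y⟩) (x (π ⟨j, y⟩)).diff)).vat q) := by
  unfold actVal
  simp only [deg_update, deg_diff]
  rw [sgn_diff, vat_sgn, vat_sgn]
  set s := shuffleSign π (fun j => (φ j).deg) (fun i => (x i).deg) with hs
  obtain ⟨f, hf⟩ := (hpure_isLin (P := P.obj c e) x).exists_linear
    (θ.deg + ∑ j, (φ j).deg + 1) q
  have key : ∀ z : Homog (P.obj c e), z.deg = θ.deg + ∑ j, (φ j).deg + 1 →
      (hpure z x).vat q = f (z.vat (θ.deg + ∑ j, (φ j).deg + 1)) := fun z hz => by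
    rw [hf, mk_vat z hz]
  rw [hpure_diff, smul_add, key _ (by rw [deg_diff, deg_ev]), ev_diff, map_add, map_sum,
    smul_add, add_assoc, ← key _ (by rw [deg_ev, deg_diff]; ring), Finset.smul_sum,
    Finset.smul_sum]
  congr 1
  simp only [smul_add, Finset.smul_sum, smul_smul, vat_sgn, Finset.sum_add_distrib]
  congr 1
  · refine Finset.sum_congr rfl fun j _ => ?_
    rw [Units.smul_def (leftSign _ _ _), map_zsmul, ← Units.smul_def, smul_smul, ← key]
    · rw [hs, leibniz_op π, mul_comm]
    · rw [deg_ev]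
      have := tdeg_update φ j (φ j).diff
      unfold tdeg at this
      rw [this, deg_diff]
      ring
  · rw [← π.sum_comp, Fintype.sum_sigma]
    refine Finset.sum_congr rfl fun j _ => Finset.sum_congr rfl fun y _ => ?_
    rw [hs, deg_ev, leibniz_word π, mul_comm, mul_assoc]

theorem exists_actMap (d : Fin n → C) (b : ∀ j, Fin (m j) → C) (c : Fin l → C) (e : C)
    (π : (Σ j, Fin (m j)) ≃ Fin l) (h : ∀ j y, c (π ⟨j, y⟩) = b j y) :
    ∃ F : htensor (P.obj d e) (fun j => htensor (P.obj (b j) (d j)) (fun y => W (b j y))) ⟶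
      htensor (P.obj c e) (fun i => W (c i)),
      ∀ (θ : Homog (P.obj d e)) (φ : ∀ j, Homog (P.obj (b j) (d j))) (x : ∀ i, Homog (W (c i))),
        ev F θ (fun j => hpure (φ j) (fun y => recolor W (h j y) (x (π ⟨j, y⟩)))) =
          sgn (shuffleSign π (fun j => (φ j).deg) (fun i => (x i).deg))
            (hpure (ev (P.comp d b c e π h) θ φ) x) := by
  obtain rfl : b = fun j y => c (π ⟨j, y⟩) := funext fun j => funext fun y => (h j y).symm
  let Γ : Fin n → Type u := fun j =>
    Homog (P.obj (fun y => c (π ⟨j, y⟩)) (d j)) × (∀ y, Homog (W (c (π ⟨j, y⟩))))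
  let xs : (∀ j, Γ j) → ∀ i, Homog (W (c i)) := fun s =>
    reindex π (A := fun i => Homog (W (c i))) (fun p => (s p.1).2 p.2)
  have hxs : ∀ s j y, xs s (π ⟨j, y⟩) = (s j).2 y := fun s j y =>
    reindex_apply π (A := fun i => Homog (W (c i))) (fun p => (s p.1).2 p.2) ⟨j, y⟩
  have hupd : ∀ (s : ∀ j, Γ j) (j : Fin n) (t : Γ j),
      (fun j' => (Function.update s j t j').1) = Function.update (fun j => (s j).1) j t.1 := by
    intro s j t
    funext j'
    rcases eq_or_ne j' j with rfl | hj
    · simp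
    · simp [hj]
  have hxu : ∀ (s : ∀ j, Γ j) (j : Fin n) (φ) (w : ∀ y, Homog (W (c (π ⟨j, y⟩)))) (y) (v),
      xs (Function.update s j (φ, Function.update w y v)) =
        Function.update (xs (Function.update s j (φ, w))) (π ⟨j, y⟩) v := by
    intro s j φ w y v
    funext i
    obtain ⟨⟨j', y'⟩, rfl⟩ := π.surjective i
    rw [hxs]
    rcases eq_or_ne j' j with rfl | hj
    · rcases eq_or_ne y' y with rfl | hy
      · simp
      · have hne : π ⟨j', y'⟩ ≠ π ⟨j', y⟩ := fun e => hy (by simpa using e)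
        rw [Function.update_of_ne hne, hxs]
        simp [hy]
    · have hne : π ⟨j', y'⟩ ≠ π ⟨j, y⟩ := fun e =>
        hj (congrArg Sigma.fst (π.injective e))
      rw [Function.update_of_ne hne, hxs]
      simp [hj]
  have hx' : ∀ (s : ∀ j, Γ j) (j : Fin n) (φ), xs (Function.update s j (φ, (s j).2)) = xs s := by
    intro s j φ
    funext i
    obtain ⟨⟨j', y'⟩, rfl⟩ := π.surjective i
    rw [hxs, hxs]
    rcases eq_or_ne j' j with rfl | hj
    · simp
    · simp [hj]
  have hxφ : ∀ (s : ∀ j, Γ j) (j : Fin n) (φ φ' w), xs (Function.update s j (φ, w)) =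
      xs (Function.update s j (φ', w)) := by
    intro s j φ φ' w
    have := hx' (Function.update s j (φ', w)) j φ
    simpa using this
  suffices H : ∃ F : htensor (P.obj d e)
      (fun j => htensor (P.obj (fun y => c (π ⟨j, y⟩)) (d j)) (fun y => W (c (π ⟨j, y⟩)))) ⟶
      htensor (P.obj c e) (fun i => W (c i)), ∀ (θ : Homog (P.obj d e)) (s : ∀ j, Γ j),
        ev F θ (fun j => hpure (s j).1 (s j).2) =
          actVal P W d c e π θ (fun j => (s j).1) (xs s) by
    obtain ⟨F, hF⟩ := H
    refine ⟨F, fun θ φ x => ?_⟩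
    refine (hF θ (fun j => (φ j, fun y => x (π ⟨j, y⟩)))).trans ?_
    have : xs (fun j => (φ j, fun y => x (π ⟨j, y⟩))) = x :=
      reindex_comp π (A := fun i => Homog (W (c i))) x
    rw [this]
    rfl
  refine exists_htensor_hom (Γ := Γ) (fun j s => hpure s.1 s.2) (fun j => ?_)
    (fun θ s => actVal P W d c e π θ (fun j => (s j).1) (xs s)) (fun θ s => ?_)
    (fun s => actVal_isLin _ _) (fun θ j s => ?_) (fun θ s l hl hl' q => ?_)
  · have := spans_hpure (P.obj (fun y => c (π ⟨j, y⟩)) (d j)) (fun y => W (c (π ⟨j, y⟩)))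
    convert this using 1
    ext z
    constructor
    · rintro ⟨s, rfl⟩
      exact ⟨s.1, s.2, rfl⟩
    · rintro ⟨φ, w, rfl⟩
      exact ⟨(φ, w), rfl⟩
  · rw [deg_actVal]
    simp only [hxs, deg_hpure]
  · have hdeg := fun t : Γ j => deg_actVal (P := P) (W := W) (π := π) (d := d) (c := c) (e := e) θ
      (fun j' => (Function.update s j t j').1) (xs (Function.update s j t))
    suffices H : ∃ l : Homog (htensor (P.obj (fun y => c (π ⟨j, y⟩)) (d j))
        (fun y => W (c (π ⟨j, y⟩)))) → Homog (htensor (P.obj c e) (fun i => W (c i))),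
        IsLin l ∧ (∀ z, (l z).deg = (θ.deg + ∑ j' ∈ Finset.univ.erase j,
          ((s j').1.deg + ∑ y, ((s j').2 y).deg)) + z.deg) ∧ ∀ φ w, l (hpure φ w) =
            actVal P W d c e π θ (fun j' => (Function.update s j (φ, w) j').1)
              (xs (Function.update s j (φ, w))) by
      obtain ⟨l, hl, -, hl'⟩ := H
      exact ⟨l, hl, fun t => hl' t.1 t.2⟩
    refine exists_hlin (fun w => ?_) (fun φ => ?_) (fun φ w => ?_)
    · simp only [hupd]
      have := (actVal_isML_op (P := P) (W := W) (π := π) (d := d) (c := c) (e := e) θ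
        (xs (Function.update s j ((s j).1, w)))).lin (fun j => (s j).1) j
      convert this using 3 with φ
      exact hxφ s j φ _ w
    · refine isML_of_lin fun w y => ?_
      simp only [hupd, hxu]
      exact (actVal_isML_word _ _).lin _ _
    · rw [hdeg, ← Finset.add_sum_erase _ _ (Finset.mem_univ j), add_comm (_ + ∑ _, _), add_assoc]
      simp only [hxs, Function.update_self]
      congr 2
      refine Finset.sum_congr rfl fun j' hj' => ?_
      rw [Function.update_of_ne (Finset.ne_of_mem_erase hj')]
  · rw [actVal_diff]
    refine congrArg _ (Finset.sum_congr rfl fun j _ => ?_)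
    refine congrArg₂ (· • ·) ?_ ?_
    · simp only [hxs, deg_hpure]
    · rw [(hl j).vat_hpure_diff]
      simp only [hxs]
      refine congrArg₂ (· + ·) ?_ (Finset.sum_congr rfl fun y _ => ?_)
      · have := hl' j ((s j).1.diff, (s j).2)
        rw [hupd, hx'] at this
        exact congrArg (fun z => z.vat q) this.symm
      · have := hl' j ((s j).1, Function.update (s j).2 y ((s j).2 y).diff)
        rw [hupd, hxu, hx', Function.update_eq_self] at this
        refine congrArg₂ (· • ·) rfl (congrArg (fun z => vat z q) this.symm)

end Special

/-- The action of an operad on the tensors `φ ⊗ x₁ ⊗ ⋯ ⊗ xₙ` of the free algebra. -/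
def actMap (d : Fin n → C) (b : ∀ j, Fin (m j) → C) (c : Fin l → C) (e : C)
    (π : (Σ j, Fin (m j)) ≃ Fin l) (h : ∀ j y, c (π ⟨j, y⟩) = b j y) :
    htensor (P.obj d e) (fun j => htensor (P.obj (b j) (d j)) (fun y => W (b j y))) ⟶
      htensor (P.obj c e) (fun i => W (c i)) :=
  (exists_actMap (P := P) (W := W) d b c e π h).choose

variable {P W}

theorem ev_actMap {d : Fin n → C} {b : ∀ j, Fin (m j) → C} {c : Fin l → C} {e : C}
    (π : (Σ j, Fin (m j)) ≃ Fin l) (h : ∀ j y, c (π ⟨j, y⟩) = b j y)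
    (θ : Homog (P.obj d e)) (φ : ∀ j, Homog (P.obj (b j) (d j))) (x : ∀ i, Homog (W (c i))) :
    ev (actMap P W d b c e π h) θ
      (fun j => hpure (φ j) (fun y => recolor W (h j y) (x (π ⟨j, y⟩)))) =
        sgn (shuffleSign π (fun j => (φ j).deg) (fun i => (x i).deg))
          (hpure (ev (P.comp d b c e π h) θ φ) x) :=
  (exists_actMap (P := P) (W := W) d b c e π h).choose_spec θ φ x

theorem hpure_sgn_left {Q : Cx k} {Y : Fin n → Cx k} (s : ℤˣ) (θ : Homog Q)
    (y : ∀ i, Homog (Y i)) : hpure (sgn s θ) y = sgn s (hpure θ y) := by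
  rw [sgn_eq_hsmul, (hpure_isLin y).smul, ← sgn_eq_hsmul]

theorem ev_sgn_left {Q Z : Cx k} {Y : Fin n → Cx k} (f : htensor Q Y ⟶ Z) (s : ℤˣ) (θ : Homog Q)
    (y : ∀ i, Homog (Y i)) : ev f (sgn s θ) y = sgn s (ev f θ y) := by
  rw [sgn_eq_hsmul, (ev_isLin f y).smul, ← sgn_eq_hsmul]

theorem isML_nested {X : Fin l → Cx k} {Y : Fin n → Cx k} {Z : Cx k} (π : (Σ j, Fin (m j)) ≃ Fin l)
    {G : (∀ j, Homog (Y j)) → Homog Z} (hG : IsML G)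
    {H : ∀ j, (∀ y, Homog (X (π ⟨j, y⟩))) → Homog (Y j)} (hH : ∀ j, IsML (H j)) :
    IsML (fun ω : ∀ x, Homog (X x) => G (fun j => H j (fun y => ω (π ⟨j, y⟩)))) := by
  refine IsML.subst hG (fun x => (π.symm x).1) (fun j ω => H j (fun y => ω (π ⟨j, y⟩)))
    (fun ω x z j hj => ?_) (fun ω x => ?_)
  · congr 1
    funext y
    refine Function.update_of_ne (fun h => hj ?_) _ _
    rw [← h, Equiv.symm_apply_apply]
  · obtain ⟨⟨j, y⟩, rfl⟩ := π.surjective x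
    rw [Equiv.symm_apply_apply]
    have : ∀ z, (fun y' => Function.update ω (π ⟨j, y⟩) z (π ⟨j, y'⟩)) =
        Function.update (fun y' => ω (π ⟨j, y'⟩)) y z := by
      intro z
      funext y'
      rcases eq_or_ne y' y with rfl | hy
      · simp
      · rw [Function.update_of_ne (fun e => hy (by simpa using e)), Function.update_of_ne hy]
    simp only [this]
    exact (hH j).lin _ _

theorem sign_swap {A B D E F : ℤˣ} (h : A * B = D * (E * F)) : A * D = B * F * E := by
  have hA : A = D * (E * F) * B := by rw [← h, mul_assoc, Int.units_mul_self, mul_one]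
  calc A * D = (D * D) * (B * F * E) := by rw [hA]; ac_rfl
    _ = _ := by rw [Int.units_mul_self, one_mul]

/-- The action on words is associative. -/
theorem actMap_comp {r : Fin l → ℕ} {s : ℕ} {t : Fin n → ℕ}
    (d : Fin n → C) (c : Fin l → C) (a : ∀ x, Fin (r x) → C) (q : ∀ j, Fin (t j) → C)
    (g : Fin s → C) (e : C)
    (π : (Σ j, Fin (m j)) ≃ Fin l) (ρ : (Σ x, Fin (r x)) ≃ Fin s)
    (σ : ∀ j, (Σ y : Fin (m j), Fin (r (π ⟨j, y⟩))) ≃ Fin (t j)) (τ : (Σ j, Fin (t j)) ≃ Fin s)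
    (hστ : ∀ j y z, τ ⟨j, σ j ⟨y, z⟩⟩ = ρ ⟨π ⟨j, y⟩, z⟩)
    (hρ : ∀ x z, g (ρ ⟨x, z⟩) = a x z)
    (hσ : ∀ j y z, q j (σ j ⟨y, z⟩) = a (π ⟨j, y⟩) z)
    (hτ : ∀ j w, g (τ ⟨j, w⟩) = q j w)
    (θ : Homog (P.obj d e)) (φ : ∀ j, Homog (P.obj (fun y => c (π ⟨j, y⟩)) (d j)))
    (ω : ∀ x, Homog (htensor (P.obj (a x) (c x)) (fun z => W (a x z)))) :
    ev (actMap P W c a g e ρ hρ)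
        (ev (P.comp d (fun j y => c (π ⟨j, y⟩)) c e π (fun _ _ => rfl)) θ φ) ω =
      sgn (shuffleSign π (fun j => (φ j).deg) (fun x => (ω x).deg))
        (ev (actMap P W d q g e τ hτ) θ (fun j =>
          ev (actMap P W (fun y => c (π ⟨j, y⟩)) (fun y => a (π ⟨j, y⟩)) (q j) (d j) (σ j)
            (fun y z => hσ j y z)) (φ j) (fun y => ω (π ⟨j, y⟩)))) := by
  have hdeg : ∀ ω : ∀ x, Homog (htensor (P.obj (a x) (c x)) (fun z => W (a x z))),
      (∑ j, ∑ y, (ω (π ⟨j, y⟩)).deg) = ∑ x, (ω x).deg := fun ω =>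
    sum_sigma_equiv π (fun _ x => (ω x).deg)
  have hR : IsML (fun ω : ∀ x, Homog (htensor (P.obj (a x) (c x)) (fun z => W (a x z))) =>
      ev (actMap P W d q g e τ hτ) θ (fun j =>
        ev (actMap P W (fun y => c (π ⟨j, y⟩)) (fun y => a (π ⟨j, y⟩)) (q j) (d j) (σ j)
          (fun y z => hσ j y z)) (φ j) (fun y => ω (π ⟨j, y⟩)))) :=
    isML_nested π (ev_isML _ _) (fun j => ev_isML _ _)
  refine IsML.eq_of_spans (ev_isML _ _) (hR.sgn (fun r => shuffleSign π (fun j => (φ j).deg) r))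
    (fun ω => ?_) (fun x => spans_hpure (P.obj (a x) (c x)) (fun z => W (a x z))) ?_ ω
  · simp only [deg_sgn, deg_ev]
    rw [Finset.sum_add_distrib, hdeg, add_assoc]
  · intro ω hω
    choose ψ w hω using hω
    obtain rfl : ω = fun x => hpure (ψ x) (w x) := funext hω
    obtain ⟨v, rfl⟩ : ∃ v : ∀ i, Homog (W (g i)),
        w = fun x z => recolor W (hρ x z) (v (ρ ⟨x, z⟩)) := by
      refine ⟨reindex ρ (A := fun i => Homog (W (g i)))
        (fun p => recolor W (hρ p.1 p.2).symm (w p.1 p.2)), ?_⟩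
      funext x z
      rw [reindex_apply ρ (A := fun i => Homog (W (g i)))
        (fun p => recolor W (hρ p.1 p.2).symm (w p.1 p.2)) ⟨x, z⟩, recolor_recolor, recolor_rfl]
    have hin : ∀ j, ev (actMap P W (fun y => c (π ⟨j, y⟩)) (fun y => a (π ⟨j, y⟩)) (q j) (d j) (σ j)
            (fun y z => hσ j y z)) (φ j)
            (fun y => hpure (ψ (π ⟨j, y⟩)) (fun z => recolor W (hρ _ z) (v (ρ ⟨π ⟨j, y⟩, z⟩)))) =
        sgn (shuffleSign (σ j) (fun y => (ψ (π ⟨j, y⟩)).deg) (fun u => (v (τ ⟨j, u⟩)).deg))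
          (hpure (ev (P.comp (fun y => c (π ⟨j, y⟩)) (fun y => a (π ⟨j, y⟩)) (q j) (d j) (σ j)
            (fun y z => hσ j y z)) (φ j) (fun y => ψ (π ⟨j, y⟩)))
            (fun u => recolor W (hτ j u) (v (τ ⟨j, u⟩)))) := by
      intro j
      refine Eq.trans ?_ (ev_actMap (σ j) (hσ j) (φ j) (fun y => ψ (π ⟨j, y⟩))
        (fun u => recolor W (hτ j u) (v (τ ⟨j, u⟩))))
      congr 1
      funext y
      congr 1
      funext z
      have : ∀ (i i' : Fin s) (hi : i = i') (h : g i = a (π ⟨j, y⟩) z)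
          (h' : g i' = a (π ⟨j, y⟩) z), recolor W h (v i) = recolor W h' (v i') := by
        rintro i _ rfl h h'; rfl
      rw [recolor_recolor]
      exact this _ _ (hστ j y z).symm _ _
    simp only [hin]
    rw [ev_actMap ρ hρ, IsML.sgn_all (ev_isML _ _), ev_actMap τ hτ, sgn_sgn, sgn_sgn,
      P.assoc d c a q g e π ρ σ τ hστ hρ hσ hτ θ φ ψ, hpure_sgn_left, sgn_sgn]
    congr 1
    have := shuffleSign_comp π ρ σ τ hστ (fun j => (φ j).deg) (fun x => (ψ x).deg)
      (fun i => (v i).deg)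
    simp only [deg_hpure, deg_recolor, deg_ev]
    exact sign_swap this

end Act

/-! ## Gluing of complexes -/

section Glue

variable {ι : Type u} (K : ι → Cx k)

/-- The direct sum of complexes. -/
def dsum : Cx k where
  X m := ModuleCat.of k (Π₀ i, (K i).X m)
  d m m' := ModuleCat.ofHom (DFinsupp.mapRange.linearMap (fun i => ((K i).d m m').hom))
  shape m m' h := by
    refine ModuleCat.hom_ext (LinearMap.ext fun z => DFinsupp.ext fun i => ?_)
    change (K i).d m m' (z i) = 0
    rw [(K i).shape m m' h]
    rfl
  d_comp_d' l m n _ _ := by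
    refine ModuleCat.hom_ext (LinearMap.ext fun z => DFinsupp.ext fun i => ?_)
    change (K i).d m n ((K i).d l m (z i)) = 0
    rw [← ModuleCat.comp_apply, HomologicalComplex.d_comp_d]
    rfl

open scoped Classical in
/-- The inclusion of a summand. -/
def dsumIncl (i : ι) : K i ⟶ dsum K where
  f m := ModuleCat.ofHom (DFinsupp.lsingle (R := k) (M := fun i => (K i).X m) i)
  comm' m m' _ := by
    refine ModuleCat.hom_ext (LinearMap.ext fun z => ?_)
    exact DFinsupp.mapRange_single (f := fun i => ((K i).d m m').hom) (hf := fun i => map_zero _)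

variable {K}

theorem dsum_spans : Spans {w : Homog (dsum K) | ∃ i z, w = map (dsumIncl K i) z} := by
  classical
  refine spans_of_span fun m => ?_
  rw [eq_top_iff]
  rintro (a : Π₀ i, (K i).X m) -
  induction a using DFinsupp.induction with
  | h0 => exact Submodule.zero_mem _
  | ha i b a _ _ ih =>
    refine Submodule.add_mem _ (Submodule.subset_span ⟨i, mk m b, ?_⟩) ih
    refine Homog.ext rfl (heq_of_eq ?_)
    change DFinsupp.single i b = DFinsupp.lsingle (R := k) (M := fun i => (K i).X m) i b
    rw [DFinsupp.lsingle_apply]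

theorem dsum_lin {Z : Cx k} (F : ∀ i, Homog (K i) → Homog Z) (hF : ∀ i, IsLin (F i)) (D : ℤ)
    (hD : ∀ i z, (F i z).deg = D + z.deg) : ∃ L : Homog (dsum K) → Homog Z, IsLin L ∧
      (∀ z, (L z).deg = D + z.deg) ∧ ∀ i z, L (map (dsumIncl K i) z) = F i z := by
  classical
  choose l hl using fun i m => (hF i).exists_linear m (D + m)
  refine ⟨_, isLin_of_linear D (fun m => DFinsupp.lsum ℕ (fun i => l i m)), fun _ => rfl,
    fun i z => ?_⟩
  rw [← mk_vat (F i z) (hD i z)]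
  refine Homog.ext rfl (heq_of_eq ?_)
  refine Eq.trans ?_ (hl i z.deg z.val)
  have e : (dsumIncl K i).f z.deg z.val = DFinsupp.single i z.val := by
    change DFinsupp.lsingle (R := k) (M := fun i => (K i).X z.deg) i z.val = _
    rw [DFinsupp.lsingle_apply]
  change (DFinsupp.lsum ℕ (fun i => l i z.deg)) ((dsumIncl K i).f z.deg z.val) = _
  rw [e]
  exact (DFinsupp.sumAddHom_single (fun i => (l i z.deg).toAddMonoidHom) i z.val)

theorem quotProj_spans {X : Cx k} (R : Set (Homog X)) {S : Set (Homog X)} (hS : Spans S) :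
    Spans {w | ∃ z ∈ S, w = map (quotProj X R) z} := by
  intro Q h₁ h₂ h₃ h₄ z
  obtain ⟨m, a⟩ := z
  obtain ⟨a, rfl⟩ := Submodule.Quotient.mk_surjective _ a
  refine hS (fun z => Q (map (quotProj X R) z)) (fun z hz => h₁ _ ⟨z, hz, rfl⟩)
    (fun m => ?_) (fun a => h₃ (a.map _)) (fun r z hz => ?_) (mk m a)
  · have : map (quotProj X R) (mk m 0) = mk m 0 := by
      rw [map_mk, map_zero]
    rw [this]
    exact h₂ m
  · rw [map_hsmul]
    exact h₄ r _ hz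

theorem quot_lin {X Z : Cx k} {R : Set (Homog X)} (L : Homog X → Homog Z) (hL : IsLin L) (D : ℤ)
    (hD : ∀ z, (L z).deg = D + z.deg) (h₀ : ∀ r ∈ R, ∀ m, (L r).vat m = 0)
    (h₁ : ∀ r ∈ R, ∀ m, (L r.diff).vat m = 0) : ∃ L' : Homog (quot X R) → Homog Z, IsLin L' ∧
      (∀ z, (L' z).deg = D + z.deg) ∧ ∀ z, L' (map (quotProj X R) z) = L z := by
  choose l hl using fun m => hL.exists_linear m (D + m)
  refine ⟨_, isLin_of_linear D (fun m => (genSub X R m).liftQ (l m) ?_), fun _ => rfl,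
    fun z => ?_⟩
  · rw [genSub, Submodule.span_le]
    rintro z (hz | ⟨r, hr, hz⟩)
    · exact (hl m z).trans (h₀ _ hz _)
    · refine (hl m z).trans ?_
      rw [hz]
      exact h₁ r hr _
  · rw [← mk_vat (L z) (hD z)]
    exact Homog.ext rfl (heq_of_eq (hl z.deg z.val))

variable {ρ : Type u} {s t : ρ → ι} {L : ρ → Cx k} (u : ∀ r, L r ⟶ K (s r)) (v : ∀ r, L r ⟶ K (t r))

/-- The relations identifying the images of the maps `u` and `v`. -/
def glueRel : Set (Homog (dsum K)) :=
  {w | ∃ (r : ρ) (z : Homog (L r)), w = mk z.deg ((dsumIncl K (s r)).f z.deg ((u r).f z.deg z.val) -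
    (dsumIncl K (t r)).f z.deg ((v r).f z.deg z.val))}

/-- The complex obtained from complexes `K i` by identifying the images of the maps `u` and `v`. -/
def glue : Cx k := quot (dsum K) (glueRel u v)

/-- The map from `K i`. -/
def glueIncl (i : ι) : K i ⟶ glue u v := dsumIncl K i ≫ quotProj _ _

theorem glueIncl_rel (r : ρ) : u r ≫ glueIncl u v (s r) = v r ≫ glueIncl u v (t r) := by
  refine Homog.hom_ext fun z => Homog.ext rfl (heq_of_eq ?_)
  have : (quotProj (dsum K) (glueRel u v)).f z.deg ((dsumIncl K (s r)).f z.deg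
      ((u r).f z.deg z.val) - (dsumIncl K (t r)).f z.deg ((v r).f z.deg z.val)) = 0 :=
    quotProj_eq_zero (R := glueRel u v) ⟨r, z, rfl⟩
  rw [map_sub, sub_eq_zero] at this
  exact this

theorem glue_spans : Spans {w | ∃ i z, w = map (glueIncl u v i) z} := by
  have := quotProj_spans (glueRel u v) (dsum_spans (K := K))
  refine fun Q h => this Q ?_
  rintro _ ⟨_, ⟨i, z, rfl⟩, rfl⟩
  exact h _ ⟨i, z, rfl⟩

theorem glue_lin {Z : Cx k} (F : ∀ i, Homog (K i) → Homog Z) (hF : ∀ i, IsLin (F i)) (D : ℤ)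
    (hD : ∀ i z, (F i z).deg = D + z.deg)
    (hrel : ∀ r z, F (s r) (map (u r) z) = F (t r) (map (v r) z)) :
    ∃ L : Homog (glue u v) → Homog Z, IsLin L ∧ (∀ z, (L z).deg = D + z.deg) ∧
      ∀ i z, L (map (glueIncl u v i) z) = F i z := by
  obtain ⟨L', hL', hD', hF'⟩ := dsum_lin F hF D hD
  have key : ∀ (r : ρ) (z : Homog (L r)) (m : ℤ), (L' (mk z.deg
      ((dsumIncl K (s r)).f z.deg ((u r).f z.deg z.val) -
        (dsumIncl K (t r)).f z.deg ((v r).f z.deg z.val)))).vat m = 0 := by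
    intro r z m
    obtain ⟨l, hl⟩ := hL'.exists_linear z.deg m
    rw [← hl, map_sub, hl, hl, sub_eq_zero]
    have := hrel r z
    rw [← hF', ← hF'] at this
    exact congrArg (fun z => vat z m) this
  obtain ⟨L'', h, h', h''⟩ := quot_lin (R := glueRel u v) L' hL' D hD' (by
    rintro _ ⟨r, z, rfl⟩ m
    exact key r z m) (by
    rintro _ ⟨r, z, rfl⟩ m
    have := key r z.diff m
    rw [← this]
    congr 2
    rw [diff_mk]
    refine Homog.ext rfl (heq_of_eq ?_)
    change (dsum K).d _ _ (_ - _) = _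
    rw [map_sub]
    congr 1
    · exact eq_of_heq (mk.inj ((map_diff (dsumIncl K (s r)) (map (u r) z)).symm.trans
        (congrArg (map (dsumIncl K (s r))) (map_diff (u r) z).symm))).2
    · exact eq_of_heq (mk.inj ((map_diff (dsumIncl K (t r)) (map (v r) z)).symm.trans
        (congrArg (map (dsumIncl K (t r))) (map_diff (v r) z).symm))).2)
  exact ⟨L'', h, h', fun i z => (h'' _).trans (hF' i z)⟩

theorem glue_hom_ext {Z : Cx k} {f g : glue u v ⟶ Z}
    (h : ∀ i, glueIncl u v i ≫ f = glueIncl u v i ≫ g) : f = g := by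
  refine hom_ext_spans (glue_spans u v) ?_
  rintro _ ⟨i, z, rfl⟩
  rw [← map_comp, h, map_comp]

theorem exists_glueDesc {Z : Cx k} (G : ∀ i, K i ⟶ Z) (hG : ∀ r, u r ≫ G (s r) = v r ≫ G (t r)) :
    ∃ g : glue u v ⟶ Z, ∀ i, glueIncl u v i ≫ g = G i := by
  obtain ⟨L', h, h', h''⟩ := glue_lin u v (fun i => map (G i)) (fun i => isLin_map _) 0
    (fun i z => by simp) (fun r z => by rw [← map_comp, hG, map_comp])
  refine ⟨homOfLin L' h ?_, fun i => Homog.hom_ext fun z => ?_⟩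
  · refine (h.comp isLin_diff).eq_of_spans (isLin_diff.comp h) (fun z => ?_) (glue_spans u v) ?_
    · simp only [h', deg_diff]; ring
    · rintro _ ⟨i, z, rfl⟩
      rw [← map_diff, h'', h'', map_diff]
  · rw [map_comp, map_homOfLin _ _ _ (fun z => (h' z).trans (zero_add _)), h'']

end Glue

section Cover

variable {n : ℕ} {P Z : Cx k} {Y : Fin n → Cx k} {I : Fin n → Type u}
  {K : ∀ i, I i → Cx k}

theorem update_sigma (s : ∀ i, Σ a, Homog (K i a)) (i : Fin n) (z : Homog (K i (s i).1)) :
    Function.update s i ⟨(s i).1, z⟩ =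
      fun j => ⟨(s j).1, Function.update (fun j => (s j).2) i z j⟩ := by
  funext j
  rcases eq_or_ne j i with rfl | hj
  · simp
  · simp [hj]

theorem isLin_update_sigma (F : ∀ a : ∀ i, I i, htensor P (fun i => K i (a i)) ⟶ Z) (θ : Homog P)
    (s : ∀ i, Σ a, Homog (K i a)) (i : Fin n) (a : I i) :
    IsLin (fun z : Homog (K i a) => ev (F fun j => (Function.update s i ⟨a, z⟩ j).1) θ
      (fun j => (Function.update s i ⟨a, z⟩ j).2)) := by
  obtain ⟨Φ, hΦ⟩ : ∃ Φ : (∀ i, Σ a, Homog (K i a)) → Homog Z,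
      Φ = fun s => ev (F fun j => (s j).1) θ (fun j => (s j).2) := ⟨_, rfl⟩
  have key : ∀ s : ∀ i, Σ a, Homog (K i a), IsLin (fun z : Homog (K i (s i).1) =>
      Φ (Function.update s i ⟨(s i).1, z⟩)) := by
    intro s
    simp only [update_sigma, hΦ]
    exact (ev_isML (F fun j => (s j).1) θ).lin (fun j => (s j).2) i
  have := key (Function.update s i ⟨a, mk 0 0⟩)
  rw [Function.update_self] at this
  simp only [Function.update_idem, hΦ] at this
  exact this

/-- A map out of `P ⊗ Y₁ ⊗ ⋯ ⊗ Yₙ`, where `Yᵢ` is covered by complexes `K i a`. -/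
theorem exists_htensor_hom_of_cover (g : ∀ i a, K i a ⟶ Y i)
    (hg : ∀ i, Spans {w | ∃ a z, w = map (g i a) z})
    (F : ∀ a : ∀ i, I i, htensor P (fun i => K i (a i)) ⟶ Z)
    (hF : ∀ θ (i : Fin n) (s : ∀ i, Σ a, Homog (K i a)), ∃ l : Homog (Y i) → Homog Z, IsLin l ∧
      ∀ a z, l (map (g i a) z) = ev (F fun j => (Function.update s i ⟨a, z⟩ j).1) θ
        (fun j => (Function.update s i ⟨a, z⟩ j).2)) :
    ∃ G : htensor P Y ⟶ Z, ∀ (θ : Homog P) (a : ∀ i, I i) (x : ∀ i, Homog (K i (a i))),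
      ev G θ (fun i => map (g i (a i)) (x i)) = ev (F a) θ x := by
  suffices H : ∃ G : htensor P Y ⟶ Z, ∀ (θ : Homog P) (s : ∀ i, Σ a, Homog (K i a)),
      ev G θ (fun i => map (g i (s i).1) (s i).2) = ev (F fun i => (s i).1) θ
        (fun i => (s i).2) by
    obtain ⟨G, hG⟩ := H
    exact ⟨G, fun θ a x => hG θ (fun i => ⟨a i, x i⟩)⟩
  refine exists_htensor_hom (Γ := fun i => Σ a, Homog (K i a))
    (fun i s => map (g i s.1) s.2) (fun i => ?_) (fun θ s => ev (F fun i => (s i).1) θ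
        (fun i => (s i).2)) (fun θ s => deg_ev _ _ _) (fun s => ev_isLin _ _) (fun θ i s => ?_)
      (fun θ s l hl hl' m => ?_)
  · convert hg i using 1
    ext w
    constructor
    · rintro ⟨⟨a, z⟩, rfl⟩
      exact ⟨a, z, rfl⟩
    · rintro ⟨a, z, rfl⟩
      exact ⟨⟨a, z⟩, rfl⟩
  · obtain ⟨l, hl, hl'⟩ := hF θ i s
    exact ⟨l, hl, fun t => hl' t.1 t.2⟩
  · rw [ev_diff]
    refine congrArg _ (Finset.sum_congr rfl fun i _ => congrArg₂ (· • ·) rfl ?_)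
    have := hl' i ⟨(s i).1, (s i).2.diff⟩
    rw [update_sigma] at this
    rw [← map_diff]
    exact congrArg (fun z => vat z m) this.symm

end Cover

/-! ## Filling of places -/

section Fill

variable (P : ColoredOperad k C) {V W : Coll k C}
  (η : ∀ d, V d ⟶ P.obj (Fin.elim0 : Fin 0 → C) d)

theorem unit_diff (a : C) : (P.unit a).diff = mk 1 0 :=
  Homog.ext rfl (heq_of_eq (P.d_one a))

theorem vat_mk_zero {X : Cx k} (q m : ℤ) : (mk q (0 : X.X q)).vat m = 0 := by
  by_cases h : q = m
  · subst h; simp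
  · rw [vat_of_ne _ h]

theorem hpure_nil_diff {Q : Cx k} {Y : Fin 0 → Cx k} (θ : Homog Q) (y : ∀ i, Homog (Y i)) :
    hpure θ.diff y = (hpure θ y).diff := by
  refine ext_vat (by simp [deg_hpure]) ?_
  rw [hpure_diff, Fin.sum_univ_zero, add_zero]

theorem update_single {X : Cx k} (w w' : Homog X) :
    Function.update (fun _ : Fin 1 => w) 0 w' = fun _ => w' := by
  funext i
  rw [Subsingleton.elim i 0, Function.update_self]

theorem hpure_single_isLin {Q X : Cx k} (θ : Homog Q) :
    IsLin (fun w : Homog X => hpure (Y := fun _ : Fin 1 => X) θ (fun _ => w)) := by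
  have := (hpure_isML (Y := fun _ : Fin 1 => X) θ).lin (fun _ => mk 0 0) 0
  simp only [update_single] at this
  exact this

theorem hpure_single_diff {Q X : Cx k} (θ : Homog Q) (hθ : θ.deg = 0)
    (hθ' : θ.diff = mk 1 0) (w : Homog X) :
    hpure (Y := fun _ : Fin 1 => X) θ (fun _ => w.diff) =
      (hpure (Y := fun _ : Fin 1 => X) θ (fun _ => w)).diff := by
  refine ext_vat (by simp [deg_hpure, add_assoc]) ?_
  rw [hpure_diff, Fin.sum_univ_one, hθ', (hpure_isLin _).zero, vat_mk_zero, zero_add,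
    update_single]
  have h : leftSign θ.deg (fun _ : Fin 1 => w.deg) 0 = 1 := by
    simp [leftSign, hθ]
  rw [h, one_smul]

/-- The word to be inserted at a place of colour `a`. -/
def slotVal (a : C) : ∀ b : Bool, Homog (vert V W a b) →
    Homog (htensor (P.obj (slotColor a b) a) (fun y => W (slotColor a b y)))
  | false, v => hpure (map (η a) v) (fun y => y.elim0)
  | true, w => hpure (P.unit a) (fun _ => w)

theorem slotVal_isLin (a : C) (b : Bool) : IsLin (slotVal P (W := W) η a b) := by
  cases b
  · exact (hpure_isLin _).comp (isLin_map (η a))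
  · exact hpure_single_isLin (P.unit a)

theorem deg_slotVal (a : C) (b : Bool) (x : Homog (vert V W a b)) :
    (slotVal P η a b x).deg = x.deg := by
  cases b
  · exact (deg_hpure (Y := fun y : Fin 0 => W (Fin.elim0 y)) _ _).trans
      ((congrArg (_ + ·) (Fin.sum_univ_zero _)).trans (add_zero _))
  · exact (deg_hpure (Y := fun _ : Fin 1 => W a) (P.unit a) (fun _ => x)).trans
      ((congrArg (_ + ·) (Fin.sum_univ_one _)).trans (zero_add _))

theorem slotVal_diff (a : C) (b : Bool) (x : Homog (vert V W a b)) :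
    slotVal P η a b x.diff = (slotVal P η a b x).diff := by
  cases b
  · refine Eq.trans ?_ (hpure_nil_diff (Y := fun y : Fin 0 => W (Fin.elim0 y)) _ _)
    exact congrArg (fun z => hpure (Y := fun y : Fin 0 => W (Fin.elim0 y)) z (fun y => y.elim0))
      (map_diff (η a) x)
  · exact hpure_single_diff (P.unit a) rfl (unit_diff P a) x

/-- The map which inserts, at a place of colour `a`, a nullary operation or a unit. -/
def slotWord (a : C) (b : Bool) :
    vert V W a b ⟶ htensor (P.obj (slotColor a b) a) (fun y => W (slotColor a b y)) :=
  homOfLin (slotVal P η a b) (slotVal_isLin P η a b) (slotVal_diff P η a b)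

@[simp] theorem map_slotWord (a : C) (b : Bool) (x : Homog (vert V W a b)) :
    map (slotWord P η a b) x = slotVal P η a b x :=
  map_homOfLin _ _ _ (deg_slotVal P η a b) x

variable {n l : ℕ}

/-- The map which fills the places not in `S` by nullary operations. -/
def fillMap (S : Fin n → Bool) (c : Fin n → C) (c' : Fin l → C) (d : C)
    (π : (Σ j, Fin (slotArity (S j))) ≃ Fin l) (h : ∀ j y, c' (π ⟨j, y⟩) = slotColor (c j) (S j) y) :
    htensor (P.obj c d) (fun j => vert V W (c j) (S j)) ⟶ htensor (P.obj c' d) (fun i => W (c' i)) :=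
  hmap (𝟙 _) (fun j => slotWord P η (c j) (S j)) ≫
    actMap P W c (fun j => slotColor (c j) (S j)) c' d π h

theorem map_fillMap (S : Fin n → Bool) (c : Fin n → C) (c' : Fin l → C) (d : C)
    (π : (Σ j, Fin (slotArity (S j))) ≃ Fin l) (h : ∀ j y, c' (π ⟨j, y⟩) = slotColor (c j) (S j) y)
    (θ : Homog (P.obj c d)) (x : ∀ j, Homog (vert V W (c j) (S j))) :
    map (fillMap P η S c c' d π h) (hpure θ x) =
      ev (actMap P W c (fun j => slotColor (c j) (S j)) c' d π h) θ
        (fun j => slotVal P η (c j) (S j) (x j)) := by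
  rw [fillMap, map_comp, map_hmap, Homog.map_id]
  simp only [map_slotWord]
  rfl

/-- Filling no place does nothing. -/
theorem map_fillMap_true (c : Fin n → C) (d : C) (π : (Σ _ : Fin n, Fin 1) ≃ Fin n)
    (hπ : ∀ j y, π ⟨j, y⟩ = j) (z : Homog (htensor (P.obj c d) (fun j => W (c j)))) :
    map (fillMap P η (fun _ => true) c c d π (fun j y => congrArg c (hπ j y))) z = z := by
  refine (isLin_map _).eq_of_spans isLin_id (fun _ => rfl) (spans_hpure _ _) ?_ z
  rintro _ ⟨θ, w, rfl⟩
  refine (map_fillMap P η (fun _ => true) c c d π _ θ w).trans ?_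
  have h₁ := ev_actMap (P := P) (W := W) (b := fun j (_ : Fin 1) => c j) π
    (fun j y => congrArg c (hπ j y)) θ (fun j => P.unit (c j)) w
  have h₂ : (fun j => hpure (P.unit (c j)) (fun y : Fin 1 =>
      recolor W (congrArg c (hπ j y)) (w (π ⟨j, y⟩)))) =
      fun j => slotVal P η (W := W) (c j) true (w j) := by
    funext j
    change _ = hpure (P.unit (c j)) (fun _ : Fin 1 => w j)
    congr 1
    funext y
    have : ∀ i (hi : i = j), recolor W (congrArg c hi) (w i) = w j := by
      rintro i rfl; rfl
    exact this _ (hπ j y)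
  rw [h₂] at h₁
  refine h₁.trans ?_
  have h₃ := P.comp_one c d π hπ θ
  have h₄ : ∀ i, (π.symm i).1 = i := fun i => by
    rw [← hπ (π.symm i).1 (π.symm i).2]
    exact π.apply_symm_apply i
  rw [show (fun j => (P.unit (c j)).deg) = fun _ => 0 from rfl, shuffleSign_zero_left π, sgn_one]
  · exact congrArg (fun z => hpure z w) h₃
  · intro i i' hi
    exact Or.inl (by rw [h₄, h₄]; exact hi)

variable {m : Fin n → ℕ}

/-- The bijection obtained by regrouping. -/
theorem exists_regroup {r : Fin l → ℕ} {s : ℕ} {t : Fin n → ℕ} (π : (Σ j, Fin (m j)) ≃ Fin l)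
    (σ : ∀ j, (Σ y : Fin (m j), Fin (r (π ⟨j, y⟩))) ≃ Fin (t j)) (τ : (Σ j, Fin (t j)) ≃ Fin s) :
    ∃ ρ : (Σ x, Fin (r x)) ≃ Fin s, ∀ j y z, τ ⟨j, σ j ⟨y, z⟩⟩ = ρ ⟨π ⟨j, y⟩, z⟩ := by
  let e : (Σ p : (Σ j, Fin (m j)), Fin (r (π p))) ≃ Σ x, Fin (r x) :=
    Equiv.sigmaCongrLeft (β := fun x => Fin (r x)) π
  refine ⟨e.symm.trans ((Equiv.sigmaAssoc (fun j y => Fin (r (π ⟨j, y⟩)))).trans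
    ((Equiv.sigmaCongrRight σ).trans τ)), fun j y z => ?_⟩
  have : (⟨π ⟨j, y⟩, z⟩ : Σ x, Fin (r x)) = e ⟨⟨j, y⟩, z⟩ := rfl
  rw [this]
  simp only [Equiv.trans_apply, Equiv.symm_apply_apply]
  rfl

/-- Filling commutes with the action of the operad. -/
theorem fill_act {s : ℕ} {t : Fin n → ℕ} {Z : Cx k} (f : V ⟶ W)
    (d : Fin n → C) (c : Fin l → C) (S : Fin l → Bool) (q : ∀ j, Fin (t j) → C)
    (g : Fin s → C) (e : C)
    (π : (Σ j, Fin (m j)) ≃ Fin l) (ρ : (Σ x, Fin (slotArity (S x))) ≃ Fin s)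
    (σ : ∀ j, (Σ y : Fin (m j), Fin (slotArity (S (π ⟨j, y⟩)))) ≃ Fin (t j))
    (τ : (Σ j, Fin (t j)) ≃ Fin s)
    (hστ : ∀ j y z, τ ⟨j, σ j ⟨y, z⟩⟩ = ρ ⟨π ⟨j, y⟩, z⟩)
    (hρ : ∀ x z, g (ρ ⟨x, z⟩) = slotColor (c x) (S x) z)
    (hσ : ∀ j y z, q j (σ j ⟨y, z⟩) = slotColor (c (π ⟨j, y⟩)) (S (π ⟨j, y⟩)) z)
    (hτ : ∀ j w, g (τ ⟨j, w⟩) = q j w)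
    (G : htensor (P.obj c e) (fun i => W (c i)) ⟶ Z)
    (G' : htensor (P.obj g e) (fun i => W (g i)) ⟶ Z)
    (hG : cubeTop f (P.obj c e) c S ≫ G = fillMap P η S c g e ρ hρ ≫ G')
    (θ : Homog (P.obj d e)) (ω : ∀ j, Homog (htensor (P.obj (fun y => c (π ⟨j, y⟩)) (d j))
      (fun y => vert V W (c (π ⟨j, y⟩)) (S (π ⟨j, y⟩))))) :
    ev (actMap P W d (fun j y => c (π ⟨j, y⟩)) c e π (fun _ _ => rfl) ≫ G) θ
        (fun j => map (cubeTop f _ (fun y => c (π ⟨j, y⟩)) (fun y => S (π ⟨j, y⟩))) (ω j)) =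
      ev (actMap P W d q g e τ hτ ≫ G') θ (fun j => map (fillMap P η
        (fun y => S (π ⟨j, y⟩)) (fun y => c (π ⟨j, y⟩)) (q j) (d j) (σ j) (hσ j)) (ω j)) := by
  refine IsML.eq_of_spans (F := fun ω : ∀ j, Homog (htensor (P.obj (fun y => c (π ⟨j, y⟩)) (d j))
      (fun y => vert V W (c (π ⟨j, y⟩)) (S (π ⟨j, y⟩)))) => ev (actMap P W d
        (fun j y => c (π ⟨j, y⟩)) c e π (fun _ _ => rfl) ≫ G) θ
        (fun j => map (cubeTop f _ (fun y => c (π ⟨j, y⟩)) (fun y => S (π ⟨j, y⟩))) (ω j)))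
    (IsML.subst (ev_isML _ θ) (fun j => j) (fun j ω => map (cubeTop f _ _ _) (ω j))
      (fun x i z j hj => by rw [Function.update_of_ne hj])
      (fun x i => by simp only [Function.update_self]; exact isLin_map _))
    (IsML.subst (ev_isML _ θ) (fun j => j) (fun j ω => map (fillMap P η _ _ (q j) (d j) (σ j) (hσ j))
      (ω j))
      (fun x i z j hj => by rw [Function.update_of_ne hj])
      (fun x i => by simp only [Function.update_self]; exact isLin_map _))
    (fun x => by simp only [deg_ev, deg_map]) (fun j => spans_hpure _ _) ?_ ω
  intro ω hω
  choose φ w hω using hω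
  obtain rfl : ω = fun j => hpure (φ j) (w j) := funext hω
  obtain ⟨x, rfl⟩ : ∃ x : ∀ i, Homog (vert V W (c i) (S i)), w = fun j y => x (π ⟨j, y⟩) := by
    refine ⟨reindex π (A := fun i => Homog (vert V W (c i) (S i))) (fun p => w p.1 p.2), ?_⟩
    funext j y
    rw [reindex_apply π (A := fun i => Homog (vert V W (c i) (S i))) (fun p => w p.1 p.2) ⟨j, y⟩]
  simp only [map_cubeTop, map_fillMap]
  have h₁ := ev_actMap (P := P) (W := W) (d := d) (e := e) π (fun _ _ => rfl) θ φ
    (fun i => map (vertTop f (c i) (S i)) (x i))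
  have h₂ := actMap_comp d c (fun i => slotColor (c i) (S i)) q g e π ρ σ τ hστ hρ hσ hτ θ φ
    (fun i => slotVal P η (c i) (S i) (x i))
  have h₃ := congrArg (fun F => ev F (ev (P.comp d (fun j y => c (π ⟨j, y⟩)) c e π
    (fun _ _ => rfl)) θ φ) x) hG
  simp only [ev, map_comp, map_cubeTop, map_fillMap, recolor_rfl, deg_map, deg_slotVal]
    at h₁ h₂ h₃ ⊢
  rw [h₂] at h₃
  rw [h₁, map_sgn, h₃, map_sgn, sgn_sgn, Int.units_mul_self, sgn_one]

end Fill

/-! ## The complexes of words -/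

section Sub

variable (P : ColoredOperad k C) {V W : Coll k C}
  (f : V ⟶ W) (η : ∀ d, V d ⟶ P.obj (Fin.elim0 : Fin 0 → C) d)

theorem map_cubeTop_true {n : ℕ} (Q : Cx k) (c : Fin n → C)
    (z : Homog (htensor Q (fun i => W (c i)))) :
    map (cubeTop f Q c (fun _ => true)) z = z := by
  refine (isLin_map (cubeTop f Q c (fun _ => true))).eq_of_spans isLin_id (fun _ => rfl)
    (spans_hpure _ _) ?_ z
  rintro _ ⟨θ, w, rfl⟩
  exact map_cubeTop f Q c (fun _ => true) θ w

variable {n l : ℕ} {m : Fin n → ℕ}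

theorem fill_act_local {s : ℕ} {t : Fin n → ℕ} {Z : Cx k}
    (d : Fin n → C) (b : ∀ j, Fin (m j) → C) (c : Fin l → C) (S : ∀ j, Fin (m j) → Bool)
    (q : ∀ j, Fin (t j) → C) (g : Fin s → C) (e : C)
    (π : (Σ j, Fin (m j)) ≃ Fin l) (h : ∀ j y, c (π ⟨j, y⟩) = b j y)
    (σ : ∀ j, (Σ y : Fin (m j), Fin (slotArity (S j y))) ≃ Fin (t j))
    (τ : (Σ j, Fin (t j)) ≃ Fin s)
    (hσ : ∀ j y z, q j (σ j ⟨y, z⟩) = slotColor (b j y) (S j y) z)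
    (hτ : ∀ j w, g (τ ⟨j, w⟩) = q j w)
    (G : htensor (P.obj c e) (fun i => W (c i)) ⟶ Z)
    (G' : htensor (P.obj g e) (fun i => W (g i)) ⟶ Z)
    (hG : ∀ (S' : Fin l → Bool) (ρ : (Σ x, Fin (slotArity (S' x))) ≃ Fin s) (hρ),
      cubeTop f (P.obj c e) c S' ≫ G = fillMap P η S' c g e ρ hρ ≫ G')
    (θ : Homog (P.obj d e))
    (ω : ∀ j, Homog (htensor (P.obj (b j) (d j)) (fun y => vert V W (b j y) (S j y)))) :
    ev (actMap P W d b c e π h ≫ G) θ (fun j => map (cubeTop f _ (b j) (S j)) (ω j)) =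
      ev (actMap P W d q g e τ hτ ≫ G') θ
        (fun j => map (fillMap P η (S j) (b j) (q j) (d j) (σ j) (hσ j)) (ω j)) := by
  obtain rfl : b = fun j y => c (π ⟨j, y⟩) := funext fun j => funext fun y => (h j y).symm
  obtain ⟨S', rfl⟩ : ∃ S' : Fin l → Bool, S = fun j y => S' (π ⟨j, y⟩) :=
    ⟨fun i => S (π.symm i).1 (π.symm i).2, funext fun j => funext fun y =>
      (congrArg (fun p : Σ j, Fin (m j) => S p.1 p.2) (π.symm_apply_apply ⟨j, y⟩)).symm⟩
  obtain ⟨ρ, hρ⟩ := exists_regroup (r := fun x => slotArity (S' x)) π σ τ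
  refine fill_act P η f d c S' q g e π ρ σ τ hρ (fun x z => ?_) hσ hτ G G' (hG S' ρ _) θ ω
  obtain ⟨⟨j, y⟩, rfl⟩ := π.surjective x
  rw [← hρ, hτ, hσ]

theorem actMap_unit (c : Fin n → C) (e : C) (π : (Σ _ : Fin 1, Fin n) ≃ Fin n)
    (hπ : ∀ j y, π ⟨j, y⟩ = y) (z : Homog (htensor (P.obj c e) (fun i => W (c i)))) :
    ev (actMap P W (fun _ : Fin 1 => e) (fun _ => c) c e π (fun j y => congrArg c (hπ j y)))
      (P.unit e) (fun _ => z) = z := by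
  have hl : IsLin (fun z : Homog (htensor (P.obj c e) (fun i => W (c i))) =>
      ev (actMap P W (fun _ : Fin 1 => e) (fun _ => c) c e π (fun j y => congrArg c (hπ j y)))
      (P.unit e) (fun _ => z)) := (isLin_map _).comp (hpure_single_isLin (P.unit e))
  refine hl.eq_of_spans isLin_id (fun z => ?_) (spans_hpure _ _) ?_ z
  · rw [deg_ev, Fin.sum_univ_one]
    exact zero_add _
  · rintro _ ⟨θ, w, rfl⟩
    have h₁ := ev_actMap (P := P) (W := W) (b := fun _ : Fin 1 => c) π
      (fun j y => congrArg c (hπ j y)) (P.unit e) (fun _ => θ) w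
    have h₂ : (fun y => recolor W (congrArg c (hπ 0 y)) (w (π ⟨0, y⟩))) = w := by
      funext y
      have : ∀ i (hi : i = y), recolor W (congrArg c hi) (w i) = w y := by
        rintro i rfl; rfl
      exact this _ (hπ 0 y)
    have h₃ : (fun j : Fin 1 => hpure θ (fun y => recolor W (congrArg c (hπ j y)) (w (π ⟨j, y⟩)))) =
        fun _ => hpure θ w := by
      funext j
      rw [Subsingleton.elim j 0, h₂]
    rw [h₃] at h₁
    refine h₁.trans ?_
    have h₄ : shuffleSign π (fun _ => θ.deg) (fun i => (w i).deg) = 1 := by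
      rw [shuffleSign_eq, ← sg_zero]
      congr 1
      unfold shE
      have e₁ : ∀ i, (((π.symm i).2 : Fin n) : ℕ) = i := fun i => by
        have := hπ (π.symm i).1 (π.symm i).2
        rw [← this]
        simp
      have e₂ : ∀ i (j : Fin 1), ¬ ((π.symm i).1 < j) := fun i j => by omega
      have e₃ : ∀ i i' : Fin n, ¬ (i < i' ∧ Before π i' i) := by
        rintro i i' ⟨h, h' | h'⟩
        · exact e₂ _ _ h'
        · have := h'.2
          rw [e₁, e₁] at this
          omega
      simp [ind, e₂, e₃]
    rw [h₄, sgn_one]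
    exact congrArg (fun z => hpure z w) (P.one_comp c e π hπ θ)

variable (C) in
/-- Collections of at most `N` colours. -/
abbrev Word (N : ℕ∞) : Type u := {x : Σ n, Fin n → C // (x.1 : ℕ∞) ≤ N}

variable (C) in
/-- The data for filling those places of a collection of colours which are not in `S`. -/
structure FillData (N : ℕ∞) : Type u where
  /-- The number of places. -/
  n : ℕ
  /-- The colours of the places. -/
  c : Fin n → C
  /-- The places which are left. -/
  S : Fin n → Bool
  /-- The number of places left. -/
  l : ℕ
  /-- The colours of the places left. -/
  c' : Fin l → C
  /-- The numbering of the places left. -/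
  π : (Σ j, Fin (slotArity (S j))) ≃ Fin l
  h : ∀ j y, c' (π ⟨j, y⟩) = slotColor (c j) (S j) y
  hn : (n : ℕ∞) ≤ N
  hl : (l : ℕ∞) ≤ N

/-- The complex of words with coefficients in `P` and at most `N` letters in `W`, in which letters
from `V` are identified with nullary operations. -/
def sub (N : ℕ∞) (d : C) : Cx k :=
  glue (ι := Word C N) (K := fun x => htensor (P.obj x.1.2 d) (fun i => W (x.1.2 i)))
    (ρ := FillData C N) (s := fun r => ⟨⟨r.n, r.c⟩, r.hn⟩) (t := fun r => ⟨⟨r.l, r.c'⟩, r.hl⟩)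
    (L := fun r => htensor (P.obj r.c d) (fun j => vert V W (r.c j) (r.S j)))
    (fun r => cubeTop f (P.obj r.c d) r.c r.S)
    (fun r => fillMap P η r.S r.c r.c' d r.π r.h)

variable {N : ℕ∞}

/-- The inclusion of the words with given colours of letters. -/
def cellIn (hn : (n : ℕ∞) ≤ N) (c : Fin n → C) (d : C) :
    htensor (P.obj c d) (fun i => W (c i)) ⟶ sub P f η N d :=
  glueIncl (ι := Word C N) (K := fun x => htensor (P.obj x.1.2 d) (fun i => W (x.1.2 i)))
    (ρ := FillData C N) (s := fun r => ⟨⟨r.n, r.c⟩, r.hn⟩) (t := fun r => ⟨⟨r.l, r.c'⟩, r.hl⟩)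
    (L := fun r => htensor (P.obj r.c d) (fun j => vert V W (r.c j) (r.S j)))
    (fun r => cubeTop f (P.obj r.c d) r.c r.S)
    (fun r => fillMap P η r.S r.c r.c' d r.π r.h) ⟨⟨n, c⟩, hn⟩

theorem cellIn_fill (hn : (n : ℕ∞) ≤ N) (hl : (l : ℕ∞) ≤ N) (S : Fin n → Bool) (c : Fin n → C)
    (c' : Fin l → C) (d : C) (π : (Σ j, Fin (slotArity (S j))) ≃ Fin l)
    (h : ∀ j y, c' (π ⟨j, y⟩) = slotColor (c j) (S j) y) :
    cubeTop f (P.obj c d) c S ≫ cellIn P f η hn c d =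
      fillMap P η S c c' d π h ≫ cellIn P f η hl c' d :=
  glueIncl_rel (ι := Word C N) (K := fun x => htensor (P.obj x.1.2 d) (fun i => W (x.1.2 i)))
    (ρ := FillData C N) (s := fun r => ⟨⟨r.n, r.c⟩, r.hn⟩) (t := fun r => ⟨⟨r.l, r.c'⟩, r.hl⟩)
    (L := fun r => htensor (P.obj r.c d) (fun j => vert V W (r.c j) (r.S j)))
    (fun r => cubeTop f (P.obj r.c d) r.c r.S)
    (fun r => fillMap P η r.S r.c r.c' d r.π r.h) ⟨n, c, S, l, c', π, h, hn, hl⟩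

theorem sub_spans (N : ℕ∞) (d : C) : Spans {w : Homog (sub P f η N d) |
    ∃ (n : ℕ) (hn : (n : ℕ∞) ≤ N) (c : Fin n → C) (z : _), w = map (cellIn P f η hn c d) z} := by
  intro Q h
  refine glue_spans _ _ Q ?_
  rintro _ ⟨⟨⟨n, c⟩, hn⟩, z, rfl⟩
  exact h _ ⟨n, hn, c, z, rfl⟩

theorem sub_lin {Z : Cx k} {d : C} (F : ∀ (n : ℕ) (_ : (n : ℕ∞) ≤ N) (c : Fin n → C),
      Homog (htensor (P.obj c d) (fun i => W (c i))) → Homog Z) (hF : ∀ n hn c, IsLin (F n hn c))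
    (D : ℤ) (hD : ∀ n hn c z, (F n hn c z).deg = D + z.deg)
    (hrel : ∀ (r : FillData C N) z, F r.n r.hn r.c (map (cubeTop f (P.obj r.c d) r.c r.S) z) =
      F r.l r.hl r.c' (map (fillMap P η r.S r.c r.c' d r.π r.h) z)) :
    ∃ L : Homog (sub P f η N d) → Homog Z, IsLin L ∧ (∀ z, (L z).deg = D + z.deg) ∧
      ∀ n hn c z, L (map (cellIn P f η (n := n) hn c d) z) = F n hn c z := by
  obtain ⟨L, h, h', h''⟩ := glue_lin (ι := Word C N)
    (K := fun x => htensor (P.obj x.1.2 d) (fun i => W (x.1.2 i)))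
    (ρ := FillData C N) (s := fun r => ⟨⟨r.n, r.c⟩, r.hn⟩) (t := fun r => ⟨⟨r.l, r.c'⟩, r.hl⟩)
    (L := fun r => htensor (P.obj r.c d) (fun j => vert V W (r.c j) (r.S j)))
    (fun r => cubeTop f (P.obj r.c d) r.c r.S)
    (fun r => fillMap P η r.S r.c r.c' d r.π r.h)
    (fun x => F x.1.1 x.2 x.1.2) (fun x => hF _ _ _) D (fun x => hD _ _ _) hrel
  exact ⟨L, h, h', fun n hn c z => h'' ⟨⟨n, c⟩, hn⟩ z⟩

theorem sub_hom_ext {Z : Cx k} {d : C} {g g' : sub P f η N d ⟶ Z}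
    (h : ∀ (n : ℕ) (hn : (n : ℕ∞) ≤ N) (c : Fin n → C),
      cellIn P f η hn c d ≫ g = cellIn P f η hn c d ≫ g') : g = g' :=
  glue_hom_ext _ _ fun x => h x.1.1 x.2 x.1.2

theorem exists_subDesc {Z : Cx k} {d : C} (G : ∀ (n : ℕ) (_ : (n : ℕ∞) ≤ N) (c : Fin n → C),
      htensor (P.obj c d) (fun i => W (c i)) ⟶ Z)
    (hrel : ∀ (r : FillData C N), cubeTop f (P.obj r.c d) r.c r.S ≫ G r.n r.hn r.c =
      fillMap P η r.S r.c r.c' d r.π r.h ≫ G r.l r.hl r.c') :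
    ∃ g : sub P f η N d ⟶ Z, ∀ n hn c, cellIn P f η (n := n) hn c d ≫ g = G n hn c := by
  obtain ⟨g, hg⟩ := exists_glueDesc (ι := Word C N)
    (K := fun x => htensor (P.obj x.1.2 d) (fun i => W (x.1.2 i)))
    (ρ := FillData C N) (s := fun r => ⟨⟨r.n, r.c⟩, r.hn⟩) (t := fun r => ⟨⟨r.l, r.c'⟩, r.hl⟩)
    (L := fun r => htensor (P.obj r.c d) (fun j => vert V W (r.c j) (r.S j)))
    (fun r => cubeTop f (P.obj r.c d) r.c r.S)
    (fun r => fillMap P η r.S r.c r.c' d r.π r.h) (fun x => G x.1.1 x.2 x.1.2) hrel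
  exact ⟨g, fun n hn c => hg ⟨⟨n, c⟩, hn⟩⟩

/-- The value of the action on words does not depend on the numbering of the letters. -/
theorem actMap_cellIn {l' : ℕ} (hl : (l : ℕ∞) ≤ N) (hl' : (l' : ℕ∞) ≤ N) (d : Fin n → C)
    (b : ∀ j, Fin (m j) → C) (e : C) (c : Fin l → C) (π : (Σ j, Fin (m j)) ≃ Fin l)
    (h : ∀ j y, c (π ⟨j, y⟩) = b j y) (c' : Fin l' → C) (π' : (Σ j, Fin (m j)) ≃ Fin l')
    (h' : ∀ j y, c' (π' ⟨j, y⟩) = b j y) :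
    actMap P W d b c e π h ≫ cellIn P f η hl c e =
      actMap P W d b c' e π' h' ≫ cellIn P f η hl' c' e := by
  refine htensor_hom_ext fun θ ω => ?_
  have := fill_act_local P f η d b c (fun _ _ => true) b c' e π h
    (fun j => Equiv.sigmaUnique (Fin (m j)) (fun _ => Fin 1)) π' (fun j y z => rfl) h'
    (cellIn P f η hl c e) (cellIn P f η hl' c' e) (fun S' ρ hρ => cellIn_fill P f η hl hl' S' c c' e ρ hρ)
    θ ω
  have h₁ : (fun j => map (cubeTop f (P.obj (b j) (d j)) (b j) (fun _ => true)) (ω j)) = ω :=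
    funext fun j => map_cubeTop_true f _ _ _
  have h₂ : (fun j => map (fillMap P η (fun _ => true) (b j) (b j) (d j)
      (Equiv.sigmaUnique (Fin (m j)) (fun _ => Fin 1)) (fun y z => rfl)) (ω j)) = ω :=
    funext fun j => map_fillMap_true P η _ _ _ (fun _ _ => rfl) _
  rw [h₁] at this
  refine this.trans ?_
  exact congrArg (fun ω => ev (actMap P W d b c' e π' h' ≫ cellIn P f η hl' c' e) θ ω) h₂

/-- The trivial filling. -/
def trivFill (x : Word C N) : FillData C N :=
  ⟨x.1.1, x.1.2, fun _ => true, x.1.1, x.1.2, Equiv.sigmaUnique (Fin x.1.1) (fun _ => Fin 1),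
    fun _ _ => rfl, x.2, x.2⟩

/-- The action on words with given colours of letters. -/
def actCell (d : Fin n → C) (e : C) (a : ∀ _ : Fin n, Word C ⊤) :
    htensor (P.obj d e) (fun j => htensor (P.obj (a j).1.2 (d j)) (fun y => W ((a j).1.2 y))) ⟶
      sub P f η ⊤ e :=
  actMap P W d (fun j => (a j).1.2)
    (fun i => (a (finSigmaFinEquiv.symm i).1).1.2 (finSigmaFinEquiv.symm i).2) e finSigmaFinEquiv
    (fun j y => by rw [Equiv.symm_apply_apply]) ≫ cellIn P f η le_top _ e

theorem actCell_eq (d : Fin n → C) (e : C) (a : ∀ _ : Fin n, Word C ⊤) (c : Fin l → C)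
    (π : (Σ j, Fin (a j).1.1) ≃ Fin l) (h : ∀ j y, c (π ⟨j, y⟩) = (a j).1.2 y) :
    actCell P f η d e a = actMap P W d (fun j => (a j).1.2) c e π h ≫ cellIn P f η le_top c e :=
  actMap_cellIn P f η le_top le_top d (fun j => (a j).1.2) e _ _ _ _ _ _

theorem actCell_rel (d : Fin n → C) (e : C) (θ : Homog (P.obj d e)) (r : ∀ _ : Fin n, FillData C ⊤)
    (ω : ∀ j, Homog (htensor (P.obj (r j).c (d j)) (fun y => vert V W ((r j).c y) ((r j).S y)))) :
    ev (actCell P f η d e (fun j => ⟨⟨(r j).n, (r j).c⟩, (r j).hn⟩)) θ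
        (fun j => map (cubeTop f _ (r j).c (r j).S) (ω j)) =
      ev (actCell P f η d e (fun j => ⟨⟨(r j).l, (r j).c'⟩, (r j).hl⟩)) θ
        (fun j => map (fillMap P η (r j).S (r j).c (r j).c' (d j) (r j).π (r j).h) (ω j)) :=
  fill_act_local P f η d (fun j => (r j).c) _ (fun j => (r j).S) (fun j => (r j).c') _ e
    finSigmaFinEquiv _ (fun j => (r j).π) finSigmaFinEquiv (fun j => (r j).h) _ _ _
    (fun S' ρ hρ => cellIn_fill P f η le_top le_top S' _ _ e ρ hρ) θ ω

theorem exists_subAct (d : Fin n → C) (e : C) :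
    ∃ G : htensor (P.obj d e) (fun j => sub P f η ⊤ (d j)) ⟶ sub P f η ⊤ e,
      ∀ (θ : Homog (P.obj d e)) (a : ∀ _ : Fin n, Word C ⊤)
        (x : ∀ j, Homog (htensor (P.obj (a j).1.2 (d j)) (fun y => W ((a j).1.2 y)))),
        ev G θ (fun j => map (cellIn P f η le_top (a j).1.2 (d j)) (x j)) =
          ev (actCell P f η d e a) θ x := by
  refine exists_htensor_hom_of_cover (I := fun _ => Word C ⊤)
    (K := fun j a => htensor (P.obj a.1.2 (d j)) (fun y => W (a.1.2 y)))
    (fun j a => cellIn P f η le_top a.1.2 (d j)) (fun j => ?_) (actCell P f η d e)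
    (fun θ j s => ?_)
  · intro Q h
    refine sub_spans P f η ⊤ (d j) Q ?_
    rintro _ ⟨n, hn, c, z, rfl⟩
    exact h _ ⟨⟨⟨n, c⟩, hn⟩, z, rfl⟩
  · suffices H : ∃ L : Homog (sub P f η ⊤ (d j)) → Homog (sub P f η ⊤ e), IsLin L ∧
        (∀ z, (L z).deg = (θ.deg + ∑ j' ∈ Finset.univ.erase j, (s j').2.deg) + z.deg) ∧
        ∀ n hn c z, L (map (cellIn P f η (n := n) hn c (d j)) z) =
          ev (actCell P f η d e fun j' => (Function.update s j ⟨⟨⟨n, c⟩, hn⟩, z⟩ j').1) θ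
            (fun j' => (Function.update s j ⟨⟨⟨n, c⟩, hn⟩, z⟩ j').2) by
      obtain ⟨L, h, -, h'⟩ := H
      exact ⟨L, h, fun a z => h' a.1.1 a.2 a.1.2 z⟩
    refine sub_lin P f η (N := ⊤) (d := d j) (Z := sub P f η ⊤ e)
      (fun n hn c z => ev (actCell P f η d e fun j' =>
        (Function.update s j ⟨⟨⟨n, c⟩, hn⟩, z⟩ j').1) θ
          (fun j' => (Function.update s j ⟨⟨⟨n, c⟩, hn⟩, z⟩ j').2))
      (fun n hn c => isLin_update_sigma (I := fun _ => Word C ⊤)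
        (K := fun j a => htensor (P.obj a.1.2 (d j)) (fun y => W (a.1.2 y)))
        (actCell P f η d e) θ s j ⟨⟨n, c⟩, hn⟩)
      (θ.deg + ∑ j' ∈ Finset.univ.erase j, (s j').2.deg) (fun n hn c z => ?_) (fun r z => ?_)
    · rw [deg_ev, ← Finset.add_sum_erase _ _ (Finset.mem_univ j), add_comm (_ : ℤ) (∑ _ ∈ _, _),
        ← add_assoc, Function.update_self]
      congr 2
      refine Finset.sum_congr rfl fun j' hj' => ?_
      rw [Function.update_of_ne (Finset.ne_of_mem_erase hj')]
    · let T : ∀ j', Σ r : FillData C ⊤,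
          Homog (htensor (P.obj r.c (d j')) (fun y => vert V W (r.c y) (r.S y))) :=
        Function.update (fun j' => ⟨trivFill (s j').1, (s j').2⟩) j ⟨r, z⟩
      have h₁ : Function.update s j ⟨⟨⟨r.n, r.c⟩, r.hn⟩, map (cubeTop f _ r.c r.S) z⟩ =
          fun j' => ⟨⟨⟨(T j').1.n, (T j').1.c⟩, (T j').1.hn⟩,
            map (cubeTop f _ (T j').1.c (T j').1.S) (T j').2⟩ := by
        funext j'
        rcases eq_or_ne j' j with rfl | hj
        · have e : T j' = ⟨r, z⟩ := Function.update_self _ _ _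
          rw [e, Function.update_self]
        · have e : T j' = ⟨trivFill (s j').1, (s j').2⟩ := Function.update_of_ne hj _ _
          rw [e, Function.update_of_ne hj]
          exact Sigma.ext rfl (heq_of_eq (map_cubeTop_true f _ _ _).symm)
      have h₂ : Function.update s j ⟨⟨⟨r.l, r.c'⟩, r.hl⟩,
            map (fillMap P η r.S r.c r.c' (d j) r.π r.h) z⟩ =
          fun j' => ⟨⟨⟨(T j').1.l, (T j').1.c'⟩, (T j').1.hl⟩,
            map (fillMap P η (T j').1.S (T j').1.c (T j').1.c' (d j') (T j').1.π (T j').1.h)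
              (T j').2⟩ := by
        funext j'
        rcases eq_or_ne j' j with rfl | hj
        · have e : T j' = ⟨r, z⟩ := Function.update_self _ _ _
          rw [e, Function.update_self]
        · have e : T j' = ⟨trivFill (s j').1, (s j').2⟩ := Function.update_of_ne hj _ _
          rw [e, Function.update_of_ne hj]
          exact Sigma.ext rfl (heq_of_eq
            (map_fillMap_true P η _ _ _ (fun _ _ => rfl) (s j').2).symm)
      let Ψ : (∀ j', Σ a : Word C ⊤, Homog (htensor (P.obj a.1.2 (d j')) (fun y => W (a.1.2 y)))) →
          Homog (sub P f η ⊤ e) := fun s => ev (actCell P f η d e fun j' => (s j').1) θ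
            (fun j' => (s j').2)
      refine (congrArg Ψ h₁).trans (Eq.trans ?_ (congrArg Ψ h₂).symm)
      exact actCell_rel P f η d e θ (fun j => (T j).1) (fun j => (T j).2)

/-- The action of `P` on the complexes of words. -/
def subAct (d : Fin n → C) (e : C) :
    htensor (P.obj d e) (fun j => sub P f η ⊤ (d j)) ⟶ sub P f η ⊤ e :=
  (exists_subAct P f η d e).choose

theorem subAct_cellIn (d : Fin n → C) (e : C) (θ : Homog (P.obj d e)) (b : ∀ j, Fin (m j) → C)
    (x : ∀ j, Homog (htensor (P.obj (b j) (d j)) (fun y => W (b j y)))) (c : Fin l → C)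
    (π : (Σ j, Fin (m j)) ≃ Fin l) (h : ∀ j y, c (π ⟨j, y⟩) = b j y) :
    ev (subAct P f η d e) θ (fun j => map (cellIn P f η le_top (b j) (d j)) (x j)) =
      map (cellIn P f η le_top c e) (ev (actMap P W d b c e π h) θ x) := by
  have := (exists_subAct P f η d e).choose_spec θ (fun j => ⟨⟨m j, b j⟩, le_top⟩) x
  refine this.trans ?_
  rw [actCell_eq P f η d e _ c π h]
  rfl

/-- The words form an algebra. -/
def subStr : AlgStr P (sub P f η ⊤) where
  act c d := subAct P f η c d
  act_unit a x := by
    have hl : IsLin (fun x : Homog (sub P f η ⊤ a) =>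
        ev (subAct P f η (fun _ : Fin 1 => a) a) (P.unit a) (fun _ => x)) :=
      (isLin_map _).comp (hpure_single_isLin (P.unit a))
    refine hl.eq_of_spans isLin_id (fun z => ?_) (sub_spans P f η ⊤ a) ?_ x
    · rw [deg_ev, Fin.sum_univ_one]
      exact zero_add _
    · rintro _ ⟨n, hn, c, z, rfl⟩
      refine (subAct_cellIn P f η (fun _ : Fin 1 => a) a (P.unit a) (fun _ => c) (fun _ => z) c
        (Equiv.uniqueSigma (fun _ : Fin 1 => Fin n)) (fun j y => ?_)).trans ?_
      · rw [Subsingleton.elim j 0]; rfl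
      · rw [actMap_unit P c a _ (fun j y => by rw [Subsingleton.elim j 0]; rfl)]
        rfl
  act_comp {n m l} d c e π θ φ x := by
    have hR : IsML (fun x : ∀ i, Homog (sub P f η ⊤ (c i)) => ev (subAct P f η d e) θ (fun j =>
        ev (subAct P f η (fun y => c (π ⟨j, y⟩)) (d j)) (φ j) (fun y => x (π ⟨j, y⟩)))) :=
      isML_nested π (ev_isML _ _) (fun j => ev_isML _ _)
    refine IsML.eq_of_spans (ev_isML _ _) (hR.sgn (fun r => shuffleSign π (fun j => (φ j).deg) r))
      (fun x => ?_) (fun i => sub_spans P f η ⊤ (c i)) ?_ x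
    · simp only [deg_sgn, deg_ev]
      rw [Finset.sum_add_distrib, sum_sigma_equiv π (fun _ i => (x i).deg), add_assoc]
    · intro x hx
      choose r hr a ω hx using hx
      obtain rfl : x = fun i => map (cellIn P f η le_top (a i) (c i)) (ω i) := funext hx
      obtain ⟨ρ, hρ⟩ := exists_regroup (r := r) π
        (fun j => finSigmaFinEquiv (n := fun y => r (π ⟨j, y⟩))) finSigmaFinEquiv
      let g : Fin (∑ j, ∑ y, r (π ⟨j, y⟩)) → C := fun i => a (ρ.symm i).1 (ρ.symm i).2
      have hg : ∀ x z, g (ρ ⟨x, z⟩) = a x z := fun x z =>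
        congrArg (fun p : Σ x, Fin (r x) => a p.1 p.2) (ρ.symm_apply_apply ⟨x, z⟩)
      let q : ∀ j, Fin (∑ y, r (π ⟨j, y⟩)) → C := fun j w => g (finSigmaFinEquiv ⟨j, w⟩)
      have hq : ∀ j y z, q j (finSigmaFinEquiv ⟨y, z⟩) = a (π ⟨j, y⟩) z := fun j y z => by
        simp only [q]
        rw [hρ, hg]
      rw [subAct_cellIn P f η c e _ a ω g ρ hg, actMap_comp d c a q g e π ρ
        (fun j => finSigmaFinEquiv (n := fun y => r (π ⟨j, y⟩))) finSigmaFinEquiv hρ hg hq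
        (fun _ _ => rfl) θ φ ω, map_sgn]
      refine congrArg _ ?_
      have h₁ : ∀ j, ev (subAct P f η (fun y => c (π ⟨j, y⟩)) (d j)) (φ j)
          (fun y => map (cellIn P f η le_top (a (π ⟨j, y⟩)) (c (π ⟨j, y⟩))) (ω (π ⟨j, y⟩))) =
          _ := fun j => subAct_cellIn P f η (fun y => c (π ⟨j, y⟩)) (d j) (φ j)
            (fun y => a (π ⟨j, y⟩)) (fun y => ω (π ⟨j, y⟩)) (q j)
            (finSigmaFinEquiv (n := fun y => r (π ⟨j, y⟩))) (hq j)
      simp only [h₁]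
      rw [subAct_cellIn P f η d e θ q _ g finSigmaFinEquiv (fun _ _ => rfl)]

end Sub

/-! ## The universal property of the algebra of words -/

section Universal

variable {P : ColoredOperad k C} {V W : Coll k C}
  {f : V ⟶ W} {η : ∀ d, V d ⟶ P.obj (Fin.elim0 : Fin 0 → C) d} {Z : Coll k C} (t : AlgStr P Z)
  (γ : ∀ d, W d ⟶ Z d)

theorem ev_comp {Q X Y : Cx k} {n : ℕ} {A : Fin n → Cx k} (F : htensor Q A ⟶ X) (G : X ⟶ Y)
    (θ : Homog Q) (x : ∀ i, Homog (A i)) : ev (F ≫ G) θ x = map G (ev F θ x) := rfl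

/-- The value of words in an algebra. -/
def wordEval {n : ℕ} (c : Fin n → C) (d : C) : htensor (P.obj c d) (fun i => W (c i)) ⟶ Z d :=
  hmap (𝟙 _) (fun i => γ (c i)) ≫ t.act c d

theorem map_wordEval {n : ℕ} (c : Fin n → C) (d : C) (θ : Homog (P.obj c d))
    (x : ∀ i, Homog (W (c i))) : map (wordEval t γ c d) (hpure θ x) =
      ev (t.act c d) θ (fun i => map (γ (c i)) (x i)) := by
  rw [wordEval, map_comp, map_hmap, Homog.map_id]
  rfl

theorem wordEval_actMap {n l : ℕ} {m : Fin n → ℕ} (d : Fin n → C) (b : ∀ j, Fin (m j) → C)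
    (c : Fin l → C) (e : C) (π : (Σ j, Fin (m j)) ≃ Fin l) (h : ∀ j y, c (π ⟨j, y⟩) = b j y)
    (θ : Homog (P.obj d e))
    (ω : ∀ j, Homog (htensor (P.obj (b j) (d j)) (fun y => W (b j y)))) :
    ev (actMap P W d b c e π h ≫ wordEval t γ c e) θ ω =
      ev (t.act d e) θ (fun j => map (wordEval t γ (b j) (d j)) (ω j)) := by
  obtain rfl : b = fun j y => c (π ⟨j, y⟩) := funext fun j => funext fun y => (h j y).symm
  refine IsML.eq_of_spans (G := fun ω : ∀ j, Homog (htensor (P.obj (fun y => c (π ⟨j, y⟩)) (d j))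
      (fun y => W (c (π ⟨j, y⟩)))) => ev (t.act d e) θ
        (fun j => map (wordEval t γ (fun y => c (π ⟨j, y⟩)) (d j)) (ω j))) (ev_isML _ θ)
    (IsML.subst (ev_isML (t.act d e) θ) (fun j => j)
      (fun j ω => map (wordEval t γ (fun y => c (π ⟨j, y⟩)) (d j)) (ω j))
      (fun x i z j hj => by rw [Function.update_of_ne hj])
      (fun x i => by simp only [Function.update_self]; exact isLin_map _))
    (fun x => by simp only [deg_ev, deg_map]) (fun j => spans_hpure _ _) ?_ ω
  intro ω hω
  choose φ w hω using hω
  obtain rfl : ω = fun j => hpure (φ j) (w j) := funext hω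
  obtain ⟨x, rfl⟩ : ∃ x : ∀ i, Homog (W (c i)), w = fun j y => x (π ⟨j, y⟩) := by
    refine ⟨reindex π (A := fun i => Homog (W (c i))) (fun p => w p.1 p.2), ?_⟩
    funext j y
    rw [reindex_apply π (A := fun i => Homog (W (c i))) (fun p => w p.1 p.2) ⟨j, y⟩]
  simp only [map_wordEval]
  have h₁ := ev_actMap (P := P) (W := W) (d := d) (e := e) π (fun _ _ => rfl) θ φ x
  have h₂ := t.act_comp d c e π θ φ (fun i => map (γ (c i)) (x i))
  simp only [recolor_rfl] at h₁
  rw [ev_comp, h₁, map_sgn, map_wordEval, h₂, sgn_sgn]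
  simp only [deg_map]
  rw [Int.units_mul_self, sgn_one]

variable (hγ : ∀ d (v : Homog (V d)), map (γ d) (map (f d) v) = evNullary η t d v)
include hγ

theorem wordEval_slotVal (a : C) (b : Bool) (x : Homog (vert V W a b)) :
    map (wordEval t γ (slotColor a b) a) (slotVal P η a b x) =
      map (γ a) (map (vertTop f a b) x) := by
  cases b
  · refine (map_wordEval t γ (Fin.elim0 : Fin 0 → C) a (map (η a) x)
      (fun y => y.elim0)).trans ?_
    refine Eq.trans ?_ (hγ a x).symm
    unfold evNullary
    congr 1
    funext i
    exact i.elim0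
  · refine (map_wordEval t γ (fun _ : Fin 1 => a) a (P.unit a) (fun _ => x)).trans ?_
    exact t.act_unit a _

theorem wordEval_fillMap {n l : ℕ} (S : Fin n → Bool) (c : Fin n → C) (c' : Fin l → C) (d : C)
    (π : (Σ j, Fin (slotArity (S j))) ≃ Fin l) (h : ∀ j y, c' (π ⟨j, y⟩) = slotColor (c j) (S j) y) :
    cubeTop f (P.obj c d) c S ≫ wordEval t γ c d = fillMap P η S c c' d π h ≫ wordEval t γ c' d := by
  refine htensor_hom_ext fun θ x => ?_
  unfold ev
  rw [map_comp, map_cubeTop, map_wordEval, map_comp, map_fillMap]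
  refine Eq.trans ?_ (wordEval_actMap t γ c _ c' d π h θ _).symm
  congr 1
  funext j
  exact (wordEval_slotVal t γ hγ (c j) (S j) (x j)).symm

theorem exists_subEval (N : ℕ∞) (d : C) : ∃ g : sub P f η N d ⟶ Z d, ∀ (n : ℕ)
    (hn : (n : ℕ∞) ≤ N) (c : Fin n → C), cellIn P f η hn c d ≫ g = wordEval t γ c d :=
  exists_subDesc P f η (fun _ _ c => wordEval t γ c d)
    (fun r => wordEval_fillMap t γ hγ r.S r.c r.c' d r.π r.h)

omit hγ

variable (P f η) in
/-- The letters. -/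
def letterIn {N : ℕ∞} (hN : ((1 : ℕ) : ℕ∞) ≤ N) (d : C) : W d ⟶ sub P f η N d :=
  homOfLin (fun w => hpure (Y := fun _ : Fin 1 => W d) (P.unit d) (fun _ => w))
    (hpure_single_isLin _) (hpure_single_diff _ rfl (unit_diff P d)) ≫
    cellIn P f η hN (fun _ : Fin 1 => d) d

theorem map_letterIn {N : ℕ∞} (hN : ((1 : ℕ) : ℕ∞) ≤ N) (d : C) (w : Homog (W d)) :
    map (letterIn P f η hN d) w =
      map (cellIn P f η hN (fun _ : Fin 1 => d) d)
        (hpure (Y := fun _ : Fin 1 => W d) (P.unit d) (fun _ => w)) := by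
  rw [letterIn, map_comp, map_homOfLin]
  intro z
  rw [deg_hpure, Fin.sum_univ_one]
  exact zero_add _

theorem letterIn_eval {N : ℕ∞} (hN : ((1 : ℕ) : ℕ∞) ≤ N) (g : ∀ d, sub P f η N d ⟶ Z d)
    (hg : ∀ (d : C) (n : ℕ) (hn : (n : ℕ∞) ≤ N) (c : Fin n → C),
      cellIn P f η hn c d ≫ g d = wordEval t γ c d) (d : C) :
    letterIn P f η hN d ≫ g d = γ d := by
  refine Homog.hom_ext fun w => ?_
  rw [map_comp, map_letterIn, ← map_comp, hg, map_wordEval]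
  exact t.act_unit d _

/-- A word is the result of the action of an operation on letters. -/
theorem cellIn_eq_act {n : ℕ} (c : Fin n → C) (d : C) (θ : Homog (P.obj c d))
    (x : ∀ i, Homog (W (c i))) : map (cellIn P f η le_top c d) (hpure θ x) =
      ev ((subStr P f η).act c d) θ (fun i => map (letterIn P f η le_top (c i)) (x i)) := by
  simp only [map_letterIn]
  have h := subAct_cellIn P f η c d θ (fun i (_ : Fin 1) => c i)
    (fun i => hpure (Y := fun _ : Fin 1 => W (c i)) (P.unit (c i)) (fun _ => x i)) c
    (Equiv.sigmaUnique (Fin n) (fun _ => Fin 1)) (fun _ _ => rfl)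
  refine Eq.trans ?_ h.symm
  congr 1
  have h' := map_fillMap_true P η c d (Equiv.sigmaUnique (Fin n) (fun _ => Fin 1)) (fun _ _ => rfl)
    (hpure θ x)
  exact h'.symm.trans (map_fillMap P η (fun _ => true) c c d
    (Equiv.sigmaUnique (Fin n) (fun _ => Fin 1)) (fun _ _ => rfl) θ x)

theorem isAlgHom_subEval (g : ∀ d, sub P f η ⊤ d ⟶ Z d)
    (hg : ∀ (d : C) (n : ℕ) (hn : (n : ℕ∞) ≤ ⊤) (c : Fin n → C),
      cellIn P f η hn c d ≫ g d = wordEval t γ c d) : IsAlgHom (subStr P f η) t g := by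
  intro n c d θ x
  refine IsML.eq_of_spans (F := fun x => map (g d) (ev ((subStr P f η).act c d) θ x))
    (G := fun x => ev (t.act c d) θ (fun i => map (g (c i)) (x i)))
    ((isLin_map _).comp_ml (ev_isML _ θ))
    (IsML.subst (ev_isML (t.act c d) θ) (fun j => j)
      (fun j ω => map (g (c j)) (ω j))
      (fun x i z j hj => by rw [Function.update_of_ne hj])
      (fun x i => by simp only [Function.update_self]; exact isLin_map _))
    (fun x => by simp only [deg_ev, deg_map]) (fun i => sub_spans P f η ⊤ (c i)) ?_ x
  intro x hx
  choose r hr a ω hx using hx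
  obtain rfl : x = fun i => map (cellIn P f η le_top (a i) (c i)) (ω i) := funext hx
  obtain ⟨b, hb⟩ : ∃ b : Fin (∑ i, r i) → C, ∀ j y, b (finSigmaFinEquiv ⟨j, y⟩) = a j y :=
    ⟨fun i => a (finSigmaFinEquiv.symm i).1 (finSigmaFinEquiv.symm i).2, fun j y =>
      congrArg (fun p : Σ x, Fin (r x) => a p.1 p.2) (finSigmaFinEquiv.symm_apply_apply ⟨j, y⟩)⟩
  have h : ev ((subStr P f η).act c d) θ
      (fun i => map (cellIn P f η le_top (a i) (c i)) (ω i)) = _ :=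
    subAct_cellIn P f η c d θ a ω b finSigmaFinEquiv hb
  rw [h, ← map_comp, hg]
  refine (wordEval_actMap t γ c a b d finSigmaFinEquiv hb θ ω).trans ?_
  congr 1
  funext i
  rw [← map_comp, hg]

include hγ in
/-- The universal property of the algebra of words. -/
theorem existsUnique_subHom : ∃! g : ∀ d, sub P f η ⊤ d ⟶ Z d,
    IsAlgHom (subStr P f η) t g ∧ ∀ d, letterIn P f η le_top d ≫ g d = γ d := by
  choose g hg using fun d => exists_subEval (f := f) (η := η) t γ hγ ⊤ d
  refine ⟨g, ⟨isAlgHom_subEval t γ g hg, letterIn_eval t γ le_top g hg⟩, ?_⟩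
  rintro g' ⟨h₁, h₂⟩
  funext d
  refine sub_hom_ext P f η fun n hn c => htensor_hom_ext fun θ x => ?_
  unfold ev
  rw [hg, map_wordEval, map_comp]
  refine (congrArg (map (g' d)) (cellIn_eq_act c d θ x)).trans ?_
  rw [h₁]
  congr 1
  funext i
  rw [← map_comp, h₂]

/-- Nullary operations as words without letters. -/
theorem letterIn_V (d : C) (v : Homog (V d)) : map (letterIn P f η le_top d)
    (map (f d) v) = evNullary η (subStr P f η) d v := by
  rw [map_letterIn]
  have h₁ := cellIn_fill P f η (N := ⊤) le_top le_top (fun _ : Fin 1 => false) (fun _ => d)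
    (Fin.elim0 : Fin 0 → C) d emptySigma (fun _ y => y.elim0)
  have h₂ := congrArg (fun F => ev F (P.unit d) (fun _ => v)) h₁
  have h₃ : ev (cubeTop f (P.obj (fun _ : Fin 1 => d) d) (fun _ => d) (fun _ => false) ≫
      cellIn P f η le_top (fun _ : Fin 1 => d) d) (P.unit d) (fun _ => v) =
      map (cellIn P f η le_top (fun _ : Fin 1 => d) d)
        (hpure (Y := fun _ : Fin 1 => W d) (P.unit d) (fun _ => map (f d) v)) :=
    congrArg (map (cellIn P f η le_top (fun _ : Fin 1 => d) d))
      (map_cubeTop f _ (fun _ : Fin 1 => d) (fun _ => false) (P.unit d) (fun _ => v))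
  refine h₃.symm.trans (h₂.trans ?_)
  refine (congrArg (map (cellIn P f η le_top (Fin.elim0 : Fin 0 → C) d))
    (map_fillMap P η (fun _ : Fin 1 => false) (fun _ => d) Fin.elim0 d emptySigma
      (fun _ y => y.elim0) (P.unit d) (fun _ => v))).trans ?_
  have h₄ := actMap_unit P (W := W) (Fin.elim0 : Fin 0 → C) d emptySigma (fun _ y => y.elim0)
    (slotVal P η d false v)
  refine (congrArg (map (cellIn P f η le_top (Fin.elim0 : Fin 0 → C) d)) h₄).trans ?_
  refine (cellIn_eq_act (Fin.elim0 : Fin 0 → C) d (map (η d) v) (fun y => y.elim0)).trans ?_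
  unfold evNullary
  congr 1
  funext i
  exact i.elim0

end Universal

/-! ## Complexes of homomorphisms -/

section IHom

open CochainComplex.HomComplex

variable (X Y : Cx k)

/-- The complex of homomorphisms of all degrees. -/
def IHom : Cx k where
  X m := ModuleCat.of k (Cochain X Y m)
  d m m' := ModuleCat.ofHom (δ_hom k X Y m m')
  shape m m' h := by
    refine ModuleCat.hom_ext (LinearMap.ext fun z => ?_)
    exact δ_shape m m' h z
  d_comp_d' l m n _ _ := by
    refine ModuleCat.hom_ext (LinearMap.ext fun z => ?_)
    exact δ_δ l m n z

variable {X Y}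

/-- The value of a homomorphism. -/
def app (F : Homog (IHom X Y)) (z : Homog X) : Homog Y :=
  mk (F.deg + z.deg)
    ((Cochain.v (show Cochain X Y F.deg from F.val) z.deg (F.deg + z.deg) (add_comm _ _)) z.val)

@[simp] theorem deg_app (F : Homog (IHom X Y)) (z : Homog X) : (app F z).deg = F.deg + z.deg := rfl

theorem app_isLin (F : Homog (IHom X Y)) : IsLin (app F) :=
  isLin_of_linear F.deg (fun m =>
    (Cochain.v (show Cochain X Y F.deg from F.val) m (F.deg + m) (add_comm _ _)).hom)

theorem app_isLin_left (z : Homog X) : IsLin (fun F : Homog (IHom X Y) => app F z) := by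
  refine ⟨fun {F F₁ F₂} a => ?_, fun r F => rfl⟩
  obtain ⟨q, b, c, rfl, rfl, rfl⟩ := a.exists_mk
  exact hadd_mk _ _ _

theorem app_diff (F : Homog (IHom X Y)) (z : Homog X) (q : ℤ) : (app F z).diff.vat q =
    (app F.diff z).vat q + F.deg.negOnePow • (app F z.diff).vat q := by
  obtain ⟨m, F⟩ := F
  obtain ⟨p, a⟩ := z
  by_cases hq : q = m + p + 1
  · subst hq
    have h₁ : (app (mk m F).diff (mk p a)).vat (m + p + 1) =
        (Cochain.v (δ m (m + 1) F) p (m + p + 1) (by ring)) a := by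
      have : ∀ (q : ℤ) (h : p + (m + 1) = q) (h' : m + 1 + p = q),
          (app (mk m F).diff (mk p a)).vat q = (Cochain.v (δ m (m + 1) F) p q h) a := by
        intro q h h'
        subst h'
        exact vat_deg _
      exact this _ _ (by ring)
    have h₂ : (app (mk m F) (mk p a).diff).vat (m + p + 1) =
        (Cochain.v F (p + 1) (m + p + 1) (by ring)) (X.d p (p + 1) a) := by
      have : ∀ (q : ℤ) (h : p + 1 + m = q) (h' : m + (p + 1) = q),
          (app (mk m F) (mk p a).diff).vat q =
            (Cochain.v F (p + 1) q h) (X.d p (p + 1) a) := by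
        intro q h h'
        subst h'
        exact vat_deg _
      exact this _ _ (by ring)
    rw [h₁, h₂, δ_v m (m + 1) rfl F p (m + p + 1) (by ring) (m + p) (p + 1) (by ring) rfl]
    refine (vat_deg _).trans ?_
    change Y.d (m + p) (m + p + 1) ((Cochain.v F p (m + p) (add_comm _ _)) a) =
      (Y.d (m + p) (m + p + 1) ((Cochain.v F p (m + p) (add_comm _ _)) a) +
        (m + 1).negOnePow • (Cochain.v F (p + 1) (m + p + 1) (by ring)) (X.d p (p + 1) a)) + _
    rw [Int.negOnePow_succ, Units.smul_def, Units.val_neg, neg_smul, Units.smul_def]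
    abel
  · have e₁ : (app (mk m F) (mk p a)).diff.deg = m + p + 1 := rfl
    have e₂ : (app (mk m F).diff (mk p a)).deg = m + 1 + p := rfl
    have e₃ : (app (mk m F) (mk p a).diff).deg = m + (p + 1) := rfl
    rw [vat_of_ne _ (by omega), vat_of_ne _ (by omega), vat_of_ne _ (by omega), smul_zero, add_zero]

theorem ihom_ext {F F' : Homog (IHom X Y)} (hd : F.deg = F'.deg) {S : Set (Homog X)}
    (hS : Spans S) (h : ∀ z ∈ S, app F z = app F' z) : F = F' := by
  have key := (app_isLin F).eq_of_spans (app_isLin F') (fun z => by simp [hd]) hS h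
  obtain ⟨m, F⟩ := F
  obtain ⟨m', F'⟩ := F'
  obtain rfl : m = m' := hd
  refine Homog.ext rfl (heq_of_eq (Cochain.ext _ _ fun p q hpq => ?_))
  obtain rfl : q = m + p := by
    have : p + m = q := hpq
    omega
  refine ModuleCat.hom_ext (LinearMap.ext fun a => ?_)
  exact eq_of_heq (mk.inj (key (mk p a))).2

theorem exists_ihom {L : Homog X → Homog Y} (hL : IsLin L) {D : ℤ}
    (hD : ∀ z, (L z).deg = D + z.deg) : ∃ F : Homog (IHom X Y), F.deg = D ∧ ∀ z, app F z = L z := by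
  choose l hl using fun p => hL.exists_linear p (D + p)
  have key : ∀ p q : ℤ, p + D = q → ∃ f : X.X p ⟶ Y.X q, ∀ a, f a = (L (mk p a)).vat q := by
    intro p q h
    obtain rfl : D + p = q := by omega
    exact ⟨ModuleCat.ofHom (l p), hl p⟩
  choose f hf using key
  refine ⟨mk D (Cochain.mk f), rfl, fun z => ?_⟩
  rw [← mk_vat (L z) (hD z)]
  exact Homog.ext rfl (heq_of_eq (hf z.deg _ _ z.val))

variable {n : ℕ} {A : Fin n → Cx k} {Q : Cx k}

/-- The value of a homomorphism on a pure tensor. -/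
def tapp (F : Homog (IHom (tensor A) Y)) (x : ∀ i, Homog (A i)) : Homog Y := app F (tpure x)

theorem deg_tapp (F : Homog (IHom (tensor A) Y)) (x : ∀ i, Homog (A i)) :
    (tapp F x).deg = F.deg + ∑ i, (x i).deg := rfl

theorem tapp_isML (F : Homog (IHom (tensor A) Y)) : IsML (tapp F) :=
  (app_isLin F).comp_ml tpure_add

theorem tapp_isLin (x : ∀ i, Homog (A i)) :
    IsLin (fun F : Homog (IHom (tensor A) Y) => tapp F x) := app_isLin_left _

theorem tapp_ext {F F' : Homog (IHom (tensor A) Y)} (hd : F.deg = F'.deg)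
    (h : ∀ x, tapp F x = tapp F' x) : F = F' :=
  ihom_ext hd (spans_pure A) (by rintro _ ⟨x, rfl⟩; exact h x)

theorem exists_tapp {F : (∀ i, Homog (A i)) → Homog Y} (hF : IsML F) {D : ℤ}
    (hD : ∀ x, (F x).deg = D + ∑ i, (x i).deg) :
    ∃ G : Homog (IHom (tensor A) Y), G.deg = D ∧ ∀ x, tapp G x = F x := by
  obtain ⟨l, hl, hl', h⟩ := hF.exists_lin hD
  obtain ⟨G, hG, hG'⟩ := exists_ihom hl hl'
  exact ⟨G, hG, fun x => (hG' _).trans (h x)⟩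

theorem tapp_diff (F : Homog (IHom (tensor A) Y)) (x : ∀ i, Homog (A i)) (q : ℤ) :
    (tapp F x).diff.vat q = (tapp F.diff x).vat q + ∑ i, leftSign F.deg (fun i => (x i).deg) i •
      (tapp F (Function.update x i (x i).diff)).vat q := by
  unfold tapp
  rw [app_diff]
  congr 1
  obtain ⟨p, hp⟩ : ∃ p, p = (tpure x).deg + 1 := ⟨_, rfl⟩
  obtain ⟨f, hf⟩ := (app_isLin F).exists_linear p q
  have key : ∀ z : Homog (tensor A), z.deg = p → (app F z).vat q = f (z.vat p) := fun z hz => by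
    rw [hf, mk_vat z hz]
  rw [key _ hp.symm, tpure_diff, map_sum, Finset.smul_sum]
  refine Finset.sum_congr rfl fun i _ => ?_
  rw [Units.smul_def (preSign _ _), map_zsmul, ← key, ← Units.smul_def, smul_smul]
  · congr 1
    unfold leftSign preSign
    rw [← Int.negOnePow_add]
  · rw [hp]
    exact (tdeg_update x i _).trans (by rw [deg_diff]; change tdeg x - _ + _ = tdeg x + 1; ring)

/-- The map of complexes with values in homomorphisms, as a map out of a tensor product. -/
def uncurry (g : Q ⟶ IHom (tensor A) Y) : htensor Q A ⟶ Y :=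
  hdesc (fun θ x => tapp (map g θ) x) (fun x => (tapp_isLin x).comp (isLin_map g))
    (fun θ => tapp_isML _) (fun θ x => deg_tapp _ _) (fun θ x q => by
      rw [tapp_diff, map_diff]; rfl)

@[simp] theorem ev_uncurry (g : Q ⟶ IHom (tensor A) Y) (θ : Homog Q) (x : ∀ i, Homog (A i)) :
    ev (uncurry g) θ x = tapp (map g θ) x := ev_hdesc _ _ _ _ _ _ _

theorem exists_curry (G : htensor Q A ⟶ Y) :
    ∃ g : Q ⟶ IHom (tensor A) Y, ∀ θ x, tapp (map g θ) x = ev G θ x := by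
  choose g hg hg' using fun θ => exists_tapp (ev_isML G θ) (fun x => deg_ev G θ x)
  have hl : IsLin g := by
    refine ⟨fun {z z₁ z₂} a => ?_, fun r z => ?_⟩
    · have h₁ : (g z₁).deg = (g z).deg := by rw [hg, hg, a.deg₁]
      have h₂ : (g z₂).deg = (g z).deg := by rw [hg, hg, a.deg₂]
      have key := hadd_mk (g z).deg ((g z₁).vat (g z).deg) ((g z₂).vat (g z).deg)
      rw [mk_vat _ h₁, mk_vat _ h₂] at key
      suffices H : g z = mk (g z).deg ((g z₁).vat (g z).deg + (g z₂).vat (g z).deg) by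
        rw [H]; exact key
      refine tapp_ext rfl fun x => ?_
      refine HAdd3.unique (z₁ := tapp (g z₁) x) (z₂ := tapp (g z₂) x) ?_ ((tapp_isLin x).add key)
      rw [hg', hg', hg']
      exact (ev_isLin G x).add a
    · refine tapp_ext (by rw [hg, deg_hsmul, deg_hsmul, hg]) fun x => ?_
      rw [hg', (tapp_isLin x).smul, hg', (ev_isLin G x).smul]
  refine ⟨homOfLin g hl fun z => ?_, fun θ x => by rw [map_homOfLin _ _ _ hg, hg']⟩
  refine tapp_ext (by rw [hg, deg_diff, deg_diff, hg]) fun x => ext_vat ?_ ?_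
  · rw [deg_tapp, deg_tapp, hg, deg_diff, deg_diff, hg]
  · have h₁ := tapp_diff (g z) x (tapp (g z.diff) x).deg
    have h₂ := ev_diff G z x (tapp (g z.diff) x).deg
    simp only [hg', hg] at h₁ h₂ ⊢
    rw [h₂] at h₁
    exact add_right_cancel h₁

/-- The map of complexes with values in homomorphisms given by a map out of a tensor product. -/
def curry (G : htensor Q A ⟶ Y) : Q ⟶ IHom (tensor A) Y := (exists_curry G).choose

@[simp] theorem tapp_curry (G : htensor Q A ⟶ Y) (θ : Homog Q) (x : ∀ i, Homog (A i)) :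
    tapp (map (curry G) θ) x = ev G θ x := (exists_curry G).choose_spec θ x

end IHom

/-! ## The enveloping operad -/

section LiftML

variable {ι : Type*} [Fintype ι] [DecidableEq ι] {A : ι → Cx k}
  {Z : Cx k}

/-- A multilinear function is determined by, and can be constructed from, its images under a
jointly injective family of linear functions. -/
theorem exists_isML_of_inj {κ : Type*} {Y : κ → Cx k} (S : ∀ i, Homog Z → Homog (Y i))
    (hS : ∀ i, IsLin (S i))
    (hinj : ∀ z z', z.deg = z'.deg → (∀ i, S i z = S i z') → z = z')
    (T : ∀ i, (∀ j, Homog (A j)) → Homog (Y i)) (hT : ∀ i, IsML (T i))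
    (D : κ → ℤ) (hSd : ∀ i z, (S i z).deg = D i + z.deg)
    (hTd : ∀ i x, (T i x).deg = D i + ∑ j, (x j).deg)
    {G : ∀ j, Set (Homog (A j))} (hG : ∀ j, Spans (G j))
    (hgen : ∀ x, (∀ j, x j ∈ G j) → ∃ z : Homog Z, z.deg = ∑ j, (x j).deg ∧ ∀ i, S i z = T i x) :
    ∃ H : (∀ j, Homog (A j)) → Homog Z, IsML H ∧ (∀ x, (H x).deg = ∑ j, (x j).deg) ∧
      ∀ i x, S i (H x) = T i x := by
  have hsum : ∀ (x : ∀ j, Homog (A j)) (j : ι) (z z' : Homog (A j)), z.deg = z'.deg →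
      ∑ l, (Function.update x j z l).deg = ∑ l, (Function.update x j z' l).deg := by
    intro x j z z' h
    refine Finset.sum_congr rfl fun l _ => ?_
    rcases eq_or_ne l j with rfl | hl
    · simp [h]
    · simp [hl]
  have hadd : ∀ (x : ∀ j, Homog (A j)) (j : ι) {z z₁ z₂ : Homog (A j)}, HAdd3 z z₁ z₂ →
      ∀ {w₁ w₂ : Homog Z}, w₁.deg = ∑ l, (Function.update x j z l).deg →
        w₂.deg = ∑ l, (Function.update x j z l).deg →
        (∀ i, S i w₁ = T i (Function.update x j z₁)) →
        (∀ i, S i w₂ = T i (Function.update x j z₂)) →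
        ∃ w : Homog Z, HAdd3 w w₁ w₂ ∧ w.deg = ∑ l, (Function.update x j z l).deg ∧
          ∀ i, S i w = T i (Function.update x j z) := by
    intro x j z z₁ z₂ a w₁ w₂ d₁ d₂ e₁ e₂
    have key := hadd_mk _ (w₁.vat (∑ l, (Function.update x j z l).deg))
      (w₂.vat (∑ l, (Function.update x j z l).deg))
    rw [mk_vat _ d₁, mk_vat _ d₂] at key
    refine ⟨_, key, rfl, fun i => ?_⟩
    have h := (hS i).add key
    rw [e₁, e₂] at h
    exact h.unique ((hT i).add x j a)
  have hex : ∀ x, ∃ z : Homog Z, z.deg = ∑ j, (x j).deg ∧ ∀ i, S i z = T i x := by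
    suffices H : ∀ s : Finset ι, ∀ x : ∀ j, Homog (A j), (∀ j ∉ s, x j ∈ G j) →
        ∃ z : Homog Z, z.deg = ∑ j, (x j).deg ∧ ∀ i, S i z = T i x from
      fun x => H Finset.univ x (by simp)
    intro s
    induction s using Finset.induction_on with
    | empty => exact fun x hx => hgen x fun i => hx i (by simp)
    | insert j s _ ih =>
      intro x hx
      have key : ∀ z, ∃ w : Homog Z, w.deg = ∑ l, (Function.update x j z l).deg ∧
          ∀ i, S i w = T i (Function.update x j z) := by
        have hs : ∀ r z, (∃ w : Homog Z, w.deg = ∑ l, (Function.update x j z l).deg ∧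
          ∀ i, S i w = T i (Function.update x j z)) → ∃ w : Homog Z,
            w.deg = ∑ l, (Function.update x j (hsmul r z) l).deg ∧
              ∀ i, S i w = T i (Function.update x j (hsmul r z)) := by
          rintro r z ⟨w, hw, hw'⟩
          refine ⟨hsmul r w, ?_, fun i => ?_⟩
          · rw [deg_hsmul, hw]
            exact hsum x j z (hsmul r z) rfl
          · rw [(hS i).smul, (hT i).smul, hw']
        refine hG j _ ?_ ?_ ?_ hs
        · intro z hz
          refine ih _ fun l hl => ?_
          rcases eq_or_ne l j with rfl | hlj
          · simpa using hz
          · rw [Function.update_of_ne hlj]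
            exact hx l (by simp [hlj, hl])
        · intro m
          refine ⟨mk _ 0, rfl, fun i => ?_⟩
          rw [(hS i).zero, ((hT i).lin x j).zero, hSd, hTd]
          rfl
        · rintro z z₁ z₂ a ⟨w₁, d₁, e₁⟩ ⟨w₂, d₂, e₂⟩
          obtain ⟨w, -, hw, hw'⟩ := hadd x j a (d₁.trans (hsum _ _ _ _ a.deg₁))
            (d₂.trans (hsum _ _ _ _ a.deg₂)) e₁ e₂
          exact ⟨w, hw, hw'⟩
      simpa using key (x j)
  choose H hH hH' using hex
  refine ⟨H, ⟨fun x j z z₁ z₂ a => ?_, fun x j r z => ?_⟩, hH, fun i x => hH' x i⟩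
  · obtain ⟨w, h₁, h₂, h₃⟩ := hadd x j a ((hH _).trans (hsum _ _ _ _ a.deg₁))
      ((hH _).trans (hsum _ _ _ _ a.deg₂)) (hH' (Function.update x j z₁))
      (hH' (Function.update x j z₂))
    rwa [hinj (H (Function.update x j z)) w ((hH _).trans h₂.symm)
      (fun i => (hH' _ i).trans (h₃ i).symm)]
  · refine hinj _ _ ?_ fun i => ?_
    · rw [hH, deg_hsmul, hH]
      exact (hsum x j z (hsmul r z) rfl).symm
    · rw [hH', (hS i).smul, hH', (hT i).smul]

end LiftML

section Enveloping

section Comp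

variable {n l : ℕ} {m : Fin n → ℕ} (X : Coll k C)

theorem exists_endComp (d : Fin n → C) (b : ∀ j, Fin (m j) → C) (c : Fin l → C) (e : C)
    (π : (Σ j, Fin (m j)) ≃ Fin l) (h : ∀ j y, c (π ⟨j, y⟩) = b j y)
    (F : Homog (IHom (tensor (fun j => X (d j))) (X e)))
    (G : ∀ j, Homog (IHom (tensor (fun y => X (b j y))) (X (d j)))) :
    ∃ H : Homog (IHom (tensor (fun i => X (c i))) (X e)), H.deg = F.deg + ∑ j, (G j).deg ∧
      ∀ x, tapp H x = sgn (shuffleSign π (fun j => (G j).deg) (fun i => (x i).deg))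
        (tapp F (fun j => tapp (G j) (fun y => recolor X (h j y) (x (π ⟨j, y⟩))))) := by
  obtain rfl : b = fun j y => c (π ⟨j, y⟩) := funext fun j => funext fun y => (h j y).symm
  have hM : IsML (fun x : ∀ i, Homog (X (c i)) =>
      tapp F (fun j => tapp (G j) (fun y => x (π ⟨j, y⟩)))) :=
    isML_nested π (tapp_isML F) (fun j => tapp_isML (G j))
  refine exists_tapp (hM.sgn (fun r => shuffleSign π (fun j => (G j).deg) r)) fun x => ?_
  simp only [deg_sgn, deg_tapp]
  rw [Finset.sum_add_distrib, sum_sigma_equiv π (fun _ i => (x i).deg), add_assoc]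

/-- The composition of multilinear maps. -/
def endComp (d : Fin n → C) (b : ∀ j, Fin (m j) → C) (c : Fin l → C) (e : C)
    (π : (Σ j, Fin (m j)) ≃ Fin l) (h : ∀ j y, c (π ⟨j, y⟩) = b j y)
    (F : Homog (IHom (tensor (fun j => X (d j))) (X e)))
    (G : ∀ j, Homog (IHom (tensor (fun y => X (b j y))) (X (d j)))) :
    Homog (IHom (tensor (fun i => X (c i))) (X e)) :=
  (exists_endComp X d b c e π h F G).choose

end Comp

variable (O : ColoredOperad k C) (A : Alg O)

/-- An `O`-algebra with a morphism from `A`. -/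
structure AlgUnder where
  /-- The underlying collection. -/
  X : Coll k C
  /-- The algebra structure. -/
  s : AlgStr O X
  /-- The morphism from `A`. -/
  u : ∀ d, A.X d ⟶ X d
  hu : IsAlgHom A.str s u

/-- Formal operations on `O`-algebras under `A`. -/
inductive Pre : ∀ {n : ℕ}, (Fin n → C) → C → Type u
  | op {n : ℕ} (c : Fin n → C) (d : C) (θ : Homog (O.obj c d)) : Pre c d
  | elt (d : C) (a : Homog (A.X d)) : Pre (Fin.elim0 : Fin 0 → C) d
  | comp {n l : ℕ} {m : Fin n → ℕ} (d : Fin n → C) (b : ∀ j, Fin (m j) → C) (c : Fin l → C) (e : C)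
    (π : (Σ j, Fin (m j)) ≃ Fin l) (h : ∀ j y, c (π ⟨j, y⟩) = b j y) (t : Pre d e)
    (ts : ∀ j, Pre (b j) (d j)) : Pre c e
  | diff {n : ℕ} {c : Fin n → C} {d : C} (t : Pre c d) : Pre c d

variable {O A}

/-- The degree of a formal operation. -/
def Pre.deg : ∀ {n : ℕ} {c : Fin n → C} {d : C}, Pre O A c d → ℤ
  | _, _, _, .op _ _ θ => θ.deg
  | _, _, _, .elt _ a => a.deg
  | _, _, _, .comp _ _ _ _ _ _ t ts => t.deg + ∑ j, (ts j).deg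
  | _, _, _, .diff t => t.deg + 1

theorem exists_const (X : Fin 0 → Cx k) {Y : Cx k} (a : Homog Y) :
    ∃ F : Homog (IHom (tensor X) Y), F.deg = a.deg ∧ ∀ x, tapp F x = a :=
  exists_tapp (isML_of_lin fun _ i => i.elim0) (fun x => by simp)

/-- The value of a formal operation in an `O`-algebra under `A`. -/
def Pre.sem (U : AlgUnder O A) : ∀ {n : ℕ} {c : Fin n → C} {d : C}, Pre O A c d →
    Homog (IHom (tensor (fun i => U.X (c i))) (U.X d))
  | _, _, _, .op c d θ => Homog.map (curry (U.s.act c d)) θ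
  | _, _, _, .elt d a => (exists_const _ (Homog.map (U.u d) a)).choose
  | _, _, _, .comp d b c e π h t ts => endComp U.X d b c e π h (t.sem U) (fun j => (ts j).sem U)
  | _, _, _, .diff t => (t.sem U).diff

theorem Pre.deg_sem (U : AlgUnder O A) {n : ℕ} {c : Fin n → C} {d : C} (t : Pre O A c d) :
    (t.sem U).deg = t.deg := by
  induction t with
  | op c d θ => rfl
  | elt d a => exact (exists_const _ (Homog.map (U.u d) a)).choose_spec.1
  | comp d b c e π h t ts ih ihs =>
    refine (exists_endComp U.X d b c e π h (t.sem U) (fun j => (ts j).sem U)).choose_spec.1.trans ?_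
    rw [ih]
    simp only [ihs]
    rfl
  | diff t ih => exact congrArg (· + 1) ih

variable (O A)

/-- Formal operations of degree `m`. -/
abbrev PreDeg {n : ℕ} (c : Fin n → C) (d : C) (m : ℤ) : Type u := {t : Pre O A c d // t.deg = m}

/-- The value of a linear combination of formal operations. -/
def semLin (U : AlgUnder O A) {n : ℕ} (c : Fin n → C) (d : C) (m : ℤ) :
    (PreDeg O A c d m →₀ k) →ₗ[k] (IHom (tensor (fun i => U.X (c i))) (U.X d)).X m :=
  Finsupp.linearCombination k (fun t => (t.1.sem U).vat m)

/-- The linear combinations of formal operations which are zero in all algebras. -/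
def semKer {n : ℕ} (c : Fin n → C) (d : C) (m : ℤ) : Submodule k (PreDeg O A c d m →₀ k) :=
  ⨅ U, LinearMap.ker (semLin O A U c d m)

/-- The differential of a formal operation. -/
def preDiff {n : ℕ} (c : Fin n → C) (d : C) {m m' : ℤ} (h : m + 1 = m') (t : PreDeg O A c d m) :
    PreDeg O A c d m' := ⟨t.1.diff, (congrArg (· + 1) t.2).trans h⟩

/-- The differential of a linear combination of formal operations. -/
def linDiff {n : ℕ} (c : Fin n → C) (d : C) (m m' : ℤ) :
    (PreDeg O A c d m →₀ k) →ₗ[k] (PreDeg O A c d m' →₀ k) :=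
  if h : m + 1 = m' then Finsupp.lmapDomain k k (preDiff O A c d h) else 0

theorem semLin_linDiff (U : AlgUnder O A) {n : ℕ} (c : Fin n → C) (d : C) (m m' : ℤ)
    (z : PreDeg O A c d m →₀ k) : semLin O A U c d m' (linDiff O A c d m m' z) =
      (IHom (tensor (fun i => U.X (c i))) (U.X d)).d m m' (semLin O A U c d m z) := by
  by_cases h : m + 1 = m'
  · suffices H : semLin O A U c d m' ∘ₗ linDiff O A c d m m' =
        ((IHom (tensor (fun i => U.X (c i))) (U.X d)).d m m').hom ∘ₗ semLin O A U c d m from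
      LinearMap.congr_fun H z
    refine Finsupp.lhom_ext' fun t => LinearMap.ext_ring ?_
    simp only [linDiff, dif_pos h, LinearMap.comp_apply, semLin, Finsupp.lsingle_apply,
      Finsupp.lmapDomain_apply, Finsupp.mapDomain_single, Finsupp.linearCombination_single, one_smul]
    exact vat_diff _ h
  · rw [linDiff, dif_neg h, (IHom _ _).shape m m' h]
    exact map_zero _

/-- The complex of operations on `O`-algebras under `A`. -/
def env {n : ℕ} (c : Fin n → C) (d : C) : Cx k where
  X m := ModuleCat.of k ((PreDeg O A c d m →₀ k) ⧸ semKer O A c d m)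
  d m m' := ModuleCat.ofHom ((semKer O A c d m).mapQ (semKer O A c d m') (linDiff O A c d m m') (by
    intro z hz
    simp only [semKer, Submodule.mem_iInf, Submodule.mem_comap, LinearMap.mem_ker] at hz ⊢
    intro U
    rw [semLin_linDiff, hz, map_zero]))
  shape m m' h := by
    refine ModuleCat.hom_ext (Submodule.linearMap_qext _ (LinearMap.ext fun z => ?_))
    change Submodule.Quotient.mk (linDiff O A c d m m' z) = 0
    rw [linDiff, dif_neg (show ¬ m + 1 = m' from h)]
    rfl
  d_comp_d' l m m' _ _ := by
    refine ModuleCat.hom_ext (Submodule.linearMap_qext _ (LinearMap.ext fun z => ?_))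
    refine (Submodule.Quotient.mk_eq_zero _).2 ?_
    simp only [semKer, Submodule.mem_iInf, LinearMap.mem_ker]
    intro U
    rw [semLin_linDiff, semLin_linDiff, ← ModuleCat.comp_apply, HomologicalComplex.d_comp_d]
    rfl

/-- The value of an operation in an `O`-algebra under `A`. -/
def envSem (U : AlgUnder O A) {n : ℕ} (c : Fin n → C) (d : C) :
    env O A c d ⟶ IHom (tensor (fun i => U.X (c i))) (U.X d) where
  f m := ModuleCat.ofHom ((semKer O A c d m).liftQ (semLin O A U c d m) (iInf_le _ U))
  comm' m m' _ := by
    refine ModuleCat.hom_ext (Submodule.linearMap_qext _ (LinearMap.ext fun z => ?_))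
    exact (semLin_linDiff O A U c d m m' z).symm

variable {O A}

/-- The class of a formal operation. -/
def Pre.gen {n : ℕ} {c : Fin n → C} {d : C} (t : Pre O A c d) : Homog (env O A c d) :=
  Homog.mk t.deg (Submodule.Quotient.mk (Finsupp.single ⟨t, rfl⟩ 1))

theorem Pre.map_gen (U : AlgUnder O A) {n : ℕ} {c : Fin n → C} {d : C} (t : Pre O A c d) :
    Homog.map (envSem O A U c d) t.gen = t.sem U := by
  rw [← mk_vat (t.sem U) (t.deg_sem U)]
  refine Homog.ext rfl (heq_of_eq ?_)
  exact (Finsupp.linearCombination_single k _ _).trans (one_smul _ _)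

theorem env_val_ext {n : ℕ} {c : Fin n → C} {d : C} {m : ℤ} {z z' : (env O A c d).X m}
    (h : ∀ U, (envSem O A U c d).f m z = (envSem O A U c d).f m z') : z = z' := by
  rw [← sub_eq_zero]
  have h' : ∀ U, (envSem O A U c d).f m (z - z') = 0 := fun U => by rw [map_sub, h, sub_self]
  generalize z - z' = w at h'
  obtain ⟨w, rfl⟩ := Submodule.Quotient.mk_surjective _ w
  refine (Submodule.Quotient.mk_eq_zero _).2 ?_
  simp only [semKer, Submodule.mem_iInf, LinearMap.mem_ker]
  exact h'

theorem env_spans {n : ℕ} (c : Fin n → C) (d : C) :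
    Spans (Set.range (Pre.gen : Pre O A c d → Homog (env O A c d))) := by
  refine spans_of_span fun m => ?_
  rw [eq_top_iff]
  rintro a -
  obtain ⟨a, rfl⟩ := Submodule.Quotient.mk_surjective _ a
  induction a using Finsupp.induction_linear with
  | zero => exact Submodule.zero_mem _
  | add a b ha hb => exact Submodule.add_mem _ ha hb
  | single t r =>
    have : (Submodule.Quotient.mk (Finsupp.single t r) : (env O A c d).X m) =
        r • (Submodule.Quotient.mk (Finsupp.single t 1) : (env O A c d).X m) := by
      refine Eq.trans ?_ (Submodule.Quotient.mk_smul (semKer O A c d m) r (Finsupp.single t 1))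
      rw [Finsupp.smul_single, smul_eq_mul, mul_one]
    rw [this]
    refine Submodule.smul_mem _ _ (Submodule.subset_span ⟨t.1, ?_⟩)
    obtain ⟨t, rfl⟩ := t
    rfl

variable (O A) in
/-- The action of the operations on an `O`-algebra under `A`. -/
def envAct (U : AlgUnder O A) {n : ℕ} (c : Fin n → C) (d : C) :
    htensor (env O A c d) (fun i => U.X (c i)) ⟶ U.X d := uncurry (envSem O A U c d)

theorem envAct_op (U : AlgUnder O A) {n : ℕ} (c : Fin n → C) (d : C) (θ : Homog (O.obj c d))
    (x : ∀ i, Homog (U.X (c i))) :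
    ev (envAct O A U c d) (Pre.op c d θ).gen x = ev (U.s.act c d) θ x := by
  rw [envAct, ev_uncurry, Pre.map_gen]
  exact tapp_curry _ _ _

theorem envAct_elt (U : AlgUnder O A) (d : C) (a : Homog (A.X d)) (x) :
    ev (envAct O A U Fin.elim0 d) (Pre.elt d a).gen x = map (U.u d) a := by
  rw [envAct, ev_uncurry, Pre.map_gen]
  exact (exists_const _ (map (U.u d) a)).choose_spec.2 x

theorem envAct_comp (U : AlgUnder O A) {n l : ℕ} {m : Fin n → ℕ} (d : Fin n → C)
    (b : ∀ j, Fin (m j) → C) (c : Fin l → C) (e : C) (π : (Σ j, Fin (m j)) ≃ Fin l)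
    (h : ∀ j y, c (π ⟨j, y⟩) = b j y) (t : Pre O A d e) (ts : ∀ j, Pre O A (b j) (d j)) (x) :
    ev (envAct O A U c e) (Pre.comp d b c e π h t ts).gen x =
      sgn (shuffleSign π (fun j => (ts j).gen.deg) (fun i => (x i).deg))
        (ev (envAct O A U d e) t.gen (fun j => ev (envAct O A U (b j) (d j)) (ts j).gen
          (fun y => recolor U.X (h j y) (x (π ⟨j, y⟩))))) := by
  simp only [envAct, ev_uncurry, Pre.map_gen]
  refine ((exists_endComp U.X d b c e π h (t.sem U)
    (fun j => (ts j).sem U)).choose_spec.2 x).trans ?_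
  simp only [Pre.deg_sem]
  rfl

theorem Pre.gen_diff {n : ℕ} {c : Fin n → C} {d : C} (t : Pre O A c d) :
    t.diff.gen = t.gen.diff := by
  refine ext_vat rfl (env_val_ext fun U => ?_)
  rw [← vat_map, ← vat_map, map_diff, map_gen, map_gen]
  rfl

theorem env_ext {n : ℕ} {c : Fin n → C} {d : C} {z z' : Homog (env O A c d)} (hd : z.deg = z'.deg)
    (h : ∀ U x, ev (envAct O A U c d) z x = ev (envAct O A U c d) z' x) : z = z' := by
  refine ext_vat hd (env_val_ext fun U => ?_)
  rw [← vat_map, ← vat_map, tapp_ext (F := map (envSem O A U c d) z)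
    (F' := map (envSem O A U c d) z') hd fun x => ?_]
  have := h U x
  rwa [envAct, ev_uncurry, ev_uncurry] at this

end Enveloping

section Nested

variable {n l : ℕ} {m : Fin n → ℕ} (π : (Σ j, Fin (m j)) ≃ Fin l)
  {Q Z' : Cx k} {X : Fin l → Cx k} {R Z : Fin n → Cx k} (F : htensor Q Z ⟶ Z')
  (G : ∀ j, htensor (R j) (fun y => X (π ⟨j, y⟩)) ⟶ Z j)

/-- The value of a composite of multilinear maps. -/
def nested (θ : Homog Q) (φ : ∀ j, Homog (R j)) (x : ∀ i, Homog (X i)) : Homog Z' :=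
  sgn (shuffleSign π (fun j => (φ j).deg) (fun i => (x i).deg))
    (ev F θ (fun j => ev (G j) (φ j) (fun y => x (π ⟨j, y⟩))))

theorem nested_isLin (φ : ∀ j, Homog (R j)) (x : ∀ i, Homog (X i)) :
    IsLin (fun θ => nested π F G θ φ x) := (isLin_sgn _).comp (ev_isLin F _)

theorem nested_isML (θ : Homog Q) (x : ∀ i, Homog (X i)) :
    IsML (fun φ => nested π F G θ φ x) := by
  have : IsML (fun φ : ∀ j, Homog (R j) =>
      ev F θ (fun j => ev (G j) (φ j) (fun y => x (π ⟨j, y⟩)))) :=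
    IsML.subst (ev_isML F θ) (fun j => j) (fun j φ => ev (G j) (φ j) (fun y => x (π ⟨j, y⟩)))
      (fun x i z j hj => by rw [Function.update_of_ne hj])
      (fun x i => by simp only [Function.update_self]; exact ev_isLin _ _)
  exact this.sgn (fun p => shuffleSign π p (fun i => (x i).deg))

theorem deg_nested (θ : Homog Q) (φ : ∀ j, Homog (R j)) (x : ∀ i, Homog (X i)) :
    (nested π F G θ φ x).deg = θ.deg + ∑ j, (φ j).deg + ∑ i, (x i).deg := by
  unfold nested
  rw [deg_sgn, deg_ev]
  simp only [deg_ev]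
  rw [Finset.sum_add_distrib, sum_sigma_equiv π (fun _ i => (x i).deg), add_assoc]

theorem IsLin.vat_ev_diff {Q X Z : Cx k} {n : ℕ} {Y : Fin n → Cx k} {L : Homog X → Homog Z}
    (hL : IsLin L) (f : htensor Q Y ⟶ X) (θ : Homog Q) (y : ∀ i, Homog (Y i)) (q : ℤ) :
    (L (ev f θ y).diff).vat q = (L (ev f θ.diff y)).vat q +
      ∑ i, leftSign θ.deg (fun i => (y i).deg) i •
        (L (ev f θ (Function.update y i (y i).diff))).vat q := by
  have := (hL.comp (isLin_map f)).vat_hpure_diff θ y q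
  rwa [map_diff] at this

theorem units_swap {a b c d : ℤˣ} (h : a * b = c * d) : a * d = b * c := by
  revert a b c d
  decide

theorem nested_diff (θ : Homog Q) (φ : ∀ j, Homog (R j)) (x : ∀ i, Homog (X i)) (q : ℤ) :
    (nested π F G θ φ x).diff.vat q = (nested π F G θ.diff φ x).vat q +
      ∑ j, leftSign θ.deg (fun j => (φ j).deg) j •
        (nested π F G θ (Function.update φ j (φ j).diff) x).vat q +
      ∑ i, leftSign (θ.deg + ∑ j, (φ j).deg) (fun i => (x i).deg) i •
        (nested π F G θ φ (Function.update x i (x i).diff)).vat q := by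
  have hφ : ∀ (j : Fin n) (z : Homog (R j)), (fun j' =>
      ev (G j') (Function.update φ j z j') (fun y => x (π ⟨j', y⟩))) =
      Function.update (fun j' => ev (G j') (φ j') (fun y => x (π ⟨j', y⟩))) j
        (ev (G j) z (fun y => x (π ⟨j, y⟩))) := by
    intro j z
    funext j'
    rcases eq_or_ne j' j with rfl | hj
    · simp
    · simp [hj]
  have hx : ∀ (j : Fin n) (y : Fin (m j)) (z : Homog (X (π ⟨j, y⟩))), (fun j' =>
      ev (G j') (φ j') (fun y' => Function.update x (π ⟨j, y⟩) z (π ⟨j', y'⟩))) =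
      Function.update (fun j' => ev (G j') (φ j') (fun y => x (π ⟨j', y⟩))) j
        (ev (G j) (φ j) (Function.update (fun y' => x (π ⟨j, y'⟩)) y z)) := by
    intro j y z
    funext j'
    rcases eq_or_ne j' j with rfl | hj
    · rw [Function.update_self]
      congr 1
      funext y'
      rcases eq_or_ne y' y with rfl | hy
      · simp
      · rw [Function.update_of_ne (fun e => hy (by simpa using e)), Function.update_of_ne hy]
    · rw [Function.update_of_ne hj]
      congr 1
      funext y'
      rw [Function.update_of_ne (fun e => hj (congrArg Sigma.fst (π.injective e)))]
  unfold nested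
  simp only [deg_update, deg_diff, hφ]
  rw [sgn_diff, vat_sgn, vat_sgn, ev_diff]
  set s := shuffleSign π (fun j => (φ j).deg) (fun i => (x i).deg) with hs
  rw [smul_add, add_assoc]
  congr 1
  rw [← π.sum_comp, Fintype.sum_sigma, ← Finset.sum_add_distrib, Finset.smul_sum]
  refine Finset.sum_congr rfl fun j _ => ?_
  rw [((ev_isML F θ).lin (fun j' => ev (G j') (φ j') (fun y => x (π ⟨j', y⟩))) j).vat_ev_diff,
    smul_add, smul_add, Finset.smul_sum, Finset.smul_sum]
  simp only [vat_sgn, smul_smul, deg_ev, hx]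
  refine congrArg₂ (· + ·) ?_ (Finset.sum_congr rfl fun y _ => ?_)
  · exact congrArg (· • _) (units_swap (leibniz_op π _ _ _ _))
  · exact congrArg (· • _) (units_swap (leibniz_word π _ _ _ _ _))

end Nested

section Enveloping

variable {O : ColoredOperad k C} {A : Alg O}

theorem env_vat_ext {n : ℕ} {c : Fin n → C} {d : C} {q : ℤ} {a b : (env O A c d).X q}
    (h : ∀ U x p, (ev (envAct O A U c d) (mk q a) x).vat p =
      (ev (envAct O A U c d) (mk q b) x).vat p) : a = b :=
  eq_of_heq (mk.inj (env_ext (z := mk q a) (z' := mk q b) rfl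
    fun U x => ext_vat (by rw [deg_ev, deg_ev]) (h U x _))).2

theorem exists_envComp {n l : ℕ} {m : Fin n → ℕ} (d : Fin n → C) (b : ∀ j, Fin (m j) → C)
    (c : Fin l → C) (e : C) (π : (Σ j, Fin (m j)) ≃ Fin l) (h : ∀ j y, c (π ⟨j, y⟩) = b j y) :
    ∃ M : htensor (env O A d e) (fun j => env O A (b j) (d j)) ⟶ env O A c e,
      ∀ θ φ U x, ev (envAct O A U c e) (ev M θ φ) x =
        sgn (shuffleSign π (fun j => (φ j).deg) (fun i => (x i).deg))
          (ev (envAct O A U d e) θ (fun j => ev (envAct O A U (b j) (d j)) (φ j)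
            (fun y => recolor U.X (h j y) (x (π ⟨j, y⟩))))) := by
  obtain rfl : b = fun j y => c (π ⟨j, y⟩) := funext fun j => funext fun y => (h j y).symm
  let N (U : AlgUnder O A) := nested π (X := fun i => U.X (c i)) (envAct O A U d e)
    (fun j => envAct O A U (fun y => c (π ⟨j, y⟩)) (d j))
  obtain ⟨H, hH, hdeg, hval⟩ := exists_isML_of_inj (ι := Fin (n + 1))
    (A := hfam (env O A d e) (fun j => env O A (fun y => c (π ⟨j, y⟩)) (d j)))
    (Z := env O A c e) (κ := Σ U : AlgUnder O A, ∀ i, Homog (U.X (c i)))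
    (Y := fun i => i.1.X e) (fun i z => ev (envAct O A i.1 c e) z i.2)
    (fun i => ev_isLin _ _) (fun z z' hd h => env_ext hd fun U x => h ⟨U, x⟩)
    (fun i ω => N i.1 (ω 0) (fun j => ω j.succ) i.2)
    (fun i => isML_hfam (F := fun θ φ => N i.1 θ φ i.2) (fun φ => nested_isLin _ _ _ φ i.2)
      (fun θ => nested_isML _ _ _ θ i.2)) (fun i => ∑ j, (i.2 j).deg)
    (fun i z => by rw [deg_ev, add_comm])
    (fun i ω => by
      obtain ⟨θ, φ, rfl⟩ := exists_hargs ω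
      refine (deg_nested π (X := fun j => i.1.X (c j)) _ _ θ φ i.2).trans ?_
      rw [add_comm]
      exact congrArg _ (tdeg_hargs θ φ).symm)
    (G := fun i => Fin.cases (motive := fun i => Set (Homog (hfam (env O A d e)
      (fun j => env O A (fun y => c (π ⟨j, y⟩)) (d j)) i))) (Set.range Pre.gen)
      (fun j => Set.range Pre.gen) i)
    (fun i => by
      refine Fin.cases ?_ (fun j => ?_) i
      · exact env_spans d e
      · exact env_spans (fun y => c (π ⟨j, y⟩)) (d j))
    (fun ω hω => by
      obtain ⟨t, ht⟩ := hω 0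
      choose ts hts using fun j : Fin n => hω j.succ
      refine ⟨(Pre.comp d _ c e π h t ts).gen, ?_, fun i => ?_⟩
      · rw [Fin.sum_univ_succ, ← ht]
        simp only [← hts]
        rfl
      · dsimp only [N]
        rw [envAct_comp]
        unfold nested
        rw [← ht]
        simp only [← hts, recolor_rfl])
  have hH' : ∀ θ φ U x, ev (envAct O A U c e) (H (hargs θ φ)) x = N U θ φ x :=
    fun θ φ U x => hval ⟨U, x⟩ (hargs θ φ)
  have hd' : ∀ θ φ, (H (hargs θ φ)).deg = θ.deg + ∑ j, (φ j).deg := fun θ φ =>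
    (hdeg _).trans (tdeg_hargs θ φ)
  refine ⟨hdesc (fun θ φ => H (hargs θ φ)) (fun φ => ?_) (fun θ => ?_) hd' (fun θ φ q => ?_),
    fun θ φ U x => ?_⟩
  · have := hH.lin (hargs (mk 0 0) φ) 0
    exact (funext fun z => by rw [hargs_update_zero (mk 0 0) z φ] :
      (fun z => H (hargs z φ)) = fun z : Homog (env O A d e) =>
        H (Function.update (hargs (mk 0 0) φ) 0 z)) ▸ this
  · refine isML_of_lin fun φ i => ?_
    have := hH.lin (hargs θ φ) i.succ
    exact (funext fun z => by rw [hargs_update θ φ i z] :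
      (fun z => H (hargs θ (Function.update φ i z))) =
        fun z : Homog (env O A (fun y => c (π ⟨i, y⟩)) (d i)) =>
        H (Function.update (hargs θ φ) i.succ z)) ▸ this
  · by_cases hq : θ.deg + ∑ j, (φ j).deg + 1 = q
    · refine env_vat_ext fun U x p => ?_
      obtain ⟨L, hL⟩ := (ev_isLin (envAct O A U c e) x).exists_linear q p
      have key : ∀ z : Homog (env O A c e), z.deg = q →
          L (z.vat q) = (ev (envAct O A U c e) z x).vat p := fun z hz => by rw [hL, mk_vat z hz]
      rw [← hL, ← hL, map_add, map_sum, key _ (by rw [deg_diff, hd', hq]),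
        key _ (by rw [hd', deg_diff, ← hq]; ring)]
      have h₁ := ev_diff (envAct O A U c e) (H (hargs θ φ)) x p
      rw [hH', nested_diff, hd'] at h₁
      simp only [hH'] at h₁ ⊢
      rw [← add_right_cancel h₁]
      refine congrArg _ (Finset.sum_congr rfl fun j _ => ?_)
      rw [Units.smul_def, Units.smul_def, map_zsmul, key, hH']
      rw [hd']
      have := tdeg_update φ j (φ j).diff
      unfold tdeg at this
      rw [this, deg_diff, ← hq]
      ring
    · rw [vat_of_ne _ (by rw [deg_diff, hd']; exact hq), vat_of_ne _ (by
        rw [hd', deg_diff]; intro h'; exact hq (by rw [← h']; ring)), zero_add]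
      refine (Finset.sum_eq_zero fun j _ => ?_).symm
      rw [vat_of_ne, smul_zero]
      rw [hd']
      have := tdeg_update φ j (φ j).diff
      unfold tdeg at this
      rw [this, deg_diff]
      intro h'
      exact hq (by rw [← h']; ring)
  · rw [ev_hdesc, hH']
    rfl

/-- The composition of operations on `O`-algebras under `A`. -/
def envComp {n l : ℕ} {m : Fin n → ℕ} (d : Fin n → C) (b : ∀ j, Fin (m j) → C)
    (c : Fin l → C) (e : C) (π : (Σ j, Fin (m j)) ≃ Fin l) (h : ∀ j y, c (π ⟨j, y⟩) = b j y) :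
    htensor (env O A d e) (fun j => env O A (b j) (d j)) ⟶ env O A c e :=
  (exists_envComp d b c e π h).choose

theorem ev_envComp {n l : ℕ} {m : Fin n → ℕ} (d : Fin n → C) (b : ∀ j, Fin (m j) → C)
    (c : Fin l → C) (e : C) (π : (Σ j, Fin (m j)) ≃ Fin l) (h : ∀ j y, c (π ⟨j, y⟩) = b j y)
    (θ : Homog (env O A d e)) (φ : ∀ j, Homog (env O A (b j) (d j))) (U : AlgUnder O A)
    (x : ∀ i, Homog (U.X (c i))) : ev (envAct O A U c e) (ev (envComp d b c e π h) θ φ) x =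
      sgn (shuffleSign π (fun j => (φ j).deg) (fun i => (x i).deg))
        (ev (envAct O A U d e) θ (fun j => ev (envAct O A U (b j) (d j)) (φ j)
          (fun y => recolor U.X (h j y) (x (π ⟨j, y⟩))))) :=
  (exists_envComp d b c e π h).choose_spec θ φ U x

end Enveloping

section Aux

theorem ev_diff_congr {Q Q' Z : Cx k} {n : ℕ} {Y : Fin n → Cx k} {f : htensor Q Y ⟶ Z}
    {g : htensor Q' Y ⟶ Z} {θ : Homog Q} {θ' : Homog Q'} (hd : θ.deg = θ'.deg)
    (h : ∀ x, ev f θ x = ev g θ' x) (x : ∀ i, Homog (Y i)) :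
    ev f θ.diff x = ev g θ'.diff x := by
  refine ext_vat (by rw [deg_ev, deg_ev, deg_diff, deg_diff, hd]) ?_
  have h₁ := ev_diff f θ x (ev f θ.diff x).deg
  have h₂ := ev_diff g θ' x (ev f θ.diff x).deg
  rw [← h, h₁] at h₂
  simp only [h, hd] at h₂
  exact add_right_cancel h₂

theorem shuffleSign_single {n : ℕ} (π : (Σ _ : Fin 1, Fin n) ≃ Fin n) (hπ : ∀ j y, π ⟨j, y⟩ = y)
    (p : Fin 1 → ℤ) (r : Fin n → ℤ) : shuffleSign π p r = 1 := by
  rw [shuffleSign_eq, ← sg_zero]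
  congr 1
  unfold shE
  have e₁ : ∀ i, (((π.symm i).2 : Fin n) : ℕ) = i := fun i => by
    have := hπ (π.symm i).1 (π.symm i).2
    rw [← this]
    simp
  have e₂ : ∀ i (j : Fin 1), ¬ ((π.symm i).1 < j) := fun i j => by omega
  have e₃ : ∀ i i' : Fin n, ¬ (i < i' ∧ Before π i' i) := by
    rintro i i' ⟨h, h' | h'⟩
    · exact e₂ _ _ h'
    · have := h'.2
      rw [e₁, e₁] at this
      omega
  simp [ind, e₂, e₃]

theorem shuffleSign_empty {n : ℕ} {m : Fin n → ℕ} (π : (Σ j, Fin (m j)) ≃ Fin 0) (p : Fin n → ℤ)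
    (r : Fin 0 → ℤ) : shuffleSign π p r = 1 := by
  simp [shuffleSign]

end Aux

theorem ev_restrict {O P : ColoredOperad k C} (φ : OperadHom O P) {X : Coll k C} (s : AlgStr P X)
    {n : ℕ} (c : Fin n → C) (d : C) (θ : Homog (O.obj c d)) (x : ∀ i, Homog (X (c i))) :
    ev ((s.restrict φ).act c d) θ x = ev (s.act c d) (map (φ.app c d) θ) x := by
  simp only [AlgStr.restrict, ev, Homog.map_comp, map_hmap, Homog.map_id]

variable (O : ColoredOperad k C) (A : Alg O)

variable {O A} in
theorem isLin_env {X : Cx k} {n : ℕ} {c : Fin n → C} {d : C} {L : Homog X → Homog (env O A c d)}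
    (hdeg : ∀ z, (L z).deg = z.deg)
    (h : ∀ U x, IsLin (fun z => ev (envAct O A U c d) (L z) x)) : IsLin L := by
  refine ⟨fun {z z₁ z₂} a => ?_, fun r z => ?_⟩
  · have key := hadd_mk z.deg ((L z₁).vat z.deg) ((L z₂).vat z.deg)
    rw [mk_vat _ ((hdeg z₁).trans a.deg₁), mk_vat _ ((hdeg z₂).trans a.deg₂)] at key
    rwa [env_ext (z := L z) (z' := mk z.deg ((L z₁).vat z.deg + (L z₂).vat z.deg))
      (hdeg z) fun U x => ((h U x).add a).unique ((ev_isLin _ x).add key)]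
  · refine env_ext (by rw [hdeg, deg_hsmul, deg_hsmul, hdeg]) fun U x => ?_
    rw [(h U x).smul, (ev_isLin _ x).smul]

theorem gen_op_diff {n : ℕ} (c : Fin n → C) (d : C) (θ : Homog (O.obj c d)) :
    (Pre.op (A := A) c d θ.diff).gen = (Pre.op c d θ).gen.diff := by
  refine env_ext rfl fun U x => ?_
  rw [envAct_op]
  exact ev_diff_congr (f := U.s.act c d) (θ := θ) (g := envAct O A U c d)
    (θ' := (Pre.op c d θ).gen) rfl (fun y => (envAct_op U c d θ y).symm) x

/-- The operations of `O`, as operations on `O`-algebras under `A`. -/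
def envOp {n : ℕ} (c : Fin n → C) (d : C) : O.obj c d ⟶ env O A c d :=
  homOfLin (fun θ => (Pre.op c d θ).gen)
    (isLin_env (fun _ => rfl) fun U x => by simpa only [envAct_op] using ev_isLin _ x)
    (gen_op_diff O A c d)

theorem map_envOp {n : ℕ} (c : Fin n → C) (d : C) (θ : Homog (O.obj c d)) :
    map (envOp O A c d) θ = (Pre.op c d θ).gen :=
  map_homOfLin (fun θ => (Pre.op c d θ).gen) _ _ (fun _ => rfl) θ

variable {O A} in
theorem ev_envOp (U : AlgUnder O A) {n : ℕ} (c : Fin n → C) (d : C) (θ : Homog (O.obj c d))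
    (x : ∀ i, Homog (U.X (c i))) :
    ev (envAct O A U c d) (map (envOp O A c d) θ) x = ev (U.s.act c d) θ x := by
  rw [map_envOp, envAct_op]

theorem gen_elt_diff (d : C) (a : Homog (A.X d)) :
    (Pre.elt d a.diff).gen = (Pre.elt d a).gen.diff := by
  refine env_ext rfl fun U x => ?_
  rw [envAct_elt, map_diff]
  have h : (ev (envAct O A U Fin.elim0 d) (Pre.elt d a).gen.diff x) =
      (ev (envAct O A U Fin.elim0 d) (Pre.elt d a).gen x).diff := by
    refine ext_vat ?_ ?_
    · rw [deg_diff, deg_ev, deg_ev]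
      simp
    · rw [ev_diff, Finset.univ_eq_empty, Finset.sum_empty, add_zero]
  rw [h, envAct_elt]

/-- The elements of `A`, as operations on `O`-algebras under `A`. -/
def envElt (d : C) : A.X d ⟶ env O A Fin.elim0 d :=
  homOfLin (fun a => (Pre.elt d a).gen)
    (isLin_env (fun _ => rfl) fun U x => by simpa only [envAct_elt] using isLin_map _)
    (gen_elt_diff O A d)

theorem map_envElt (d : C) (a : Homog (A.X d)) :
    map (envElt O A d) a = (Pre.elt d a).gen :=
  map_homOfLin (fun a => (Pre.elt d a).gen) _ _ (fun _ => rfl) a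

variable {O A} in
theorem ev_envElt (U : AlgUnder O A) (d : C) (a : Homog (A.X d)) (x) :
    ev (envAct O A U Fin.elim0 d) (map (envElt O A d) a) x = map (U.u d) a := by
  rw [map_envElt, envAct_elt]

theorem envComp_gen {n l : ℕ} {m : Fin n → ℕ} (d : Fin n → C) (b : ∀ j, Fin (m j) → C)
    (c : Fin l → C) (e : C) (π : (Σ j, Fin (m j)) ≃ Fin l) (h : ∀ j y, c (π ⟨j, y⟩) = b j y)
    (t : Pre O A d e) (ts : ∀ j, Pre O A (b j) (d j)) :
    ev (envComp d b c e π h) t.gen (fun j => (ts j).gen) = (Pre.comp d b c e π h t ts).gen := by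
  refine env_ext (by rw [deg_ev]; rfl) fun U x => ?_
  rw [ev_envComp, envAct_comp]

/-- The operad of operations on `O`-algebras under `A`. -/
def envOperad : ColoredOperad k C where
  obj c d := env O A c d
  one a := (Pre.op (fun _ : Fin 1 => a) a (O.unit a)).gen.val
  d_one a := by
    have h := (Homog.ext_iff.1 (gen_op_diff O A _ _ (O.unit a))).2
    rw [show (O.unit a).diff = mk 1 0 from
      Homog.ext rfl (heq_of_eq (O.d_one a)), ← map_envOp] at h
    refine (eq_of_heq h).symm.trans ?_
    exact map_zero ((envOp O A (fun _ : Fin 1 => a) a).f 1).hom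
  comp := envComp
  assoc d c a q g e π ρ σ τ hστ hρ hσ hτ θ φ ψ := by
    refine env_ext ?_ fun U v => ?_
    · simp only [deg_sgn, deg_ev]
      rw [Finset.sum_add_distrib, sum_sigma_equiv π (fun _ x => (ψ x).deg), add_assoc]
    rw [ev_envComp, ev_envComp, ev_sgn_left, ev_envComp, sgn_sgn, sgn_sgn]
    simp only [ev_envComp, recolor_rfl]
    rw [IsML.sgn_all (ev_isML _ _), sgn_sgn]
    have hin : ∀ j y, (fun z => recolor U.X (hρ (π ⟨j, y⟩) z) (v (ρ ⟨π ⟨j, y⟩, z⟩))) =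
        fun z => recolor U.X (hσ j y z) (recolor U.X (hτ j (σ j ⟨y, z⟩)) (v (τ ⟨j, σ j ⟨y, z⟩⟩))) := by
      intro j y
      funext z
      have : ∀ (i i' : _) (hi : i = i') (h : g i = a (π ⟨j, y⟩) z)
          (h' : g i' = a (π ⟨j, y⟩) z), recolor U.X h (v i) = recolor U.X h' (v i') := by
        rintro i _ rfl h h'; rfl
      rw [recolor_recolor]
      exact this _ _ (hστ j y z).symm _ _
    simp only [hin]
    congr 1
    have := shuffleSign_comp π ρ σ τ hστ (fun j => (φ j).deg) (fun x => (ψ x).deg)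
      (fun i => (v i).deg)
    simp only [deg_recolor, deg_ev]
    rw [this]
    simp only [mul_assoc]
  one_comp c e π hπ θ := by
    refine env_ext ?_ fun U x => ?_
    · rw [deg_ev, Fin.sum_univ_one]
      exact zero_add _
    · have h₂ : ∀ j, ev (envAct O A U c e) θ
          (fun y => recolor U.X (congrArg c (hπ j y)) (x (π ⟨j, y⟩))) =
          ev (envAct O A U c e) θ x := by
        intro j
        congr 1
        funext y
        have : ∀ i (hi : i = y), recolor U.X (congrArg c hi) (x i) = x y := by
          rintro i rfl; rfl
        exact this _ (hπ j y)
      refine (ev_envComp _ _ _ _ _ _ _ _ _ _).trans ?_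
      rw [shuffleSign_single π hπ, sgn_one]
      simp only [h₂]
      exact (envAct_op U _ _ (O.unit e) _).trans (U.s.act_unit e _)
  comp_one d e π hπ θ := by
    refine env_ext ?_ fun U x => ?_
    · rw [deg_ev]
      simp
    · refine (ev_envComp _ _ _ _ _ _ _ _ _ _).trans ?_
      have h₁ : shuffleSign π (fun _ => 0) (fun i => (x i).deg) = 1 := by
        refine shuffleSign_zero_left π (fun i i' h => Or.inl ?_) _
        have : ∀ i, (π.symm i).1 = i := fun i => by
          rw [← hπ (π.symm i).1 (π.symm i).2]
          simp
        rwa [this, this]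
      refine (congrArg (fun s => sgn s _) h₁).trans ((sgn_one _).trans ?_)
      congr 1
      funext j
      have h₂ : (fun y : Fin 1 => recolor U.X (congrArg d (hπ j y)) (x (π ⟨j, y⟩))) =
          fun _ => x j := by
        funext y
        have : ∀ i (hi : i = j), recolor U.X (congrArg d hi) (x i) = x j := by
          rintro i rfl; rfl
        exact this _ (hπ j y)
      refine (congrArg _ h₂).trans ?_
      exact (envAct_op U _ _ (O.unit (d j)) _).trans (U.s.act_unit (d j) _)

/-- The map from an operad to the operad of operations on algebras under `A`. -/
def envHom : OperadHom O (envOperad O A) where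
  app c d := envOp O A c d
  map_unit a := map_envOp O A _ a (O.unit a)
  map_comp d b c e π h θ φ := by
    obtain rfl : b = fun j y => c (π ⟨j, y⟩) := funext fun j => funext fun y => (h j y).symm
    refine env_ext ?_ fun U x => ?_
    · exact (deg_ev (O.comp d (fun j y => c (π ⟨j, y⟩)) c e π h) θ φ).trans
        (deg_ev (envComp d (fun j y => c (π ⟨j, y⟩)) c e π h)
        (map (envOp O A d e) θ) (fun j => map (envOp O A _ (d j)) (φ j))).symm
    · refine Eq.trans ?_ (ev_envComp _ _ _ _ _ _ _ _ _ _).symm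
      refine (ev_envOp U c e _ x).trans ((U.s.act_comp d c e π θ φ x).trans ?_)
      refine congrArg _ (Eq.trans ?_ (ev_envOp U d e θ _).symm)
      exact congrArg (ev _ θ) (funext fun j => (ev_envOp U _ (d j) (φ j) _).symm)

theorem isAlgHom_envElt : IsAlgHom A.str ((nullary (envOperad O A)).restrict (envHom O A))
    (envElt O A) := by
  intro n c d θ x
  rw [ev_restrict]
  refine env_ext ?_ fun U v => ?_
  · exact (deg_ev (A.str.act c d) θ x).trans (deg_ev ((nullary (envOperad O A)).act c d)
      (map (envOp O A c d) θ) (fun j => map (envElt O A (c j)) (x j))).symm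
  · refine Eq.trans ?_ (ev_envComp _ _ _ _ _ _ _ _ _ _).symm
    rw [shuffleSign_empty, sgn_one]
    refine (ev_envElt U d _ v).trans ((U.hu c d θ x).trans (Eq.trans ?_ (ev_envOp U c d θ _).symm))
    exact congrArg (ev _ θ) (funext fun j => (ev_envElt U (c j) (x j) _).symm)

theorem isAlgHom_env {X Y : Coll k C} (s : AlgStr (envOperad O A) X) (t : AlgStr (envOperad O A) Y)
    (f : ∀ d, X d ⟶ Y d) (hf : IsAlgHom (s.restrict (envHom O A)) (t.restrict (envHom O A)) f)
    (hη : ∀ (d : C) (a : Homog (A.X d)),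
      map (f d) (evNullary (envElt O A) s d a) = evNullary (envElt O A) t d a) :
    IsAlgHom s t f := by
  have key : ∀ {n : ℕ} {c : Fin n → C} {d : C} (z : Pre O A c d) (x : ∀ i, Homog (X (c i))),
      map (f d) (ev (s.act c d) z.gen x) =
        ev (t.act c d) z.gen (fun i => map (f (c i)) (x i)) := by
    intro n c d z
    induction z with
    | op c d θ =>
      intro x
      have := hf c d θ x
      rw [ev_restrict, ev_restrict] at this
      rwa [← map_envOp]
    | elt d a =>
      intro x
      have h : map (f d) (ev (s.act Fin.elim0 d) (Pre.elt d a).gen (fun i => i.elim0)) =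
          ev (t.act Fin.elim0 d) (Pre.elt d a).gen (fun i => i.elim0) := by
        rw [← map_envElt]
        exact hη d a
      rw [Subsingleton.elim x (fun i => i.elim0), h]
      congr 1
      exact Subsingleton.elim _ _
    | @comp n l m d b c e π h z zs ih ihs =>
      obtain rfl : b = fun j y => c (π ⟨j, y⟩) := funext fun j => funext fun y => (h j y).symm
      intro x
      rw [← envComp_gen]
      refine (congrArg _ (s.act_comp d c e π z.gen (fun j => (zs j).gen) x)).trans ?_
      refine Eq.trans ?_ (t.act_comp d c e π z.gen (fun j => (zs j).gen) _).symm
      rw [map_sgn, ih]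
      simp only [ihs]
      rfl
    | @diff n c d z ih =>
      intro x
      rw [Pre.gen_diff]
      have h₁ : ∀ θ x, ev (s.act c d ≫ f d) θ x = map (f d) (ev (s.act c d) θ x) :=
        fun _ _ => rfl
      have h₂ : ∀ θ x, ev (hmap (𝟙 ((envOperad O A).obj c d)) (fun i => f (c i)) ≫ t.act c d) θ x =
          ev (t.act c d) θ (fun i => map (f (c i)) (x i)) := by
        intro θ x
        simp only [ev, Homog.map_comp, map_hmap, Homog.map_id]
      exact (h₁ _ _).symm.trans ((ev_diff_congr rfl (fun x => (h₁ _ _).trans ((ih x).trans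
        (h₂ _ _).symm)) x).trans (h₂ _ _))
  intro n c d θ x
  refine IsLin.eq_of_spans (((isLin_map (f d))).comp (ev_isLin (s.act c d) x))
    (ev_isLin (t.act c d) _) (fun θ => ?_) (env_spans c d) ?_ θ
  · rw [deg_map, deg_ev, deg_ev]
    rfl
  · rintro _ ⟨z, rfl⟩
    exact key z x

/-- The operations on an `O`-algebra under `A`. -/
def envAlg (U : AlgUnder O A) : AlgStr (envOperad O A) U.X where
  act c d := envAct O A U c d
  act_unit a x := (envAct_op U _ _ (O.unit a) _).trans (U.s.act_unit a x)
  act_comp _ _ _ _ _ _ _ := ev_envComp _ _ _ _ _ _ _ _ _ _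

theorem envAlg_restrict (U : AlgUnder O A) : (envAlg O A U).restrict (envHom O A) = U.s := by
  refine AlgStr.ext ?_
  funext n c d
  refine htensor_hom_ext fun θ x => ?_
  rw [ev_restrict]
  exact (congrArg (fun z => ev _ z x) (map_envOp O A c d θ)).trans (envAct_op U c d θ x)

theorem evNullary_envAlg (U : AlgUnder O A) (d : C) (a : Homog (A.X d)) :
    evNullary (envElt O A) (envAlg O A U) d a = map (U.u d) a :=
  (congrArg (fun z => ev (envAct O A U Fin.elim0 d) z _) (map_envElt O A d a)).trans
    (envAct_elt U d a _)

theorem algStr_ext_of_isAlgHom {P : ColoredOperad k C} {X : Coll k C} {s t : AlgStr P X}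
    (h : IsAlgHom s t (fun d => 𝟙 (X d))) : s = t := by
  refine AlgStr.ext ?_
  funext n c d
  exact htensor_hom_ext fun θ x => h c d θ x

/-- Every algebra has an enveloping operad. -/
def envelopingOperad : EnvelopingOperad O A where
  operad := envOperad O A
  φ := envHom O A
  η := envElt O A
  isAlgHom_η := isAlgHom_envElt O A
  existsUnique_algStr X s u hu := by
    refine ⟨envAlg O A ⟨X, s, u, hu⟩, ⟨envAlg_restrict O A _, evNullary_envAlg O A _⟩, ?_⟩
    rintro t ⟨h₁, h₂⟩
    refine algStr_ext_of_isAlgHom (isAlgHom_env O A _ _ _ ?_ fun d a => ?_)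
    · rw [h₁, envAlg_restrict]
      exact fun _ _ _ _ => rfl
    · rw [h₂, evNullary_envAlg]
      rfl
  isAlgHom X Y s t f := isAlgHom_env O A s t f

section Fill

variable (P : ColoredOperad k C) {V W : Coll k C}
  (f : V ⟶ W) (η : ∀ d, V d ⟶ P.obj (Fin.elim0 : Fin 0 → C) d) {n l : ℕ}

theorem koszulSign_eq (σ : Equiv.Perm (Fin n)) (r : Fin n → ℤ) :
    koszulSign σ r = shuffleSign (permSigma σ) (fun _ => 0) r := by
  have h : ∀ i, (((permSigma σ).symm i).1 : Fin n) = σ.symm i := fun i => rfl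
  unfold koszulSign shuffleSign
  congr 1
  simp only [zero_mul, ite_self, Finset.sum_const_zero, zero_add, h]
  rw [Finset.sum_comm]
  refine Eq.trans ?_ (Equiv.sum_comp σ _)
  refine Finset.sum_congr rfl fun b _ => Eq.trans ?_ (Equiv.sum_comp σ _)
  refine Finset.sum_congr rfl fun a _ => ?_
  have h' : ∀ x y : Fin 1, ¬ (x : ℕ) < y := fun x y => by omega
  rw [mul_comm]
  refine if_congr ?_ rfl rfl
  simp only [h', and_false, or_false, Equiv.symm_apply_apply]
  exact and_comm

/-- The bijection `∐_{∗} I ≃ I`. -/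
def sigmaOne (n : ℕ) : (Σ _ : Fin 1, Fin n) ≃ Fin n where
  toFun p := p.2
  invFun z := ⟨0, z⟩
  left_inv p := by obtain ⟨y, z⟩ := p; rw [Subsingleton.elim y 0]
  right_inv _ := rfl

/-- The numbering of the places left after a permutation. -/
theorem exists_permFill (S : Fin n → Bool) (σ : Equiv.Perm (Fin n))
    (ρ : (Σ x, Fin (slotArity (S x))) ≃ Fin l) :
    ∃ τ : (Σ j, Fin (slotArity (S (σ j)))) ≃ Fin l, ∀ j w, τ ⟨j, w⟩ = ρ ⟨σ j, w⟩ :=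
  ⟨(Equiv.sigmaCongrLeft (β := fun i => Fin (slotArity (S i))) σ).trans ρ, fun _ _ => rfl⟩

theorem fillMap_relabel {c c' : Fin n → C} (d : C) (σ : Equiv.Perm (Fin n))
    (h : ∀ i, c' (σ i) = c i) (S : Fin n → Bool) (g : Fin l → C)
    (ρ : (Σ x, Fin (slotArity (S x))) ≃ Fin l) (hρ : ∀ x z, g (ρ ⟨x, z⟩) = slotColor (c' x) (S x) z)
    (τ : (Σ j, Fin (slotArity (S (σ j)))) ≃ Fin l) (hτρ : ∀ j w, τ ⟨j, w⟩ = ρ ⟨σ j, w⟩)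
    (hτ : ∀ j w, g (τ ⟨j, w⟩) = slotColor (c j) (S (σ j)) w)
    (θ : Homog (P.obj c d)) (x : ∀ i, Homog (vert V W (c' i) (S i))) :
    ev (fillMap P η S c' g d ρ hρ) (P.relabel d σ h θ) x =
      sgn (koszulSign σ (fun i => (x i).deg))
        (ev (fillMap P η (fun i => S (σ i)) c g d τ hτ) θ
          (fun i => recolor (fun a => vert V W a (S (σ i))) (h i) (x (σ i)))) := by
  obtain rfl : c = fun i => c' (σ i) := funext fun i => (h i).symm
  have key := actMap_comp (P := P) (W := W) (fun i => c' (σ i)) c'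
    (fun i => slotColor (c' i) (S i)) (fun j => slotColor (c' (σ j)) (S (σ j))) g d
    (permSigma σ) ρ (fun j => sigmaOne (slotArity (S (σ j)))) τ
    (fun j y z => hτρ j z) hρ (fun j y z => rfl) hτ θ (fun j => P.unit (c' (σ j)))
    (fun i => slotVal P η (c' i) (S i) (x i))
  have h₁ := map_fillMap P η S c' g d ρ hρ (P.relabel d σ h θ) x
  have h₂ := map_fillMap P η (fun i => S (σ i)) (fun i => c' (σ i)) g d τ hτ θ
    (fun i => recolor (fun a => vert V W a (S (σ i))) (h i) (x (σ i)))
  refine h₁.trans (key.trans ?_)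
  rw [koszulSign_eq]
  have hs : (fun x_1 => (slotVal P η (W := W) (c' x_1) (S x_1) (x x_1)).deg) =
    fun i => (x i).deg := funext fun i => deg_slotVal _ _ _ _ _
  refine (congrArg (fun r => sgn (shuffleSign _ _ r) _) hs).trans (congrArg _ ?_)
  refine Eq.trans ?_ h₂.symm
  congr 1
  funext j
  exact actMap_unit P (W := W) (slotColor (c' (σ j)) (S (σ j))) (c' (σ j))
    (sigmaOne (slotArity (S (σ j)))) (fun _ _ => rfl)
    (slotVal P η (c' (σ j)) (S (σ j)) (x (σ j)))

/-- The action of isomorphisms of collections of colours on words. -/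
theorem fillMap_perm {c c' : Fin n → C} (d : C) (σ : Equiv.Perm (Fin n))
    (h : ∀ i, c' (σ i) = c i) (θ : Homog (P.obj c d)) (x : ∀ i, Homog (W (c' i))) :
    ev (fillMap P η (fun _ => true) c c' d (permSigma σ) (fun j _ => h j)) θ
        (fun i => recolor W (h i) (x (σ i))) =
      sgn (koszulSign σ (fun i => (x i).deg)) (hpure (P.relabel d σ h θ) x) := by
  refine (map_fillMap P η (fun _ => true) c c' d (permSigma σ) (fun j _ => h j) θ _).trans ?_
  rw [koszulSign_eq]
  exact ev_actMap (P := P) (W := W) (b := fun j (_ : Fin 1) => c j) (permSigma σ) (fun j _ => h j) θ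
    (fun j => P.unit (c j)) x

/-- Words with permuted letters. -/
theorem cellIn_relabel {N : ℕ∞} (hn : (n : ℕ∞) ≤ N) (c c' : Fin n → C) (d : C)
    (σ : Equiv.Perm (Fin n)) (h : ∀ i, c' (σ i) = c i) (θ : Homog (P.obj c d))
    (x : ∀ i, Homog (W (c' i))) :
    ev (cellIn P f η hn c' d) (P.relabel d σ h θ) x =
      sgn (koszulSign σ (fun i => (x i).deg))
        (ev (cellIn P f η hn c d) θ (fun i => recolor W (h i) (x (σ i)))) := by
  have h₁ := congrArg (fun F => ev F θ (fun i => recolor W (h i) (x (σ i))))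
    (cellIn_fill P f η hn hn (fun _ => true) c c' d (permSigma σ) (fun j _ => h j))
  have h₂ := congrArg (map (cellIn P f η hn c' d)) (fillMap_perm P η d σ h θ x)
  have h₃ := congrArg (map (cellIn P f η hn c d)) (map_cubeTop_true f (P.obj c d) c
    (hpure θ (fun i => recolor W (h i) (x (σ i)))))
  have h₄ := h₃.symm.trans (h₁.trans h₂)
  rw [map_sgn] at h₄
  refine Eq.trans ?_ (congrArg (sgn (koszulSign σ (fun i => (x i).deg))) h₄.symm)
  rw [sgn_sgn, Int.units_mul_self, sgn_one]
  rfl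

theorem relabel_exists_args {c c' : Fin n → C} (σ : Equiv.Perm (Fin n)) (h : ∀ i, c' (σ i) = c i)
    (S : Fin n → Bool) (x : ∀ i, Homog (vert V W (c i) (S (σ i)))) :
    ∃ y : ∀ i, Homog (vert V W (c' i) (S i)),
      x = fun i => recolor (fun a => vert V W a (S (σ i))) (h i) (y (σ i)) := by
  obtain rfl : c = fun i => c' (σ i) := funext fun i => (h i).symm
  refine ⟨fun i => (σ.apply_symm_apply i) ▸ x (σ.symm i), ?_⟩
  funext i
  have : ∀ j (hj : σ j = σ i), x i = (hj ▸ x j : Homog (vert V W (c' (σ i)) (S (σ i)))) := by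
    intro j hj
    obtain rfl := σ.injective hj
    rfl
  exact this _ _

theorem fillMap_perm_fillMap {c c' : Fin n → C} (d : C) (σ : Equiv.Perm (Fin n))
    (h : ∀ i, c' (σ i) = c i) (g : Fin l → C)
    (ρ : (Σ _ : Fin n, Fin 1) ≃ Fin l) (hρ : ∀ x (z : Fin 1), g (ρ ⟨x, z⟩) = c' x)
    (τ : (Σ _ : Fin n, Fin 1) ≃ Fin l) (hτρ : ∀ j w, τ ⟨j, w⟩ = ρ ⟨σ j, w⟩)
    (hτ : ∀ j (w : Fin 1), g (τ ⟨j, w⟩) = c j) :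
    fillMap P (W := W) η (fun _ => true) c c' d (permSigma σ) (fun j _ => h j) ≫
      fillMap P η (fun _ => true) c' g d ρ hρ = fillMap P η (fun _ => true) c g d τ hτ := by
  refine htensor_hom_ext fun θ x => ?_
  obtain ⟨y, rfl⟩ := relabel_exists_args (V := V) (W := W) σ h (fun _ => true) x
  have h₁ := fillMap_perm P η d σ h θ y
  have h₂ := fillMap_relabel P η d σ h (fun _ => true) g ρ hρ τ hτρ hτ θ y
  refine (congrArg (map (fillMap P η (fun _ => true) c' g d ρ hρ)) h₁).trans ?_
  refine (map_sgn _ _ _).trans ?_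
  refine (congrArg (sgn _) h₂).trans ((sgn_sgn _ _ _).trans ?_)
  rw [Int.units_mul_self]
  exact sgn_one _

theorem fillMap_nil (S : Fin 0 → Bool) (d : C) (π : (Σ j, Fin (slotArity (S j))) ≃ Fin 0)
    (h : ∀ j y, (Fin.elim0 : Fin 0 → C) (π ⟨j, y⟩) = slotColor (Fin.elim0 j) (S j) y)
    (θ : Homog (P.obj (Fin.elim0 : Fin 0 → C) d)) (x) :
    map (fillMap P (W := W) η S (Fin.elim0 : Fin 0 → C) Fin.elim0 d π h) (hpure θ x) =
      hpure θ (fun y => y.elim0) := by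
  obtain rfl : S = fun _ => true := Subsingleton.elim _ _
  refine (map_fillMap_true P η (Fin.elim0 : Fin 0 → C) d π (fun y => y.elim0) _).trans ?_
  exact congrArg (hpure (Y := fun y : Fin 0 => W (Fin.elim0 y)) θ) (funext fun y => y.elim0)

/-- Filling places in two steps. -/
theorem fillMap_vertMap {Z : Cx k} {l' : ℕ} (S S' : Fin n → Bool) (hS : ∀ i, S i ≤ S' i)
    (c : Fin n → C) (d : C)
    (g : Fin l → C) (π : (Σ j, Fin (slotArity (S' j))) ≃ Fin l)
    (hπ : ∀ j y, g (π ⟨j, y⟩) = slotColor (c j) (S' j) y)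
    (g' : Fin l' → C) (τ : (Σ j, Fin (slotArity (S j))) ≃ Fin l')
    (hτ : ∀ j y, g' (τ ⟨j, y⟩) = slotColor (c j) (S j) y)
    (G : htensor (P.obj g d) (fun i => W (g i)) ⟶ Z)
    (G' : htensor (P.obj g' d) (fun i => W (g' i)) ⟶ Z)
    (hG : ∀ (S' : Fin l → Bool) (ρ : (Σ x, Fin (slotArity (S' x))) ≃ Fin l') (hρ),
      cubeTop f (P.obj g d) g S' ≫ G = fillMap P η S' g g' d ρ hρ ≫ G') :
    hmap (𝟙 (P.obj c d)) (fun i => vertMap f (c i) (S i) (S' i) (hS i)) ≫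
        fillMap P η S' c g d π hπ ≫ G = fillMap P η S c g' d τ hτ ≫ G' := by
  have key : ∀ (a : C) (s s' : Bool), s ≤ s' → ∃ (σ : (Σ _ : Fin (slotArity s'), Fin (slotArity s)) ≃
      Fin (slotArity s)) (hσ : ∀ y z, slotColor a s (σ ⟨y, z⟩) = slotColor (slotColor a s' y) s z),
      ∀ (hs : s ≤ s') (x : Homog (vert V W a s)), ∃ ω : Homog (htensor (P.obj (slotColor a s') a)
        (fun y => vert V W (slotColor a s' y) s)),
        map (cubeTop f _ (slotColor a s') (fun _ => s)) ω =
          slotVal P η a s' (map (vertMap f a s s' hs) x) ∧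
        map (fillMap P η (fun _ => s) (slotColor a s') (slotColor a s) a σ hσ) ω =
          slotVal P η a s x := by
    intro a s s' hs
    cases s' with
    | false =>
      cases s with
      | true => exact absurd hs (by decide)
      | false =>
        refine ⟨emptySigma, fun y _ => y.elim0, fun _ x =>
          ⟨hpure (map (η a) x) (fun y => y.elim0), ?_, ?_⟩⟩
        · refine (map_cubeTop f _ (Fin.elim0 : Fin 0 → C) (fun _ => false) _ _).trans ?_
          refine congrArg (hpure (Y := fun y : Fin 0 => W (Fin.elim0 y)) (map (η a) x)) ?_
          exact funext fun y => y.elim0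
        · exact fillMap_nil P η _ _ _ _ _ _
    | true =>
      cases s with
      | false =>
        refine ⟨emptySigma, fun _ z => z.elim0, fun _ x =>
          ⟨hpure (P.unit a) (fun _ => x), ?_, ?_⟩⟩
        · exact map_cubeTop f _ (fun _ : Fin 1 => a) (fun _ => false) _ _
        · refine (map_fillMap P η (fun _ => false) (fun _ : Fin 1 => a) Fin.elim0 a emptySigma
            (fun _ z => z.elim0) _ _).trans ?_
          exact actMap_unit P (W := W) (Fin.elim0 : Fin 0 → C) a emptySigma (fun _ y => y.elim0)
            (slotVal P η a false x)
      | true =>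
        refine ⟨Equiv.sigmaUnique (Fin 1) (fun _ => Fin 1), fun _ _ => rfl, fun _ x =>
          ⟨hpure (P.unit a) (fun _ => x), ?_, ?_⟩⟩
        · exact map_cubeTop f _ (fun _ : Fin 1 => a) (fun _ => true) _ _
        · exact map_fillMap_true P η (fun _ : Fin 1 => a) a _ (fun _ _ => rfl)
            (hpure (P.unit a) (fun _ => x))
  choose σ hσ ω' hω₁' hω₂' using fun j => key (c j) (S j) (S' j) (hS j)
  refine htensor_hom_ext fun θ x => ?_
  have hω₁ := fun j => hω₁' j (hS j) (x j)
  have hω₂ := fun j => hω₂' j (hS j) (x j)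
  have h₁ := fill_act_local P f η c (fun j => slotColor (c j) (S' j)) g (fun j _ => S j)
    (fun j => slotColor (c j) (S j)) g' d π hπ σ τ hσ hτ G G' hG θ (fun j => ω' j (hS j) (x j))
  simp only [hω₁, hω₂] at h₁
  refine Eq.trans ?_ (h₁.trans ?_)
  · refine (congrArg (fun z => map G (map (fillMap P η S' c g d π hπ) z))
      (map_hmap _ _ _ _)).trans ?_
    rw [Homog.map_id, map_fillMap]
    rfl
  · refine congrArg (map G') (map_fillMap P η S c g' d τ hτ θ x).symm

end Fill

section Slots

variable {n l : ℕ}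

theorem size_eq (S : Fin n → Bool) (π : (Σ j, Fin (slotArity (S j))) ≃ Fin l) : size S = l := by
  simpa using Fintype.card_congr ((slotEquiv S).symm.trans π)

theorem size_le (S : Fin n → Bool) : size S ≤ n :=
  (Finset.card_le_univ (supp S)).trans_eq (Fintype.card_fin n)

theorem size_true : size (fun _ : Fin n => true) = n := by simp [size, supp]

theorem exists_eq_permSigma (π : (Σ _ : Fin n, Fin 1) ≃ Fin n) : ∃ σ, π = permSigma σ := by
  refine ⟨(Equiv.sigmaUnique (Fin n) (fun _ => Fin 1)).symm.trans π, ?_⟩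
  unfold permSigma
  rw [← Equiv.trans_assoc, Equiv.self_trans_symm, Equiv.refl_trans]

end Slots

section Quot

theorem quot_hom_ext {X Y : Cx k} {R : Set (Homog X)} {a b : quot X R ⟶ Y}
    (h : quotProj X R ≫ a = quotProj X R ≫ b) : a = b := by
  ext m : 1
  refine ModuleCat.hom_ext (Submodule.linearMap_qext _ (LinearMap.ext fun z => ?_))
  exact congrArg (fun F : X ⟶ Y => F.f m z) h

theorem f_tmk {n : ℕ} {Q Z : Cx k} {Y : Fin n → Cx k} (F : htensor Q Y ⟶ Z) (θ : Homog Q)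
    (y : ∀ i, Homog (Y i)) (m : ℤ) (h : tdeg (hargs θ y) = m) :
    F.f m (tmk (hargs θ y) m h) = (ev F θ y).vat m := by
  subst h
  exact (vat_deg (ev F θ y)).symm

theorem f_sub_smul {X Z : Cx k} (F : X ⟶ Z) (m : ℤ) (a b : X.X m) (s : ℤˣ) :
    F.f m (a - s • b) = F.f m a - s • F.f m b := by
  rw [map_sub, Units.smul_def, map_zsmul, ← Units.smul_def]

end Quot

section Steps

variable (P : ColoredOperad k C) {V W : Coll k C}
  (f : V ⟶ W) (η : ∀ d, V d ⟶ P.obj (Fin.elim0 : Fin 0 → C) d) {n l : ℕ}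

variable {f} in
theorem srcRel_val {c : Fin n → C} {d : C} {Z : Cx k} (g : cornerObj f (P.obj c d) c ⟶ Z)
    (h : ∀ (σ : Equiv.Perm (Fin n)) (h : ∀ i, c (σ i) = c i) (S : Fin n → Bool)
      (hS : S ≠ fun _ => true) (hS' : (fun i => S (σ i)) ≠ fun _ => true)
      (θ : Homog (P.obj c d)) (x : ∀ i, Homog (vert V W (c i) (S i))),
      ev (cornerIncl f (P.obj c d) c ⟨S, hS⟩ ≫ g) (P.relabel d σ h θ) x =
        sgn (koszulSign σ (fun i => (x i).deg))
          (ev (cornerIncl f (P.obj c d) c ⟨fun i => S (σ i), hS'⟩ ≫ g) θ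
            (fun i => recolor (fun a => vert V W a (S (σ i))) (h i) (x (σ i))))) :
    ∀ r ∈ srcRel P f c d, (map g r).val = 0 := by
  rintro _ ⟨σ, hσ, S, hS, hS', θ, x, m, h₁, h₂, rfl⟩
  have e₁ := f_tmk (cornerIncl f (P.obj c d) c ⟨S, hS⟩ ≫ g) _ _ m h₁
  have e₂ := f_tmk (cornerIncl f (P.obj c d) c ⟨fun i => S (σ i), hS'⟩ ≫ g) _ _ m h₂
  have h₀ := h σ hσ S hS hS' θ x
  refine (f_sub_smul g m _ _ _).trans (sub_eq_zero.2 (Eq.trans ?_ (congrArg _ e₂.symm)))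
  refine e₁.trans ?_
  rw [h₀, vat_sgn]

theorem tgtRel_val {c : Fin n → C} {d : C} {Z : Cx k} (g : htensor (P.obj c d) (fun i => W (c i)) ⟶ Z)
    (h : ∀ (σ : Equiv.Perm (Fin n)) (h : ∀ i, c (σ i) = c i) (θ : Homog (P.obj c d))
      (x : ∀ i, Homog (W (c i))), ev g (P.relabel d σ h θ) x =
        sgn (koszulSign σ (fun i => (x i).deg))
          (ev g θ (fun i => recolor W (h i) (x (σ i))))) :
    ∀ r ∈ tgtRel P W c d, (map g r).val = 0 := by
  rintro _ ⟨σ, hσ, θ, x, m, h₁, h₂, rfl⟩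
  have e₁ := f_tmk g _ _ m h₁
  have e₂ := f_tmk g _ _ m h₂
  have h₀ := h σ hσ θ x
  refine (f_sub_smul g m _ _ _).trans (sub_eq_zero.2 (Eq.trans ?_ (congrArg _ e₂.symm)))
  refine e₁.trans ?_
  rw [h₀, vat_sgn]

theorem ev_quotProj_relabel {c : Fin n → C} {d : C} (σ : Equiv.Perm (Fin n))
    (h : ∀ i, c (σ i) = c i) (θ : Homog (P.obj c d)) (x : ∀ i, Homog (W (c i))) :
    ev (quotProj _ (tgtRel P W c d)) (P.relabel d σ h θ) x =
      sgn (koszulSign σ (fun i => (x i).deg))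
        (ev (quotProj _ (tgtRel P W c d)) θ (fun i => recolor W (h i) (x (σ i)))) := by
  have hd : tdeg (hargs θ (fun i => recolor W (h i) (x (σ i)))) =
      tdeg (hargs (P.relabel d σ h θ) x) := by
    rw [tdeg_hargs, tdeg_hargs]
    simp only [deg_recolor]
    rw [Equiv.sum_comp σ (fun i => (x i).deg)]
    congr 1
    unfold ColoredOperad.relabel
    rw [deg_ev]
    simp [ColoredOperad.unit]
  refine ext_vat ?_ ?_
  · exact hd.symm
  · have e := quotProj_eq_zero (R := tgtRel P W c d) ⟨σ, h, θ, x, _, rfl, hd, rfl⟩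
    have e₁ := f_tmk (quotProj _ (tgtRel P W c d)) (P.relabel d σ h θ) x _ rfl
    have e₂ := f_tmk (quotProj _ (tgtRel P W c d)) θ (fun i => recolor W (h i) (x (σ i))) _ hd
    refine e₁.symm.trans ((sub_eq_zero.1 ((f_sub_smul _ _ _ _ _).symm.trans e)).trans ?_)
    rw [vat_sgn]
    exact congrArg _ e₂

/-- The projection to the orbits. -/
def srcProj (c : Fin n → C) (d : C) : cornerObj f (P.obj c d) c ⟶ orbitSrc P f c d :=
  quotProj _ _

/-- The projection to the orbits. -/
def tgtProj (W : Coll k C) (c : Fin n → C) (d : C) :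
    htensor (P.obj c d) (fun i => W (c i)) ⟶ orbitTgt P W c d := quotProj _ _

/-- The inclusion of a summand. -/
def srcIncl (d : C) (c : CollClass C n) : orbitSrc P f c.out d ⟶ stepSrc P f n d :=
  Limits.Sigma.ι (fun c : CollClass C n => orbitSrc P f c.out d) c

/-- The inclusion of a summand. -/
def tgtIncl (W : Coll k C) (d : C) (c : CollClass C n) : orbitTgt P W c.out d ⟶ stepTgt P W n d :=
  Limits.Sigma.ι (fun c : CollClass C n => orbitTgt P W c.out d) c

theorem vertexIncl_comp (d : C) (c : CollClass C n) (S : Proper n) {Z : Cx k}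
    (a : stepSrc P f n d ⟶ Z) : vertexIncl P f d c S ≫ a =
      cornerIncl f (P.obj c.out d) c.out S ≫ srcProj P f c.out d ≫ srcIncl P f d c ≫ a := by
  have : vertexIncl P f d c S =
    cornerIncl f (P.obj c.out d) c.out S ≫ srcProj P f c.out d ≫ srcIncl P f d c := rfl
  rw [this, Category.assoc, Category.assoc]

theorem topIncl_comp (d : C) (c : CollClass C n) {Z : Cx k}
    (a : stepTgt P W n d ⟶ Z) : topIncl P W d c ≫ a =
      tgtProj P W c.out d ≫ tgtIncl P W d c ≫ a := by
  have : topIncl P W d c = tgtProj P W c.out d ≫ tgtIncl P W d c := rfl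
  rw [this, Category.assoc]

theorem stepSrc_hom_ext {d : C} {Z : Cx k} {a b : stepSrc P f n d ⟶ Z}
    (h : ∀ c S, vertexIncl P f d c S ≫ a = vertexIncl P f d c S ≫ b) : a = b := by
  refine Limits.Sigma.hom_ext _ _ fun c => quot_hom_ext (colimit.hom_ext fun S => ?_)
  have := h c S
  rwa [vertexIncl_comp, vertexIncl_comp] at this

theorem stepTgt_hom_ext {d : C} {Z : Cx k} {a b : stepTgt P W n d ⟶ Z}
    (h : ∀ c, topIncl P W d c ≫ a = topIncl P W d c ≫ b) : a = b := by
  refine Limits.Sigma.hom_ext _ _ fun c => quot_hom_ext ?_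
  have := h c
  rwa [topIncl_comp, topIncl_comp] at this

theorem srcProj_orbitMap (c : Fin n → C) (d : C) : srcProj P f c d ≫ orbitMap P f c d =
    cornerMap f (P.obj c d) c ≫ tgtProj P W c d := rfl

theorem srcIncl_stepMap (d : C) (c : CollClass C n) : srcIncl P f d c ≫ stepMap P f n d =
    orbitMap P f c.out d ≫ tgtIncl P W d c := Limits.Sigma.ι_map _ _

theorem vertexIncl_stepMap (d : C) (c : CollClass C n) (S : Proper n) :
    vertexIncl P f d c S ≫ stepMap P f n d = cubeTop f (P.obj c.out d) c.out S.1 ≫ topIncl P W d c := by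
  rw [vertexIncl_comp, srcIncl_stepMap, ← Category.assoc (srcProj _ _ _ _), srcProj_orbitMap,
    ← cornerIncl_map, Category.assoc, Category.assoc]
  rfl

/-- The inclusion of words with fewer letters. -/
theorem exists_subIncl {N N' : ℕ∞} (h : N ≤ N') (d : C) : ∃ g : sub P f η N d ⟶ sub P f η N' d,
    ∀ (n : ℕ) (hn : (n : ℕ∞) ≤ N) (c : Fin n → C),
      cellIn P f η hn c d ≫ g = cellIn P f η (hn.trans h) c d :=
  exists_subDesc P f η (fun _ hn c => cellIn P f η (hn.trans h) c d)
    (fun r => cellIn_fill P f η _ _ r.S r.c r.c' d r.π r.h)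

/-- The inclusion of words with fewer letters. -/
def subIncl {N N' : ℕ∞} (h : N ≤ N') (d : C) : sub P f η N d ⟶ sub P f η N' d :=
  (exists_subIncl P f η h d).choose

@[simp]
theorem cellIn_subIncl {N N' : ℕ∞} (h : N ≤ N') (d : C) (hn : (n : ℕ∞) ≤ N) (c : Fin n → C) :
    cellIn P f η hn c d ≫ subIncl P f η h d = cellIn P f η (hn.trans h) c d :=
  (exists_subIncl P f η h d).choose_spec n hn c

theorem subIncl_refl (N : ℕ∞) (d : C) : subIncl P f η (le_refl N) d = 𝟙 _ :=
  sub_hom_ext P f η fun n hn c => by rw [cellIn_subIncl, Category.comp_id]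

theorem subIncl_trans {N N' N'' : ℕ∞} (h : N ≤ N') (h' : N' ≤ N'') (d : C) :
    subIncl P f η h d ≫ subIncl P f η h' d = subIncl P f η (h.trans h') d :=
  sub_hom_ext P f η fun n hn c => by
    rw [← Category.assoc, cellIn_subIncl, cellIn_subIncl, cellIn_subIncl]

/-- The result of filling does not depend on the numbering of the letters. -/
theorem fillMap_cellIn {N : ℕ∞} {l' : ℕ} (hl : (l : ℕ∞) ≤ N) (hl' : (l' : ℕ∞) ≤ N)
    (S : Fin n → Bool) (c : Fin n → C) (d : C) (c' : Fin l → C)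
    (π : (Σ j, Fin (slotArity (S j))) ≃ Fin l) (h : ∀ j y, c' (π ⟨j, y⟩) = slotColor (c j) (S j) y)
    (c'' : Fin l' → C) (π' : (Σ j, Fin (slotArity (S j))) ≃ Fin l')
    (h' : ∀ j y, c'' (π' ⟨j, y⟩) = slotColor (c j) (S j) y) :
    fillMap P η S c c' d π h ≫ cellIn P f η hl c' d =
      fillMap P η S c c'' d π' h' ≫ cellIn P f η hl' c'' d := by
  unfold fillMap
  rw [Category.assoc, Category.assoc, actMap_cellIn P f η hl hl' c _ d c' π h c'' π' h']

theorem slot_color (S : Fin n → Bool) (c : Fin n → C) (j : Fin n) (y : Fin (slotArity (S j))) :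
    c (enum S (slotEquiv S ⟨j, y⟩)) = slotColor (c j) (S j) y :=
  (congrArg c (enum_slotEquiv S ⟨j, y⟩)).trans (slotColor_eq (c j) (S j) y)

theorem size_lt' (S : Proper (n + 1)) : ((size S.1 : ℕ) : ℕ∞) ≤ n := by
  exact_mod_cast Nat.le_of_lt_succ (size_lt S)

/-- The attaching map on a vertex of the cube. -/
def attachVertex (c : Fin (n + 1) → C) (d : C) (S : Proper (n + 1)) :
    htensor (P.obj c d) (fun i => vert V W (c i) (S.1 i)) ⟶ sub P f η n d :=
  fillMap P η S.1 c (fun a => c (enum S.1 a)) d (slotEquiv S.1) (slot_color S.1 c) ≫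
    cellIn P f η (size_lt' S) _ d

/-- The attaching map for given colours. -/
def attachCorner (c : Fin (n + 1) → C) (d : C) : cornerObj f (P.obj c d) c ⟶ sub P f η n d :=
  colimit.desc (cube f (P.obj c d) c)
    { pt := sub P f η n d
      ι :=
        { app := fun S => attachVertex P f η c d S
          naturality := fun S S' h => (fillMap_vertMap P f η S.1 S'.1 (leOfHom h) c d _ _ _ _ _ _ _ _
            (fun S'' ρ hρ => cellIn_fill P f η _ _ S'' _ _ d ρ hρ)).trans
              (Category.comp_id _).symm } }

theorem cornerIncl_attachCorner (c : Fin (n + 1) → C) (d : C) (S : Proper (n + 1)) :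
    cornerIncl f (P.obj c d) c S ≫ attachCorner P f η c d = attachVertex P f η c d S :=
  colimit.ι_desc _ _

/-- The attaching map on orbits. -/
def attachOrbit (c : Fin (n + 1) → C) (d : C) : orbitSrc P f c d ⟶ sub P f η n d :=
  quotDesc _ (attachCorner P f η c d) (srcRel_val P _ (by
    intro σ h S hS hS' θ x
    obtain ⟨τ, hτ⟩ := exists_permFill S σ (slotEquiv S)
    have hτ' : ∀ j w, c (enum S (τ ⟨j, w⟩)) = slotColor (c j) (S (σ j)) w := by
      intro j w
      rw [hτ]
      refine (slot_color S c (σ j) w).trans ?_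
      exact congrArg (fun a => slotColor a (S (σ j)) w) (h j)
    rw [cornerIncl_attachCorner, cornerIncl_attachCorner]
    unfold attachVertex
    rw [fillMap_cellIn P f η _ (size_lt' ⟨S, hS⟩) (fun i => S (σ i)) c d _ _ _
      (fun a => c (enum S a)) τ hτ', ev_comp,
      ev_comp]
    exact (congrArg _ (fillMap_relabel P η d σ h S (fun a => c (enum S a)) (slotEquiv S)
      (slot_color S c) τ hτ hτ' θ x)).trans (map_sgn _ _ _)))

/-- The attaching map. -/
def attachMap (n : ℕ) (d : C) : stepSrc P f (n + 1) d ⟶ sub P f η n d :=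
  Limits.Sigma.desc fun c => attachOrbit P f η c.out d

theorem vertexIncl_attachMap (d : C) (c : CollClass C (n + 1)) (S : Proper (n + 1)) :
    vertexIncl P f d c S ≫ attachMap P f η n d = attachVertex P f η c.out d S := by
  have h : srcIncl P f d c ≫ attachMap P f η n d = attachOrbit P f η c.out d :=
    Limits.Sigma.ι_desc _ _
  rw [vertexIncl_comp, h]
  exact cornerIncl_attachCorner P f η c.out d S

/-- The words with exactly `n` letters. -/
def stepIn (n : ℕ) (d : C) : stepTgt P W n d ⟶ sub P f η n d :=
  Limits.Sigma.desc fun c => quotDesc _ (cellIn P f η le_rfl c.out d)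
    (tgtRel_val P _ (fun σ h θ x => cellIn_relabel P f η le_rfl c.out c.out d σ h θ x))

theorem topIncl_stepIn (n : ℕ) (d : C) (c : CollClass C n) :
    topIncl P W d c ≫ stepIn P f η n d = cellIn P f η le_rfl c.out d := by
  rw [topIncl_comp]
  have h : tgtIncl P W d c ≫ stepIn P f η n d = quotDesc _ (cellIn P f η le_rfl c.out d) _ :=
    Limits.Sigma.ι_desc _ _
  rw [h]
  rfl

theorem step_comm (n : ℕ) (d : C) (h : (n : ℕ∞) ≤ (n + 1 : ℕ)) :
    stepMap P f (n + 1) d ≫ stepIn P f η (n + 1) d = attachMap P f η n d ≫ subIncl P f η h d := by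
  refine stepSrc_hom_ext P f fun c S => ?_
  rw [← Category.assoc, ← Category.assoc, vertexIncl_stepMap, vertexIncl_attachMap, Category.assoc,
    topIncl_stepIn, attachVertex, Category.assoc, cellIn_subIncl]
  exact cellIn_fill P f η _ _ S.1 _ _ d _ _

variable (W) in
/-- The action of isomorphisms of collections of colours on words. -/
def permMap {c c' : Fin n → C} (d : C) (σ : Equiv.Perm (Fin n)) (h : ∀ i, c' (σ i) = c i) :
    htensor (P.obj c d) (fun i => W (c i)) ⟶ htensor (P.obj c' d) (fun i => W (c' i)) :=
  fillMap P η (fun _ => true) c c' d (permSigma σ) (fun j _ => h j)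

variable (W) in
theorem ev_permMap {c c' : Fin n → C} (d : C) (σ : Equiv.Perm (Fin n)) (h : ∀ i, c' (σ i) = c i)
    (θ : Homog (P.obj c d)) (x : ∀ i, Homog (W (c' i))) :
    ev (permMap P W η d σ h) θ (fun i => recolor W (h i) (x (σ i))) =
      sgn (koszulSign σ (fun i => (x i).deg)) (hpure (P.relabel d σ h θ) x) :=
  fillMap_perm P η d σ h θ x

variable (W) in
theorem permMap_comp {c c' c'' : Fin n → C} (d : C) (σ τ ρ : Equiv.Perm (Fin n))
    (h : ∀ i, c' (σ i) = c i) (h' : ∀ i, c'' (τ i) = c' i) (h'' : ∀ i, c'' (ρ i) = c i)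
    (hρ : ∀ i, ρ i = τ (σ i)) :
    permMap P W η d σ h ≫ permMap P W η d τ h' = permMap P W η d ρ h'' :=
  fillMap_perm_fillMap P (W := W) η d σ h c'' (permSigma τ) (fun j _ => h' j) (permSigma ρ)
    (fun j _ => hρ j) (fun j _ => h'' j)

variable (W) in
theorem topIncl_aut (d : C) (q : CollClass C n) (σ : Equiv.Perm (Fin n))
    (h : ∀ i, q.out (σ i) = q.out i) :
    permMap P W η d σ h ≫ topIncl P W d q = topIncl P W d q := by
  refine htensor_hom_ext fun θ x => ?_
  obtain ⟨y, rfl⟩ := relabel_exists_args (V := V) (W := W) σ h (fun _ => true) x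
  have h₁ := congrArg (map (topIncl P W d q)) (ev_permMap P W η d σ h θ y)
  refine h₁.trans ((map_sgn _ _ _).trans ?_)
  have h₂ := congrArg (map (tgtIncl P W d q)) (ev_quotProj_relabel P σ h θ y)
  refine (congrArg (sgn _) (h₂.trans (map_sgn _ _ _))).trans ((sgn_sgn _ _ _).trans ?_)
  rw [Int.units_mul_self]
  exact sgn_one _

theorem permMap_topIncl (d : C) (c : Fin n → C) (q : CollClass C n)
    (σ σ' : Equiv.Perm (Fin n)) (h : ∀ i, q.out (σ i) = c i) (h' : ∀ i, q.out (σ' i) = c i) :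
    permMap P W η d σ h ≫ topIncl P W d q = permMap P W η d σ' h' ≫ topIncl P W d q := by
  have h₀ : ∀ i, q.out ((σ' * σ⁻¹) i) = q.out i := fun i => by
    obtain ⟨i, rfl⟩ := σ.surjective i
    rw [Equiv.Perm.mul_apply, h, ← h']
    simp
  rw [← topIncl_aut P W η d q (σ' * σ⁻¹) h₀, ← Category.assoc,
    permMap_comp P W η d σ (σ' * σ⁻¹) σ' h h₀ h' (fun i => by simp), topIncl_aut]

theorem exists_perm_out (c : Fin n → C) :
    ∃ (q : CollClass C n) (σ : Equiv.Perm (Fin n)), ∀ i, q.out (σ i) = c i :=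
  ⟨⟦c⟧, (collSetoid C n).symm (Quotient.mk_out c)⟩

theorem class_eq {c : Fin n → C} {q q' : CollClass C n} {σ σ' : Equiv.Perm (Fin n)}
    (h : ∀ i, q.out (σ i) = c i) (h' : ∀ i, q'.out (σ' i) = c i) : q = q' := by
  rw [← Quotient.out_eq q, ← Quotient.out_eq q']
  exact Quotient.sound ((collSetoid C n).trans ((collSetoid C n).symm ⟨σ, h⟩) ⟨σ', h'⟩)

theorem size_le_of_perm {N m : ℕ} (hN : N = m + 1) (S : Proper N) : ((size S.1 : ℕ) : ℕ∞) ≤ m := by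
  have := size_lt S
  exact_mod_cast (by omega : size S.1 ≤ m)

theorem exists_stepDesc {m N : ℕ} (hN : N = m + 1) (d : C) {Z : Cx k} (a : stepTgt P W N d ⟶ Z)
    (b : sub P f η m d ⟶ Z)
    (hab : ∀ (q : CollClass C N) (S : Proper N),
      cubeTop f (P.obj q.out d) q.out S.1 ≫ topIncl P W d q ≫ a =
        fillMap P η S.1 q.out (fun a => q.out (enum S.1 a)) d (slotEquiv S.1)
          (slot_color S.1 q.out) ≫ cellIn P f η (size_le_of_perm hN S) _ d ≫ b) :
    ∃ w : sub P f η N d ⟶ Z, (∀ (n : ℕ) (hn : (n : ℕ∞) ≤ m) (hn' : (n : ℕ∞) ≤ N) (c : Fin n → C),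
      cellIn P f η hn' c d ≫ w = cellIn P f η hn c d ≫ b) ∧
      ∀ q : CollClass C N, cellIn P f η le_rfl q.out d ≫ w = topIncl P W d q ≫ a := by
  have hex : ∀ (n : ℕ) (_ : (n : ℕ∞) ≤ N) (c : Fin n → C),
      ∃ g : htensor (P.obj c d) (fun i => W (c i)) ⟶ Z,
        (∀ h : (n : ℕ∞) ≤ m, g = cellIn P f η h c d ≫ b) ∧
        ∀ (h : n = N) (q : CollClass C n) (σ : Equiv.Perm (Fin n)) (hσ : ∀ i, q.out (σ i) = c i),
          g = permMap P W η d σ hσ ≫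
            topIncl P W d q ≫ eqToHom (by rw [h]) ≫ a := by
    intro n hn c
    by_cases h : n ≤ m
    · exact ⟨cellIn P f η (by exact_mod_cast h) c d ≫ b, fun _ => rfl, fun h' => by omega⟩
    · obtain rfl : n = N := by
        have : n ≤ N := by exact_mod_cast hn
        omega
      obtain ⟨q, σ, hσ⟩ := exists_perm_out c
      refine ⟨permMap P W η d σ hσ ≫
        topIncl P W d q ≫ a, fun h' => absurd (by exact_mod_cast h') h, ?_⟩
      intro h' q' σ' hσ'
      obtain rfl := class_eq hσ hσ'
      rw [eqToHom_refl, Category.id_comp, ← Category.assoc, ← Category.assoc,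
        permMap_topIncl P η d c q σ σ' hσ hσ']
  choose G hG₁ hG₂ using hex
  have hrel : ∀ r : FillData C N, cubeTop f (P.obj r.c d) r.c r.S ≫ G r.n r.hn r.c =
      fillMap P η r.S r.c r.c' d r.π r.h ≫ G r.l r.hl r.c' := by
    rintro ⟨n, c, S, l, c', π, h, hn, hl⟩
    dsimp only
    have hl' := size_eq S π
    have hln := size_le S
    by_cases hnm : n ≤ m
    · have hlm : l ≤ m := by omega
      rw [hG₁ n hn c (by exact_mod_cast hnm), hG₁ l hl c' (by exact_mod_cast hlm),
        ← Category.assoc, ← Category.assoc, cellIn_fill P f η _ _ S c c' d π h]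
    · obtain rfl : n = N := by
        have : n ≤ N := by exact_mod_cast hn
        omega
      obtain ⟨q, σ, hσ⟩ := exists_perm_out c
      rw [hG₂ n hn c rfl q σ hσ, eqToHom_refl, Category.id_comp]
      by_cases hS : S = fun _ => true
      · subst hS
        obtain rfl : n = l := size_true.symm.trans hl'
        obtain ⟨ρ, rfl⟩ := exists_eq_permSigma π
        have hρ : ∀ i, c' (ρ i) = c i := fun i => h i (0 : Fin 1)
        have hσ' : ∀ i, q.out ((σ * ρ⁻¹) i) = c' i := fun i => by
          obtain ⟨i, rfl⟩ := ρ.surjective i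
          rw [Equiv.Perm.mul_apply, hρ, ← hσ]
          simp
        rw [hG₂ n hl c' rfl q (σ * ρ⁻¹) hσ', eqToHom_refl, Category.id_comp]
        have h₁ := permMap_comp P W η d ρ (σ * ρ⁻¹) σ hρ hσ' hσ (fun i => by simp)
        refine Eq.trans ?_ ((congrArg (· ≫ topIncl P W d q ≫ a) h₁.symm).trans
          (Category.assoc _ _ _))
        refine Homog.hom_ext fun z => ?_
        exact congrArg (map (permMap P W η d σ hσ ≫ topIncl P W d q ≫ a))
          (map_cubeTop_true f (P.obj c d) c z)
      · have hlm : size S < n := size_lt ⟨S, hS⟩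
        rw [hG₁ l hl c' (by exact_mod_cast (by omega : l ≤ m))]
        obtain ⟨S₀, rfl⟩ : ∃ S₀ : Fin n → Bool, S = fun i => S₀ (σ i) :=
          ⟨fun i => S (σ⁻¹ i), by simp⟩
        have hS₀ : S₀ ≠ fun _ => true := by
          rintro rfl
          exact hS rfl
        refine htensor_hom_ext fun θ x => ?_
        obtain ⟨y, rfl⟩ := relabel_exists_args (V := V) (W := W) σ hσ S₀ x
        obtain ⟨τ, hτ⟩ := exists_permFill S₀ σ (slotEquiv S₀)
        have hτ' : ∀ j w, q.out (enum S₀ (τ ⟨j, w⟩)) = slotColor (c j) (S₀ (σ j)) w := by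
          intro j w
          rw [hτ]
          refine (slot_color S₀ q.out (σ j) w).trans ?_
          exact congrArg (fun a => slotColor a (S₀ (σ j)) w) (hσ j)
        have h₁ := ev_permMap P W η d σ hσ θ
          (fun i => map (vertTop f (q.out i) (S₀ i)) (y i))
        have h₂ := congrArg (fun F => ev F (P.relabel d σ hσ θ) y) (hab q ⟨S₀, hS₀⟩)
        have h₃ := fillMap_relabel P η d σ hσ S₀ (fun a => q.out (enum S₀ a)) (slotEquiv S₀)
          (slot_color S₀ q.out) τ hτ hτ' θ y
        have h₄ := fillMap_cellIn P f η (N := (m : ℕ∞)) (size_le_of_perm hN ⟨S₀, hS₀⟩)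
          (by exact_mod_cast (by omega : l ≤ m)) (fun i => S₀ (σ i)) c d
          (fun a => q.out (enum S₀ a)) τ hτ' c' π h
        have e₁ : ev (cubeTop f (P.obj c d) c (fun i => S₀ (σ i)) ≫ permMap P W η d σ hσ ≫ topIncl P W d q ≫ a) θ
            (fun i => recolor (fun a => vert V W a (S₀ (σ i))) (hσ i) (y (σ i))) =
            map (topIncl P W d q ≫ a) (sgn (koszulSign σ fun i => (y i).deg)
              (hpure (P.relabel d σ hσ θ)
                (fun i => map (vertTop f (q.out i) (S₀ i)) (y i)))) := by
          refine Eq.trans (b := map (permMap P W η d σ hσ ≫ topIncl P W d q ≫ a)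
            (hpure θ fun i => recolor W (hσ i) (map (vertTop f (q.out (σ i)) (S₀ (σ i)))
              (y (σ i))))) ?_ (congrArg (map (topIncl P W d q ≫ a)) h₁)
          refine (congrArg (map (permMap P W η d σ hσ ≫ topIncl P W d q ≫ a))
            (map_cubeTop f (P.obj c d) c (fun i => S₀ (σ i)) θ _)).trans ?_
          congr 2
          funext i
          exact recolor_vertTop f (hσ i) (S₀ (σ i)) (y (σ i))
        refine e₁.trans ((map_sgn _ _ _).trans ?_)
        have e₂ : map (topIncl P W d q ≫ a) (hpure (P.relabel d σ hσ θ)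
            (fun i => map (vertTop f (q.out i) (S₀ i)) (y i))) = _ :=
          (congrArg (map (topIncl P W d q ≫ a))
            (map_cubeTop f (P.obj q.out d) q.out S₀ _ y).symm).trans h₂
        rw [e₂, ← Category.assoc (fillMap _ _ _ c c' _ _ _), ← h₄]
        refine (congrArg (fun z => sgn _ (map (cellIn P f η
          (size_le_of_perm hN ⟨S₀, hS₀⟩) (fun a => q.out (enum S₀ a)) d ≫ b) z)) h₃).trans ?_
        rw [map_sgn, sgn_sgn, Int.units_mul_self, sgn_one]
        rfl
  obtain ⟨w, hw⟩ := exists_subDesc P f η G hrel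
  refine ⟨w, fun n hn hn' c => by rw [hw, hG₁ n hn' c hn], fun q => ?_⟩
  rw [hw, hG₂ N le_rfl q.out rfl q 1 (fun _ => rfl), eqToHom_refl, Category.id_comp]
  exact (Category.assoc _ _ _).symm.trans
    (congrArg (· ≫ a) (topIncl_aut P W η d q 1 (fun _ => rfl)))

theorem permMap_cellIn {N : ℕ∞} (hn : (n : ℕ∞) ≤ N) (c c' : Fin n → C) (d : C)
    (σ : Equiv.Perm (Fin n)) (h : ∀ i, c' (σ i) = c i) :
    permMap P W η d σ h ≫ cellIn P f η hn c' d = cellIn P f η hn c d := by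
  refine Homog.hom_ext fun z => ?_
  have h₁ := congrArg (fun F => map F z)
    (cellIn_fill P f η hn hn (fun _ => true) c c' d (permSigma σ) (fun j _ => h j))
  exact h₁.symm.trans (congrArg (map (cellIn P f η hn c d))
    (map_cubeTop_true f (P.obj c d) c z))

theorem sub_hom_ext_step {n : ℕ} (d : C) {Z : Cx k} (h : (n : ℕ∞) ≤ (n + 1 : ℕ))
    {w w' : sub P f η (n + 1 : ℕ) d ⟶ Z}
    (h₁ : subIncl P f η h d ≫ w = subIncl P f η h d ≫ w')
    (h₂ : ∀ q : CollClass C (n + 1),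
      cellIn P f η le_rfl q.out d ≫ w = cellIn P f η le_rfl q.out d ≫ w') : w = w' := by
  refine sub_hom_ext P f η fun l hl c => ?_
  by_cases hln : l ≤ n
  · have hln' : (l : ℕ∞) ≤ n := by exact_mod_cast hln
    rw [← cellIn_subIncl P f η h d hln' c, Category.assoc, Category.assoc, h₁]
  · obtain rfl : l = n + 1 := by
      have : l ≤ n + 1 := by exact_mod_cast hl
      omega
    obtain ⟨q, σ, hσ⟩ := exists_perm_out c
    rw [← permMap_cellIn P f η hl c q.out d σ hσ, Category.assoc, Category.assoc, h₂]

theorem isPushout_step (n : ℕ) (d : C) (h : (n : ℕ∞) ≤ (n + 1 : ℕ)) :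
    IsPushout (stepMap P f (n + 1) d) (attachMap P f η n d) (stepIn P f η (n + 1) d)
      (subIncl P f η h d) := by
  have H : ∀ s : PushoutCocone (stepMap P f (n + 1) d) (attachMap P f η n d),
      ∃ w : sub P f η (n + 1 : ℕ) d ⟶ s.pt,
        subIncl P f η h d ≫ w = s.inr ∧ stepIn P f η (n + 1) d ≫ w = s.inl := by
    intro s
    obtain ⟨w, hw₁, hw₂⟩ := exists_stepDesc P f η rfl d s.inl s.inr (by
      intro q S
      have := congrArg (vertexIncl P f d q S ≫ ·) s.condition
      simp only [← Category.assoc] at this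
      rw [vertexIncl_stepMap, vertexIncl_attachMap] at this
      rw [← Category.assoc, this, attachVertex, Category.assoc])
    refine ⟨w, sub_hom_ext P f η fun l hl c => ?_, stepTgt_hom_ext P fun q => ?_⟩
    · rw [← Category.assoc, cellIn_subIncl P f η h d, hw₁ l hl]
    · rw [← Category.assoc, topIncl_stepIn, hw₂]
  choose w hw₁ hw₂ using H
  refine ⟨⟨step_comm P f η n d h⟩, ⟨PushoutCocone.IsColimit.mk _ w hw₂ hw₁ ?_⟩⟩
  intro s m h₁ h₂
  refine sub_hom_ext_step P f η d h (h₂.trans (hw₁ s).symm) fun q => ?_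
  rw [← topIncl_stepIn, Category.assoc, Category.assoc, h₁, hw₂]

end Steps

/-! ## Nullary operations -/

section Nullary

/-- The identification of a tensor product with no further factors. -/
def nilIn (Q : Cx k) (Y : Fin 0 → Cx k) : Q ⟶ htensor Q Y :=
  homOfLin (fun θ => hpure θ (fun i => i.elim0)) (hpure_isLin _) (fun θ => hpure_nil_diff θ _)

theorem map_nilIn (Q : Cx k) (Y : Fin 0 → Cx k) (θ : Homog Q) (y : ∀ i, Homog (Y i)) :
    map (nilIn Q Y) θ = hpure θ y := by
  obtain rfl : y = fun i => i.elim0 := funext fun i => i.elim0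
  exact map_homOfLin _ _ _ (fun θ => by rw [deg_hpure, Fin.sum_univ_zero, add_zero]) θ

variable {P : ColoredOperad k C}

/-- The map from the algebra of nullary operations to an algebra. -/
def nullaryMap {Z : Coll k C} (t : AlgStr P Z) (d : C) : P.obj (Fin.elim0 : Fin 0 → C) d ⟶ Z d :=
  nilIn _ _ ≫ t.act (Fin.elim0 : Fin 0 → C) d

theorem map_nullaryMap {Z : Coll k C} (t : AlgStr P Z) (d : C)
    (θ : Homog (P.obj (Fin.elim0 : Fin 0 → C) d)) (y : ∀ i : Fin 0, Homog (Z (Fin.elim0 i))) :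
    map (nullaryMap t d) θ = ev (t.act (Fin.elim0 : Fin 0 → C) d) θ y := by
  rw [nullaryMap, map_comp, map_nilIn _ _ _ y]
  rfl

theorem evNullary_eq {A Z : Coll k C} (η : ∀ d, A d ⟶ P.obj (Fin.elim0 : Fin 0 → C) d)
    (t : AlgStr P Z) (d : C) (a : Homog (A d)) :
    evNullary η t d a = map (η d ≫ nullaryMap t d) a :=
  (map_nullaryMap t d _ _).symm

theorem act_comp_of {Z : Coll k C} (t : AlgStr P Z) {n l : ℕ} {m : Fin n → ℕ} (d : Fin n → C)
    (b : ∀ j, Fin (m j) → C) (c : Fin l → C) (e : C) (π : (Σ j, Fin (m j)) ≃ Fin l)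
    (h : ∀ j y, c (π ⟨j, y⟩) = b j y) (θ : Homog (P.obj d e))
    (φ : ∀ j, Homog (P.obj (b j) (d j))) (x : ∀ i, Homog (Z (c i))) :
    ev (t.act c e) (ev (P.comp d b c e π h) θ φ) x =
      sgn (shuffleSign π (fun j => (φ j).deg) (fun i => (x i).deg))
        (ev (t.act d e) θ (fun j => ev (t.act (b j) (d j)) (φ j)
          (fun y => recolor Z (h j y) (x (π ⟨j, y⟩))))) := by
  obtain rfl : b = fun j y => c (π ⟨j, y⟩) := funext fun j => funext fun y => (h j y).symm
  exact t.act_comp d c e π θ φ x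

theorem isAlgHom_nullaryMap {Z : Coll k C} (t : AlgStr P Z) :
    IsAlgHom (nullary P) t (nullaryMap t) := by
  intro n c d θ x
  have h := act_comp_of t c (fun _ => Fin.elim0) Fin.elim0 d emptySigma (fun _ y => y.elim0) θ x
    (fun i => i.elim0)
  rw [shuffleSign_empty, sgn_one] at h
  refine (map_nullaryMap t d _ (fun i => i.elim0)).trans (h.trans ?_)
  exact congrArg (ev _ θ) (funext fun j => (map_nullaryMap t (c j) _ _).symm)

theorem comp_nil {m : Fin 0 → ℕ} (c : Fin 0 → C) (b : ∀ j : Fin 0, Fin (m j) → C) (d : C)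
    (π : (Σ j, Fin (m j)) ≃ Fin 0) (h : ∀ j y, c (π ⟨j, y⟩) = b j y) (θ : Homog (P.obj c d))
    (φ : ∀ j, Homog (P.obj (b j) (c j))) : ev (P.comp c b c d π h) θ φ = θ := by
  obtain rfl : m = fun _ => 1 := funext fun j => j.elim0
  obtain rfl : b = fun j _ => c j := funext fun j => j.elim0
  obtain rfl : φ = fun j => P.unit (c j) := funext fun j => j.elim0
  exact P.comp_one c d π (fun j => j.elim0) θ

theorem nullary_act_nil (d : C) (θ : Homog (P.obj (Fin.elim0 : Fin 0 → C) d))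
    (y : ∀ i : Fin 0, Homog (P.obj (Fin.elim0 : Fin 0 → C) (Fin.elim0 i : C))) :
    ev ((nullary P).act (Fin.elim0 : Fin 0 → C) d) θ y = θ :=
  comp_nil _ _ _ _ _ _ _

theorem nullary_hom_eq {g : ∀ d, P.obj (Fin.elim0 : Fin 0 → C) d ⟶ P.obj (Fin.elim0 : Fin 0 → C) d}
    (hg : IsAlgHom (nullary P) (nullary P) g) (d : C) : g d = 𝟙 _ := by
  refine Homog.hom_ext fun θ => ?_
  have h := hg (Fin.elim0 : Fin 0 → C) d θ (fun i => i.elim0)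
  rw [nullary_act_nil, nullary_act_nil] at h
  exact h

theorem isAlgHom_comp {X Y Z : Coll k C} {s : AlgStr P X} {t : AlgStr P Y} {r : AlgStr P Z}
    {f : ∀ d, X d ⟶ Y d} {g : ∀ d, Y d ⟶ Z d} (hf : IsAlgHom s t f) (hg : IsAlgHom t r g) :
    IsAlgHom s r (fun d => f d ≫ g d) := fun c d θ x => by
  simp only [map_comp]
  rw [hf, hg]

theorem isAlgHom_restrict {O : ColoredOperad k C} (φ : OperadHom O P) {X Y : Coll k C}
    {s : AlgStr P X} {t : AlgStr P Y} {f : ∀ d, X d ⟶ Y d} (hf : IsAlgHom s t f) :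
    IsAlgHom (s.restrict φ) (t.restrict φ) f := fun c d θ x => by
  rw [ev_restrict, ev_restrict, hf]

end Nullary

section Envelope

variable {O : ColoredOperad k C} {A : Alg O}
  (E : EnvelopingOperad O A)

/-- The algebra structure on `A` over its enveloping operad. -/
theorem EnvelopingOperad.exists_self : ∃ t : AlgStr E.operad A.X, t.restrict E.φ = A.str ∧
    ∀ d (a : Homog (A.X d)), evNullary E.η t d a = a := by
  obtain ⟨t, ht, -⟩ := E.existsUnique_algStr A.X A.str (fun d => 𝟙 _) (fun _ _ _ _ => rfl)
  exact ⟨t, ht⟩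

/-- The algebra structure on `A` over its enveloping operad. -/
def EnvelopingOperad.self : AlgStr E.operad A.X := E.exists_self.choose

theorem EnvelopingOperad.self_restrict : E.self.restrict E.φ = A.str := E.exists_self.choose_spec.1

theorem EnvelopingOperad.η_nullaryMap (d : C) : E.η d ≫ nullaryMap E.self d = 𝟙 _ :=
  Homog.hom_ext fun a => (evNullary_eq E.η E.self d a).symm.trans (E.exists_self.choose_spec.2 d a)

theorem EnvelopingOperad.nullaryMap_η (d : C) : nullaryMap E.self d ≫ E.η d = 𝟙 _ := by
  refine nullary_hom_eq (g := fun d => nullaryMap E.self d ≫ E.η d) (E.isAlgHom _ _ _ _ _ ?_ ?_) d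
  · refine isAlgHom_comp (isAlgHom_restrict E.φ (isAlgHom_nullaryMap E.self)) ?_
    rw [E.self_restrict]
    exact E.isAlgHom_η
  · intro d a
    have h : evNullary E.η (nullary E.operad) d a = Homog.map (E.η d) a := nullary_act_nil d _ _
    rw [h, ← map_comp, ← Category.assoc, E.η_nullaryMap, Category.id_comp]

end Envelope

/-! ## Attaching cells -/

section Attach

variable {O : ColoredOperad k C} {A : Alg O}
  {V W : Coll k C}

@[simp] theorem Alg.comp_f {A B D : Alg O} (u : A ⟶ B) (v : B ⟶ D) (d : C) :
    (u ≫ v).f d = u.f d ≫ v.f d := rfl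

@[simp] theorem Alg.id_f (A : Alg O) (d : C) : Alg.Hom.f (𝟙 A) d = 𝟙 (A.X d) := rfl

/-- `B` is obtained from `A` by attaching the free algebra on `W` along the free algebra
on `V`. -/
structure IsCellAttach (f : V ⟶ W) {A B : Alg O} (α : ∀ d, V d ⟶ A.X d) (i : A ⟶ B)
    (β : ∀ d, W d ⟶ B.X d) : Prop where
  comm : ∀ d, f d ≫ β d = α d ≫ i.f d
  existsUnique : ∀ (Z : Alg O) (j : A ⟶ Z) (γ : ∀ d, W d ⟶ Z.X d),
    (∀ d, f d ≫ γ d = α d ≫ j.f d) → ∃! h : B ⟶ Z, i ≫ h = j ∧ ∀ d, β d ≫ h.f d = γ d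

theorem IsCellAttach.exists_iso {f : V ⟶ W} {A B B' : Alg O} {α : ∀ d, V d ⟶ A.X d} {i : A ⟶ B}
    {β : ∀ d, W d ⟶ B.X d} {i' : A ⟶ B'} {β' : ∀ d, W d ⟶ B'.X d} (h : IsCellAttach f α i β)
    (h' : IsCellAttach f α i' β') : ∃ e : B ≅ B', i ≫ e.hom = i' ∧
      ∀ d, β d ≫ e.hom.f d = β' d := by
  obtain ⟨u, ⟨hu₁, hu₂⟩, -⟩ := h.existsUnique B' i' β' h'.comm
  obtain ⟨v, ⟨hv₁, hv₂⟩, -⟩ := h'.existsUnique B i β h.comm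
  refine ⟨⟨u, v, ?_, ?_⟩, hu₁, hu₂⟩
  · refine (h.existsUnique B i β h.comm).unique ⟨?_, fun d => ?_⟩ ⟨Category.comp_id _, fun d => ?_⟩
    · rw [← Category.assoc, hu₁, hv₁]
    · rw [Alg.comp_f, ← Category.assoc, hu₂, hv₂]
    · rw [Alg.id_f, Category.comp_id]
  · refine (h'.existsUnique B' i' β' h'.comm).unique ⟨?_, fun d => ?_⟩
      ⟨Category.comp_id _, fun d => ?_⟩
    · rw [← Category.assoc, hv₁, hu₁]
    · rw [Alg.comp_f, ← Category.assoc, hv₂, hu₂]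
    · rw [Alg.id_f, Category.comp_id]

theorem isCellAttach_of_isPushout {F : Coll k C ⥤ Alg O} (adj : F ⊣ Alg.forget O) {f : V ⟶ W}
    {A B : Alg O} {g : F.obj V ⟶ A} {j : F.obj W ⟶ B} {i : A ⟶ B}
    (h : IsPushout (F.map f) g j i) :
    IsCellAttach f (adj.homEquiv V A g) i (adj.homEquiv W B j) where
  comm d := by
    have h₁ := adj.homEquiv_naturality_left f j
    have h₂ := adj.homEquiv_naturality_right g i
    exact congrFun (h₁.symm.trans ((congrArg (adj.homEquiv V B) h.w).trans h₂)) d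
  existsUnique Z j' γ hγ := by
    obtain ⟨δ, rfl⟩ : ∃ δ : F.obj W ⟶ Z, adj.homEquiv W Z δ = γ := (adj.homEquiv W Z).surjective γ
    have hw : F.map f ≫ δ = g ≫ j' :=
      (adj.homEquiv V Z).injective ((adj.homEquiv_naturality_left f δ).trans
        (Eq.trans (funext hγ) (adj.homEquiv_naturality_right g j').symm))
    refine ⟨h.desc _ _ hw, ⟨h.inr_desc _ _ hw, fun d => ?_⟩, ?_⟩
    · have h₁ := adj.homEquiv_naturality_right j (h.desc _ _ hw)
      rw [h.inl_desc] at h₁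
      exact (congrFun h₁ d).symm
    · rintro w ⟨h₁, h₂⟩
      refine h.hom_ext ?_ ?_
      · rw [h.inl_desc]
        exact (adj.homEquiv W Z).injective ((adj.homEquiv_naturality_right j w).trans (funext h₂))
      · rw [h.inr_desc, h₁]

variable (E : EnvelopingOperad O A) (f : V ⟶ W) (α : ∀ d, V d ⟶ A.X d)

/-- The map from `V` to the nullary operations. -/
def cellη (d : C) : V d ⟶ E.operad.obj (Fin.elim0 : Fin 0 → C) d := α d ≫ E.η d

/-- The algebra obtained from `A` by attaching cells. -/
def cellAlg : Alg O := ⟨sub E.operad f (cellη E α) ⊤, (subStr E.operad f (cellη E α)).restrict E.φ⟩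

/-- The map from `A` to the algebra obtained by attaching cells. -/
def cellAlgIn : A ⟶ cellAlg E f α :=
  ⟨fun d => E.η d ≫ nullaryMap (subStr E.operad f (cellη E α)) d,
    isAlgHom_comp E.isAlgHom_η (isAlgHom_restrict E.φ (isAlgHom_nullaryMap _))⟩

/-- The letters of the algebra obtained by attaching cells. -/
def cellAlgLetter (d : C) : W d ⟶ (cellAlg E f α).X d := letterIn E.operad f (cellη E α) le_top d

theorem isCellAttach_cellAlg : IsCellAttach f α (cellAlgIn E f α) (cellAlgLetter E f α) where
  comm d := by
    refine Homog.hom_ext fun v => ?_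
    have h₁ := letterIn_V (P := E.operad) (f := f) (η := cellη E α) d v
    rw [evNullary_eq, cellη, Category.assoc] at h₁
    exact h₁
  existsUnique Z j γ hγ := by
    obtain ⟨t, ⟨ht₁, ht₂⟩, -⟩ := E.existsUnique_algStr Z.X Z.str j.f j.isAlgHom
    have hγ' : ∀ d (v : Homog (V d)), map (γ d) (map (f d) v) =
        evNullary (cellη E α) t d v := by
      intro d v
      refine (congrArg (fun F => map F v) (hγ d)).trans ?_
      exact (ht₂ d (map (α d) v)).symm
    obtain ⟨g, ⟨hg₁, hg₂⟩, hg₃⟩ := existsUnique_subHom t γ hγ'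
    have hg₄ : IsAlgHom (cellAlg E f α).str Z.str g := by
      rw [← ht₁]
      exact isAlgHom_restrict E.φ hg₁
    have key : ∀ (g : ∀ d, (cellAlg E f α).X d ⟶ Z.X d), IsAlgHom (subStr E.operad f (cellη E α)) t g →
        ∀ d a, map (g d) (evNullary E.η (subStr E.operad f (cellη E α)) d a) =
          map (j.f d) a := fun g hg d a => by
      rw [← ht₂]
      refine (hg _ d _ _).trans ?_
      exact congrArg (ev _ _) (funext fun i => i.elim0)
    refine ⟨⟨g, hg₄⟩, ⟨?_, hg₂⟩, ?_⟩
    · apply Alg.Hom.ext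
      funext d
      refine Homog.hom_ext fun a => ?_
      exact (congrArg (map (g d)) (evNullary_eq _ _ d a).symm).trans (key g hg₁ d a)
    · rintro ⟨g', hg'⟩ ⟨h₁, h₂⟩
      apply Alg.Hom.ext
      refine hg₃ g' ⟨E.isAlgHom _ _ _ _ _ ?_ ?_, h₂⟩
      · rw [ht₁]
        exact hg'
      · intro d a
        rw [ht₂]
        refine (congrArg (map (g' d)) (evNullary_eq _ _ d a)).trans ?_
        exact congrArg (fun F : A ⟶ Z => map (F.f d) a) h₁

end Attach

/-! ## Free algebras -/

section Free

variable (P : ColoredOperad k C) (W : Coll k C)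

/-- The map from the initial collection. -/
def fromInitial (W : Coll k C) : (fun _ : C => ⊥_ (Cx k)) ⟶ W := fun d => initial.to (W d)

/-- The free algebra. -/
def freeAlg : Alg P := ⟨sub P (fromInitial W) (fun _ => initial.to _) ⊤, subStr P _ _⟩

/-- The letters of the free algebra. -/
def freeLetter : W ⟶ (freeAlg P W).X :=
  fun d => letterIn P (fromInitial W) (fun _ => initial.to _) le_top d

theorem existsUnique_freeHom (Z : Alg P) (γ : W ⟶ Z.X) :
    ∃! h : freeAlg P W ⟶ Z, freeLetter P W ≫ (Alg.forget P).map h = γ := by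
  obtain ⟨g, ⟨hg₁, hg₂⟩, hg₃⟩ := existsUnique_subHom (f := fromInitial W)
    (η := fun _ => initial.to _) Z.str γ (fun d v => by
      rw [evNullary_eq, ← map_comp]
      congr 1
      exact initial.hom_ext _ _)
  refine ⟨⟨g, hg₁⟩, funext hg₂, ?_⟩
  rintro ⟨g', hg'⟩ h
  apply Alg.Hom.ext
  exact hg₃ g' ⟨hg', fun d => congrFun h d⟩

theorem isRightAdjoint_forget : (Alg.forget P).IsRightAdjoint := by
  have : ∀ W : Coll k C, HasInitial (StructuredArrow W (Alg.forget P)) := fun W => by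
    refine IsInitial.hasInitial (X := StructuredArrow.mk (Y := freeAlg P W) (freeLetter P W)) ?_
    refine IsInitial.ofUniqueHom (fun Z => StructuredArrow.homMk
      (existsUnique_freeHom P W Z.right Z.hom).choose
      (existsUnique_freeHom P W Z.right Z.hom).choose_spec.1) fun Z m => ?_
    refine StructuredArrow.hom_ext _ _ ?_
    exact (existsUnique_freeHom P W Z.right Z.hom).choose_spec.2 m.right (StructuredArrow.w m)
  exact isRightAdjointOfStructuredArrowInitials _

end Free

/-! ## The cellular filtration -/

section Signs

variable {n : ℕ}

theorem sum_enum (S : Fin n → Bool) (g : Fin n → ℤ) :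
    ∑ a, g (enum S a) = ∑ i, if S i = true then g i else 0 := by
  rw [← Finset.sum_filter]
  have : Finset.univ.filter (fun i => S i = true) = Finset.univ.map (enum S).toEmbedding :=
    ((supp S).map_orderEmbOfFin_univ rfl).symm
  rw [this, Finset.sum_map]
  rfl

theorem shuffleSign_slotEquiv (S : Fin n → Bool) (q : Fin n → ℤ) :
    shuffleSign (slotEquiv S) (fun j => if S j = true then 0 else q j) (fun a => q (enum S a)) =
      splitSign S q := by
  have h : ∀ a, ((slotEquiv S).symm a).1 = enum S a := fun a => by
    rw [← enum_slotEquiv S ((slotEquiv S).symm a), Equiv.apply_symm_apply]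
  unfold shuffleSign splitSign
  congr 1
  have h₂ : ∀ i i' : Fin (size S), (if i < i' ∧ (((slotEquiv S).symm i').1 < ((slotEquiv S).symm i).1 ∨
      (((slotEquiv S).symm i').1 = ((slotEquiv S).symm i).1 ∧
        (((slotEquiv S).symm i').2 : ℕ) < (((slotEquiv S).symm i).2 : ℕ)))
      then q (enum S i) * q (enum S i') else 0) = 0 := by
    intro i i'
    refine if_neg ?_
    rintro ⟨h₁, h₂⟩
    have := (enum S).strictMono h₁
    rcases h₂ with h₂ | ⟨h₂, -⟩ <;> rw [h, h] at h₂
    · exact absurd (h₂.trans this) (lt_irrefl _)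
    · exact this.ne' h₂
  rw [Finset.sum_eq_zero (fun i _ => Finset.sum_eq_zero fun i' _ => h₂ i i'), add_zero]
  simp only [h]
  rw [Finset.sum_comm]
  rw [sum_enum S (fun i => ∑ j, if i < j then (if S j = true then 0 else q j) * q i else 0)]
  refine Finset.sum_congr rfl fun i _ => ?_
  by_cases hi : S i = true
  · rw [if_pos hi]
    refine Finset.sum_congr rfl fun j _ => ?_
    by_cases hj : S j = true
    · simp [hj]
    · simp [hi, hj, mul_comm]
  · simp [hi]

end Signs

section Attaching

variable {O : ColoredOperad k C} {A : Alg O}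
  {V W : Coll k C} (E : EnvelopingOperad O A) (f : V ⟶ W) (α : ∀ d, V d ⟶ A.X d)

theorem deg_slotOp (a : C) (b : Bool) (x : Homog (vert V W a b)) :
    (slotOp E α a b x).deg = if b = true then 0 else x.deg := by
  cases b <;> rfl

theorem deg_slotElt {a : C} (b : Bool) (h : b = true) (x : Homog (vert V W a b)) :
    (slotElt b h x).deg = x.deg := by
  subst h; rfl

theorem slotVal_eq (a : C) (b : Bool) (x : Homog (vert V W a b))
    (z : ∀ y : Fin (slotArity b), Homog (W (slotColor a b y)))
    (hz : ∀ y, z y = recolor W (slotColor_eq a b y) (slotElt b (slotArity_pos y) x)) :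
    slotVal E.operad (cellη E α) a b x = hpure (slotOp E α a b x) z := by
  cases b
  · have : z = fun y => y.elim0 := funext fun y => y.elim0
    subst this
    rfl
  · have : z = fun _ => x := funext hz
    subst this
    rfl

theorem map_fillMap_slotEquiv {n : ℕ} (c : Fin n → C) (d : C) (S : Fin n → Bool)
    (θ : Homog (E.operad.obj c d)) (x : ∀ i, Homog (vert V W (c i) (S i))) :
    map (fillMap E.operad (cellη E α) S c (fun a => c (enum S a)) d (slotEquiv S)
      (slot_color S c)) (hpure θ x) =
      sgn (splitSign S (fun i => (x i).deg)) (hpure (fillOp E α c d S θ x)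
        (fun a => slotElt (S (enum S a)) (enum_mem S a) (x (enum S a)))) := by
  rw [map_fillMap]
  have h₁ := ev_actMap (P := E.operad) (W := W) (slotEquiv S) (slot_color S c) θ
    (fun j => slotOp E α (c j) (S j) (x j))
    (fun a => slotElt (S (enum S a)) (enum_mem S a) (x (enum S a)))
  have h₂ : (fun j => slotVal E.operad (cellη E α) (c j) (S j) (x j)) = fun j =>
      hpure (slotOp E α (c j) (S j) (x j)) (fun y => recolor W (slot_color S c j y)
        (slotElt (S (enum S (slotEquiv S ⟨j, y⟩))) (enum_mem S (slotEquiv S ⟨j, y⟩))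
          (x (enum S (slotEquiv S ⟨j, y⟩))))) := by
    funext j
    refine slotVal_eq E α _ _ _ _ fun y => ?_
    have key : ∀ (i : Fin n) (hi : i = j) (h : S i = true) (h' : c i = slotColor (c j) (S j) y),
        recolor W h' (slotElt (S i) h (x i)) =
          recolor W (slotColor_eq (c j) (S j) y) (slotElt (S j) (slotArity_pos y) (x j)) := by
      rintro i rfl h h'
      rfl
    exact key _ (enum_slotEquiv S ⟨j, y⟩) _ _
  rw [h₂, h₁]
  simp only [deg_slotOp, deg_slotElt]
  rw [shuffleSign_slotEquiv S (fun i => (x i).deg)]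
  rfl

/-- The sequence of words with a bounded number of letters. -/
def subSeq (P : ColoredOperad k C) (η : ∀ d, V d ⟶ P.obj (Fin.elim0 : Fin 0 → C) d) :
    ℕ ⥤ Coll k C where
  obj n := fun d => sub P f η n d
  map h := fun d => subIncl P f η (by exact_mod_cast leOfHom h) d
  map_id n := funext fun d => subIncl_refl P f η n d
  map_comp h h' := funext fun d => (subIncl_trans P f η _ _ d).symm

theorem exists_colimDesc (P : ColoredOperad k C) (η : ∀ d, V d ⟶ P.obj (Fin.elim0 : Fin 0 → C) d)
    (d : C) {Z : Cx k} (b : ∀ n : ℕ, sub P f η n d ⟶ Z)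
    (hb : ∀ (n m : ℕ) (h : (n : ℕ∞) ≤ m), subIncl P f η h d ≫ b m = b n) :
    ∃ w : sub P f η ⊤ d ⟶ Z, ∀ n : ℕ, subIncl P f η le_top d ≫ w = b n := by
  obtain ⟨w, hw⟩ := exists_subDesc P f η (N := ⊤) (d := d)
    (fun n _ c => cellIn P f η le_rfl c d ≫ b n) (by
      rintro ⟨n, c, S, l, c', π, h, hn, hl⟩
      dsimp only
      have hl' := size_eq S π
      have hln := size_le S
      have hln' : (l : ℕ∞) ≤ n := by exact_mod_cast (by omega : l ≤ n)
      rw [← Category.assoc, cellIn_fill P f η le_rfl hln' S c c' d π h, ← hb l n hln',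
        ← Category.assoc (cellIn P f η _ c' d), cellIn_subIncl, Category.assoc])
  refine ⟨w, fun n => sub_hom_ext P f η fun m hm c => ?_⟩
  rw [← Category.assoc, cellIn_subIncl, hw, ← hb m n hm, ← Category.assoc, cellIn_subIncl]

theorem colim_hom_ext (P : ColoredOperad k C) (η : ∀ d, V d ⟶ P.obj (Fin.elim0 : Fin 0 → C) d)
    (d : C) {Z : Cx k} {w w' : sub P f η ⊤ d ⟶ Z}
    (h : ∀ n : ℕ, subIncl P f η (le_top (a := (n : ℕ∞))) d ≫ w = subIncl P f η le_top d ≫ w') :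
    w = w' := by
  refine sub_hom_ext P f η fun n _ c => ?_
  rw [← cellIn_subIncl P f η (le_top (a := (n : ℕ∞))) d le_rfl c, Category.assoc, Category.assoc, h]

/-- Words without letters. -/
def zeroIn (d : C) : A.X d ⟶ sub E.operad f (cellη E α) (0 : ℕ) d :=
  E.η d ≫ nilIn _ _ ≫ cellIn E.operad f (cellη E α) le_rfl (Fin.elim0 : Fin 0 → C) d

theorem wordEval_fillMap_nil {P : ColoredOperad k C} {Z : Coll k C} (t : AlgStr P Z)
    (γ : ∀ d, W d ⟶ Z d) (η : ∀ d, V d ⟶ P.obj (Fin.elim0 : Fin 0 → C) d) {n l : ℕ} (hn : n = 0)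
    (S : Fin n → Bool) (c : Fin n → C) (c' : Fin l → C) (d : C)
    (π : (Σ j, Fin (slotArity (S j))) ≃ Fin l) (h : ∀ j y, c' (π ⟨j, y⟩) = slotColor (c j) (S j) y) :
    cubeTop f (P.obj c d) c S ≫ wordEval t γ c d = fillMap P η S c c' d π h ≫ wordEval t γ c' d := by
  refine htensor_hom_ext fun θ x => ?_
  unfold ev
  rw [map_comp, map_cubeTop, map_wordEval, map_comp, map_fillMap]
  refine Eq.trans ?_ (wordEval_actMap t γ c _ c' d π h θ _).symm
  congr 1
  funext j
  exact absurd j.2 (by omega)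

theorem exists_zeroOut (d : C) : ∃ w : sub E.operad f (cellη E α) (0 : ℕ) d ⟶ A.X d,
    zeroIn E f α d ≫ w = 𝟙 _ ∧ w ≫ zeroIn E f α d = 𝟙 _ := by
  have hrel : ∀ r : FillData C ((0 : ℕ) : ℕ∞), cubeTop f (E.operad.obj r.c d) r.c r.S ≫
      wordEval E.self (fun d => (0 : W d ⟶ A.X d)) r.c d =
      fillMap E.operad (cellη E α) r.S r.c r.c' d r.π r.h ≫
        wordEval E.self (fun d => (0 : W d ⟶ A.X d)) r.c' d := fun r =>
    wordEval_fillMap_nil f E.self _ _ (Nat.le_zero.1 (Nat.cast_le.1 r.hn)) r.S r.c r.c' d r.π r.h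
  obtain ⟨w, hw⟩ := exists_subDesc E.operad f (cellη E α)
    (fun n _ c => wordEval E.self (fun d => (0 : W d ⟶ A.X d)) c d) hrel
  refine ⟨w, ?_, ?_⟩
  · rw [zeroIn, Category.assoc, Category.assoc, hw, ← E.η_nullaryMap]
    congr 1
    refine Homog.hom_ext fun θ => ?_
    rw [map_comp, map_nilIn _ _ _ (fun i => i.elim0), map_wordEval, map_nullaryMap]
  · refine sub_hom_ext _ _ _ fun n hn c => ?_
    obtain rfl : n = 0 := by
      have : n ≤ 0 := by exact_mod_cast hn
      omega
    obtain rfl : c = Fin.elim0 := funext fun i => i.elim0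
    refine htensor_hom_ext fun θ x => ?_
    have h₁ : ev (cellIn E.operad f (cellη E α) hn (Fin.elim0 : Fin 0 → C) d ≫ w) θ x =
        map (nullaryMap E.self d) θ := by
      rw [hw]
      exact (map_wordEval _ _ _ _ θ x).trans (map_nullaryMap _ _ _ _).symm
    have h₂ := congrArg (map (zeroIn E f α d)) h₁
    refine h₂.trans ?_
    rw [zeroIn, ← map_comp, ← Category.assoc, E.nullaryMap_η, Category.id_comp, map_comp,
      map_nilIn _ _ _ x]
    rfl

/-- The identification of `A` with the words without letters. -/
def zeroIso : A.X ≅ (subSeq f E.operad (cellη E α)).obj 0 where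
  hom := fun d => zeroIn E f α d
  inv := fun d => (exists_zeroOut E f α d).choose
  hom_inv_id := funext fun d => (exists_zeroOut E f α d).choose_spec.1
  inv_hom_id := funext fun d => (exists_zeroOut E f α d).choose_spec.2

theorem zeroIn_top (d : C) : zeroIn E f α d ≫ subIncl E.operad f (cellη E α) le_top d =
    (cellAlgIn E f α).f d := by
  refine (Category.assoc _ _ _).trans (congrArg (E.η d ≫ ·) ?_)
  rw [Category.assoc, cellIn_subIncl]
  refine Homog.hom_ext fun θ => ?_
  rw [map_comp, map_nilIn _ _ _ (fun i => i.elim0), map_nullaryMap _ _ _ (fun i => i.elim0)]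
  refine (cellIn_eq_act (Fin.elim0 : Fin 0 → C) d θ (fun i => i.elim0)).trans ?_
  exact congrArg (ev _ θ) (funext fun i => i.elim0)

variable {B : Alg O} (i : A ⟶ B)

/-- The components of the inverse of an isomorphism with an algebra obtained by attaching cells. -/
def isoInv (e : B ≅ cellAlg E f α) (d : C) : sub E.operad f (cellη E α) ⊤ d ⟶ B.X d := e.inv.f d

/-- The components of an isomorphism with an algebra obtained by attaching cells. -/
def isoHom (e : B ≅ cellAlg E f α) (d : C) : B.X d ⟶ sub E.operad f (cellη E α) ⊤ d := e.hom.f d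

theorem isoInv_isoHom (e : B ≅ cellAlg E f α) (d : C) :
    isoInv E f α e d ≫ isoHom E f α e d = 𝟙 _ :=
  congrArg (fun F : cellAlg E f α ⟶ _ => F.f d) e.inv_hom_id

theorem isoHom_isoInv (e : B ≅ cellAlg E f α) (d : C) :
    isoHom E f α e d ≫ isoInv E f α e d = 𝟙 _ :=
  congrArg (fun F : B ⟶ _ => F.f d) e.hom_inv_id

/-- The maps from the words with a bounded number of letters. -/
def subSeqTop (e : B ≅ cellAlg E f α) :
    subSeq f E.operad (cellη E α) ⟶ (Functor.const ℕ).obj B.X where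
  app n d := subIncl E.operad f (cellη E α) le_top d ≫ isoInv E f α e d
  naturality n m h := funext fun d => by
    have h₁ : (n : ℕ∞) ≤ m := by exact_mod_cast leOfHom h
    have h₂ : subIncl E.operad f (cellη E α) h₁ d ≫ subIncl E.operad f (cellη E α) le_top d ≫
        isoInv E f α e d =
        (subIncl E.operad f (cellη E α) le_top d ≫ isoInv E f α e d) ≫ 𝟙 (B.X d) := by
      rw [← Category.assoc, subIncl_trans, Category.comp_id]
    exact h₂

theorem exists_seqDesc (e : B ≅ cellAlg E f α) (s : Cocone (subSeq f E.operad (cellη E α)))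
    (d : C) : ∃ w : B.X d ⟶ s.pt d,
      ∀ n : ℕ, (subSeqTop E f α e).app n d ≫ w = s.ι.app n d := by
  obtain ⟨w, hw⟩ := exists_colimDesc f E.operad (cellη E α) d (fun n => s.ι.app n d)
    (fun n m h => congrFun (s.w (homOfLE (by exact_mod_cast h))) d)
  refine ⟨isoHom E f α e d ≫ w, fun n => Eq.trans ?_ (hw n)⟩
  have h₁ : (subIncl E.operad f (cellη E α) (le_top (a := (n : ℕ∞))) d ≫ isoInv E f α e d) ≫
      isoHom E f α e d ≫ w = subIncl E.operad f (cellη E α) le_top d ≫ w := by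
    rw [Category.assoc, ← Category.assoc (isoInv E f α e d), isoInv_isoHom, Category.id_comp]
  exact h₁

theorem seq_hom_ext (e : B ≅ cellAlg E f α) (d : C) {Z : Cx k} {w w' : B.X d ⟶ Z}
    (h : ∀ n : ℕ, (subSeqTop E f α e).app n d ≫ w = (subSeqTop E f α e).app n d ≫ w') : w = w' := by
  have h₂ : isoInv E f α e d ≫ w = isoInv E f α e d ≫ w' :=
    colim_hom_ext f E.operad (cellη E α) d fun n =>
      (Category.assoc _ _ _).symm.trans ((h n).trans (Category.assoc _ _ _))
  rw [← Category.id_comp w, ← Category.id_comp w', ← isoHom_isoInv, Category.assoc,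
    Category.assoc, h₂]

/-- The colimit of the words with a bounded number of letters. -/
def isColimitSubSeq (e : B ≅ cellAlg E f α) : IsColimit (Cocone.mk B.X (subSeqTop E f α e)) where
  desc s d := (exists_seqDesc E f α e s d).choose
  fac s n := funext fun d => (exists_seqDesc E f α e s d).choose_spec n
  uniq s _ hm := funext fun d => seq_hom_ext E f α e d fun n =>
    (congrFun (hm n) d).trans ((exists_seqDesc E f α e s d).choose_spec n).symm

theorem ev_attachMap {n : ℕ} (d : C) (c : CollClass C (n + 1)) (S : Proper (n + 1))
    (θ : Homog (E.operad.obj c.out d)) (x : ∀ i, Homog (vert V W (c.out i) (S.1 i))) :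
    ev (vertexIncl E.operad f d c S ≫ attachMap E.operad f (cellη E α) n d) θ x =
      sgn (splitSign S.1 (fun i => (x i).deg))
        (map (subIncl E.operad f (cellη E α) (size_lt' S) d)
          (ev (cellIn E.operad f (cellη E α) le_rfl (fun a => c.out (enum S.1 a)) d)
            (fillOp E α c.out d S.1 θ x)
            (fun a => slotElt (S.1 (enum S.1 a)) (enum_mem S.1 a) (x (enum S.1 a))))) := by
  rw [vertexIncl_attachMap, attachVertex,
    ← cellIn_subIncl E.operad f (cellη E α) (size_lt' S) d le_rfl]
  unfold ev
  rw [map_comp, map_fillMap_slotEquiv, map_sgn, map_comp]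

/-- The cellular filtration of an algebra obtained by attaching cells. -/
def cellFiltration (α : V ⟶ A.X) (e : B ≅ cellAlg E f α) (he : i ≫ e.hom = cellAlgIn E f α) :
    CellFiltration E f α i where
  seq := subSeq f E.operad (cellη E α)
  zeroIso := zeroIso E f α
  toB := subSeqTop E f α e
  isColimit := isColimitSubSeq E f α e
  zeroIso_toB := funext fun d => by
    have h₁ := zeroIn_top E f α d
    have h₂ : cellAlgIn E f α ≫ e.inv = i := by rw [← he, Category.assoc, e.hom_inv_id, Category.comp_id]
    refine (Category.assoc _ _ _).symm.trans ((congrArg (· ≫ e.inv.f d) h₁).trans ?_)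
    exact congrArg (fun F : A ⟶ B => F.f d) h₂
  cell c d := cellIn E.operad f (cellη E α) le_rfl c d
  cell_relabel c c' d σ h θ x := cellIn_relabel _ _ _ _ _ _ _ _ _ _ _
  cell_zero d a :=
    (congrArg (map (cellIn E.operad f (cellη E α) le_rfl (Fin.elim0 : Fin 0 → C) d))
      (map_nilIn _ _ _ _)).symm
  attach n d := attachMap E.operad f (cellη E α) n d
  attach_eq n d c S θ x := ev_attachMap E f α d c S θ x
  step n d := stepIn E.operad f (cellη E α) (n + 1) d
  topIncl_step n d c := topIncl_stepIn _ _ _ _ _ _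
  isPushout n d := isPushout_step _ _ _ n d (by exact_mod_cast Nat.le_succ n)

end Attaching

/-! ## Trivial fibrations and cofibrations of complexes -/

section Complexes

/-- The elementwise form of trivial fibrations. -/
def ElemTrivFib {M N : Cx k} (p : M ⟶ N) : Prop :=
  ∀ (m : ℤ) (y : N.X m) (x' : M.X (m + 1)), M.d (m + 1) (m + 1 + 1) x' = 0 →
    p.f (m + 1) x' = N.d m (m + 1) y → ∃ x : M.X m, p.f m x = y ∧ M.d m (m + 1) x = x'

theorem ElemTrivFib.of_eq {M N : Cx k} {p : M ⟶ N} (hp : ElemTrivFib p) {a b : ℤ} (hb : a + 1 = b)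
    (c : ℤ) (hc : b + 1 = c) (y : N.X a) (x' : M.X b) (h : M.d b c x' = 0)
    (h' : p.f b x' = N.d a b y) : ∃ x : M.X a, p.f a x = y ∧ M.d a b x = x' := by
  subst hb hc
  exact hp a y x' h h'

theorem d_d_apply (M : Cx k) (i j l : ℤ) (x : M.X i) : M.d j l (M.d i j x) = 0 := by
  rw [← ModuleCat.comp_apply, HomologicalComplex.d_comp_d]; rfl

theorem f_d_apply {M N : Cx k} (p : M ⟶ N) (i j : ℤ) (x : M.X i) :
    p.f j (M.d i j x) = N.d i j (p.f i x) := by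
  rw [← ModuleCat.comp_apply, ← ModuleCat.comp_apply, p.comm]

theorem mono_iff_elem {M N : Cx k} (p : M ⟶ N) (i j l : ℤ) (hi : i + 1 = j) (hl : j + 1 = l) :
    Mono (HomologicalComplex.homologyMap p j) ↔ ∀ (x : M.X j), M.d j l x = 0 →
      ∀ y : N.X i, p.f j x = N.d i j y → ∃ z : M.X i, M.d i j z = x := by
  rw [HomologicalComplex.mono_homologyMap_iff_up_to_refinements p i j l
    (ComplexShape.prev_eq' _ hi) (ComplexShape.next_eq' _ hl)]
  constructor
  · intro h x hx y hy
    obtain ⟨A', π, hπ, x₁, h₁⟩ := h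
      (ModuleCat.ofHom (LinearMap.toSpanSingleton k _ x) : ModuleCat.of k k ⟶ M.X j)
      (ModuleCat.hom_ext (LinearMap.ext_ring (by simp [hx])))
      (ModuleCat.ofHom (LinearMap.toSpanSingleton k _ y))
      (ModuleCat.hom_ext (LinearMap.ext_ring (by simp [hy])))
    obtain ⟨a, ha⟩ := (ModuleCat.epi_iff_surjective π).1 hπ 1
    refine ⟨x₁ a, ?_⟩
    have h₂ := congrArg (fun F => F.hom a) h₁
    simp only [ModuleCat.hom_comp, LinearMap.comp_apply] at h₂
    refine h₂.symm.trans ?_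
    rw [ha]
    simp
  · intro h A x hx y hy
    have hx' : ∀ a, M.d j l (x a) = 0 := fun a => congrArg (fun F => F.hom a) hx
    have hy' : ∀ a, p.f j (x a) = N.d i j (y a) := fun a => congrArg (fun F => F.hom a) hy
    choose z hz using fun a => h (x a) (hx' a) (y a) (hy' a)
    refine ⟨ModuleCat.of k (A →₀ k), ModuleCat.ofHom (Finsupp.linearCombination k id), ?_,
      ModuleCat.ofHom (Finsupp.linearCombination k z), ?_⟩
    · rw [ModuleCat.epi_iff_surjective]
      exact fun a => ⟨Finsupp.single a 1, by simp⟩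
    · refine ModuleCat.hom_ext (Finsupp.lhom_ext' fun a => LinearMap.ext_ring ?_)
      simp [hz]

theorem epi_iff_elem {M N : Cx k} (p : M ⟶ N) (i j l : ℤ) (hi : i + 1 = j) (hl : j + 1 = l) :
    Epi (HomologicalComplex.homologyMap p j) ↔ ∀ (y : N.X j), N.d j l y = 0 →
      ∃ (x : M.X j) (z : N.X i), M.d j l x = 0 ∧ y = p.f j x + N.d i j z := by
  rw [HomologicalComplex.epi_homologyMap_iff_up_to_refinements p i j l
    (ComplexShape.prev_eq' _ hi) (ComplexShape.next_eq' _ hl)]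
  constructor
  · intro h y hy
    obtain ⟨A', π, hπ, x₁, h₁, z, h₂⟩ := h
      (ModuleCat.ofHom (LinearMap.toSpanSingleton k _ y) : ModuleCat.of k k ⟶ N.X j)
      (ModuleCat.hom_ext (LinearMap.ext_ring (by simp [hy])))
    obtain ⟨a, ha⟩ := (ModuleCat.epi_iff_surjective π).1 hπ 1
    refine ⟨x₁ a, z a, congrArg (fun F => F.hom a) h₁, ?_⟩
    have h₂ := congrArg (fun F => F.hom a) h₂
    simp only [ModuleCat.hom_comp, LinearMap.comp_apply] at h₂
    refine Eq.trans ?_ h₂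
    rw [ha]
    simp
  · intro h A y hy
    have hy' : ∀ a, N.d j l (y a) = 0 := fun a => congrArg (fun F => F.hom a) hy
    choose x z hx hz using fun a => h (y a) (hy' a)
    refine ⟨ModuleCat.of k (A →₀ k), ModuleCat.ofHom (Finsupp.linearCombination k id), ?_,
      ModuleCat.ofHom (Finsupp.linearCombination k x), ?_,
      ModuleCat.ofHom (Finsupp.linearCombination k z), ?_⟩
    · rw [ModuleCat.epi_iff_surjective]
      exact fun a => ⟨Finsupp.single a 1, by simp⟩
    · refine ModuleCat.hom_ext (Finsupp.lhom_ext' fun a => LinearMap.ext_ring ?_)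
      simp [hx]
    · refine ModuleCat.hom_ext (Finsupp.lhom_ext' fun a => LinearMap.ext_ring ?_)
      simp [hz]

theorem trivFib_iff {M N : Cx k} (p : M ⟶ N) : trivFib k p ↔ ElemTrivFib p := by
  constructor
  · rintro ⟨hq, hs⟩ m y x' hx' hxy
    obtain ⟨x₀, rfl⟩ := hs m y
    have hm : Mono (HomologicalComplex.homologyMap p (m + 1)) := inferInstance
    have he : Epi (HomologicalComplex.homologyMap p m) := inferInstance
    rw [mono_iff_elem p m (m + 1) (m + 1 + 1) rfl rfl] at hm
    rw [epi_iff_elem p (m - 1) m (m + 1) (by ring) rfl] at he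
    obtain ⟨z, hz⟩ := hm (x' - M.d m (m + 1) x₀) (by rw [map_sub, hx', d_d_apply, sub_zero]) 0
      (by rw [map_sub, hxy, f_d_apply, sub_self, map_zero])
    obtain ⟨z', w, hz', hw⟩ := he (p.f m z) (by
      rw [← f_d_apply, hz, map_sub, hxy, f_d_apply, sub_self])
    obtain ⟨w', rfl⟩ := hs (m - 1) w
    refine ⟨x₀ + (z - z' - M.d (m - 1) m w'), ?_, ?_⟩
    · rw [map_add, map_sub, map_sub, hw, f_d_apply]
      abel
    · rw [map_add, map_sub, map_sub, hz, hz', d_d_apply]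
      abel
  · intro h
    have hs : ∀ n, Function.Surjective (p.f n) := by
      intro n y
      obtain ⟨x', hx', hx''⟩ := h (n + 1) (N.d n (n + 1) y) 0 (map_zero _)
        (by rw [map_zero, d_d_apply])
      obtain ⟨x, hx, -⟩ := h n y x' hx'' hx'
      exact ⟨x, hx⟩
    refine ⟨⟨fun n => ?_⟩, hs⟩
    rw [quasiIsoAt_iff_isIso_homologyMap]
    have hm : Mono (HomologicalComplex.homologyMap p n) := by
      obtain ⟨m, rfl⟩ : ∃ m, n = m + 1 := ⟨n - 1, by ring⟩
      rw [mono_iff_elem p m (m + 1) (m + 1 + 1) rfl rfl]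
      intro x hx y hy
      obtain ⟨z, -, hz⟩ := h m y x hx hy
      exact ⟨z, hz⟩
    have he : Epi (HomologicalComplex.homologyMap p n) := by
      rw [epi_iff_elem p (n - 1) n (n + 1) (by ring) rfl]
      intro y hy
      obtain ⟨x, hx, hx'⟩ := h n y 0 (map_zero _) (by rw [map_zero, hy])
      exact ⟨x, 0, hx', by rw [hx, map_zero, add_zero]⟩
    exact isIso_of_mono_of_epi _

theorem cofibrant_iff (X : Cx k) : cofib k (initial.to X) ↔
    ∀ ⦃M N : Cx k⦄ (p : M ⟶ N), ElemTrivFib p → ∀ g : X ⟶ N, ∃ l : X ⟶ M, l ≫ p = g := by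
  constructor
  · intro h M N p hp g
    have := h p ((trivFib_iff p).2 hp)
    have sq : CommSq (initial.to M) (initial.to X) p g := ⟨initial.hom_ext _ _⟩
    exact ⟨sq.lift, sq.fac_right⟩
  · intro h M N p hp
    refine ⟨fun {t b} sq => ?_⟩
    obtain ⟨l, hl⟩ := h p ((trivFib_iff p).1 hp) b
    exact ⟨⟨l, initial.hom_ext _ _, hl⟩⟩

theorem cofib_iff {X Y : Cx k} (i : X ⟶ Y) : cofib k i ↔
    ∀ ⦃M N : Cx k⦄ (p : M ⟶ N), ElemTrivFib p → ∀ (t : X ⟶ M) (b : Y ⟶ N), t ≫ p = i ≫ b →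
      ∃ l : Y ⟶ M, i ≫ l = t ∧ l ≫ p = b := by
  constructor
  · intro h M N p hp t b hw
    have := h p ((trivFib_iff p).2 hp)
    have sq : CommSq t i p b := ⟨hw⟩
    exact ⟨sq.lift, sq.fac_left, sq.fac_right⟩
  · intro h M N p hp
    refine ⟨fun {t b} sq => ?_⟩
    obtain ⟨l, hl, hl'⟩ := h p ((trivFib_iff p).1 hp) t b sq.w
    exact ⟨⟨l, hl, hl'⟩⟩

/-- The complex of pairs of an element and a prescribed value of its differential. -/
def pairCx {M N : Cx k} (p : M ⟶ N) (m : ℤ) : Cx k :=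
  CochainComplex.of (fun j => ModuleCat.of k (N.X (j + m) × M.X (j + 1 + m)))
    (fun j => ModuleCat.ofHom (LinearMap.prod
      ((m.negOnePow : ℤ) • ((N.d (j + m) (j + 1 + m)).hom ∘ₗ LinearMap.fst k _ _ -
        (p.f (j + 1 + m)).hom ∘ₗ LinearMap.snd k _ _))
      (-(m.negOnePow : ℤ) • ((M.d (j + 1 + m) (j + 1 + 1 + m)).hom ∘ₗ LinearMap.snd k _ _))))
    (fun j => by
      refine ModuleCat.hom_ext (LinearMap.ext fun ⟨n, u⟩ => Prod.ext ?_ ?_)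
      · simp [f_d_apply, d_d_apply]
      · simp [d_d_apply])

theorem pairCx_d {M N : Cx k} (p : M ⟶ N) (m j : ℤ) (n : N.X (j + m)) (u : M.X (j + 1 + m)) :
    (pairCx p m).d j (j + 1) (n, u) = ((m.negOnePow : ℤ) • (N.d (j + m) (j + 1 + m) n -
      p.f (j + 1 + m) u), -(m.negOnePow : ℤ) • M.d (j + 1 + m) (j + 1 + 1 + m) u) := by
  exact congrArg (fun F => F.hom (n, u)) (CochainComplex.of_d
    (fun j => ModuleCat.of k (N.X (j + m) × M.X (j + 1 + m))) _ j)

/-- The map between complexes of pairs. -/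
def pairMap {M N : Cx k} (p : M ⟶ N) (m : ℤ) : pairCx (𝟙 M) m ⟶ pairCx p m where
  f j := ModuleCat.ofHom (LinearMap.prodMap (p.f (j + m)).hom LinearMap.id)
  comm' i j h := by
    obtain rfl : i + 1 = j := h
    refine ModuleCat.hom_ext (LinearMap.ext fun ⟨n, u⟩ => ?_)
    change (pairCx p m).d i (i + 1) (p.f (i + m) n, u) =
      (LinearMap.prodMap (p.f (i + 1 + m)).hom LinearMap.id) ((pairCx (𝟙 M) m).d i (i + 1) (n, u))
    rw [pairCx_d, pairCx_d]
    refine Prod.ext ?_ rfl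
    simp [f_d_apply]

theorem negOnePow_smul_smul {A : Type*} [AddCommGroup A] (m : ℤ) (a : A) :
    (m.negOnePow : ℤ) • (m.negOnePow : ℤ) • a = a := by
  rw [smul_smul, ← Units.val_mul, Int.units_mul_self, Units.val_one, one_smul]

theorem elemTrivFib_pairMap {M N : Cx k} (p : M ⟶ N) (hp : ElemTrivFib p) (m : ℤ) :
    ElemTrivFib (pairMap p m) := by
  rintro j ⟨n, u⟩ ⟨a, b⟩ h₁ h₂
  replace h₁ := h₁.symm.trans (pairCx_d (𝟙 M) m (j + 1) a b)
  replace h₂ := Eq.trans h₂ (pairCx_d p m j n u)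
  have ha : p.f (j + 1 + m) a = (m.negOnePow : ℤ) • (N.d (j + m) (j + 1 + m) n -
    p.f (j + 1 + m) u) := congrArg Prod.fst h₂
  have hb : b = -(m.negOnePow : ℤ) • M.d (j + 1 + m) (j + 1 + 1 + m) u := congrArg Prod.snd h₂
  have hab : 0 = (m.negOnePow : ℤ) • (M.d (j + 1 + m) (j + 1 + 1 + m) a - b) :=
    congrArg Prod.fst h₁
  suffices H : ∃ x : M.X (j + m), p.f (j + m) x = n ∧
      M.d (j + m) (j + 1 + m) x = u + (m.negOnePow : ℤ) • a by
    obtain ⟨x, hx, hx'⟩ := H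
    refine ⟨(x, u), Prod.ext hx rfl, (pairCx_d (𝟙 M) m j x u).trans (Prod.ext ?_ hb.symm)⟩
    change (m.negOnePow : ℤ) • (M.d (j + m) (j + 1 + m) x - u) = a
    rw [hx', add_sub_cancel_left, negOnePow_smul_smul]
  refine hp.of_eq (by ring) (j + 1 + 1 + m) (by ring) n _ ?_ ?_
  · have hda : M.d (j + 1 + m) (j + 1 + 1 + m) a - b = 0 := by
      rw [← negOnePow_smul_smul m (_ - b), ← hab, smul_zero]
    rw [map_add, map_zsmul, sub_eq_zero.1 hda, hb, neg_smul, smul_neg, negOnePow_smul_smul,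
      add_neg_cancel]
  · rw [map_add, map_zsmul, ha, negOnePow_smul_smul, add_sub_cancel]

open CochainComplex.HomComplex

variable {X M N : Cx k}

theorem cochain_closed {m : ℤ} {b : Cochain X M (m + 1)} (hb : δ (m + 1) (m + 1 + 1) b = 0) (j : ℤ)
    (x : X.X j) : M.d (j + 1 + m) (j + 1 + 1 + m) (b.v j (j + 1 + m) (by ring) x) =
      -((m.negOnePow : ℤ) • b.v (j + 1) (j + 1 + 1 + m) (by ring) (X.d j (j + 1) x)) := by
  have := Cochain.congr_v hb j (j + 1 + 1 + m) (by ring)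
  rw [δ_v (m + 1) (m + 1 + 1) rfl b j (j + 1 + 1 + m) (by ring) (j + 1 + m) (j + 1) (by ring)
    rfl, Int.negOnePow_succ, Int.negOnePow_succ, neg_neg] at this
  exact eq_neg_of_add_eq_zero_left (congrArg (fun F => F.hom x) this)

theorem cochain_bound {p : M ⟶ N} {m : ℤ} {a : Cochain X N m} {b : Cochain X M (m + 1)}
    (hab : b.comp (Cochain.ofHom p) (add_zero _) = δ m (m + 1) a) (j : ℤ) (x : X.X j) :
    p.f (j + 1 + m) (b.v j (j + 1 + m) (by ring) x) =
      N.d (j + m) (j + 1 + m) (a.v j (j + m) rfl x) - (m.negOnePow : ℤ) •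
        a.v (j + 1) (j + 1 + m) rfl (X.d j (j + 1) x) := by
  have := Cochain.congr_v hab j (j + 1 + m) (by ring)
  rw [δ_v m (m + 1) rfl a j (j + 1 + m) (by ring) (j + m) (j + 1) (by ring)
    rfl, Int.negOnePow_succ, Cochain.comp_v _ _ (add_zero _) j (j + 1 + m) (j + 1 + m) (by ring)
    (by ring), Cochain.ofHom_v, Units.neg_smul, ← sub_eq_add_neg] at this
  exact congrArg (fun F => F.hom x) this

/-- Maps into the complex of pairs. -/
def pairLift (p : M ⟶ N) (m : ℤ) (a : Cochain X N m) (b : Cochain X M (m + 1))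
    (hb : δ (m + 1) (m + 1 + 1) b = 0)
    (hab : b.comp (Cochain.ofHom p) (add_zero _) = δ m (m + 1) a) : X ⟶ pairCx p m where
  f j := ModuleCat.ofHom (LinearMap.prod (a.v j (j + m) rfl).hom
    (b.v j (j + 1 + m) (by ring)).hom)
  comm' i j h := by
    obtain rfl : i + 1 = j := h
    refine ModuleCat.hom_ext (LinearMap.ext fun x => ?_)
    refine (pairCx_d p m i _ _).trans (Prod.ext ?_ ?_)
    · refine (congrArg (fun z => (m.negOnePow : ℤ) • (N.d (i + m) (i + 1 + m)
        (a.v i (i + m) rfl x) - z)) (cochain_bound hab i x)).trans ?_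
      rw [sub_sub_cancel, negOnePow_smul_smul]
      rfl
    · refine (congrArg (fun z => -(m.negOnePow : ℤ) • z) (cochain_closed hb i x)).trans ?_
      rw [neg_smul, smul_neg, neg_neg, negOnePow_smul_smul]
      rfl

/-- The first component of a map into the complex of pairs. -/
def pairFst {p : M ⟶ N} {m : ℤ} (l : X ⟶ pairCx p m) : Cochain X N m :=
  Cochain.mk (fun i j h => by
    subst h
    exact ModuleCat.ofHom (LinearMap.fst k (N.X (i + m)) (M.X (i + 1 + m)) ∘ₗ (l.f i).hom))

/-- Lifting of cochains out of a cofibrant complex, with prescribed differential. -/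
theorem exists_cochain_lift (hX : cofib k (initial.to X)) {p : M ⟶ N}
    (hp : ElemTrivFib p) (m : ℤ) (a : Cochain X N m) (b : Cochain X M (m + 1))
    (hb : δ (m + 1) (m + 1 + 1) b = 0)
    (hab : b.comp (Cochain.ofHom p) (add_zero _) = δ m (m + 1) a) :
    ∃ c : Cochain X M m, c.comp (Cochain.ofHom p) (add_zero _) = a ∧ δ m (m + 1) c = b := by
  obtain ⟨l, hl⟩ := (cofibrant_iff X).1 hX _ (elemTrivFib_pairMap p hp m) (pairLift p m a b hb hab)
  have hl' : ∀ (j : ℤ) (x : X.X j), (pairMap p m).f j (l.f j x) =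
    (pairLift p m a b hb hab).f j x := fun j x => congrArg (fun F : X ⟶ pairCx p m => F.f j x) hl
  have h₂ : ∀ (j : ℤ) (x : X.X j), Prod.snd (l.f j x : M.X (j + m) × M.X (j + 1 + m)) =
    b.v j (j + 1 + m) (by ring) x := fun j x => congrArg Prod.snd (hl' j x)
  have h₃ : ∀ (j : ℤ) (x : X.X j), (m.negOnePow : ℤ) • (M.d (j + m) (j + 1 + m)
      ((pairFst l).v j (j + m) rfl x) - b.v j (j + 1 + m) (by ring) x) =
        (pairFst l).v (j + 1) (j + 1 + m) rfl (X.d j (j + 1) x) := by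
    intro j x
    rw [← h₂]
    refine (congrArg Prod.fst (pairCx_d (𝟙 M) m j (l.f j x).1 (l.f j x).2)).symm.trans ?_
    exact congrArg Prod.fst (f_d_apply l j (j + 1) x).symm
  refine ⟨pairFst l, ?_, ?_⟩
  · ext i j h
    subst h
    rw [Cochain.comp_v _ _ (add_zero _) i (i + m) (i + m) rfl (by ring), Cochain.ofHom_v]
    exact congrArg Prod.fst (hl' i _)
  · ext i j h x
    obtain rfl : j = i + 1 + m := by rw [← h]; ring
    rw [δ_v m (m + 1) rfl (pairFst l) i (i + 1 + m) (by ring) (i + m) (i + 1) (by ring)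
      rfl, Int.negOnePow_succ, Units.neg_smul]
    change M.d (i + m) (i + 1 + m) ((pairFst l).v i (i + m) rfl x) + -((m.negOnePow : ℤ) •
      (pairFst l).v (i + 1) (i + 1 + m) rfl (X.d i (i + 1) x)) = _
    rw [← h₃, negOnePow_smul_smul]
    abel

/-- The functoriality of the complex of homomorphisms. -/
def ihomMap (X : Cx k) (p : M ⟶ N) : IHom X M ⟶ IHom X N where
  f m := ModuleCat.ofHom
    { toFun := fun F : Cochain X M m => F.comp (Cochain.ofHom p) (add_zero m)
      map_add' := fun F G => Cochain.add_comp _ _ _ _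
      map_smul' := fun r F => Cochain.smul_comp _ _ _ _ }
  comm' m m' h := by
    refine ModuleCat.hom_ext (LinearMap.ext fun F => ?_)
    exact δ_comp_ofHom (n := m) F p m'

theorem app_ihomMap (p : M ⟶ N) (F : Homog (IHom X M)) (z : Homog X) :
    app (map (ihomMap X p) F) z = map p (app F z) := by
  obtain ⟨m, F⟩ := F
  have h := Cochain.comp_v (F : Cochain X M m) (Cochain.ofHom p) (add_zero m) z.deg (m + z.deg)
    (m + z.deg) (add_comm _ _) (add_zero _)
  rw [Cochain.ofHom_v] at h
  exact Homog.ext rfl (heq_of_eq (congrArg (fun G : X.X z.deg ⟶ N.X (m + z.deg) => G z.val) h))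

theorem elemTrivFib_ihomMap (hX : cofib k (initial.to X)) {p : M ⟶ N} (hp : ElemTrivFib p) :
    ElemTrivFib (ihomMap X p) := fun m a b hb hab => exists_cochain_lift hX hp m a b hb hab

/-- The cofibrant complexes are closed under tensor products. -/
theorem cofibrant_tensor {n : ℕ} (A : Fin n → Cx k) (hA : ∀ i, cofib k (initial.to (A i))) :
    cofib k (initial.to (tensor A)) := by
  induction n with
  | zero =>
    refine (cofibrant_iff _).2 fun M N p hp g => ?_
    obtain ⟨x, hx, hx'⟩ := hp 0 (g.f 0 (tmk (fun i => i.elim0) 0 rfl)) 0 (map_zero _) (by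
      rw [← f_d_apply, map_zero]
      have := tpure_diff (X := A) (fun i => i.elim0) 1
      rw [Finset.univ_eq_empty, Finset.sum_empty] at this
      exact ((congrArg (g.f 1) this).trans (map_zero _)).symm)
    obtain ⟨F, hF⟩ := exists_tensor_hom (X := A) (Z := M) (Γ := fun _ => PEmpty)
      (fun i => i.elim0) (fun i => i.elim0) (fun _ => mk 0 x) (fun _ => rfl)
      (fun i => i.elim0) (fun s l _ _ m => by
        rw [Finset.univ_eq_empty, Finset.sum_empty, Homog.diff_mk, hx', vat_mk_zero])
    refine ⟨F, tensor_hom_ext fun y => ?_⟩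
    obtain rfl : y = fun i => i.elim0 := funext fun i => i.elim0
    have h₁ : map F (tpure fun i => i.elim0) = mk 0 x :=
      (congrArg (fun y => map F (tpure y)) (funext fun i => i.elim0)).trans
        (hF fun i => i.elim0)
    rw [Homog.map_comp, h₁, map_mk, hx]
    rfl
  | succ n ih =>
    obtain ⟨P, B, rfl⟩ : ∃ P B, A = hfam P B := ⟨A 0, fun i => A i.succ, (Fin.cons_self_tail A).symm⟩
    refine (cofibrant_iff _).2 fun M N p hp (g : htensor P B ⟶ N) => ?_
    obtain ⟨l, hl⟩ := (cofibrant_iff P).1 (hA 0) _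
      (elemTrivFib_ihomMap (ih B fun i => hA i.succ) hp) (curry g)
    refine ⟨uncurry l, htensor_hom_ext fun θ x => ?_⟩
    have : ev (uncurry l ≫ p) θ x = map p (ev (uncurry l) θ x) := rfl
    refine this.trans ?_
    rw [ev_uncurry, tapp, ← app_ihomMap, ← Homog.map_comp]
    refine Eq.trans ?_ (tapp_curry g θ x)
    rw [← hl]
    rfl

/-- A degreewise splitting of a sequence of complexes. -/
structure DegreewiseSplitting {A B C : Cx k} (i : A ⟶ B) (π : B ⟶ C) where
  /-- The retraction. -/
  r : ∀ j, B.X j →ₗ[k] A.X j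
  /-- The section. -/
  s : ∀ j, C.X j →ₗ[k] B.X j
  r_i : ∀ j a, r j (i.f j a) = a
  π_s : ∀ j c, π.f j (s j c) = c
  add : ∀ j b, i.f j (r j b) + s j (π.f j b) = b

section Splitting

variable {A B C : Cx k} {i : A ⟶ B} {π : B ⟶ C}

theorem DegreewiseSplitting.π_i (D : DegreewiseSplitting i π) (j : ℤ) (a : A.X j) :
    π.f j (i.f j a) = 0 := by
  have := D.add j (i.f j a)
  rw [D.r_i, add_eq_left] at this
  rw [← D.π_s j (π.f j (i.f j a)), this, map_zero]

theorem DegreewiseSplitting.r_s (D : DegreewiseSplitting i π) (j : ℤ) (c : C.X j) :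
    D.r j (D.s j c) = 0 := by
  have := congrArg (D.r j) (D.add j (D.s j c))
  rw [D.π_s, map_add, D.r_i] at this
  exact add_eq_left.1 this

theorem DegreewiseSplitting.s_d (D : DegreewiseSplitting i π) (j : ℤ) (c : C.X j) :
    D.s (j + 1) (C.d j (j + 1) c) = B.d j (j + 1) (D.s j c) -
      i.f (j + 1) (D.r (j + 1) (B.d j (j + 1) (D.s j c))) := by
  rw [eq_sub_iff_add_eq']
  exact (congrArg (fun y => _ + D.s (j + 1) y) ((f_d_apply π j (j + 1) _).trans
    (congrArg _ (D.π_s j c)))).symm.trans (D.add (j + 1) (B.d j (j + 1) (D.s j c)))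

theorem exists_homotopy_lift {p : M ⟶ N} (hX : cofib k (initial.to X)) (hp : ElemTrivFib p)
    (a : ∀ j, X.X j →ₗ[k] N.X j) (b : ∀ j, X.X j →ₗ[k] M.X (j + 1))
    (hb : ∀ j x, M.d (j + 1) (j + 1 + 1) (b j x) = -b (j + 1) (X.d j (j + 1) x))
    (hab : ∀ j x, p.f (j + 1) (b j x) = N.d j (j + 1) (a j x) - a (j + 1) (X.d j (j + 1) x)) :
    ∃ c : ∀ j, X.X j →ₗ[k] M.X j, (∀ j x, p.f j (c j x) = a j x) ∧
      ∀ j x, M.d j (j + 1) (c j x) - c (j + 1) (X.d j (j + 1) x) = b j x := by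
  let b' : Cochain X M (0 + 1) := Cochain.mk fun i j h => ModuleCat.ofHom (b i) ≫
    (M.XIsoOfEq (show i + 1 = j by omega)).hom
  have hb' : ∀ j, b'.v j (j + 1) (by ring) = ModuleCat.ofHom (b j) := fun j => by simp [b']
  obtain ⟨c, hc, hc'⟩ := exists_cochain_lift hX hp 0 (Cochain.ofHoms fun j => ModuleCat.ofHom (a j))
    b' (by
      ext j l h x
      obtain rfl : l = j + 1 + 1 := by omega
      rw [δ_v (0 + 1) (0 + 1 + 1) rfl b' j (j + 1 + 1) (by ring) (j + 1) (j + 1) (by ring) rfl,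
        hb', hb', Int.negOnePow_even (0 + 1 + 1) ⟨1, rfl⟩,
        one_smul]
      refine (congrArg (· + b (j + 1) (X.d j (j + 1) x)) (hb j x)).trans (neg_add_cancel _)) (by
      ext j l h x
      obtain rfl : l = j + 1 := by omega
      rw [δ_v 0 (0 + 1) rfl _ j (j + 1) (by ring) j (j + 1) (by ring) rfl,
        Cochain.comp_v _ _ (add_zero _) j (j + 1) (j + 1) (by ring) (by ring), hb']
      simp [hab, sub_eq_add_neg])
  refine ⟨fun j => (c.v j j (add_zero _)).hom, fun j x => ?_, fun j x => ?_⟩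
  · have := Cochain.congr_v hc j j (add_zero _)
    rw [Cochain.comp_v _ _ (add_zero _) j j j (by ring) (by ring), Cochain.ofHom_v,
      Cochain.ofHoms_v] at this
    exact congrArg (fun F => F.hom x) this
  · have := Cochain.congr_v hc' j (j + 1) (by ring)
    rw [δ_v 0 (0 + 1) rfl _ j (j + 1) (by ring) j (j + 1) (by ring) rfl, hb'] at this
    refine Eq.trans ?_ (congrArg (fun F => F.hom x) this)
    simp [sub_eq_add_neg]

/-- Degreewise split monomorphisms with cofibrant cokernel are cofibrations. -/
theorem DegreewiseSplitting.cofib (D : DegreewiseSplitting i π) (hC : cofib k (initial.to C)) :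
    cofib k i := by
  refine (cofib_iff i).2 fun M N p hp t b hw => ?_
  have hw' : ∀ j x, p.f j (t.f j x) = b.f j (i.f j x) := fun j x =>
    congrArg (fun F : A ⟶ N => F.f j x) hw
  obtain ⟨c, hc, hc'⟩ := exists_homotopy_lift hC hp (fun j => (b.f j).hom ∘ₗ D.s j)
    (fun j => (t.f (j + 1)).hom ∘ₗ D.r (j + 1) ∘ₗ (B.d j (j + 1)).hom ∘ₗ D.s j)
    (fun j x => by
      change M.d _ _ (t.f _ (D.r _ (B.d _ _ (D.s _ _)))) = -t.f _ (D.r _ (B.d _ _ (D.s _ _)))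
      rw [D.s_d, map_sub, d_d_apply, zero_sub, ← f_d_apply i, map_neg, D.r_i, map_neg, neg_neg,
        f_d_apply t])
    (fun j x => by
      change p.f _ (t.f _ _) = N.d _ _ (b.f _ _) - b.f _ (D.s _ _)
      rw [hw', D.s_d, map_sub, f_d_apply, sub_sub_cancel]
      rfl)
  refine ⟨⟨fun j => ModuleCat.ofHom ((t.f j).hom ∘ₗ D.r j + c j ∘ₗ (π.f j).hom), fun j l h => ?_⟩,
    ?_, ?_⟩
  · obtain rfl : j + 1 = l := h
    refine ModuleCat.hom_ext (LinearMap.ext fun x => ?_)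
    change M.d _ _ (t.f _ (D.r _ x) + c _ (π.f _ x)) = t.f _ (D.r _ (B.d _ _ x)) +
      c _ (π.f _ (B.d _ _ x))
    have h₁ := hc' j (π.f j x)
    change _ = t.f _ (D.r _ (B.d _ _ (D.s _ (π.f _ x)))) at h₁
    rw [eq_sub_iff_add_eq'.2 (D.add j x), map_sub, ← f_d_apply i, map_sub, D.r_i, map_sub,
      sub_eq_iff_eq_add] at h₁
    rw [map_add, h₁, f_d_apply π, ← f_d_apply t]
    abel
  · ext j x
    change t.f _ (D.r _ (i.f j x)) + c _ (π.f _ (i.f j x)) = _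
    rw [D.r_i, D.π_i, map_zero, add_zero]
  · ext j x
    change p.f _ (t.f _ (D.r _ x) + c _ (π.f _ x)) = _
    rw [map_add, hw', hc]
    change _ + b.f _ (D.s _ _) = _
    rw [← map_add, D.add]

theorem elemTrivFib_pairCx (M : Cx k) (m : ℤ) (hN : IsZero N) :
    ElemTrivFib (0 : pairCx (𝟙 M) m ⟶ N) := by
  rintro j y ⟨a, b⟩ h -
  refine ⟨((0 : M.X (j + m)), -(m.negOnePow : ℤ) • a),
    congrArg (fun F : N ⟶ N => F.f j y) (hN.eq_of_src 0 (𝟙 N)), ?_⟩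
  have h₁ : (m.negOnePow : ℤ) • (M.d (j + 1 + m) (j + 1 + 1 + m) a - b) = 0 :=
    congrArg Prod.fst ((pairCx_d (𝟙 M) m (j + 1) a b).symm.trans h)
  have h₂ : M.d (j + 1 + m) (j + 1 + 1 + m) a - b = 0 := by
    rw [← negOnePow_smul_smul m (_ - b), h₁, smul_zero]
  refine (pairCx_d (𝟙 M) m j _ _).trans (Prod.ext ?_ ?_)
  · change (m.negOnePow : ℤ) • (M.d _ _ 0 - (-(m.negOnePow : ℤ) • a)) = a
    rw [map_zero, zero_sub, neg_smul, neg_neg, negOnePow_smul_smul]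
  · change -(m.negOnePow : ℤ) • M.d _ _ (-(m.negOnePow : ℤ) • a) = b
    rw [map_zsmul, neg_smul, neg_smul, smul_neg, neg_neg, negOnePow_smul_smul]
    exact sub_eq_zero.1 h₂

open ZeroObject in
/-- Cofibrations are degreewise split, with cofibrant cokernel. -/
theorem exists_degreewiseSplitting (hi : cofib k i) : ∃ (C : Cx k) (π : B ⟶ C),
    cofib k (initial.to C) ∧ Nonempty (DegreewiseSplitting i π) := by
  obtain ⟨l, hl, -⟩ := (cofib_iff i).1 hi _ (elemTrivFib_pairCx A 0 (isZero_zero (Cx k)))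
    (pairLift (𝟙 A) 0 (Cochain.ofHom (𝟙 A)) 0 (δ_zero _ _) (by simp)) 0 (by simp)
  let R : Set (Homog B) := {z | ∃ a, z = map i a}
  have hR : ∀ j, genSub B R j = LinearMap.range (i.f j).hom := fun j => by
    refine le_antisymm (Submodule.span_le.2 ?_) ?_
    · rintro z (⟨⟨q, a⟩, h⟩ | ⟨_, ⟨⟨q, a⟩, rfl⟩, h⟩)
      · obtain rfl : j = q := congrArg Homog.deg h
        exact ⟨a, (eq_of_heq (mk.inj h).2).symm⟩
      · obtain rfl : j = q + 1 := congrArg Homog.deg h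
        exact ⟨A.d q (q + 1) a, (f_d_apply i _ _ _).trans (eq_of_heq (mk.inj h).2).symm⟩
    · rintro _ ⟨a, rfl⟩
      exact Submodule.subset_span (Or.inl ⟨mk j a, rfl⟩)
  let r : ∀ j, B.X j →ₗ[k] A.X j := fun j => ((pairFst l).v j j (add_zero j)).hom
  have hr : ∀ j a, r j (i.f j a) = a := fun j a => by
    have : ∀ (q : ℤ) (h : j + 0 = q), (pairFst l).v j q h (i.f j a) =
        (Cochain.ofHom (𝟙 A)).v j q h a := by
      intro q h
      subst h
      exact congrArg (fun F : A ⟶ pairCx (𝟙 A) 0 => Prod.fst (F.f j a)) hl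
    refine (this j (add_zero j)).trans ?_
    rw [Cochain.ofHom_v]
    rfl
  refine ⟨quot B R, quotProj B R, (cofibrant_iff _).2 fun M N p hp g => ?_, ⟨⟨r, fun j =>
    (genSub B R j).liftQ (LinearMap.id - (i.f j).hom ∘ₗ r j) ?_, hr, fun j => ?_, fun j b => ?_⟩⟩⟩
  · have h0 : i ≫ quotProj B R = 0 := by
      ext j a
      exact (Submodule.Quotient.mk_eq_zero _).2 ((hR j).ge ⟨a, rfl⟩)
    obtain ⟨l, hl, hl'⟩ := (cofib_iff i).1 hi p hp 0 (quotProj B R ≫ g) (by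
      rw [← Category.assoc, h0, zero_comp, zero_comp])
    refine ⟨quotDesc R l ?_, quot_hom_ext ?_⟩
    · rintro _ ⟨a, rfl⟩
      exact congrArg (fun F : A ⟶ M => F.f a.deg a.val) hl
    · rw [← hl', ← Category.assoc, quotProj_desc]
  · rw [hR]
    rintro _ ⟨a, rfl⟩
    change i.f j a - i.f j (r j (i.f j a)) = 0
    rw [hr, sub_self]
  · intro c
    obtain ⟨c, rfl⟩ := Submodule.Quotient.mk_surjective _ c
    refine (Submodule.Quotient.eq _).2 ((hR j).ge ⟨-r j c, ?_⟩)
    change i.f j (-r j c) = c - i.f j (r j c) - c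
    rw [map_neg]
    abel
  · change i.f j (r j b) + (b - i.f j (r j b)) = b
    abel

end Splitting

end Complexes

section GradedMaps

variable {X Y Z : Cx k}

/-- The function of homogeneous elements given by a degreewise linear map. -/
def hlin (l : ∀ j, X.X j →ₗ[k] Y.X j) (z : Homog X) : Homog Y := mk z.deg (l z.deg z.val)

theorem hlin_isLin (l : ∀ j, X.X j →ₗ[k] Y.X j) : IsLin (hlin l) := by
  refine ⟨fun a => ?_, fun r z => ?_⟩
  · obtain ⟨q, b, c, rfl, rfl, rfl⟩ := a.exists_mk
    unfold hlin
    dsimp only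
    rw [map_add]
    exact hadd_mk _ _ _
  · unfold hlin hsmul
    dsimp only
    rw [map_smul]

theorem exists_hlin_eq {L : Homog X → Homog Y} (hL : IsLin L) (hdeg : ∀ z, (L z).deg = z.deg) :
    ∃ l : ∀ j, X.X j →ₗ[k] Y.X j, ∀ z, hlin l z = L z := by
  choose l hl using fun j => hL.exists_linear j j
  exact ⟨l, fun z => (congrArg (mk z.deg) (hl z.deg z.val)).trans (mk_vat (L z) (hdeg z))⟩

theorem vat_mk_sum {ι : Type*} [Fintype ι] {F : ι → Homog X} {E : ℤ} (hE : ∀ i, (F i).deg = E)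
    (m : ℤ) : (mk E (∑ i, (F i).vat E)).vat m = ∑ i, (F i).vat m := by
  by_cases h : E = m
  · subst h
    rw [vat_mk]
  · rw [vat_of_ne _ h, Finset.sum_eq_zero]
    exact fun i _ => vat_of_ne _ (by rwa [hE])

theorem isLin_hsum {ι : Type*} [Fintype ι] {F : ι → Homog X → Homog Y} (hF : ∀ i, IsLin (F i))
    {E : Homog X → ℤ} (hE : ∀ i z, (F i z).deg = E z) (hE' : ∀ z z', z.deg = z'.deg → E z = E z') :
    IsLin (fun z => mk (E z) (∑ i, (F i z).vat (E z))) := by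
  refine ⟨fun a => ⟨hE' _ _ a.deg₁, hE' _ _ a.deg₂, fun m => ?_⟩, fun r z => ?_⟩
  · rw [vat_mk_sum (fun i => hE i _), vat_mk_sum (fun i => hE i _), vat_mk_sum (fun i => hE i _),
      ← Finset.sum_add_distrib]
    exact Finset.sum_congr rfl fun i _ => ((hF i).add a).vat m
  · refine ext_vat (hE' _ _ rfl) ?_
    rw [vat_mk_sum (fun i => hE i _), vat_hsmul, vat_mk_sum (fun i => hE i _), Finset.smul_sum]
    exact Finset.sum_congr rfl fun i _ => by rw [(hF i).smul, vat_hsmul]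

theorem ev_eq_zero {n : ℕ} {Q : Cx k} {A : Fin n → Cx k} (g : htensor Q A ⟶ Y) (θ : Homog Q)
    (y : ∀ i, Homog (A i)) (i : Fin n) (h : (y i).val = 0) (m : ℤ) : (ev g θ y).vat m = 0 := by
  have h₁ := ((ev_isML g θ).lin y i).zero (y i).deg
  have h₂ : Function.update y i (mk (y i).deg 0) = y := by
    rw [← h]
    exact Function.update_eq_self i y
  rw [h₂] at h₁
  rw [h₁, vat_mk_zero]

theorem spans_of_hom_eq_zero {S : Set (Homog X)} (hS : ∀ z ∈ S, z.diff ∈ S)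
    (h : ∀ (Z : Cx k) (g : X ⟶ Z), (∀ z ∈ S, (map g z).val = 0) → g = 0) : Spans S := by
  refine spans_of_span fun m => ?_
  have h₀ := h _ (quotProj X S) fun z hz => quotProj_eq_zero hz
  have h₁ : genSub X S m = ⊤ := by
    refine eq_top_iff.2 fun a _ => (Submodule.Quotient.mk_eq_zero _).1 ?_
    exact congrArg (fun F : X ⟶ quot X S => F.f m a) h₀
  rw [← h₁, genSub]
  congr 1
  ext a
  refine ⟨Or.inl, ?_⟩
  rintro (ha | ⟨r, hr, ha⟩)
  · exact ha
  · change mk m a ∈ S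
    rw [ha]
    exact hS r hr

theorem spans_of_isColimit {J : Type*} [Category J] {F : J ⥤ Cx k} {s : Cocone F}
    (hs : IsColimit s) : Spans {z | ∃ (j : J) (z' : Homog (F.obj j)),
      z = map (s.ι.app j) z'} := by
  refine spans_of_hom_eq_zero ?_ fun Z g hg => hs.hom_ext fun j => Homog.hom_ext fun z => ?_
  · rintro _ ⟨j, z, rfl⟩
    exact ⟨j, z.diff, (map_diff _ _).symm⟩
  · exact Homog.ext rfl (heq_of_eq ((hg _ ⟨j, z, rfl⟩).trans (congrArg (fun G : F.obj j ⟶ Z =>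
      G.f z.deg z.val) comp_zero).symm))

end GradedMaps

section Orbits

variable (P : ColoredOperad k C) {V W T : Coll k C}
  {n : ℕ} (c : Fin n → C) (d : C)

/-- The automorphisms of a collection of colours act on words. -/
abbrev autMap (W : Coll k C) (σ : Equiv.Perm (Fin n)) (h : ∀ i, c (σ i) = c i) :
    htensor (P.obj c d) (fun i => W (c i)) ⟶ htensor (P.obj c d) (fun i => W (c i)) :=
  permMap P W (V := fun _ => ⊥_ (Cx k)) (fun _ => initial.to _) d σ h

variable {c d}

theorem ev_autMap (σ : Equiv.Perm (Fin n)) (h : ∀ i, c (σ i) = c i) (θ : Homog (P.obj c d))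
    (x : ∀ i, Homog (W (c i))) :
    map (autMap P c d W σ h) (hpure θ (fun i => recolor W (h i) (x (σ i)))) =
      sgn (koszulSign σ (fun i => (x i).deg)) (hpure (P.relabel d σ h θ) x) :=
  ev_permMap P W _ d σ h θ x

theorem exists_of_mem_tgtRel {r : Homog (htensor (P.obj c d) (fun i => W (c i)))}
    (hr : r ∈ tgtRel P W c d) : ∃ (σ : Equiv.Perm (Fin n)) (h : ∀ i, c (σ i) = c i) (m : ℤ)
      (b : (htensor (P.obj c d) (fun i => W (c i))).X m) (κ : ℤˣ),
      r = mk m (κ • ((autMap P c d W σ h).f m b - b)) := by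
  obtain ⟨σ, h, θ, x, m, h₁, h₂, rfl⟩ := hr
  refine ⟨σ, h, m, tmk _ m h₂, koszulSign σ (fun i => (x i).deg), congrArg (mk m) ?_⟩
  have key := congrArg (sgn (koszulSign σ fun i => (x i).deg)) (ev_autMap P σ h θ x)
  rw [sgn_sgn, Int.units_mul_self, sgn_one] at key
  have h₃ : hpure θ (fun i => recolor W (h i) (x (σ i))) = mk m (tmk _ m h₂) :=
    (mk_tmk _ m h₂).symm
  have h₄ : hpure (P.relabel d σ h θ) x = mk m (tmk _ m h₁) := (mk_tmk _ m h₁).symm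
  rw [h₃, h₄] at key
  have key' : ∀ {M : Type u} [AddCommGroup M] (a b b' : M) (s : ℤˣ), s • b' = a →
      a - s • b = s • (b' - b) := by
    rintro M _ _ b b' s rfl
    exact (smul_sub _ _ _).symm
  exact key' _ _ _ _ (eq_of_heq (mk.inj key).2)

/-- Degreewise linear maps out of the coinvariants. -/
theorem exists_tgt_lin {Z : Cx k} {L : Homog (htensor (P.obj c d) (fun i => W (c i))) → Homog Z}
    (hL : IsLin L) (hdeg : ∀ z, (L z).deg = z.deg)
    (h : ∀ (σ : Equiv.Perm (Fin n)) (h : ∀ i, c (σ i) = c i) (θ : Homog (P.obj c d))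
      (x : ∀ i, Homog (W (c i))), L (hpure (P.relabel d σ h θ) x) =
        sgn (koszulSign σ (fun i => (x i).deg))
          (L (hpure θ (fun i => recolor W (h i) (x (σ i)))))) :
    ∃ l : ∀ j, (orbitTgt P W c d).X j →ₗ[k] Z.X j, ∀ θ x,
      hlin l (ev (tgtProj P W c d) θ x) = L (hpure θ x) := by
  have hs : ∀ (s : ℤˣ) z, L (sgn s z) = sgn s (L z) := fun s z => by
    rw [sgn_eq_hsmul, sgn_eq_hsmul, hL.smul]
  have key : ∀ (σ : Equiv.Perm (Fin n)) (hσ : ∀ i, c (σ i) = c i) z,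
      L (map (autMap P c d W σ hσ) z) = L z := by
    intro σ hσ
    refine (hL.comp (isLin_map _)).eq_of_spans hL (fun z => by rw [hdeg, hdeg]; rfl)
      (spans_hpure _ _) ?_
    rintro _ ⟨θ, y, rfl⟩
    obtain ⟨x, rfl⟩ := relabel_exists_args (V := W) (W := W) σ hσ (fun _ => true) y
    refine (congrArg L (ev_autMap P σ hσ θ x)).trans ((hs _ _).trans ?_)
    refine (congrArg (sgn _) (h σ hσ θ x)).trans ?_
    rw [sgn_sgn, Int.units_mul_self, sgn_one]
    rfl
  have key' : ∀ (κ : ℤˣ) (σ : Equiv.Perm (Fin n)) (hσ : ∀ i, c (σ i) = c i) (m q : ℤ)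
      (b : (htensor (P.obj c d) (fun i => W (c i))).X m),
      (L (mk m (κ • ((autMap P c d W σ hσ).f m b - b)))).vat q = 0 := by
    intro κ σ hσ m q b
    obtain ⟨l, hl⟩ := hL.exists_linear m q
    rw [← hl, Units.smul_def, map_zsmul, map_sub, hl, hl, ← map_mk, key, sub_self, smul_zero]
  obtain ⟨L', hL', hdeg', h'⟩ := quot_lin (R := tgtRel P W c d) L hL 0
    (fun z => by rw [hdeg, zero_add])
    (fun r hr q => by
      obtain ⟨σ, hσ, m, b, κ, rfl⟩ := exists_of_mem_tgtRel P hr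
      exact key' κ σ hσ m q b)
    (fun r hr q => by
      obtain ⟨σ, hσ, m, b, κ, rfl⟩ := exists_of_mem_tgtRel P hr
      have : (mk m (κ • ((autMap P c d W σ hσ).f m b - b))).diff = mk (m + 1)
          (κ • ((autMap P c d W σ hσ).f (m + 1) ((htensor (P.obj c d) (fun i => W (c i))).d m
            (m + 1) b) - (htensor (P.obj c d) (fun i => W (c i))).d m (m + 1) b)) := by
        rw [Homog.diff_mk, Units.smul_def, map_zsmul, map_sub, f_d_apply, Units.smul_def]
      rw [this]
      exact key' κ σ hσ (m + 1) q _)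
  obtain ⟨l, hl⟩ := exists_hlin_eq hL' (fun z => by rw [hdeg', zero_add])
  exact ⟨l, fun θ x => (hl _).trans (h' _)⟩

theorem spans_orbitTgt : Spans {z | ∃ (θ : Homog (P.obj c d)) (x : ∀ i, Homog (W (c i))),
    z = ev (tgtProj P W c d) θ x} := by
  have := quotProj_spans (tgtRel P W c d) (spans_hpure (P.obj c d) (fun i => W (c i)))
  refine fun Q h => this Q ?_
  rintro _ ⟨_, ⟨θ, x, rfl⟩, rfl⟩
  exact h _ ⟨θ, x, rfl⟩

variable (c d)

/-- The functoriality of the coinvariants. -/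
def orbitTgtMap (π : ∀ a, W a ⟶ T a) : orbitTgt P W c d ⟶ orbitTgt P T c d :=
  quotDesc _ (hmap (𝟙 _) (fun i => π (c i)) ≫ tgtProj P T c d) (tgtRel_val P _ fun σ h θ x => by
    have key : ∀ θ (x : ∀ i, Homog (W (c i))), ev (hmap (𝟙 _) (fun i => π (c i)) ≫
        tgtProj P T c d) θ x = ev (tgtProj P T c d) θ fun i => map (π (c i)) (x i) := by
      intro θ x
      unfold ev
      rw [Homog.map_comp, map_hmap, Homog.map_id]
    rw [key, key]
    refine (ev_quotProj_relabel P σ h θ _).trans (congrArg (sgn _) (congrArg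
      (ev (tgtProj P T c d) θ) (funext fun i => ?_)))
    have : ∀ {a b : C} (h : a = b) (x : Homog (W a)), recolor T h (map (π a) x) =
        map (π b) (recolor W h x) := by
      intro a b h x
      subst h
      rfl
    exact this _ _)

variable {c d}

theorem map_orbitTgtMap (π : ∀ a, W a ⟶ T a) (θ : Homog (P.obj c d)) (x : ∀ i, Homog (W (c i))) :
    map (orbitTgtMap P c d π) (ev (tgtProj P W c d) θ x) =
      ev (tgtProj P T c d) θ fun i => map (π (c i)) (x i) := by
  change map (tgtProj P T c d) (map (hmap (𝟙 _) (fun i => π (c i))) (hpure θ x)) = _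
  rw [map_hmap, Homog.map_id]
  rfl

end Orbits

section Vertices

variable (P : ColoredOperad k C) {V W T : Coll k C}
  {f : V ⟶ W} {π : ∀ a, W a ⟶ T a} (D : ∀ a, DegreewiseSplitting (f a) (π a))

/-- The section of the projection between factors at a vertex. -/
def vertSec (a : C) : ∀ b : Bool, Homog (vert V T a b) → Homog (vert V W a b)
  | false => id
  | true => hlin (D a).s

/-- The projection to a factor at a vertex. -/
def vertPr (a : C) : ∀ b : Bool, Homog (W a) → Homog (vert V W a b)
  | false => hlin (D a).r
  | true => fun w => hlin (D a).s (map (π a) w)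

theorem deg_vertPr (a : C) (b : Bool) (w : Homog (W a)) : (vertPr D a b w).deg = w.deg := by
  cases b <;> rfl

theorem vertPr_isLin (a : C) (b : Bool) : IsLin (vertPr D a b) := by
  cases b
  · exact hlin_isLin _
  · exact (hlin_isLin _).comp (isLin_map _)

theorem vertPr_self (a : C) (b : Bool) (y : Homog (vert V T a b)) :
    vertPr D a b (map (vertTop f a b) (vertSec D a b y)) = vertSec D a b y := by
  cases b
  · exact Homog.ext rfl (heq_of_eq ((D a).r_i _ _))
  · exact Homog.ext rfl (heq_of_eq (congrArg ((D a).s _) ((D a).π_s _ _)))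

theorem vertPr_ne (a : C) {b b' : Bool} (h : b ≠ b') (y : Homog (vert V T a b')) :
    (vertPr D a b (map (vertTop f a b') (vertSec D a b' y))).val = 0 := by
  cases b <;> cases b' <;> simp only [ne_eq, not_true_eq_false] at h
  · exact (D a).r_s _ _
  · exact (congrArg ((D a).s _) ((D a).π_i _ _)).trans (map_zero _)

theorem spans_vert (a : C) (b' : Bool) : Spans {z : Homog (vert V W a b') | ∃ (b : Bool)
    (h : b ≤ b') (y : Homog (vert V T a b)), z = map (vertMap f a b b' h)
      (vertSec D a b y)} := by
  intro Q h₁ _ h₃ _ z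
  cases b'
  · exact h₁ _ ⟨false, le_rfl, z, rfl⟩
  · obtain ⟨m, z⟩ := z
    have : ∀ z : (W a).X m, HAdd3 (mk m z) (mk m ((f a).f m ((D a).r m z)))
        (mk m ((D a).s m ((π a).f m z))) := fun z => by
      have h := hadd_mk m ((f a).f m ((D a).r m z)) ((D a).s m ((π a).f m z))
      rwa [(D a).add] at h
    exact h₃ (this z) (h₁ _ ⟨false, Bool.false_le _, mk m ((D a).r m z), rfl⟩)
      (h₁ _ ⟨true, le_rfl, mk m ((π a).f m z), rfl⟩)

theorem spans_vertTop (a : C) : Spans {z : Homog (W a) | ∃ (b : Bool) (y : Homog (vert V T a b)),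
    z = map (vertTop f a b) (vertSec D a b y)} := by
  refine fun Q h => spans_vert D a true Q ?_
  rintro _ ⟨b, hb, y, rfl⟩
  refine h _ ⟨b, y, ?_⟩
  cases b <;> rfl

variable {n : ℕ} {c : Fin n → C} {d : C}

/-- The class of a tensor at a vertex. -/
abbrev vertexClass (S : Proper n) :
    htensor (P.obj c d) (fun i => vert V W (c i) (S.1 i)) ⟶ orbitSrc P f c d :=
  cornerIncl f (P.obj c d) c S ≫ srcProj P f c d

theorem deg_vertexClass (S : Proper n) (θ : Homog (P.obj c d)) (w : ∀ i, Homog (W (c i))) :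
    (ev (vertexClass P (f := f) S) θ (fun i => vertPr D (c i) (S.1 i) (w i))).deg =
      θ.deg + ∑ i, (w i).deg := by
  rw [deg_ev]
  simp only [deg_vertPr]

theorem vertexClass_relabel (σ : Equiv.Perm (Fin n)) (h : ∀ i, c (σ i) = c i) (S : Fin n → Bool)
    (hS : S ≠ fun _ => true) (hS' : (fun i => S (σ i)) ≠ fun _ => true)
    (θ : Homog (P.obj c d)) (x : ∀ i, Homog (vert V W (c i) (S i))) :
    ev (vertexClass P (f := f) ⟨S, hS⟩) (P.relabel d σ h θ) x =
      sgn (koszulSign σ (fun i => (x i).deg))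
        (ev (vertexClass P (f := f) ⟨fun i => S (σ i), hS'⟩) θ
          (fun i => recolor (fun a => vert V W a (S (σ i))) (h i) (x (σ i)))) := by
  have hd : tdeg (hargs θ (fun i => recolor (fun a => vert V W a (S (σ i))) (h i) (x (σ i)))) =
      tdeg (hargs (P.relabel d σ h θ) x) := by
    rw [tdeg_hargs, tdeg_hargs]
    unfold ColoredOperad.relabel
    rw [deg_ev]
    simp [ColoredOperad.unit]
    exact Equiv.sum_comp σ (fun i => (x i).deg)
  refine ext_vat hd.symm ?_
  have e := quotProj_eq_zero (R := srcRel P f c d) ⟨σ, h, S, hS, hS', θ, x, _, rfl, hd, rfl⟩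
  have e₁ := f_tmk (vertexClass P (f := f) ⟨S, hS⟩) (P.relabel d σ h θ) x _ rfl
  have e₂ := f_tmk (vertexClass P (f := f) ⟨fun i => S (σ i), hS'⟩) θ
    (fun i => recolor (fun a => vert V W a (S (σ i))) (h i) (x (σ i))) _ hd
  refine e₁.symm.trans ((sub_eq_zero.1 ((f_sub_smul _ _ _ _ _).symm.trans e)).trans ?_)
  rw [vat_sgn]
  exact congrArg _ e₂

theorem vertexClass_map {S S' : Proper n} (h : ∀ i, S.1 i ≤ S'.1 i) (θ : Homog (P.obj c d))
    (x : ∀ i, Homog (vert V W (c i) (S.1 i))) :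
    ev (vertexClass P (f := f) S') θ (fun i => map (vertMap f (c i) _ _ (h i)) (x i)) =
      ev (vertexClass P (f := f) S) θ x := by
  have hw := colimit.w (cube f (P.obj c d) c) (homOfLE (show S ≤ S' from h))
  have : map (vertexClass P (f := f) S') (map ((cube f (P.obj c d) c).map
      (homOfLE (show S ≤ S' from h))) (hpure θ x)) = ev (vertexClass P (f := f) S) θ x :=
    congrArg (fun F => ev (F ≫ srcProj P f c d) θ x) hw
  refine Eq.trans (congrArg (map (vertexClass P (f := f) S')) ?_) this
  change _ = map (hmap (𝟙 _) _) (hpure θ x)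
  rw [map_hmap, Homog.map_id]

/-- The sum of the projections to all proper vertices. -/
def vertexSum (θ : Homog (P.obj c d)) (w : ∀ i, Homog (W (c i))) : Homog (orbitSrc P f c d) :=
  mk (θ.deg + ∑ i, (w i).deg) (∑ S : Proper n,
    (ev (vertexClass P S) θ (fun i => vertPr D (c i) (S.1 i) (w i))).vat (θ.deg + ∑ i, (w i).deg))

theorem vat_vertexSum (θ : Homog (P.obj c d)) (w : ∀ i, Homog (W (c i))) (m : ℤ) :
    (vertexSum P D θ w).vat m = ∑ S : Proper n,
      (ev (vertexClass P S) θ (fun i => vertPr D (c i) (S.1 i) (w i))).vat m :=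
  vat_mk_sum (fun S => deg_vertexClass P D S θ w) m

theorem vertexSum_top (θ : Homog (P.obj c d)) (y : ∀ i, Homog (T (c i))) (m : ℤ) :
    (vertexSum P D θ (fun i => hlin (D (c i)).s (y i))).vat m = 0 := by
  rw [vat_vertexSum]
  refine Finset.sum_eq_zero fun S _ => ?_
  obtain ⟨i, hi⟩ := Function.ne_iff.1 S.2
  exact ev_eq_zero _ θ _ i (vertPr_ne D (c i) (b' := true) hi (y i)) m

theorem vertexSum_proper (S : Proper n) (θ : Homog (P.obj c d))
    (y : ∀ i, Homog (vert V T (c i) (S.1 i))) : vertexSum P D θ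
      (fun i => map (vertTop f (c i) (S.1 i)) (vertSec D (c i) (S.1 i) (y i))) =
        ev (vertexClass P S) θ (fun i => vertSec D (c i) (S.1 i) (y i)) := by
  refine ext_vat ?_ ?_
  · rw [deg_ev]
    rfl
  · rw [vat_vertexSum, Finset.sum_eq_single S]
    · congr 3
      exact funext fun i => vertPr_self D (c i) _ _
    · intro S' _ hS'
      obtain ⟨i, hi⟩ := Function.ne_iff.1 (fun h => hS' (Subtype.ext h))
      exact ev_eq_zero _ θ _ i (vertPr_ne D (c i) hi _) _
    · exact fun h => absurd (Finset.mem_univ _) h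

theorem vertexSum_relabel (σ : Equiv.Perm (Fin n)) (h : ∀ i, c (σ i) = c i) (θ : Homog (P.obj c d))
    (w : ∀ i, Homog (W (c i))) : vertexSum P D (P.relabel d σ h θ) w =
      sgn (koszulSign σ (fun i => (w i).deg))
        (vertexSum P D θ (fun i => recolor W (h i) (w (σ i)))) := by
  have hr : (P.relabel d σ h θ).deg = θ.deg := by
    unfold ColoredOperad.relabel
    rw [deg_ev]
    simp [ColoredOperad.unit]
  refine ext_vat ?_ ?_
  · change _ + _ = _ + ∑ i, (w (σ i)).deg
    rw [hr, Equiv.sum_comp σ (fun i => (w i).deg)]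
  · rw [vat_sgn, vat_vertexSum, vat_vertexSum, Finset.smul_sum]
    have hσ : ∀ S : Fin n → Bool, (S ≠ fun _ => true) ↔ (fun i => S (σ i)) ≠ fun _ => true := by
      refine fun S => not_congr ⟨fun h => by rw [h], fun h => funext fun i => ?_⟩
      obtain ⟨i, rfl⟩ := σ.surjective i
      exact congrFun h i
    let e : Proper n ≃ Proper n := Equiv.subtypeEquiv (σ.arrowCongr (Equiv.refl Bool)).symm hσ
    refine Eq.trans (Finset.sum_congr rfl fun S _ => ?_) (e.sum_comp _)
    have := vertexClass_relabel P (f := f) σ h S.1 S.2 ((hσ S.1).1 S.2) θ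
      (fun i => vertPr D (c i) (S.1 i) (w i))
    rw [this, vat_sgn]
    simp only [deg_vertPr]
    refine congrArg (fun z => koszulSign σ (fun i => (w i).deg) • z.vat _)
      (congrArg (ev (vertexClass P (e S)) θ) (funext fun i => ?_))
    have : ∀ {a a' : C} (h : a = a') (b : Bool) (w : Homog (W a)),
        recolor (fun a => vert V W a b) h (vertPr D a b w) = vertPr D a' b (recolor W h w) := by
      intro a a' h b w
      subst h
      rfl
    exact this _ _ _

theorem exists_retraction : ∃ l : ∀ j, (orbitTgt P W c d).X j →ₗ[k] (orbitSrc P f c d).X j,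
    ∀ θ w, hlin l (ev (tgtProj P W c d) θ w) = vertexSum P D θ w := by
  have h₁ : ∀ w : (∀ i, Homog (W (c i))), IsLin (fun θ : Homog (P.obj c d) =>
      vertexSum P D θ w) := fun w =>
    isLin_hsum (E := fun θ : Homog (P.obj c d) => θ.deg + ∑ i, (w i).deg)
      (fun S => ev_isLin (vertexClass P S) _) (fun S θ => deg_vertexClass P D S θ w)
      (fun θ θ' h => by rw [h])
  have h₂ : ∀ θ : Homog (P.obj c d), IsML (vertexSum P D θ) := by
    refine fun θ => isML_of_lin fun w i => ?_
    refine isLin_hsum (E := fun z : Homog (W (c i)) => θ.deg + ∑ j, (Function.update w i z j).deg)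
      (F := fun S z => ev (vertexClass P S) θ
        (fun j => vertPr D (c j) (S.1 j) (Function.update w i z j))) (fun S => ?_)
      (fun S z => deg_vertexClass P D S θ _) (fun z z' h => ?_)
    · have := ((ev_isML (vertexClass P (f := f) S) θ).subst (fun j => j)
        (fun j (w : ∀ i, Homog (W (c i))) => vertPr D (c j) (S.1 j) (w j))
        (fun x i z j hj => by rw [Function.update_of_ne hj])
        (fun x i => by simp only [Function.update_self]; exact vertPr_isLin D _ _)).lin w i
      exact this
    · congr 1
      refine Finset.sum_congr rfl fun j _ => ?_
      rcases eq_or_ne j i with rfl | hj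
      · simpa using h
      · simp [hj]
  obtain ⟨L, hL, hdeg, h⟩ := exists_hlin h₁ h₂ (D := 0) (fun θ w => (zero_add _).symm)
  obtain ⟨l, hl⟩ := exists_tgt_lin P hL (fun z => by rw [hdeg, zero_add]) (fun σ hσ θ x => by
    rw [h, h, vertexSum_relabel])
  exact ⟨l, fun θ w => (hl θ w).trans (h θ w)⟩

theorem exists_section : ∃ l : ∀ j, (orbitTgt P T c d).X j →ₗ[k] (orbitTgt P W c d).X j,
    ∀ θ y, hlin l (ev (tgtProj P T c d) θ y) =
      ev (tgtProj P W c d) θ fun i => hlin (D (c i)).s (y i) := by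
  obtain ⟨L, hL, hdeg, h⟩ := exists_hlin (F := fun θ (y : ∀ i, Homog (T (c i))) =>
    ev (tgtProj P W c d) θ fun i => hlin (D (c i)).s (y i)) (D := 0) (fun w => ev_isLin _ _)
    (fun θ => (ev_isML _ θ).subst (fun j => j) (fun j y => hlin (D (c j)).s (y j))
        (fun x i z j hj => by rw [Function.update_of_ne hj])
        (fun x i => by simp only [Function.update_self]; exact hlin_isLin _))
    (fun θ w => by rw [deg_ev, zero_add]; rfl)
  obtain ⟨l, hl⟩ := exists_tgt_lin P hL (fun z => by rw [hdeg, zero_add]) (fun σ hσ θ x => by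
    rw [h, h]
    refine (ev_quotProj_relabel P σ hσ θ _).trans (congrArg (sgn _) (congrArg
      (ev (tgtProj P W c d) θ) (funext fun i => ?_)))
    have : ∀ {a b : C} (h : a = b) (x : Homog (T a)), recolor W h (hlin (D a).s x) =
        hlin (D b).s (recolor T h x) := by
      intro a b h x
      subst h
      rfl
    exact this _ _)
  exact ⟨l, fun θ w => (hl θ w).trans (h θ w)⟩

theorem map_orbitMap (S : Proper n) (θ : Homog (P.obj c d))
    (x : ∀ i, Homog (vert V W (c i) (S.1 i))) :
    map (orbitMap P f c d) (ev (vertexClass P S) θ x) =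
      ev (tgtProj P W c d) θ (fun i => map (vertTop f (c i) (S.1 i)) (x i)) := by
  have : vertexClass P S ≫ orbitMap P f c d = cubeTop f (P.obj c d) c S.1 ≫ tgtProj P W c d := by
    change cornerIncl f (P.obj c d) c S ≫ cornerMap f (P.obj c d) c ≫ tgtProj P W c d = _
    rw [← Category.assoc, cornerIncl_map]
  refine (congrArg (fun F => ev F θ x) this).trans ?_
  exact congrArg (map (tgtProj P W c d)) (map_cubeTop f (P.obj c d) c S.1 θ x)

/-- The maps of coinvariants induced by degreewise split maps are degreewise split. -/
theorem nonempty_orbitSplitting (D : ∀ a, DegreewiseSplitting (f a) (π a)) :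
    Nonempty (DegreewiseSplitting (orbitMap P f c d) (orbitTgtMap P c d π)) := by
  obtain ⟨r, hr⟩ := exists_retraction P D (c := c) (d := d)
  obtain ⟨s, hs⟩ := exists_section P D (c := c) (d := d)
  have h₁ : ∀ z, hlin r (map (orbitMap P f c d) z) = z := by
    have hlin₁ := (hlin_isLin r).comp (isLin_map (orbitMap P f c d))
    refine hlin₁.eq_of_spans isLin_id (fun _ => rfl)
      (quotProj_spans _ (spans_of_isColimit (colimit.isColimit (cube f (P.obj c d) c)))) ?_
    rintro _ ⟨_, ⟨S, z, rfl⟩, rfl⟩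
    have hv := isLin_map (vertexClass P (c := c) (d := d) (f := f) S)
    refine (hlin₁.comp hv).eq_of_spans hv (fun _ => rfl) (spans_hpure _ _) ?_ z
    rintro _ ⟨θ, x, rfl⟩
    have hm := ev_isML (vertexClass P (c := c) (d := d) (f := f) S) θ
    refine (hlin₁.comp_ml hm).eq_of_spans hm (fun _ => rfl)
      (fun i => spans_vert D (c i) (S.1 i)) (fun x hx => ?_) x
    choose b hb y hy using hx
    obtain rfl : x = _ := funext hy
    have hbS : b ≠ fun _ => true := by
      rintro rfl
      exact S.2 (funext fun i => top_le_iff.1 (hb i))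
    change hlin r (map _ (ev _ _ _)) = ev _ _ _
    rw [vertexClass_map P (S := ⟨b, hbS⟩) hb, map_orbitMap, hr]
    exact vertexSum_proper P D ⟨b, hbS⟩ θ y
  have h₂ : ∀ z, map (orbitTgtMap P c d π) (hlin s z) = z := by
    refine ((isLin_map _).comp (hlin_isLin s)).eq_of_spans isLin_id (fun _ => rfl)
      (spans_orbitTgt P) ?_
    rintro _ ⟨θ, y, rfl⟩
    rw [hs, map_orbitTgtMap]
    refine congrArg (ev (tgtProj P T c d) θ) (funext fun i => ?_)
    exact Homog.ext rfl (heq_of_eq ((D (c i)).π_s _ _))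
  have h₃ : ∀ z, hlin (fun j => ((orbitMap P f c d).f j).hom ∘ₗ r j +
      s j ∘ₗ ((orbitTgtMap P c d π).f j).hom) z = z := by
    refine (hlin_isLin _).eq_of_spans isLin_id (fun _ => rfl) (spans_orbitTgt P) ?_
    rintro _ ⟨θ, w, rfl⟩
    have hm := ev_isML (tgtProj P W c d) θ
    refine ((hlin_isLin _).comp_ml hm).eq_of_spans hm (fun _ => rfl)
      (fun i => spans_vertTop D (c i)) (fun w hw => ?_) w
    choose b y hy using hw
    obtain rfl : w = _ := funext hy
    refine ext_vat rfl ?_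
    have hadd : ∀ z : Homog (orbitTgt P W c d), (hlin (fun j => ((orbitMap P f c d).f j).hom ∘ₗ
        r j + s j ∘ₗ ((orbitTgtMap P c d π).f j).hom) z).vat z.deg =
        (map (orbitMap P f c d) (hlin r z)).vat z.deg +
          (hlin s (map (orbitTgtMap P c d π) z)).vat z.deg := fun ⟨m, z⟩ =>
      (vat_mk m _).trans ((LinearMap.add_apply _ _ _).trans
        (congrArg₂ (· + ·) (vat_mk m _).symm (vat_mk m _).symm))
    refine (hadd _).trans ?_
    rw [hr, map_orbitTgtMap, hs]
    by_cases hb : b = fun _ => true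
    · subst hb
      have h₀ : ∀ m, (vertexSum P D θ (fun i => map (vertTop f (c i) true)
        (vertSec D (c i) true (y i)))).vat m = 0 := vertexSum_top P D θ y
      rw [vat_map, h₀, map_zero, zero_add]
      refine congrArg (fun z => (ev (tgtProj P W c d) θ z).vat _) (funext fun i => ?_)
      exact Homog.ext rfl (heq_of_eq (congrArg ((D (c i)).s _) ((D (c i)).π_s _ _)))
    · obtain ⟨i, hi⟩ := Function.ne_iff.1 hb
      have h₀ := vertexSum_proper P D ⟨b, hb⟩ θ y
      have h₄ : (hlin (D (c i)).s (map (π (c i)) (map (vertTop f (c i) (b i))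
          (vertSec D (c i) (b i) (y i))))).val = 0 :=
        vertPr_ne D (c i) (b := true) (fun h => hi h.symm) (y i)
      rw [ev_eq_zero _ _ _ i h₄, add_zero]
      refine congrArg (fun z : Homog (orbitTgt P W c d) => z.vat _)
        ((congrArg (map (orbitMap P f c d)) h₀).trans ?_)
      exact map_orbitMap P ⟨b, hb⟩ θ _
  refine ⟨⟨r, s, fun j a => ?_, fun j a => ?_, fun j a => ?_⟩⟩
  · exact eq_of_heq (mk.inj (h₁ (mk j a))).2
  · exact eq_of_heq (mk.inj (h₂ (mk j a))).2
  · exact eq_of_heq (mk.inj (h₃ (mk j a))).2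

end Vertices

section Retracts

theorem cofibrant_of_retract {X Y : Cx k} (hY : cofib k (initial.to Y)) (i : X ⟶ Y) (r : Y ⟶ X)
    (h : i ≫ r = 𝟙 X) : cofib k (initial.to X) := by
  refine (cofibrant_iff X).2 fun M N p hp g => ?_
  obtain ⟨l, hl⟩ := (cofibrant_iff Y).1 hY p hp (r ≫ g)
  exact ⟨i ≫ l, by rw [Category.assoc, hl, ← Category.assoc, h, Category.id_comp]⟩

theorem cofib_sigmaMap {J : Type u} {X Y : J → Cx k} (f : ∀ j, X j ⟶ Y j)
    (hf : ∀ j, cofib k (f j)) : cofib k (Limits.Sigma.map f) := by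
  refine (cofib_iff _).2 fun M N p hp t b hw => ?_
  have h : ∀ j, ∃ l : Y j ⟶ M, f j ≫ l = Sigma.ι X j ≫ t ∧ l ≫ p = Sigma.ι Y j ≫ b := fun j =>
    (cofib_iff _).1 (hf j) p hp _ _ (by rw [Category.assoc, hw, ← Category.assoc, Sigma.ι_map,
      Category.assoc])
  choose l hl hl' using h
  refine ⟨Sigma.desc l, Sigma.hom_ext _ _ fun j => ?_, Sigma.hom_ext _ _ fun j => ?_⟩
  · rw [← Category.assoc, Sigma.ι_map, Category.assoc, Sigma.ι_desc, hl]
  · rw [← Category.assoc, Sigma.ι_desc, hl']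

theorem cofib_inl (X : Cx k) {Y : Cx k} (hY : cofib k (initial.to Y)) :
    cofib k (biprod.inl : X ⟶ X ⊞ Y) := by
  refine (cofib_iff _).2 fun M N p hp t b hw => ?_
  obtain ⟨l, hl⟩ := (cofibrant_iff Y).1 hY p hp (biprod.inr ≫ b)
  refine ⟨biprod.desc t l, biprod.inl_desc _ _, biprod.hom_ext' _ _ ?_ ?_⟩
  · rw [← Category.assoc, biprod.inl_desc, hw]
  · rw [← Category.assoc, biprod.inr_desc, hl]

theorem val_eq_zero_of_initial (x : Homog (⊥_ (Cx k))) : x.val = 0 := by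
  have h : (𝟙 (⊥_ (Cx k)) : _ ⟶ _) = 0 := initial.hom_ext _ _
  exact congrArg (fun F : (⊥_ (Cx k)) ⟶ ⊥_ (Cx k) => F.f x.deg x.val) h

end Retracts

/-- The composition of a sequence of cofibrations is a cofibration. -/
theorem cofib_of_seq (D : ℕ ⥤ Cx k) (s : Cocone D)
    (hdesc : ∀ {Z : Cx k} (b : ∀ n, D.obj n ⟶ Z), (∀ n m (h : n ≤ m), D.map (homOfLE h) ≫ b m = b n) →
      ∃ w : s.pt ⟶ Z, ∀ n, s.ι.app n ≫ w = b n)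
    (hext : ∀ {Z : Cx k} {w w' : s.pt ⟶ Z}, (∀ n, s.ι.app n ≫ w = s.ι.app n ≫ w') → w = w')
    (hD : ∀ n, cofib k (D.map (homOfLE (Nat.le_succ n)))) : cofib k (s.ι.app 0) := by
  refine (cofib_iff _).2 fun M N p hp t g ht => ?_
  have step : ∀ (n : ℕ) (l : {l : D.obj n ⟶ M // l ≫ p = s.ι.app n ≫ g}),
      ∃ l' : {l' : D.obj (n + 1) ⟶ M // l' ≫ p = s.ι.app (n + 1) ≫ g},
        D.map (homOfLE (Nat.le_succ n)) ≫ l'.1 = l.1 := by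
    rintro n ⟨l, hl⟩
    obtain ⟨l', h₁, h₂⟩ := (cofib_iff _).1 (hD n) p hp l (s.ι.app (n + 1) ≫ g) (by
      rw [hl, ← Category.assoc]
      exact congrArg (· ≫ g) (s.w (homOfLE (Nat.le_succ n))).symm)
    exact ⟨⟨l', h₂⟩, h₁⟩
  choose next hnext using step
  let l : ∀ n : ℕ, {l : D.obj n ⟶ M // l ≫ p = s.ι.app n ≫ g} := fun n => Nat.rec ⟨t, ht⟩ next n
  obtain ⟨w, hw⟩ := hdesc (fun n => (l n).1) (by
    intro n m h
    obtain ⟨r, rfl⟩ := Nat.exists_eq_add_of_le h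
    induction r with
    | zero => exact (congrArg (· ≫ (l n).1) (D.map_id n)).trans (Category.id_comp _)
    | succ r ih =>
      rw [← ih (Nat.le_add_right n r), ← hnext (n + r) (l (n + r)), ← Category.assoc, ← D.map_comp]
      rfl)
  refine ⟨w, hw 0, hext fun n => ?_⟩
  rw [← Category.assoc, hw, (l n).2]

/-! ## Operads with cofibrant orbits -/

section Orbits

variable (P : ColoredOperad k C) {V W : Coll k C}

/-- The complexes `P(c,d) ⊗_{Σ_c} ⨂ᵢ T_{c(i)}`, for nonempty `c`, preserve cofibrancy. -/
def HasCofibrantOrbits : Prop := ∀ T : Coll k C, IsCofibrant T → ∀ (n : ℕ)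
  (q : CollClass C (n + 1)) (d : C), cofib k (initial.to (orbitTgt P T q.out d))

variable {P}

theorem HasCofibrantOrbits.cofib_subIncl (hP : HasCofibrantOrbits P) {f : V ⟶ W}
    (hf : IsCofibration f) (η : ∀ d, V d ⟶ P.obj (Fin.elim0 : Fin 0 → C) d) (n : ℕ) (d : C)
    (h : (n : ℕ∞) ≤ (n + 1 : ℕ)) : cofib k (subIncl P f η h d) := by
  choose T π hT D using fun a => exists_degreewiseSplitting (hf a)
  have hstep : cofib k (stepMap P f (n + 1) d) := cofib_sigmaMap _ fun q =>
    (nonempty_orbitSplitting P (c := q.out) (d := d) (fun a => (D a).some)).some.cofib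
      (hP T hT n q d)
  exact MorphismProperty.of_isPushout (P := (trivFib k).llp) (isPushout_step P f η n d h).flip hstep

theorem HasCofibrantOrbits.cofib_subIncl_top (hP : HasCofibrantOrbits P) {f : V ⟶ W}
    (hf : IsCofibration f) (η : ∀ d, V d ⟶ P.obj (Fin.elim0 : Fin 0 → C) d) (d : C) :
    cofib k (subIncl P f η (le_top (a := ((0 : ℕ) : ℕ∞))) d) :=
  cofib_of_seq (subSeq f P η ⋙ Pi.eval _ d)
    (Cocone.mk (sub P f η ⊤ d) ⟨fun n => subIncl P f η le_top d,
      fun n m h => (subIncl_trans P f η (by exact_mod_cast leOfHom h) le_top d).trans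
        (Category.comp_id _).symm⟩)
    (fun b hb => exists_colimDesc f P η d b fun n m h => hb n m (by exact_mod_cast h))
    (fun h => colim_hom_ext f P η d h) (fun n => hP.cofib_subIncl hf η n d (by exact_mod_cast Nat.le_succ n))

theorem htensor_hom_eq_of_initial {n : ℕ} {c : Fin n → C} {Q Z : Cx k} {S : Fin n → Bool} (j : Fin n)
    (hj : S j = false)
    (g g' : htensor Q (fun i => vert (fun _ : C => ⊥_ (Cx k)) W (c i) (S i)) ⟶ Z) : g = g' := by
  refine htensor_hom_ext fun θ x => ?_
  have hx : (x j).val = 0 := by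
    have : ∀ (b : Bool) (_ : b = false) (y : Homog (vert (fun _ : C => ⊥_ (Cx k)) W (c j) b)),
        y.val = 0 := by
      rintro _ rfl y
      exact val_eq_zero_of_initial y
    exact this (S j) hj (x j)
  exact ext_vat rfl ((ev_eq_zero g θ x j hx _).trans (ev_eq_zero g' θ x j hx _).symm)

variable (P) in
/-- If there are no relations, the words with at most `N` letters form a direct summand. -/
theorem exists_subRetract (T : Coll k C)
    (η : ∀ d, (⊥_ (Cx k)) ⟶ P.obj (Fin.elim0 : Fin 0 → C) d) (N : ℕ∞) (d : C) :
    ∃ r : sub P (fromInitial T) η ⊤ d ⟶ sub P (fromInitial T) η N d,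
      subIncl P (fromInitial T) η le_top d ≫ r = 𝟙 _ := by
  classical
  obtain ⟨r, hr⟩ := exists_subDesc P (fromInitial T) η (N := ⊤) (d := d)
    (fun n _ c => if h : (n : ℕ∞) ≤ N then cellIn P (fromInitial T) η h c d else 0) (by
      rintro ⟨n, c, S, l, c', π, h, hn, hl⟩
      dsimp only
      by_cases hS : ∃ j, S j = false
      · obtain ⟨j, hj⟩ := hS
        exact htensor_hom_eq_of_initial j hj _ _
      · obtain rfl : S = fun _ => true := funext fun j => by
          by_contra hj
          exact hS ⟨j, by simpa using hj⟩
        have hln : l = n := (size_eq _ π).symm.trans size_true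
        subst hln
        by_cases hN : (l : ℕ∞) ≤ N
        · rw [dif_pos hN, dif_pos hN]
          exact cellIn_fill P (fromInitial T) η hN hN _ c c' d π h
        · rw [dif_neg hN, dif_neg hN, comp_zero, comp_zero])
  refine ⟨r, sub_hom_ext P _ _ fun n hn c => ?_⟩
  rw [← Category.assoc, cellIn_subIncl, hr, dif_pos hn, Category.comp_id]

variable (P) in
theorem exists_orbitRetract (T : Coll k C)
    (η : ∀ d, (⊥_ (Cx k)) ⟶ P.obj (Fin.elim0 : Fin 0 → C) d) (n : ℕ) (q : CollClass C (n + 1))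
    (d : C) : ∃ (i : orbitTgt P T q.out d ⟶ sub P (fromInitial T) η ⊤ d)
      (r : sub P (fromInitial T) η ⊤ d ⟶ orbitTgt P T q.out d), i ≫ r = 𝟙 _ := by
  obtain ⟨r, hr⟩ := exists_subRetract P T η (n + 1 : ℕ) d
  obtain ⟨w, -, hw⟩ := exists_stepDesc P (fromInitial T) η (m := n) rfl d (𝟙 (stepTgt P T (n + 1) d))
    (0 : sub P (fromInitial T) η n d ⟶ _) (fun q S => by
      obtain ⟨j, hj⟩ : ∃ j, S.1 j = false := by
        by_contra hS
        refine S.2 (funext fun j => ?_)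
        by_contra hj
        exact hS ⟨j, by simpa using hj⟩
      exact htensor_hom_eq_of_initial j hj _ _)
  have hw' : stepIn P (fromInitial T) η (n + 1) d ≫ w = 𝟙 _ := stepTgt_hom_ext P fun q => by
    rw [← Category.assoc, topIncl_stepIn, hw]
  classical
  refine ⟨Sigma.ι (fun q : CollClass C (n + 1) => orbitTgt P T q.out d) q ≫
      stepIn P (fromInitial T) η (n + 1) d ≫ subIncl P (fromInitial T) η le_top d,
    r ≫ w ≫ Sigma.π (fun q : CollClass C (n + 1) => orbitTgt P T q.out d) q, ?_⟩
  have h₁ : stepIn P (fromInitial T) η (n + 1) d ≫ subIncl P (fromInitial T) η le_top d ≫ r ≫ w =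
      𝟙 _ := by
    rw [← Category.assoc (subIncl _ _ _ _ _), hr, Category.id_comp, hw']
  have h₂ := congrArg (fun F : stepTgt P T (n + 1) d ⟶ stepTgt P T (n + 1) d =>
    Sigma.ι (fun q : CollClass C (n + 1) => orbitTgt P T q.out d) q ≫ F ≫
      Sigma.π (fun q : CollClass C (n + 1) => orbitTgt P T q.out d) q) h₁
  simp only [Category.assoc] at h₂ ⊢
  refine h₂.trans ?_
  refine (congrArg (_ ≫ ·) (Category.id_comp _)).trans ?_
  exact Sigma.ι_π_eq_id _ _

end Orbits

/-! ## Attaching cells to algebras with well-behaved enveloping operads -/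

section Good

variable {O : ColoredOperad k C} {A : Alg O}
  {V W : Coll k C}

theorem HasCofibrantOrbits.cofib_cellAlgIn {E : EnvelopingOperad O A}
    (hE : HasCofibrantOrbits E.operad) {f : V ⟶ W} (hf : IsCofibration f)
    (α : ∀ d, V d ⟶ A.X d) (d : C) : cofib k ((cellAlgIn E f α).f d) := by
  obtain ⟨w, hw, hw'⟩ := exists_zeroOut E f α d
  have : IsIso (zeroIn E f α d) := ⟨w, hw, hw'⟩
  rw [← zeroIn_top]
  refine (trivFib k).llp.comp_mem _ _ ?_ (hE.cofib_subIncl_top hf _ d)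
  exact (cofib_iff _).2 fun M N p _ t b h => ⟨inv (zeroIn E f α d) ≫ t, by simp, by simp [h]⟩

theorem cofibrant_of_cofib {X Y : Cx k} (i : X ⟶ Y) (hi : cofib k i) (hX : cofib k (initial.to X)) :
    cofib k (initial.to Y) := by
  rw [← initial.hom_ext (initial.to X ≫ i) (initial.to Y)]
  exact (trivFib k).llp.comp_mem _ _ hX hi

theorem HasCofibrantOrbits.cofibrant_cellAlg {E : EnvelopingOperad O A}
    (hE : HasCofibrantOrbits E.operad) (hA : IsCofibrant A.X) {f : V ⟶ W} (hf : IsCofibration f)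
    (α : ∀ d, V d ⟶ A.X d) : IsCofibrant (cellAlg E f α).X := fun d =>
  cofibrant_of_cofib _ (hE.cofib_cellAlgIn hf α d) (hA d)

theorem hasCofibrantOrbits_of_cellAlg (E : EnvelopingOperad O A)
    (h : ∀ T : Coll k C, IsCofibrant T →
      IsCofibrant (cellAlg E (fromInitial T) (fun d => initial.to (A.X d))).X) :
    HasCofibrantOrbits E.operad := fun T hT n q d => by
  obtain ⟨i, r, hr⟩ := exists_orbitRetract E.operad T
    (cellη E (fun d => initial.to (A.X d))) n q d
  exact cofibrant_of_retract (h T hT d) i r hr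

theorem IsCellAttach.comp {A B D : Alg O} {f : V ⟶ W} {α : ∀ d, V d ⟶ A.X d} {i : A ⟶ B}
    {β : ∀ d, W d ⟶ B.X d} (h : IsCellAttach f α i β) {T : Coll k C} {i' : B ⟶ D}
    {β' : ∀ d, T d ⟶ D.X d}
    (h' : IsCellAttach (fromInitial T) (fun d => initial.to (B.X d)) i' β') :
    IsCellAttach (W := fun d => W d ⊞ T d) (fun d => f d ≫ biprod.inl) α (i ≫ i')
      (fun d => biprod.desc (β d ≫ i'.f d) (β' d)) where
  comm d := by
    rw [Category.assoc, biprod.inl_desc, ← Category.assoc, h.comm, Alg.comp_f, Category.assoc]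
  existsUnique Z j γ hγ := by
    obtain ⟨u, ⟨hu₁, hu₂⟩, hu₃⟩ := h.existsUnique Z j (fun d => biprod.inl ≫ γ d)
      (fun d => by rw [← Category.assoc, hγ])
    obtain ⟨v, ⟨hv₁, hv₂⟩, hv₃⟩ := h'.existsUnique Z u (fun d => biprod.inr ≫ γ d)
      (fun d => initial.hom_ext _ _)
    refine ⟨v, ⟨by rw [Category.assoc, hv₁, hu₁], fun d => biprod.hom_ext' _ _ ?_ ?_⟩, ?_⟩
    · rw [← Category.assoc, biprod.inl_desc, Category.assoc, ← Alg.comp_f, hv₁, hu₂]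
    · rw [← Category.assoc, biprod.inr_desc, hv₂]
    · rintro v' ⟨h₁, h₂⟩
      refine hv₃ v' ⟨hu₃ _ ⟨by rw [← Category.assoc, h₁], fun d => ?_⟩, fun d => ?_⟩
      · rw [← h₂, ← Category.assoc biprod.inl, biprod.inl_desc, Category.assoc, Alg.comp_f]
      · rw [← h₂, ← Category.assoc biprod.inr, biprod.inr_desc]

theorem cofibrant_of_algIso {A B : Alg O} (e : A ≅ B) (h : IsCofibrant A.X) : IsCofibrant B.X :=
  fun d => cofibrant_of_retract (h d) (e.inv.f d) (e.hom.f d) (by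
    rw [← Alg.comp_f, e.inv_hom_id, Alg.id_f])

theorem HasCofibrantOrbits.attach {E : EnvelopingOperad O A} (hE : HasCofibrantOrbits E.operad)
    (hA : IsCofibrant A.X) {f : V ⟶ W} (hf : IsCofibration f) (α : ∀ d, V d ⟶ A.X d)
    (E' : EnvelopingOperad O (cellAlg E f α)) : HasCofibrantOrbits E'.operad := by
  refine hasCofibrantOrbits_of_cellAlg E' fun T hT => ?_
  obtain ⟨e, -⟩ := (isCellAttach_cellAlg E (V := V) (W := fun d => W d ⊞ T d)
    (fun d => f d ≫ biprod.inl) α).exists_iso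
      ((isCellAttach_cellAlg E f α).comp (isCellAttach_cellAlg E' (fromInitial T) _))
  exact cofibrant_of_algIso e (hE.cofibrant_cellAlg hA
    (fun d => (trivFib k).llp.comp_mem _ _ (hf d) (cofib_inl (W d) (hT d))) α)

end Good

/-! ## Orbits of `Σ`-cofibrant operads -/

section Koszul

variable {n : ℕ}

theorem shuffleSign_zero_zero {l : ℕ} {m : Fin n → ℕ} (π : (Σ j, Fin (m j)) ≃ Fin l) :
    shuffleSign π (fun _ => 0) (fun _ => 0) = 1 := by
  simp [shuffleSign]

theorem koszulSign_mul (σ τ : Equiv.Perm (Fin n)) (r : Fin n → ℤ) :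
    koszulSign (σ * τ) r = koszulSign σ r * koszulSign τ (fun i => r (σ i)) := by
  have h := shuffleSign_comp (permSigma τ) (permSigma σ)
    (fun _ => Equiv.sigmaUnique (Fin 1) (fun _ => Fin 1)) (permSigma (σ * τ))
    (fun j y z => by rfl) (fun _ => 0) (fun _ => 0) r
  simp only [zero_add, Finset.univ_unique, Finset.sum_const_zero, Finset.sum_singleton] at h
  rw [Finset.prod_eq_one (fun j _ => shuffleSign_zero_left _ (fun i i' hi => by omega) _),
    shuffleSign_zero_zero, one_mul, mul_one] at h
  rw [koszulSign_eq, koszulSign_eq, koszulSign_eq]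
  exact h.symm

theorem koszulSign_leibniz (σ : Equiv.Perm (Fin n)) (t : ℤ) (r : Fin n → ℤ) (j : Fin n) :
    koszulSign σ r * leftSign t (fun i => r (σ i)) j =
      leftSign t r (σ j) * koszulSign σ (Function.update r (σ j) (r (σ j) + 1)) := by
  have h := leibniz_word (permSigma σ) t (fun _ => 0) r j 0
  have h₁ : leftSign 0 (fun y : Fin 1 => r (permSigma σ ⟨j, y⟩)) 0 = 1 := by
    simp [leftSign]
  rw [h₁] at h
  simp only [zero_add, Finset.sum_const_zero, add_zero, mul_one, Finset.univ_unique,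
    Finset.sum_singleton, ← koszulSign_eq] at h
  have h₂ : koszulSign σ r * leftSign t r (σ j) =
      koszulSign σ (Function.update r (σ j) (r (σ j) + 1)) * leftSign t (fun i => r (σ i)) j := h
  have h₃ : ∀ a b d e : ℤˣ, a * b = d * e → a * e = b * d := by decide
  exact h₃ _ _ _ _ h₂

end Koszul

section PermHom

variable {n : ℕ} {T : Coll k C} {c : Fin n → C}

/-- The permutation of a sequence of elements. -/
def permArgs (σ : Equiv.Perm (Fin n)) (h : ∀ i, c (σ i) = c i) (x : ∀ i, Homog (T (c i))) (i : Fin n) :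
    Homog (T (c i)) := recolor T (h i) (x (σ i))

theorem permArgs_update (σ : Equiv.Perm (Fin n)) (h : ∀ i, c (σ i) = c i)
    (x : ∀ i, Homog (T (c i))) (j : Fin n) (z : Homog (T (c (σ j)))) :
    permArgs σ h (Function.update x (σ j) z) =
      Function.update (permArgs σ h x) j (recolor T (h j) z) := by
  funext i
  rcases eq_or_ne i j with rfl | hi
  · simp [permArgs]
  · rw [Function.update_of_ne hi]
    unfold permArgs
    rw [Function.update_of_ne (fun e => hi (σ.injective e))]

theorem sum_deg_permArgs (σ : Equiv.Perm (Fin n)) (h : ∀ i, c (σ i) = c i)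
    (x : ∀ i, Homog (T (c i))) : ∑ i, (permArgs σ h x i).deg = ∑ i, (x i).deg :=
  Equiv.sum_comp σ (fun i => (x i).deg)

variable (T c)

/-- The complex of maps out of `⨂ᵢ T_{c(i)}`. -/
abbrev tensorHom (Y : Cx k) : Cx k := IHom (tensor fun i => T (c i)) Y

variable {T c} {Y : Cx k}

theorem exists_permHom (Y : Cx k) (σ : Equiv.Perm (Fin n)) (h : ∀ i, c (σ i) = c i) :
    ∃ ρ : tensorHom T c Y ⟶ tensorHom T c Y, ∀ F x, tapp (map ρ F) x =
      sgn (koszulSign σ (fun i => (x i).deg)) (tapp F (permArgs σ h x)) := by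
  have hml : ∀ F : Homog (tensorHom T c Y), IsML (fun x : ∀ i, Homog (T (c i)) =>
      tapp F (permArgs σ h x)) := fun F => isML_of_lin fun x i => by
    obtain ⟨j, rfl⟩ := σ.surjective i
    simp only [permArgs_update]
    exact ((tapp_isML F).lin (permArgs σ h x) j).comp (isLin_map _)
  refine ⟨curry (hdesc (fun F x => sgn (koszulSign σ (fun i => (x i).deg))
    (tapp F (permArgs σ h x))) (fun x => ?_) (fun F => (hml F).sgn (koszulSign σ)) (fun F x => ?_)
    (fun F x m => ?_)), fun F x => ?_⟩
  · exact (isLin_sgn _).comp (tapp_isLin (permArgs σ h x))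
  · rw [deg_sgn, deg_tapp, sum_deg_permArgs]
  · rw [sgn_diff, vat_sgn, vat_sgn, tapp_diff, smul_add]
    congr 1
    rw [Finset.smul_sum]
    refine Eq.trans ?_ (Equiv.sum_comp σ _)
    refine Finset.sum_congr rfl fun j _ => ?_
    rw [vat_sgn, smul_smul, smul_smul, permArgs_update]
    have e₁ : recolor T (h j) (x (σ j)).diff = (permArgs σ h x j).diff := map_diff _ _
    have e₂ : (fun i => (Function.update x (σ j) (x (σ j)).diff i).deg) =
        Function.update (fun i => (x i).deg) (σ j) ((x (σ j)).deg + 1) := by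
      funext i
      rcases eq_or_ne i (σ j) with rfl | hi
      · simp
      · simp [hi]
    rw [e₁, e₂]
    congr 1
    exact koszulSign_leibniz σ F.deg (fun i => (x i).deg) j
  · rw [tapp_curry]
    exact ev_hdesc _ _ _ _ _ _ _

/-- The action of a permutation on maps out of `⨂ᵢ T_{c(i)}`. -/
def permHom (Y : Cx k) (σ : Equiv.Perm (Fin n)) (h : ∀ i, c (σ i) = c i) :
    tensorHom T c Y ⟶ tensorHom T c Y := (exists_permHom Y σ h).choose

theorem tapp_permHom (σ : Equiv.Perm (Fin n)) (h : ∀ i, c (σ i) = c i)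
    (F : Homog (tensorHom T c Y)) (x : ∀ i, Homog (T (c i))) : tapp (map (permHom Y σ h) F) x =
      sgn (koszulSign σ (fun i => (x i).deg)) (tapp F (permArgs σ h x)) :=
  (exists_permHom Y σ h).choose_spec F x

theorem permHom_one (h : ∀ i, c ((1 : Equiv.Perm (Fin n)) i) = c i) : permHom Y 1 h =
    𝟙 (tensorHom T c Y) := Homog.hom_ext fun F => tapp_ext rfl fun x => by
  rw [tapp_permHom]
  have h₁ := koszulSign_mul (1 : Equiv.Perm (Fin n)) 1 (fun i => (x i).deg)
  rw [mul_one] at h₁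
  have h₂ : koszulSign (1 : Equiv.Perm (Fin n)) (fun i => (x i).deg) = 1 := left_eq_mul.1 h₁
  rw [h₂, sgn_one]
  rfl

theorem permHom_mul (σ τ : Equiv.Perm (Fin n)) (h : ∀ i, c (σ i) = c i) (h' : ∀ i, c (τ i) = c i)
    (h'' : ∀ i, c ((σ * τ) i) = c i) : permHom Y (σ * τ) h'' =
      (permHom Y τ h' ≫ permHom Y σ h : tensorHom T c Y ⟶ _) :=
  Homog.hom_ext fun F => tapp_ext rfl fun x => by
    rw [map_comp, tapp_permHom, tapp_permHom, tapp_permHom, sgn_sgn]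
    refine congrArg₂ sgn (koszulSign_mul σ τ _) (congrArg (tapp F) (funext fun i => ?_))
    exact (recolor_recolor (W := T) (h (τ i)) (h' i) _).symm

variable (T c Y) in
/-- The action of `Σ_c` on maps out of `⨂ᵢ T_{c(i)}`. -/
def homAction : Action (Cx k) (autGroup c) where
  V := tensorHom T c Y
  ρ :=
    { toFun := fun σ => permHom Y σ.1 σ.2
      map_one' := permHom_one _
      map_mul' := fun σ τ => permHom_mul σ.1 τ.1 σ.2 τ.2 _ }

theorem tapp_ihomMap {Z : Cx k} (p : Y ⟶ Z) (F : Homog (tensorHom T c Y))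
    (x : ∀ i, Homog (T (c i))) :
    tapp (map (ihomMap _ p) F) x = map p (tapp F x) := app_ihomMap p F _

theorem permHom_ihomMap {Z : Cx k} (p : Y ⟶ Z) (σ : Equiv.Perm (Fin n)) (h : ∀ i, c (σ i) = c i) :
    permHom Y σ h ≫ ihomMap (tensor fun i => T (c i)) p = ihomMap _ p ≫ permHom Z σ h :=
  Homog.hom_ext fun F => tapp_ext rfl fun x => by
    rw [map_comp, map_comp, tapp_ihomMap, tapp_permHom, tapp_permHom, tapp_ihomMap, map_sgn]

variable {O : ColoredOperad k C}

theorem cofibrant_orbitTgt (hO : O.IsSigmaCofibrant) (hT : IsCofibrant T) (c : Fin n → C) (d : C) :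
    cofib k (initial.to (orbitTgt O T c d)) := by
  refine (cofibrant_iff _).2 fun M N p hp g => ?_
  let p' : homAction T c M ⟶ homAction T c N := ⟨ihomMap _ p, fun σ => permHom_ihomMap p σ.1 σ.2⟩
  have hp' : trivFib k p'.hom := (trivFib_iff _).2
    (elemTrivFib_ihomMap (cofibrant_tensor _ fun i => hT (c i)) hp)
  have hg : ∀ (σ : Equiv.Perm (Fin n)) (h : ∀ i, c (σ i) = c i) (θ : Homog (O.obj c d)),
      map (curry (quotProj _ (tgtRel O T c d) ≫ g)) (O.relabel d σ h θ) =
        map (permHom N σ h) (map (curry (quotProj _ (tgtRel O T c d) ≫ g)) θ) :=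
    fun σ h θ => tapp_ext (by
      rw [deg_map, deg_map, deg_map, ColoredOperad.relabel, deg_ev]
      simp [ColoredOperad.unit]) fun x => by
      rw [tapp_permHom, tapp_curry, tapp_curry]
      exact (congrArg (map g) (ev_quotProj_relabel O σ h θ x)).trans (map_sgn _ _ _)
  obtain ⟨l, hl, hl'⟩ : ∃ l : O.obj c d ⟶ tensorHom T c M,
      l ≫ ihomMap _ p = curry (quotProj _ (tgtRel O T c d) ≫ g) ∧
        ∀ (σ : Equiv.Perm (Fin n)) (h : ∀ i, c (σ i) = c i) (θ : Homog (O.obj c d)),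
          map l (O.relabel d σ h θ) = map (permHom M σ h) (map l θ) := by
    obtain ⟨l, hl, hl'⟩ := hO c d p' hp' _ (fun σ θ => hg σ.1 σ.2 θ)
    exact ⟨l, hl, fun σ h θ => hl' ⟨σ, h⟩ θ⟩
  refine ⟨quotDesc _ (uncurry l) (tgtRel_val O _ fun σ h θ x => ?_), quot_hom_ext ?_⟩
  · rw [ev_uncurry, ev_uncurry, hl', tapp_permHom]
    rfl
  · refine (Category.assoc _ _ _).symm.trans ((congrArg (· ≫ p) (quotProj_desc _ _ _)).trans ?_)
    refine htensor_hom_ext fun θ x => ?_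
    have h₁ := tapp_curry (quotProj _ (tgtRel O T c d) ≫ g) θ x
    rw [← hl, map_comp, tapp_ihomMap] at h₁
    refine Eq.trans ?_ h₁
    exact congrArg (map p) (ev_uncurry l θ x)

theorem hasCofibrantOrbits (hO : O.IsSigmaCofibrant) : HasCofibrantOrbits O :=
  fun _ hT _ q d => cofibrant_orbitTgt hO hT q.out d

theorem cofibrant_nullary (hO : O.IsSigmaCofibrant) :
    IsCofibrant (fun d => O.obj (Fin.elim0 : Fin 0 → C) d) := fun d => by
  refine (cofibrant_iff _).2 fun M N p hp g => ?_
  let p' : (⟨M, 1⟩ : Action (Cx k) (autGroup (Fin.elim0 : Fin 0 → C))) ⟶ ⟨N, 1⟩ :=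
    { hom := p
      comm := fun σ => (Category.id_comp p).trans (Category.comp_id p).symm }
  obtain ⟨l, hl, -⟩ := hO (Fin.elim0 : Fin 0 → C) d p' ((trivFib_iff p).2 hp) g (fun σ θ => by
    refine congrArg (map g) ?_
    exact comp_nil _ _ _ _ _ θ _)
  exact ⟨l, hl⟩

end PermHom

section Initial

variable (O : ColoredOperad k C)

/-- The initial algebra. -/
def initialAlg : Alg O := ⟨fun d => O.obj (Fin.elim0 : Fin 0 → C) d, nullary O⟩

theorem nullaryMap_unique {Z : Coll k C} (t : AlgStr O Z)
    {u : ∀ d, O.obj (Fin.elim0 : Fin 0 → C) d ⟶ Z d} (hu : IsAlgHom (nullary O) t u) (d : C) :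
    u d = nullaryMap t d := by
  refine Homog.hom_ext fun θ => ?_
  have h := hu (Fin.elim0 : Fin 0 → C) d θ (fun i => i.elim0)
  rw [nullary_act_nil] at h
  exact h.trans (map_nullaryMap t d θ _).symm

/-- An operad is the enveloping operad of its initial algebra. -/
def initialEnvelope : EnvelopingOperad O (initialAlg O) where
  operad := O
  φ := ⟨fun c d => 𝟙 (O.obj c d), fun _ => rfl, fun _ _ _ _ _ _ _ _ => rfl⟩
  η d := 𝟙 _
  isAlgHom_η {n} c d θ x := by rw [ev_restrict]; rfl
  existsUnique_algStr X s u hu := by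
    have h : ∀ t : AlgStr O X, t.restrict ⟨fun c d => 𝟙 (O.obj c d), fun _ => rfl,
        fun _ _ _ _ _ _ _ _ => rfl⟩ = t := fun t => by
      apply AlgStr.ext
      funext n c d
      refine htensor_hom_ext fun θ x => ?_
      rw [ev_restrict]
      rfl
    refine ⟨s, ⟨h s, fun d a => ?_⟩, fun t ht => (h t).symm.trans ht.1⟩
    refine (evNullary_eq (fun d => 𝟙 (O.obj (Fin.elim0 : Fin 0 → C) d)) s d a).trans ?_
    rw [Category.id_comp, nullaryMap_unique O s hu]
    rfl
  isAlgHom X Y s t f hf _ := by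
    intro n c d θ x
    have h := hf c d θ x
    rw [ev_restrict, ev_restrict] at h
    exact h

end Initial

/-! ## Sequential colimits of algebras -/

section Sequences

variable (D : ℕ ⥤ Cx k)

instance : PreservesFilteredColimitsOfSize.{0, 0} (forget (ModuleCat.{u} k)) :=
  have : PreservesFilteredColimitsOfSize.{u, u} (forget (ModuleCat.{u} k)) :=
    ModuleCat.FilteredColimits.forget_preservesFilteredColimits
  preservesSmallestFilteredColimits_of_preservesFilteredColimits _

theorem exists_rep (z : Homog (colimit D)) :
    ∃ (n : ℕ) (y : Homog (D.obj n)), map (colimit.ι D n) y = z := by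
  obtain ⟨m, z⟩ := z
  obtain ⟨n, y, hy⟩ := Concrete.isColimit_exists_rep _
    (isColimitOfPreserves (HomologicalComplex.eval (ModuleCat.{u} k) (ComplexShape.up ℤ) m)
      (colimit.isColimit D)) z
  exact ⟨n, mk m y, Homog.ext rfl (heq_of_eq hy)⟩

theorem exists_rep_eq {n : ℕ} {y y' : Homog (D.obj n)}
    (h : map (colimit.ι D n) y = map (colimit.ι D n) y') :
    ∃ (m : ℕ) (g : n ⟶ m), map (D.map g) y = map (D.map g) y' := by
  obtain ⟨q, y⟩ := y
  obtain ⟨q', y'⟩ := y'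
  obtain rfl : q = q' := congrArg Homog.deg h
  obtain ⟨m, g, g', hg⟩ := Concrete.isColimit_exists_of_rep_eq _
    (isColimitOfPreserves (HomologicalComplex.eval (ModuleCat.{u} k) (ComplexShape.up ℤ) q)
      (colimit.isColimit D)) y y' (eq_of_heq (mk.inj h).2)
  obtain rfl : g = g' := Subsingleton.elim _ _
  exact ⟨m, g, Homog.ext rfl (heq_of_eq hg)⟩

end Sequences

section ColimAlg

variable {O : ColoredOperad k C} (F : ℕ ⥤ Alg O)

/-- The complexes of a given colour underlying a sequence of algebras. -/
def und (d : C) : ℕ ⥤ Cx k where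
  obj n := (F.obj n).X d
  map h := (F.map h).f d
  map_id n := by rw [F.map_id]; rfl
  map_comp h h' := by rw [F.map_comp]; rfl

/-- The colimit of the complexes underlying a sequence of algebras. -/
def colimX : Coll k C := fun d => colimit (und F d)

/-- The maps to the colimit. -/
def colimIn (n : ℕ) (d : C) : (F.obj n).X d ⟶ colimX F d := colimit.ι (und F d) n

variable {F}

theorem colimIn_map {n m : ℕ} (h : n ⟶ m) (d : C) (z : Homog ((F.obj n).X d)) :
    map (colimIn F m d) (map ((F.map h).f d) z) = map (colimIn F n d) z :=
  congrArg (fun G : (F.obj n).X d ⟶ colimX F d => map G z) (colimit.w (und F d) h)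

theorem exists_reps {ι : Type*} [Fintype ι] (c : ι → C) (x : ∀ i, Homog (colimX F (c i))) :
    ∃ (N : ℕ) (y : ∀ i, Homog ((F.obj N).X (c i))), x = fun i => map (colimIn F N (c i)) (y i) := by
  choose n y hy using fun i => exists_rep (und F (c i)) (x i)
  refine ⟨Finset.univ.sup n, fun i => map ((F.map (homOfLE
    (Finset.le_sup (Finset.mem_univ i)))).f (c i)) (y i), funext fun i => ?_⟩
  exact ((colimIn_map _ (c i) (y i)).trans (hy i)).symm

theorem exists_reps_eq {ι : Type*} [Fintype ι] (c : ι → C) {N : ℕ}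
    {y y' : ∀ i, Homog ((F.obj N).X (c i))}
    (h : ∀ i, map (colimIn F N (c i)) (y i) = map (colimIn F N (c i)) (y' i)) :
    ∃ (M : ℕ) (g : N ⟶ M), ∀ i, map ((F.map g).f (c i)) (y i) =
      map ((F.map g).f (c i)) (y' i) := by
  choose m g hg using fun i => exists_rep_eq (und F (c i)) (h i)
  refine ⟨N + Finset.univ.sup m, homOfLE (Nat.le_add_right _ _), fun i => ?_⟩
  have e : homOfLE (Nat.le_add_right N (Finset.univ.sup m)) = g i ≫ homOfLE
    ((Finset.le_sup (Finset.mem_univ i)).trans (Nat.le_add_left _ _)) := Subsingleton.elim _ _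
  rw [e, F.map_comp, Alg.comp_f, map_comp, map_comp]
  exact congrArg _ (hg i)

variable {n : ℕ} {c : Fin n → C} {d : C}

/-- The values of the action of operations on the colimit. -/
def colimVal (θ : Homog (O.obj c d)) (x : ∀ i, Homog (colimX F (c i))) : Homog (colimX F d) :=
  map (colimIn F _ d)
    (ev ((F.obj (exists_reps c x).choose).str.act c d) θ (exists_reps c x).choose_spec.choose)

theorem colimIn_ev {N M : ℕ} (h : N ⟶ M) (θ : Homog (O.obj c d))
    (y : ∀ i, Homog ((F.obj N).X (c i))) :
    map (colimIn F M d) (ev ((F.obj M).str.act c d) θ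
        (fun i => map ((F.map h).f (c i)) (y i))) =
      map (colimIn F N d) (ev ((F.obj N).str.act c d) θ y) := by
  rw [← (F.map h).isAlgHom, colimIn_map]

theorem colimVal_eq (θ : Homog (O.obj c d)) (N : ℕ) (y : ∀ i, Homog ((F.obj N).X (c i))) :
    colimVal θ (fun i => map (colimIn F N (c i)) (y i)) =
      map (colimIn F N d) (ev ((F.obj N).str.act c d) θ y) := by
  have key : ∀ (N' : ℕ) (y' : ∀ i, Homog ((F.obj N').X (c i))),
      (fun i => map (colimIn F N (c i)) (y i)) =
        (fun i => map (colimIn F N' (c i)) (y' i)) →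
      map (colimIn F N' d) (ev ((F.obj N').str.act c d) θ y') =
        map (colimIn F N d) (ev ((F.obj N).str.act c d) θ y) := by
    intro N' y' h
    obtain ⟨M, g, hg⟩ := exists_reps_eq (F := F) c (N := N + N')
      (y := fun i => map ((F.map (homOfLE (Nat.le_add_right N N'))).f (c i)) (y i))
      (y' := fun i => map ((F.map (homOfLE (Nat.le_add_left N' N))).f (c i)) (y' i))
      (fun i => by rw [colimIn_map, colimIn_map]; exact congrFun h i)
    rw [← colimIn_ev (homOfLE (Nat.le_add_left N' N)), ← colimIn_ev g,
      ← colimIn_ev (homOfLE (Nat.le_add_right N N')), ← colimIn_ev g]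
    exact congrArg (fun y => map (colimIn F M d) (ev ((F.obj M).str.act c d) θ y))
      (funext fun i => (hg i).symm)
  exact key _ _ (exists_reps c _).choose_spec.choose_spec

theorem colimVal_isML (θ : Homog (O.obj c d)) : IsML (colimVal (F := F) θ) := by
  refine isML_of_lin fun x i => ?_
  have key : ∀ z₁ z₂ : Homog (colimX F (c i)), ∃ (N : ℕ) (y : ∀ i, Homog ((F.obj N).X (c i)))
      (y₁ y₂ : Homog ((F.obj N).X (c i))), z₁ = map (colimIn F N (c i)) y₁ ∧
        z₂ = map (colimIn F N (c i)) y₂ ∧ ∀ y', colimVal θ (Function.update x i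
          (map (colimIn F N (c i)) y')) = map (colimIn F N d)
            (ev ((F.obj N).str.act c d) θ (Function.update y i y')) := by
    intro z₁ z₂
    obtain ⟨N, y, hy⟩ := exists_reps (F := F) (ι := Fin n ⊕ Bool) (Sum.elim c (fun _ => c i))
      (fun s => match s with
        | .inl j => x j
        | .inr true => z₁
        | .inr false => z₂)
    refine ⟨N, fun j => y (.inl j), y (.inr true), y (.inr false), congrFun hy (.inr true),
      congrFun hy (.inr false),
      fun y' => ?_⟩
    have hx : x = fun j => map (colimIn F N (c j)) (y (.inl j)) :=
      funext fun j => congrFun hy (.inl j)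
    rw [← colimVal_eq, map_update (fun j => colimIn F N (c j)) (fun j => y (.inl j)) i y', ← hx]
  refine ⟨fun {z z₁ z₂} h => ?_, fun r z => ?_⟩
  · obtain ⟨N, y, y₁, y₂, rfl, rfl, hy⟩ := key z₁ z₂
    have hdeg : y₂.deg = y₁.deg := h.deg₂.trans h.deg₁.symm
    have h₁ := hadd_mk y₁.deg y₁.val (y₂.vat y₁.deg)
    rw [mk_vat _ hdeg] at h₁
    obtain rfl := h.unique (h₁.map (colimIn F N (c i)))
    rw [hy, hy, hy]
    exact (((ev_isML _ θ).lin y i).add h₁).map _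
  · obtain ⟨N, y, y₁, -, rfl, -, hy⟩ := key z z
    rw [← (isLin_map _).smul, hy, hy, ← (isLin_map _).smul, ((ev_isML _ θ).lin y i).smul]

variable (F) in
/-- The action of operations on the colimit. -/
def colimAct {n : ℕ} (c : Fin n → C) (d : C) :
    htensor (O.obj c d) (fun i => colimX F (c i)) ⟶ colimX F d :=
  hdesc colimVal
    (fun x => by
      obtain ⟨N, y, rfl⟩ := exists_reps c x
      simp only [colimVal_eq]
      exact (isLin_map _).comp (ev_isLin _ y))
    (fun θ => colimVal_isML θ)
    (fun θ x => by
      obtain ⟨N, y, rfl⟩ := exists_reps c x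
      rw [colimVal_eq, deg_map, deg_ev]
      rfl)
    (fun θ x m => by
      obtain ⟨N, y, rfl⟩ := exists_reps c x
      have h := ev_diff ((F.obj N).str.act c d) θ y m
      rw [colimVal_eq, colimVal_eq, ← map_diff, vat_map, h, map_add, map_sum, vat_map]
      congr 1
      refine Finset.sum_congr rfl fun i _ => ?_
      have e := (map_update (fun j => colimIn F N (c j)) y i (y i).diff).symm
      rw [map_diff] at e
      rw [e, colimVal_eq, vat_map, Units.smul_def, map_zsmul]
      rfl)

theorem ev_colimAct (θ : Homog (O.obj c d)) (N : ℕ) (y : ∀ i, Homog ((F.obj N).X (c i))) :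
    ev (colimAct F c d) θ (fun i => map (colimIn F N (c i)) (y i)) =
      map (colimIn F N d) (ev ((F.obj N).str.act c d) θ y) :=
  (ev_hdesc _ _ _ _ _ _ _).trans (colimVal_eq θ N y)

variable (F) in
/-- The colimit of a sequence of algebras. -/
def colimAlg : Alg O where
  X := colimX F
  str :=
    { act := colimAct F
      act_unit := fun a x => by
        obtain ⟨N, y, rfl⟩ := exists_rep (und F a) x
        refine (ev_colimAct (c := fun _ : Fin 1 => a) _ N (fun _ => y)).trans ?_
        exact congrArg (map (colimIn F N a)) ((F.obj N).str.act_unit a y)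
      act_comp := fun d c e π θ φ x => by
        obtain ⟨N, y, rfl⟩ := exists_reps c x
        rw [ev_colimAct, (F.obj N).str.act_comp, map_sgn, ← ev_colimAct]
        refine congrArg (sgn _) (congrArg (ev _ θ) (funext fun j => ?_))
        exact (ev_colimAct (φ j) N (fun y' => y (π ⟨j, y'⟩))).symm }

variable {A : Alg O}

variable (F) in
theorem exists_colimAlgDesc (q : ∀ n, F.obj n ⟶ A)
    (hq : ∀ {n m} (h : n ⟶ m), F.map h ≫ q m = q n) :
    ∃ p : colimAlg F ⟶ A, ∀ n d, colimIn F n d ≫ p.f d = (q n).f d := by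
  let p : ∀ d, colimX F d ⟶ A.X d := fun d => colimit.desc (und F d) ⟨A.X d, ⟨fun n => (q n).f d,
    fun n m h => (congrArg (fun G : F.obj n ⟶ A => G.f d) (hq h)).trans (Category.comp_id _).symm⟩⟩
  have hp : ∀ n d, colimIn F n d ≫ p d = (q n).f d := fun n d => colimit.ι_desc _ _
  refine ⟨⟨p, fun c d θ x => ?_⟩, hp⟩
  obtain ⟨N, y, rfl⟩ := exists_reps c x
  refine (congrArg (map (p d)) (ev_colimAct θ N y)).trans ?_
  rw [← map_comp, hp, (q N).isAlgHom]
  refine congrArg (ev _ θ) (funext fun i => ?_)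
  exact (congrArg (fun G => map G (y i)) (hp N (c i))).symm

end ColimAlg

/-! ## Spheres and disks -/

section Cells

variable {M N : Cx k}

variable (k) in
/-- The complex generated by an element of degree `m`. -/
def disk (m : ℤ) : Cx k :=
  HomologicalComplex.double (c := ComplexShape.up ℤ) (𝟙 (ModuleCat.of k k)) (i₀ := m) (i₁ := m + 1) rfl

/-- The generator of a disk. -/
def diskElt (m : ℤ) : (disk k m).X m :=
  (HomologicalComplex.doubleXIso₀ (c := ComplexShape.up ℤ) (𝟙 (ModuleCat.of k k)) rfl).inv (1 : k)

theorem disk_hom_ext {m : ℤ} {g g' : disk k m ⟶ M} (h : g.f m (diskElt m) = g'.f m (diskElt m)) :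
    g = g' := by
  have hm : m ≠ m + 1 := by omega
  refine (HomologicalComplex.evalCompCoyonedaCorepresentableByDoubleId (rfl : (ComplexShape.up ℤ).Rel
    m (m + 1)) hm (ModuleCat.of k k)).homEquiv.injective ?_
  exact ModuleCat.hom_ext (LinearMap.ext_ring h)

theorem exists_diskHom {m : ℤ} (x : M.X m) : ∃ g : disk k m ⟶ M, g.f m (diskElt m) = x := by
  have hm : m ≠ m + 1 := by omega
  let e := (HomologicalComplex.evalCompCoyonedaCorepresentableByDoubleId (rfl : (ComplexShape.up ℤ).Rel
    m (m + 1)) hm (ModuleCat.of k k)).homEquiv (Y := M)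
  obtain ⟨g, hg⟩ := e.surjective (ModuleCat.ofHom (LinearMap.toSpanSingleton k _ x))
  refine ⟨g, ?_⟩
  have := congrArg (fun F : ModuleCat.of k k ⟶ M.X m => F (1 : k)) hg
  exact this.trans (by simp)

variable (k) in
/-- The complex generated by a cycle of degree `m`. -/
def sphere (m : ℤ) : Cx k :=
  (HomologicalComplex.single (ModuleCat.{u} k) (ComplexShape.up ℤ) m).obj (ModuleCat.of k k)

/-- The generator of a sphere. -/
def sphereElt (m : ℤ) : (sphere k m).X m :=
  (HomologicalComplex.singleObjXSelf (ComplexShape.up ℤ) m (ModuleCat.of k k)).inv (1 : k)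

theorem d_sphereElt (m : ℤ) : (sphere k m).d m (m + 1) (sphereElt m) = 0 := by
  have : (sphere k m).d m (m + 1) = 0 := HomologicalComplex.single_obj_d _ _ _ _ _
  rw [this]
  rfl

theorem sphere_hom_ext {m : ℤ} {g g' : sphere k m ⟶ M}
    (h : g.f m (sphereElt m) = g'.f m (sphereElt m)) : g = g' := by
  refine HomologicalComplex.from_single_hom_ext ?_
  rw [← cancel_epi (HomologicalComplex.singleObjXSelf (ComplexShape.up ℤ) m (ModuleCat.of k k)).inv]
  exact ModuleCat.hom_ext (LinearMap.ext_ring h)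

theorem exists_sphereHom {m : ℤ} (x : M.X m) (hx : M.d m (m + 1) x = 0) :
    ∃ g : sphere k m ⟶ M, g.f m (sphereElt m) = x := by
  refine ⟨HomologicalComplex.mkHomFromSingle (ModuleCat.ofHom (LinearMap.toSpanSingleton k _ x))
    (fun j hj => ?_), ?_⟩
  · obtain rfl : m + 1 = j := hj
    refine ModuleCat.hom_ext (LinearMap.ext_ring ?_)
    simpa using hx
  · rw [HomologicalComplex.mkHomFromSingle_f]
    have := congrArg (fun G : ModuleCat.of k k ⟶ M.X m => G (1 : k)) (Iso.inv_hom_id_assoc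
      (HomologicalComplex.singleObjXSelf (ComplexShape.up ℤ) m (ModuleCat.of k k))
      (ModuleCat.ofHom (LinearMap.toSpanSingleton k _ x)))
    exact this.trans (by simp)

/-- The inclusion of a sphere into a disk. -/
def sphereIncl (k : Type u) [CommRing k] (m : ℤ) : sphere k (m + 1) ⟶ disk k m :=
  (exists_sphereHom ((disk k m).d m (m + 1) (diskElt m)) (d_d_apply _ _ _ _ _)).choose

theorem sphereIncl_elt (m : ℤ) : (sphereIncl k m).f (m + 1) (sphereElt (m + 1)) =
    (disk k m).d m (m + 1) (diskElt m) :=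
  (exists_sphereHom ((disk k m).d m (m + 1) (diskElt m)) (d_d_apply _ _ _ _ _)).choose_spec

theorem cofib_sphereIncl (m : ℤ) : cofib k (sphereIncl k m) := by
  refine (cofib_iff _).2 fun M N p hp t b hw => ?_
  obtain ⟨x, hx, hx'⟩ := hp m (b.f m (diskElt m)) (t.f (m + 1) (sphereElt (m + 1)))
    (by rw [← f_d_apply, d_sphereElt, map_zero])
    (by
      have := congrArg (fun F : sphere k (m + 1) ⟶ N => F.f (m + 1) (sphereElt (m + 1))) hw
      refine this.trans ?_
      rw [← f_d_apply, ← sphereIncl_elt]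
      rfl)
  obtain ⟨l, hl⟩ := exists_diskHom x
  refine ⟨l, sphere_hom_ext ?_, disk_hom_ext ?_⟩
  · have : l.f (m + 1) ((sphereIncl k m).f (m + 1) (sphereElt (m + 1))) =
        t.f (m + 1) (sphereElt (m + 1)) := by rw [sphereIncl_elt, f_d_apply, hl, hx']
    exact this
  · have : p.f m (l.f m (diskElt m)) = b.f m (diskElt m) := by rw [hl, hx]
    exact this

end Cells

/-! ## Cofibrant algebras over `Σ`-cofibrant operads -/

section Tower

variable {O : ColoredOperad k C} (A : Alg O)

/-- An algebra over `A` with good homotopical properties. -/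
structure Stage where
  /-- The algebra. -/
  Z : Alg O
  /-- Its enveloping operad. -/
  E : EnvelopingOperad O Z
  cof : IsCofibrant Z.X
  orb : HasCofibrantOrbits E.operad
  /-- The map to `A`. -/
  q : Z ⟶ A

variable {A}

/-- The lifting problems of spheres and disks. -/
structure Problem (S : Stage A) (d : C) : Type u where
  /-- The dimension. -/
  m : ℤ
  /-- The disk. -/
  y : (A.X d).X m
  /-- The sphere. -/
  x' : (S.Z.X d).X (m + 1)
  d_x' : (S.Z.X d).d (m + 1) (m + 1 + 1) x' = 0
  map_x' : (S.q.f d).f (m + 1) x' = (A.X d).d m (m + 1) y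

/-- The solution of all lifting problems by attaching cells. -/
theorem Stage.exists_next (S : Stage A) : ∃ (S' : Stage A) (j : S.Z ⟶ S'.Z), j ≫ S'.q = S.q ∧
    (∀ d, cofib k (j.f d)) ∧ ∀ d (γ : Problem S d), ∃ x : (S'.Z.X d).X γ.m,
      (S'.q.f d).f γ.m x = γ.y ∧ (S'.Z.X d).d γ.m (γ.m + 1) x = (j.f d).f (γ.m + 1) γ.x' := by
  choose a ha using fun d (γ : Problem S d) => exists_sphereHom γ.x' γ.d_x'
  choose b hb using fun d (γ : Problem S d) => exists_diskHom γ.y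
  let V : Coll k C := fun d => ∐ fun γ : Problem S d => sphere k (γ.m + 1)
  let W : Coll k C := fun d => ∐ fun γ : Problem S d => disk k γ.m
  let f : V ⟶ W := fun d => Limits.Sigma.map fun γ : Problem S d => sphereIncl k γ.m
  let α : ∀ d, V d ⟶ S.Z.X d := fun d => Sigma.desc (a d)
  let β : ∀ d, W d ⟶ A.X d := fun d => Sigma.desc (b d)
  have hf : IsCofibration f := fun d => cofib_sigmaMap _ fun γ => cofib_sphereIncl γ.m
  have hαβ : ∀ d, f d ≫ β d = α d ≫ S.q.f d := fun d => Sigma.hom_ext _ _ fun γ => by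
    have h₁ : Sigma.ι (fun γ : Problem S d => sphere k (γ.m + 1)) γ ≫ f d ≫ β d =
        sphereIncl k γ.m ≫ b d γ := by
      simp [f, β]
    have h₂ : Sigma.ι (fun γ : Problem S d => sphere k (γ.m + 1)) γ ≫ α d ≫ S.q.f d =
        a d γ ≫ S.q.f d := by
      rw [← Category.assoc, Sigma.ι_desc]
    refine h₁.trans (Eq.trans ?_ h₂.symm)
    refine sphere_hom_ext ?_
    have h₃ : (b d γ).f (γ.m + 1) ((sphereIncl k γ.m).f (γ.m + 1) (sphereElt (γ.m + 1))) =
        (S.q.f d).f (γ.m + 1) ((a d γ).f (γ.m + 1) (sphereElt (γ.m + 1))) := by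
      rw [sphereIncl_elt, f_d_apply, hb, ha, γ.map_x']
    exact h₃
  obtain ⟨q, ⟨hq, hq'⟩, -⟩ := (isCellAttach_cellAlg S.E f α).existsUnique A S.q β hαβ
  refine ⟨⟨cellAlg S.E f α, envelopingOperad O _, S.orb.cofibrant_cellAlg S.cof hf α,
    S.orb.attach S.cof hf α _, q⟩, cellAlgIn S.E f α, hq, S.orb.cofib_cellAlgIn hf α, fun d γ => ?_⟩
  let e : disk k γ.m ⟶ (cellAlg S.E f α).X d :=
    Sigma.ι (fun γ : Problem S d => disk k γ.m) γ ≫ cellAlgLetter S.E f α d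
  refine ⟨e.f γ.m (diskElt γ.m), ?_, ?_⟩
  · have h₁ : e ≫ q.f d = b d γ := by
      rw [Category.assoc, hq']
      exact Sigma.ι_desc _ _
    exact (congrArg (fun F : disk k γ.m ⟶ A.X d => F.f γ.m (diskElt γ.m)) h₁).trans (hb d γ)
  · have h₁ : sphereIncl k γ.m ≫ e = a d γ ≫ (cellAlgIn S.E f α).f d := by
      have h₂ := congrArg (Sigma.ι (fun γ : Problem S d => sphere k (γ.m + 1)) γ ≫ ·)
        ((isCellAttach_cellAlg S.E f α).comm d)
      have h₃ : Sigma.ι (fun γ : Problem S d => sphere k (γ.m + 1)) γ ≫ f d ≫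
          cellAlgLetter S.E f α d = sphereIncl k γ.m ≫ e := by
        rw [← Category.assoc, Sigma.ι_map, Category.assoc]
      have h₄ : Sigma.ι (fun γ : Problem S d => sphere k (γ.m + 1)) γ ≫ α d ≫
          (cellAlgIn S.E f α).f d = a d γ ≫ (cellAlgIn S.E f α).f d := by
        rw [← Category.assoc, Sigma.ι_desc]
      exact h₃.symm.trans (h₂.trans h₄)
    have h₂ := congrArg (fun F : sphere k (γ.m + 1) ⟶ (cellAlg S.E f α).X d =>
      F.f (γ.m + 1) (sphereElt (γ.m + 1))) h₁
    have h₃ : e.f (γ.m + 1) ((sphereIncl k γ.m).f (γ.m + 1) (sphereElt (γ.m + 1))) =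
        ((cellAlgIn S.E f α).f d).f (γ.m + 1) ((a d γ).f (γ.m + 1) (sphereElt (γ.m + 1))) := h₂
    rw [sphereIncl_elt, f_d_apply, ha] at h₃
    exact h₃

/-- Over a `Σ`-cofibrant operad, each algebra is the target of a trivial fibration from an algebra
with cofibrant underlying complexes. -/
theorem exists_resolution (hO : O.IsSigmaCofibrant) (A : Alg O) : ∃ (Z : Alg O) (p : Z ⟶ A),
    IsCofibrant Z.X ∧ ∀ d, ElemTrivFib (p.f d) := by
  choose next j hj hj' hnext using fun S : Stage A => S.exists_next
  let q₀ : initialAlg O ⟶ A := ⟨nullaryMap A.str, isAlgHom_nullaryMap A.str⟩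
  let S : ℕ → Stage A := fun n => Nat.rec
    ⟨initialAlg O, initialEnvelope O, cofibrant_nullary hO, hasCofibrantOrbits hO, q₀⟩
    (fun _ S => next S) n
  let F : ℕ ⥤ Alg O := Functor.ofSequence (X := fun n => (S n).Z) (fun n => j (S n))
  have hF : ∀ n, F.map (homOfLE (Nat.le_succ n)) = j (S n) := fun n => Functor.ofSequence_map_homOfLE_succ _ n
  have hq : ∀ {n m} (h : n ⟶ m), F.map h ≫ (S m).q = (S n).q := by
    intro n m h
    obtain ⟨r, rfl⟩ := Nat.exists_eq_add_of_le (leOfHom h)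
    obtain rfl : h = homOfLE (Nat.le_add_right n r) := Subsingleton.elim _ _
    induction r with
    | zero => exact (congrArg (· ≫ (S n).q) (F.map_id n)).trans (Category.id_comp _)
    | succ r ih =>
      have e : homOfLE (Nat.le_add_right n (r + 1)) =
        homOfLE (Nat.le_add_right n r) ≫ homOfLE (Nat.le_succ (n + r)) := Subsingleton.elim _ _
      have e' : F.map (homOfLE (Nat.le_add_right n (r + 1))) =
          F.map (homOfLE (Nat.le_add_right n r)) ≫ j (S (n + r)) :=
        (congrArg F.map e).trans ((F.map_comp _ _).trans
          (congrArg (F.map (homOfLE (Nat.le_add_right n r)) ≫ ·) (hF (n + r))))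
      exact (congrArg (· ≫ (S (n + (r + 1))).q) e').trans ((Category.assoc _ _ _).trans
        ((congrArg (F.map (homOfLE (Nat.le_add_right n r)) ≫ ·) (hj (S (n + r)))).trans ih))
  obtain ⟨p, hp⟩ := exists_colimAlgDesc F (fun n => (S n).q) hq
  refine ⟨colimAlg F, p, fun d => ?_, fun d m y x' hx' hy => ?_⟩
  · refine cofibrant_of_cofib (colimIn F 0 d) ?_ ((S 0).cof d)
    refine cofib_of_seq (und F d) (colimit.cocone (und F d)) (fun {Z} b hb => ?_)
      (fun h => colimit.hom_ext h) (fun n => ?_)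
    · exact ⟨colimit.desc (und F d) ⟨Z, ⟨b, fun n m h =>
        (hb n m (leOfHom h)).trans (Category.comp_id _).symm⟩⟩, fun n => colimit.ι_desc _ _⟩
    · have : (und F d).map (homOfLE (Nat.le_succ n)) = (j (S n)).f d :=
        congrArg (fun G : (S n).Z ⟶ (S (n + 1)).Z => G.f d) (hF n)
      rw [this]
      exact hj' (S n) d
  · obtain ⟨n, b, rfl⟩ : ∃ (n : ℕ) (b : ((F.obj n).X d).X (m + 1)),
        (colimIn F n d).f (m + 1) b = x' := by
      obtain ⟨n, ⟨m', b⟩, hb⟩ := exists_rep (und F d) (mk (m + 1) x')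
      obtain rfl : m' = m + 1 := congrArg Homog.deg hb
      exact ⟨n, b, eq_of_heq (mk.inj hb).2⟩
    have h₀ : map (colimIn F n d) (mk (m + 1 + 1) (((F.obj n).X d).d (m + 1) (m + 1 + 1) b)) =
        map (colimIn F n d) (mk (m + 1 + 1) 0) :=
      congrArg (mk (m + 1 + 1)) ((f_d_apply (colimIn F n d) (m + 1) (m + 1 + 1) b).trans
        (hx'.trans (map_zero ((colimIn F n d).f (m + 1 + 1)).hom).symm))
    obtain ⟨M, g, hg⟩ := exists_rep_eq (und F d) h₀
    let b' : ((S M).Z.X d).X (m + 1) := ((F.map g).f d).f (m + 1) b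
    have hb' : (colimIn F M d).f (m + 1) b' = (colimIn F n d).f (m + 1) b :=
      eq_of_heq (mk.inj (colimIn_map g d (mk (m + 1) b))).2
    have hdb : ((S M).Z.X d).d (m + 1) (m + 1 + 1) b' = 0 := by
      have h₁ : ((F.map g).f d).f (m + 1 + 1) (((F.obj n).X d).d (m + 1) (m + 1 + 1) b) =
          ((F.map g).f d).f (m + 1 + 1) 0 := eq_of_heq (mk.inj hg).2
      exact (f_d_apply ((F.map g).f d) (m + 1) (m + 1 + 1) b).symm.trans
        (h₁.trans (map_zero (((F.map g).f d).f (m + 1 + 1)).hom))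
    have hpq : ∀ (n : ℕ) (i : ℤ) (z : ((S n).Z.X d).X i), (p.f d).f i ((colimIn F n d).f i z) =
        ((S n).q.f d).f i z := fun n i z =>
      congrArg (fun G : (S n).Z.X d ⟶ A.X d => G.f i z) (hp n d)
    obtain ⟨x, hx, hdx⟩ := hnext (S M) d ⟨m, y, b', hdb, by rw [← hpq, hb', hy]⟩
    refine ⟨(colimIn F (M + 1) d).f m x, (hpq (M + 1) m x).trans hx, ?_⟩
    have h₁ := (f_d_apply (colimIn F (M + 1) d) m (m + 1) x).symm
    refine h₁.trans ((congrArg _ hdx).trans ?_)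
    refine Eq.trans ?_ hb'
    have h₂ := colimIn_map (F := F) (homOfLE (Nat.le_succ M)) d (mk (m + 1) b')
    rw [hF] at h₂
    exact eq_of_heq (mk.inj h₂).2

theorem Alg.IsCofibrant.underlying (hO : O.IsSigmaCofibrant) {A : Alg O} (hA : A.IsCofibrant) :
    DGOperad.IsCofibrant A.X := fun d => by
  obtain ⟨Z, p, hZ, hp⟩ := exists_resolution hO A
  obtain ⟨l, hl⟩ := hA p (fun d => (trivFib_iff _).2 (hp d)) (𝟙 A)
  exact cofibrant_of_retract (hZ d) (l.f d) (p.f d)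
    (congrArg (fun G : A ⟶ A => G.f d) hl)

/-- Attaching free cells to a cofibrant algebra yields a cofibrant algebra. -/
theorem Alg.IsCofibrant.cellAlg {A : Alg O} (hA : A.IsCofibrant) (E : EnvelopingOperad O A)
    {T : Coll k C} (hT : DGOperad.IsCofibrant T) :
    (cellAlg E (fromInitial T) (fun d => initial.to (A.X d))).IsCofibrant := by
  intro X Y p hp g
  have H := isCellAttach_cellAlg E (fromInitial T) (fun d => initial.to (A.X d))
  obtain ⟨l, hl⟩ := hA p hp (cellAlgIn E _ _ ≫ g)
  choose t ht using fun d => (cofibrant_iff (T d)).1 (hT d) (p.f d) ((trivFib_iff _).1 (hp d))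
    (cellAlgLetter E (fromInitial T) (fun d => initial.to (A.X d)) d ≫ g.f d)
  obtain ⟨u, ⟨hu, hu'⟩, -⟩ := H.existsUnique X l t (fun d => initial.hom_ext _ _)
  refine ⟨u, (H.existsUnique Y (cellAlgIn E _ _ ≫ g) _ (fun d => initial.hom_ext _ _)).unique
    ⟨?_, fun d => ?_⟩ ⟨rfl, fun d => rfl⟩⟩
  · rw [← Category.assoc, hu, hl]
  · rw [Alg.comp_f, ← Category.assoc, hu', ht]

theorem Alg.IsCofibrant.hasCofibrantOrbits (hO : O.IsSigmaCofibrant) {A : Alg O}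
    (hA : A.IsCofibrant) (E : EnvelopingOperad O A) : HasCofibrantOrbits E.operad :=
  hasCofibrantOrbits_of_cellAlg E fun _ hT => (hA.cellAlg E hT).underlying hO

end Tower

end

end DGOperad

open DGOperad
theorem proposition2p7p2 {k : Type u} [CommRing k] {C : Type u} (O : ColoredOperad k C) :
    (Alg.forget O).IsRightAdjoint ∧
    ∀ (F : Coll k C ⥤ Alg O) (adj : F ⊣ Alg.forget O) (A : Alg O), A.IsCofibrant →
      ∃ E : EnvelopingOperad O A,
        ∀ (V W : Coll k C) (f : V ⟶ W), IsCofibrant V → IsCofibration f →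
          ∀ (B : Alg O) (g : F.obj V ⟶ A) (j : F.obj W ⟶ B) (i : A ⟶ B),
            IsPushout (F.map f) g j i →
              ∃ Φ : CellFiltration E f (adj.homEquiv V A g) i,
                O.IsSigmaCofibrant →
                  ∀ n : ℕ, IsCofibration (Φ.seq.map (homOfLE (Nat.le_succ n))) := by
  refine ⟨isRightAdjoint_forget O, fun F adj A hA => ⟨envelopingOperad O A, ?_⟩⟩
  intro V W f _ hf B g j i h
  obtain ⟨e, he, -⟩ := (isCellAttach_of_isPushout adj h).exists_iso
    (isCellAttach_cellAlg (envelopingOperad O A) f (adj.homEquiv V A g))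
  exact ⟨cellFiltration (envelopingOperad O A) f i (adj.homEquiv V A g) e he, fun hO n d =>
    (hA.hasCofibrantOrbits hO _).cofib_subIncl hf _ n d (by exact_mod_cast Nat.le_succ n)⟩
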